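/- **Setting.** Let $D=(0,L_1)\times(0,L_2)$ with $L_1,L_2>0$, let $T>0$, $H=L^2(D;\mathbb C)$, and $V=H^1_0(D;\mathbb C)$ (the closure of $C_c^\infty(D)$ in $H^1(D)$). Let $\alpha,\beta,\gamma,\sigma\in\mathbb R$ with $\gamma>0$, $\sigma>2$ and $0<|\beta|<\frac{\sqrt{2\sigma+1}}{\sigma}$, let $\lambda_1,\lambda_2\in\mathbb C^2$, and put $$Au=(1+i\alpha)\Delta u,\qquad Bu=-(1-i\beta)|u|^{2\sigma}u+\gamma u+\lambda_1\cdot\nabla(|u|^2u)+(\lambda_2\cdot\nabla u)|u|^2 .$$ Let $\mathcal Z$ be a locally compact Polish space with a Borel measure $\nu$ that is finite on compact sets, and let $g:\mathcal Z\to\mathbb C$ be measurable with $\int_{\mathcal Z}|g|^2\,d\nu<\infty$ and such that, for some $\delta>0$, $\int_E e^{\delta|g(z)|^2}\nu(dz)<\infty$ for every Borel set $E\subseteq\mathcal Z$ with $\nu(E)<\infty$. Fix $u(0)\in V$. Let $\mathcal Z_T=[0,T]\times\mathcal Z$ and $\nu_T=\lambda_T\otimes\nu$, where $\lambda_T$ is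 Lebesgue measure on $[0,T]$. For $N\in\mathbb N$ let $S^N$ be the set of measurable $\varphi:\mathcal Z_T\to[0,\infty)$ with $\int_{\mathcal Z_T}(\varphi\log\varphi-\varphi+1)\,d\nu_T\le N$, with the topology induced by $\varphi\mapsto\nu_T^\varphi:=\varphi\,\nu_T$ from the vague topology: $\varphi_n\to\varphi$ means $\int f\varphi_n\,d\nu_T\to\int f\varphi\,d\nu_T$ for all $f\in C_c(\mathcal Z_T)$. Let $\mathbb S=\bigcup_N S^N$. For $\varphi\in\mathbb S$, the skeleton solution $u^\varphi=:\mathcal G^0(\nu_T^\varphi)$ is the solution in $C([0,T],H)\cap L^2([0,T],V)\cap L^{2\sigma+2}([0,T],L^{2\sigma+2}(D))$ of $$u(t)=u(0)+\int_0^tAu(s)\,ds+\int_0^tBu(s)\,ds+\int_0^t\!\int_{\mathcal Z}u(s)g(z)(\varphi(s,z)-1)\,\nu(dz)\,ds,\qquad t\in[0,T],$$ understood in the sense of distributions on $D$ (equivalently, in $V^*$). **Proposition.** For every $\varphi\in\mathbb S$ the skeleton solution $u^\varphi$ exists and is unique. If $N\in\mathbb N$, $\varphi_n,\varphi\in S^N$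 and $\varphi_n\to\varphi$ in $S^N$, then $$u^{\varphi_n}\to u^\varphi\quad\text{in}\quad C([0,T],H)\cap L^2([0,T],V)\cap L^{2\sigma+2}([0,T],L^{2\sigma+2}(D)),$$ that is, in each of the three norms. -/

import Mathlib

open MeasureTheory Filter Topology Set
open scoped ContDiff NNReal

noncomputable section

namespace GinzburgLandau

/-! Function spaces on the rectangle `D = (0,L₁) × (0,L₂)`. -/

/-- The rectangle `D = (0,L₁) × (0,L₂)`. -/
def rect (L₁ L₂ : ℝ) : Set (ℝ × ℝ) := Ioo 0 L₁ ×ˢ Ioo 0 L₂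

/-- `H = L²(D)`, complex valued. -/
abbrev H (L₁ L₂ : ℝ) : Type := Lp ℂ 2 (volume.restrict (rect L₁ L₂))

/-- The partial derivative in the first space variable. -/
def d₁ (ψ : ℝ × ℝ → ℂ) (x : ℝ × ℝ) : ℂ := fderiv ℝ ψ x (1, 0)

/-- The partial derivative in the second space variable. -/
def d₂ (ψ : ℝ × ℝ → ℂ) (x : ℝ × ℝ) : ℂ := fderiv ℝ ψ x (0, 1)

/-- Complex-valued test functions: `C_c^∞(D)`. -/
structure IsTest (L₁ L₂ : ℝ) (ψ : ℝ × ℝ → ℂ) : Prop where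
  smooth : ContDiff ℝ ∞ ψ
  compact : HasCompactSupport ψ
  support : tsupport ψ ⊆ rect L₁ L₂

/-- The Hilbert space of triples `(w, w₁, w₂)` in `H`, with norm
`(‖w‖² + ‖w₁‖² + ‖w₂‖²)^{1/2}`. A function in `H¹(D)` is recorded as the triple
`(w, ∂₁w, ∂₂w)`. -/
abbrev Jet (L₁ L₂ : ℝ) : Type := PiLp 2 (fun _ : Fin 3 => H L₁ L₂)

/-- The triples `(ψ, ∂₁ψ, ∂₂ψ)` of test functions. -/
def testJets (L₁ L₂ : ℝ) : Set (Jet L₁ L₂) :=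
  {w | ∃ ψ : ℝ × ℝ → ℂ, IsTest L₁ L₂ ψ ∧
    w 0 =ᵐ[volume.restrict (rect L₁ L₂)] ψ ∧
    w 1 =ᵐ[volume.restrict (rect L₁ L₂)] d₁ ψ ∧
    w 2 =ᵐ[volume.restrict (rect L₁ L₂)] d₂ ψ}

/-- `V = H₀¹(D)`: the closure of `C_c^∞(D)` in the `H¹` norm. An element `w` consists of the
function `w 0` and its weak partial derivatives `w 1`, `w 2`. (The span is only there to obtain
a submodule; `testJets` is already closed under linear combinations.) -/
abbrev V (L₁ L₂ : ℝ) : Submodule ℂ (Jet L₁ L₂) :=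
  (Submodule.span ℂ (testJets L₁ L₂)).topologicalClosure

/-- The function `w ∈ H` underlying an element of `V`. -/
def fn {L₁ L₂ : ℝ} (w : V L₁ L₂) : H L₁ L₂ := (w : Jet L₁ L₂) 0

/-- The weak derivative `∂₁w`. -/
def dx {L₁ L₂ : ℝ} (w : V L₁ L₂) : H L₁ L₂ := (w : Jet L₁ L₂) 1

/-- The weak derivative `∂₂w`. -/
def dy {L₁ L₂ : ℝ} (w : V L₁ L₂) : H L₁ L₂ := (w : Jet L₁ L₂) 2

/-- `∫₀ᵀ ‖f(s)‖_{L^p(D)}^p ds` for `f : [0,T] → H`; finite iff `f ∈ L^p([0,T]; L^p(D))`. -/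
def LpLpEnergy {L₁ L₂ : ℝ} (T p : ℝ) (f : ℝ → H L₁ L₂) : ENNReal :=
  ∫⁻ s in Icc 0 T, ∫⁻ x in rect L₁ L₂, ‖f s x‖ₑ ^ p

/-! The operators `A` and `B`, as distributions on `D`. -/

/-- The pairing `∫_D v ψ dx`. -/
def pair {L₁ L₂ : ℝ} (v : H L₁ L₂) (ψ : ℝ × ℝ → ℂ) : ℂ :=
  ∫ x in rect L₁ L₂, v x * ψ x

/-- `A w = (1 + iα) Δw` paired with `ψ`: `-(1 + iα) ∫_D ∇w · ∇ψ dx`. -/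
def pairA {L₁ L₂ : ℝ} (α : ℝ) (w : V L₁ L₂) (ψ : ℝ × ℝ → ℂ) : ℂ :=
  -(1 + Complex.I * α) * ∫ x in rect L₁ L₂, (dx w x * d₁ ψ x + dy w x * d₂ ψ x)

/-- `F(w) = a · ∇(|w|² w) + (b · ∇w) |w|²` paired with `ψ`; the first gradient is the
distributional one. -/
def pairF {L₁ L₂ : ℝ} (a b : ℂ × ℂ) (w : V L₁ L₂) (ψ : ℝ × ℝ → ℂ) : ℂ :=
  -(∫ x in rect L₁ L₂, ((‖fn w x‖ ^ 2 : ℝ) : ℂ) * fn w x * (a.1 * d₁ ψ x + a.2 * d₂ ψ x)) +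
    ∫ x in rect L₁ L₂, (b.1 * dx w x + b.2 * dy w x) * ((‖fn w x‖ ^ 2 : ℝ) : ℂ) * ψ x

/-- `B w = -(1 - iβ) |w|^{2σ} w + γ w + F(w)` paired with `ψ`. -/
def pairB {L₁ L₂ : ℝ} (β γ σ : ℝ) (a b : ℂ × ℂ) (w : V L₁ L₂) (ψ : ℝ × ℝ → ℂ) : ℂ :=
  -(1 - Complex.I * β) *
      (∫ x in rect L₁ L₂, ((‖fn w x‖ ^ (2 * σ) : ℝ) : ℂ) * fn w x * ψ x) +
    γ * pair (fn w) ψ + pairF a b w ψ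

/-! The controls. A function on `[0,T] × Z` is given as a function on `ℝ × Z`, whose values for
times outside `[0,T]` play no role. -/

/-- `l(r) = r log r - r + 1`. -/
def ell (r : ℝ) : ℝ := r * Real.log r - r + 1

/-- `ν_T = λ_T ⊗ ν`. -/
def nuT {Z : Type*} [MeasurableSpace Z] (T : ℝ) (ν : Measure Z) : Measure (ℝ × Z) :=
  (volume.restrict (Icc 0 T)).prod ν

/-- `L_T(φ) = ∫ l(φ) dν_T`, with values in `[0,∞]` (note that `l ≥ 0` on `[0,∞)`). -/
def cost {Z : Type*} [MeasurableSpace Z] (T : ℝ) (ν : Measure Z) (φ : ℝ × Z → ℝ≥0) : ENNReal :=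
  ∫⁻ q, ENNReal.ofReal (ell (φ q)) ∂(nuT T ν)

/-- `S^N`: the measurable `φ ≥ 0` with `L_T(φ) ≤ N`. -/
def controls {Z : Type*} [MeasurableSpace Z] (T : ℝ) (ν : Measure Z) (N : ℕ) :
    Set (ℝ × Z → ℝ≥0) :=
  {φ | Measurable φ ∧ cost T ν φ ≤ N}

/-- The measure `ν_T^φ(A) = ∫_A φ dν_T`. -/
def nuTphi {Z : Type*} [MeasurableSpace Z] (T : ℝ) (ν : Measure Z) (φ : ℝ × Z → ℝ≥0) :
    Measure (ℝ × Z) :=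
  (nuT T ν).withDensity (fun q => (φ q : ENNReal))

/-- `φ_n → φ` in the topology induced by `φ ↦ ν_T^φ`: convergence of the integrals of all
continuous functions with compact support. (The measures live on `[0,T] × Z`, and the
elements of `C_c([0,T] × Z)` are the restrictions of the elements of `C_c(ℝ × Z)`.) -/
def ControlTendsto {Z : Type*} [TopologicalSpace Z] [MeasurableSpace Z] (T : ℝ) (ν : Measure Z)
    (φn : ℕ → ℝ × Z → ℝ≥0) (φ : ℝ × Z → ℝ≥0) : Prop :=
  ∀ f : ℝ × Z → ℝ, Continuous f → HasCompactSupport f →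
    Tendsto (fun n => ∫ q, f q ∂(nuTphi T ν (φn n))) atTop (𝓝 (∫ q, f q ∂(nuTphi T ν φ)))

/-- `u` solves the skeleton equation
`u(t) = u₀ + ∫₀ᵗ A u ds + ∫₀ᵗ B u ds + ∫₀ᵗ ∫_Z u(s) g(z) (φ(s,z) - 1) ν(dz) ds`, `t ∈ [0,T]`,
in the class `C([0,T], H) ∩ L²([0,T], V) ∩ L^{2σ+2}([0,T], L^{2σ+2}(D))`. Here `U` is the path `u`
regarded as a `V`-valued function, and the equation is read in the sense of distributions
on `D` (equivalently in `V*`, as `C_c^∞(D)` is dense in `V`). -/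
structure IsSkeletonSolution {Z : Type*} [MeasurableSpace Z] {L₁ L₂ : ℝ} (T α β γ σ : ℝ)
    (a b : ℂ × ℂ) (ν : Measure Z) (g : Z → ℂ) (u₀ : V L₁ L₂) (φ : ℝ × Z → ℝ≥0)
    (u : ℝ → H L₁ L₂) (U : ℝ → V L₁ L₂) : Prop where
  continuousOn : ContinuousOn u (Icc 0 T)
  memLp : MemLp U 2 (volume.restrict (Icc 0 T))
  eq_ae : ∀ᵐ s ∂(volume.restrict (Icc 0 T)), fn (U s) = u s
  energy : LpLpEnergy T (2 * σ + 2) u < ⊤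
  equation : ∀ ψ : ℝ × ℝ → ℂ, IsTest L₁ L₂ ψ → ∀ t ∈ Icc 0 T,
    pair (u t) ψ = pair (fn u₀) ψ + (∫ s in (0 : ℝ)..t, pairA α (U s) ψ) +
      (∫ s in (0 : ℝ)..t, pairB β γ σ a b (U s) ψ) +
      ∫ s in (0 : ℝ)..t, ∫ z, pair (u s) ψ * g z * ((φ (s, z) : ℂ) - 1) ∂ν

end GinzburgLandau

end

open GinzburgLandau

open scoped ComplexConjugate

noncomputable section

namespace GinzburgLandau

/-! ### Entropy estimates for the controls -/

section Controls

/-! The control enters the equation only through the function h(s) = ∫ g(z)(φ(s,z) − 1) ν(dz), which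
is constant in space and multiplies u. Let θ be the primitive of h and write u = e^θ v. Since
|cv|^{2σ}cv = c|c|^{2σ}|v|^{2σ}v, and similarly for the cubic derivative terms, v solves the same
equation without forcing, with the nonlinear coefficients multiplied by powers of |e^θ|
(`form_smul_left`, `IsForced.isWeak`, `IsWeak.isForced`). So the control acts on v only through θ,
and the proposition splits into two independent questions: the uniform convergence of the primitives
θ_n, and the well-posedness and stability of the equation for v with respect to its coefficients. No
compactness of the family of solutions is needed.

Convergence of θ_n. The entropy `ell` is the Legendre transform of eʸ − 1, which gives ∫_S |g||φ −
1| ≤ c⁻¹(N + ∫_S kap(c|g|)) for every c > 0; the exponential moments of g make `kap (c |g|)`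
integrable (`integrable_kap`). Taking c large yields equicontinuity and small tails, uniformly over
S^N. On what remains, g is bounded and the measure is finite, and vague convergence extends to
bounded integrable functions because S^N is uniformly integrable (`tendsto_integral_bdd_mul`,
`tendstoUniformlyOn_theta`).

The equation for v. The condition on β is the positive definiteness of a quadratic form on the plane
(`quadratic_ge`). It makes z ↦ (1 − iβ)|z|^{2σ}z strongly monotone with gain (|z| + |z′|)^{2σ}|z −
z′|² (`re_pow_sub_ge`). After Young's inequality the derivative terms cost quartic weights, which
this gain absorbs because σ > 2. The result is a one-sided estimate for the difference of the weak
forms at u and v that requires a V-bound on v only (`exists_form_mono`). The same positivity, used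
after testing with −Δ, gives an H¹ estimate (`exists_re_form_lapl_le`). Hence the Galerkin
approximations in the sine eigenbasis are bounded in V with ∫‖Δv‖² bounded; combined with
monotonicity this makes them a Cauchy sequence, and the limit is a weak solution bounded in V
(`exists_galerkin_sub_le`, `exists_isWeak`).

An arbitrary solution in the class of the statement has no evident time derivative in a space where
it can be tested with itself. The energy inequality for a difference of two solutions is obtained
from finite increments and the continuity of translations (`energy_le_of_weak_derivative`).
Comparing an arbitrary solution with the one bounded in V gives uniqueness, and a squared error of
order δ² when the coefficients differ by δ, in H uniformly in time, in L²(V), and for the (2σ+2)-th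
power of the L^{2σ+2} norm (`exists_stability`). Undoing the gauge gives
`IsForced.exists_stability`, from which the convergence follows. -/

theorem mul_le_ell_add_exp {r : ℝ} (hr : 0 ≤ r) (y : ℝ) :
    y * r ≤ ell r + (Real.exp y - 1) := by
  unfold ell
  rcases hr.eq_or_lt with rfl | hr
  · simp [(Real.exp_pos y).le]
  · have h1 := Real.add_one_le_exp (y - Real.log r)
    rw [Real.exp_sub, Real.exp_log hr, le_div_iff₀ hr] at h1
    nlinarith

theorem ell_nonneg {r : ℝ} (hr : 0 ≤ r) : 0 ≤ ell r := by
  simpa using mul_le_ell_add_exp hr 0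

/-- The convex conjugate bound behind the integrability of `g (φ - 1)`. -/
def kap (y : ℝ) : ℝ := Real.exp y - 1 - y

theorem kap_nonneg (y : ℝ) : 0 ≤ kap y := by
  unfold kap; linarith [Real.add_one_le_exp y]

/-- `mul_le_ell_add_exp` is the Fenchel–Young inequality for `ell` and eʸ − 1. It is used with y for
r ≥ 1 and with −y for r ≤ 1; the second case needs e⁻ʸ − 1 + y ≤ eʸ − 1 − y, that is y ≤ sinh y. -/
theorem mul_abs_sub_one_le {r y : ℝ} (hr : 0 ≤ r) (hy : 0 ≤ y) :
    y * |r - 1| ≤ ell r + kap y := by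
  unfold kap
  rcases le_total 1 r with h | h
  · rw [abs_of_nonneg (by linarith)]
    linarith [mul_le_ell_add_exp hr y]
  · rw [abs_of_nonpos (by linarith)]
    have h1 := mul_le_ell_add_exp hr (-y)
    have h2 := Real.self_le_sinh_iff.2 hy
    rw [Real.sinh_eq] at h2
    linarith

theorem measurable_ell : Measurable ell := by
  unfold ell; fun_prop

/-- The free scale c is the point: a large c makes the entropy contribution, which is at most N
after integration, small, and the remaining term no longer involves φ. -/
theorem norm_mul_sub_one_le {Z : Type*} (φ : ℝ × Z → ℝ≥0) (g : Z → ℂ) {c : ℝ} (hc : 0 < c) (q : ℝ × Z) :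
    ‖g q.2 * ((φ q : ℂ) - 1)‖ ≤ c⁻¹ * (ell (φ q) + kap (c * ‖g q.2‖)) := by
  have h1 := mul_abs_sub_one_le (r := φ q) (y := c * ‖g q.2‖) (φ q).coe_nonneg (by positivity)
  have h2 : ‖(φ q : ℂ) - 1‖ = |(φ q : ℝ) - 1| := by
    rw [← Real.norm_eq_abs, ← Complex.norm_real]; push_cast; rfl
  rw [norm_mul, h2, le_inv_mul_iff₀ hc, ← mul_assoc]
  exact h1

variable {Z : Type*} [MeasurableSpace Z]

/-- The drift coefficient `h(s) = ∫ g(z) (φ(s,z) - 1) ν(dz)`. -/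
def drift (ν : Measure Z) (g : Z → ℂ) (φ : ℝ × Z → ℝ≥0) (s : ℝ) : ℂ :=
  ∫ z, g z * ((φ (s, z) : ℂ) - 1) ∂ν

/-- The primitive of the drift coefficient. -/
def theta (ν : Measure Z) (g : Z → ℂ) (φ : ℝ × Z → ℝ≥0) (t : ℝ) : ℂ :=
  ∫ s in (0 : ℝ)..t, drift ν g φ s

variable {ν : Measure Z} {T : ℝ} {N : ℕ} {φ : ℝ × Z → ℝ≥0} {g : Z → ℂ}

theorem integrable_ell (hφ : φ ∈ controls T ν N) :
    Integrable (fun q => ell (φ q)) (nuT T ν) := by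
  obtain ⟨hm, hc⟩ := hφ
  refine ⟨(measurable_ell.comp (by fun_prop)).aestronglyMeasurable, ?_⟩
  rw [hasFiniteIntegral_iff_ofReal (ae_of_all _ fun q => ell_nonneg (φ q).coe_nonneg)]
  exact lt_of_le_of_lt hc (by simp)

theorem integral_ell_le (hφ : φ ∈ controls T ν N) :
    ∫ q, ell (φ q) ∂(nuT T ν) ≤ N := by
  rw [integral_eq_lintegral_of_nonneg_ae (ae_of_all _ fun q => ell_nonneg (φ q).coe_nonneg)
    (integrable_ell hφ).1]
  exact ENNReal.toReal_le_of_le_ofReal (by positivity) (by simpa [cost] using hφ.2)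

theorem setIntegral_ell_le (hφ : φ ∈ controls T ν N) (S : Set (ℝ × Z)) :
    ∫ q in S, ell (φ q) ∂(nuT T ν) ≤ N :=
  (setIntegral_le_integral (integrable_ell hφ) (ae_of_all _ fun q => ell_nonneg (φ q).coe_nonneg)).trans
    (integral_ell_le hφ)

/-- `kap` is quadratic near 0, so square integrability of g handles the region c|g| < 1. The region
c|g| ≥ 1 has finite measure by Chebyshev's inequality, and there c|g| ≤ c²/(4δ) + δ|g|² reduces the
claim to the exponential moment. -/
theorem integrable_kap (hg : Measurable g) (hg2 : MemLp g 2 ν)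
    (hgexp : ∃ δ > 0, ∀ E : Set Z, MeasurableSet E → ν E < ⊤ →
      IntegrableOn (fun z => Real.exp (δ * ‖g z‖ ^ 2)) E ν) {c : ℝ} (hc : 0 < c) :
    Integrable (fun z => kap (c * ‖g z‖)) ν := by
  obtain ⟨δ, hδ, hE⟩ := hgexp
  have hi2 : Integrable (fun z => ‖g z‖ ^ 2) ν := hg2.integrable_norm_pow (by norm_num)
  set E : Set Z := {z | c⁻¹ ^ 2 ≤ ‖g z‖ ^ 2}
  have hEm : MeasurableSet E := measurableSet_le measurable_const (by fun_prop)
  have hEf : ν E < ⊤ := by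
    have := hi2.measure_norm_ge_lt_top (ε := c⁻¹ ^ 2) (by positivity)
    simpa [E] using this
  have h3 : Integrable (fun z => c ^ 2 * ‖g z‖ ^ 2 +
      Real.exp (c ^ 2 / (4 * δ)) * E.indicator (fun z => Real.exp (δ * ‖g z‖ ^ 2)) z) ν :=
    (hi2.const_mul _).add (((integrable_indicator_iff hEm).2 (hE E hEm hEf)).const_mul _)
  refine h3.mono' (by unfold kap; fun_prop) (ae_of_all _ fun z => ?_)
  rw [Real.norm_of_nonneg (kap_nonneg _)]
  by_cases hz : z ∈ E
  · rw [indicator_of_mem hz, ← Real.exp_add]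
    have h4 : c * ‖g z‖ ≤ c ^ 2 / (4 * δ) + δ * ‖g z‖ ^ 2 := by
      have : 0 ≤ (c / (2 * δ) - ‖g z‖) ^ 2 * δ := by positivity
      have e : (c / (2 * δ) - ‖g z‖) ^ 2 * δ = c ^ 2 / (4 * δ) + δ * ‖g z‖ ^ 2 - c * ‖g z‖ := by
        field_simp; ring
      linarith
    have := Real.exp_le_exp.2 h4
    have h5 : 0 ≤ c * ‖g z‖ := by positivity
    have h6 : 0 ≤ c ^ 2 * ‖g z‖ ^ 2 := by positivity
    unfold kap; linarith
  · rw [indicator_of_notMem hz, mul_zero, add_zero]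
    have h4 : ‖g z‖ ≤ c⁻¹ := by
      have : ‖g z‖ ^ 2 < c⁻¹ ^ 2 := not_le.1 hz
      exact le_of_sq_le_sq this.le (by positivity)
    have h5 : |c * ‖g z‖| ≤ 1 := by
      rw [abs_of_nonneg (by positivity)]
      calc c * ‖g z‖ ≤ c * c⁻¹ := by gcongr
        _ = 1 := mul_inv_cancel₀ hc.ne'
    have := (abs_le.1 (Real.abs_exp_sub_one_sub_id_le h5)).2
    unfold kap; linarith [mul_pow c ‖g z‖ 2]

/-- This is the uniform integrability of S^N: choosing first c large and then G small in L¹ makes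
the bound small for all controls of cost at most N. It is Fenchel–Young at y = c|G| together with eʸ
− 1 ≤ y eʸ. -/
theorem integrable_bdd_mul (hφ : φ ∈ controls T ν N) {G : ℝ × Z → ℝ} {R : ℝ}
    (hGR : ∀ q, |G q| ≤ R) (hG : Integrable G (nuT T ν)) :
    Integrable (fun q => G q * φ q) (nuT T ν) ∧ ∀ c > 0,
      ∫ q, |G q| * φ q ∂(nuT T ν) ≤ c⁻¹ * N + Real.exp (c * R) * ∫ q, |G q| ∂(nuT T ν) := by
  have hφm := hφ.1
  have hb : ∀ c > 0, ∀ q, |G q| * φ q ≤ c⁻¹ * ell (φ q) + Real.exp (c * R) * |G q| := by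
    intro c hc q
    have h1 := mul_le_ell_add_exp (r := φ q) (φ q).coe_nonneg (c * |G q|)
    have h2 : Real.exp (c * |G q|) - 1 ≤ c * |G q| * Real.exp (c * |G q|) := by
      have h := Real.add_one_le_exp (-(c * |G q|))
      rw [Real.exp_neg] at h
      have hp := Real.exp_pos (c * |G q|)
      have := mul_le_mul_of_nonneg_right h hp.le
      rw [inv_mul_cancel₀ hp.ne'] at this
      linarith
    have h3 : Real.exp (c * |G q|) ≤ Real.exp (c * R) := by
      gcongr; exact hGR q
    have h4 : c * |G q| * Real.exp (c * |G q|) ≤ c * |G q| * Real.exp (c * R) := by gcongr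
    have h5 : c * (|G q| * φ q) ≤ ell (φ q) + c * |G q| * Real.exp (c * R) := by linarith
    calc |G q| * φ q = c⁻¹ * (c * (|G q| * φ q)) := by field_simp
      _ ≤ c⁻¹ * (ell (φ q) + c * |G q| * Real.exp (c * R)) := by gcongr
      _ = _ := by field_simp
  have hint : ∀ c : ℝ, Integrable (fun q => c⁻¹ * ell (φ q) + Real.exp (c * R) * |G q|)
      (nuT T ν) := fun c => ((integrable_ell hφ).const_mul _).add (hG.abs.const_mul _)
  have hI : Integrable (fun q => G q * φ q) (nuT T ν) := by
    refine (hint 1).mono' (hG.1.mul (Measurable.aestronglyMeasurable (by fun_prop)))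
      (ae_of_all _ fun q => ?_)
    rw [norm_mul, Real.norm_eq_abs, Real.norm_of_nonneg (φ q).coe_nonneg]
    exact hb 1 one_pos q
  refine ⟨hI, fun c hc => ?_⟩
  have hI' : Integrable (fun q => |G q| * φ q) (nuT T ν) := by
    refine hI.norm.congr (ae_of_all _ fun q => ?_)
    simp
  refine (integral_mono hI' (hint c) (hb c hc)).trans ?_
  rw [integral_add ((integrable_ell hφ).const_mul _) (hG.abs.const_mul _), integral_const_mul,
    integral_const_mul]
  gcongr
  exact integral_ell_le hφ

variable [SFinite ν]

theorem integrable_snd_nuT {f : Z → ℝ} (hf : Integrable f ν) :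
    Integrable (fun q : ℝ × Z => f q.2) (nuT T ν) := by
  unfold nuT
  exact hf.comp_snd _

theorem integrable_mul_sub_one (hφ : φ ∈ controls T ν N) (hg : Measurable g) (hg2 : MemLp g 2 ν)
    (hgexp : ∃ δ > 0, ∀ E : Set Z, MeasurableSet E → ν E < ⊤ →
      IntegrableOn (fun z => Real.exp (δ * ‖g z‖ ^ 2)) E ν) :
    Integrable (fun q : ℝ × Z => g q.2 * ((φ q : ℂ) - 1)) (nuT T ν) := by
  have h := hφ.1
  refine (((integrable_ell hφ).add
    (integrable_snd_nuT (T := T) (integrable_kap hg hg2 hgexp one_pos))).const_mul 1⁻¹).mono'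
    (Measurable.aestronglyMeasurable (by fun_prop))
    (ae_of_all _ fun q => norm_mul_sub_one_le φ g one_pos q)

theorem setIntegral_mul_sub_one_le (hφ : φ ∈ controls T ν N) (hg : Measurable g)
    (hg2 : MemLp g 2 ν)
    (hgexp : ∃ δ > 0, ∀ E : Set Z, MeasurableSet E → ν E < ⊤ →
      IntegrableOn (fun z => Real.exp (δ * ‖g z‖ ^ 2)) E ν) {c : ℝ} (hc : 0 < c)
    (S : Set (ℝ × Z)) :
    ∫ q in S, ‖g q.2 * ((φ q : ℂ) - 1)‖ ∂(nuT T ν) ≤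
      c⁻¹ * (N + ∫ q in S, kap (c * ‖g q.2‖) ∂(nuT T ν)) := by
  have h1 := (integrable_ell hφ).integrableOn (s := S)
  have h2 := (integrable_snd_nuT (T := T) (integrable_kap hg hg2 hgexp hc)).integrableOn (s := S)
  calc _ ≤ ∫ q in S, c⁻¹ * (ell (φ q) + kap (c * ‖g q.2‖)) ∂(nuT T ν) :=
        setIntegral_mono (integrable_mul_sub_one hφ hg hg2 hgexp).norm.integrableOn
          ((h1.add h2).const_mul _) (fun q => norm_mul_sub_one_le φ g hc q)
    _ ≤ _ := by
        rw [integral_const_mul, integral_add h1 h2]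
        gcongr
        exact setIntegral_ell_le hφ S

theorem integrableOn_drift (hφ : φ ∈ controls T ν N) (hg : Measurable g) (hg2 : MemLp g 2 ν)
    (hgexp : ∃ δ > 0, ∀ E : Set Z, MeasurableSet E → ν E < ⊤ →
      IntegrableOn (fun z => Real.exp (δ * ‖g z‖ ^ 2)) E ν) :
    IntegrableOn (drift ν g φ) (Icc 0 T) := by
  have := integrable_mul_sub_one hφ hg hg2 hgexp
  unfold nuT at this
  exact this.integral_prod_left

theorem setIntegral_drift (hφ : φ ∈ controls T ν N) (hg : Measurable g) (hg2 : MemLp g 2 ν)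
    (hgexp : ∃ δ > 0, ∀ E : Set Z, MeasurableSet E → ν E < ⊤ →
      IntegrableOn (fun z => Real.exp (δ * ‖g z‖ ^ 2)) E ν) {I : Set ℝ} (hI : MeasurableSet I)
    (hIT : I ⊆ Icc 0 T) :
    ∫ s in I, drift ν g φ s = ∫ q in I ×ˢ univ, g q.2 * ((φ q : ℂ) - 1) ∂(nuT T ν) := by
  have := (integrable_mul_sub_one hφ hg hg2 hgexp).integrableOn (s := I ×ˢ univ)
  unfold nuT at *
  rw [IntegrableOn] at this
  rw [← Measure.prod_restrict, Measure.restrict_restrict hI, Measure.restrict_univ,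
    inter_eq_left.2 hIT] at *
  exact (integral_prod _ this).symm

theorem theta_sub (hφ : φ ∈ controls T ν N) (hg : Measurable g) (hg2 : MemLp g 2 ν)
    (hgexp : ∃ δ > 0, ∀ E : Set Z, MeasurableSet E → ν E < ⊤ →
      IntegrableOn (fun z => Real.exp (δ * ‖g z‖ ^ 2)) E ν) {s t : ℝ} (hs : 0 ≤ s) (hst : s ≤ t)
    (ht : t ≤ T) :
    theta ν g φ t - theta ν g φ s =
      ∫ q in (Ioc s t) ×ˢ univ, g q.2 * ((φ q : ℂ) - 1) ∂(nuT T ν) := by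
  have hi := integrableOn_drift hφ hg hg2 hgexp
  unfold theta
  rw [intervalIntegral.integral_interval_sub_left, intervalIntegral.integral_of_le hst,
    setIntegral_drift hφ hg hg2 hgexp measurableSet_Ioc]
  · exact fun x hx => ⟨hs.trans hx.1.le, hx.2.trans ht⟩
  · exact (intervalIntegrable_iff_integrableOn_Ioc_of_le (hs.trans hst)).2
      (hi.mono_set fun x hx => ⟨hx.1.le, hx.2.trans ht⟩)
  · exact (intervalIntegrable_iff_integrableOn_Ioc_of_le hs).2
      (hi.mono_set fun x hx => ⟨hx.1.le, hx.2.trans (hst.trans ht)⟩)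

theorem setIntegral_snd_nuT (f : Z → ℝ) {I : Set ℝ} (hI : MeasurableSet I)
    (hIT : I ⊆ Icc 0 T) (B : Set Z) :
    ∫ q in I ×ˢ B, f q.2 ∂(nuT T ν) = (volume I).toReal * ∫ z in B, f z ∂ν := by
  unfold nuT
  rw [← Measure.prod_restrict, Measure.restrict_restrict hI, inter_eq_left.2 hIT,
    integral_fun_snd]
  simp [Measure.real]

/-- The primitives of the drift coefficients are equicontinuous, uniformly over `S^N`. -/
theorem norm_theta_sub_le (hφ : φ ∈ controls T ν N) (hg : Measurable g) (hg2 : MemLp g 2 ν)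
    (hgexp : ∃ δ > 0, ∀ E : Set Z, MeasurableSet E → ν E < ⊤ →
      IntegrableOn (fun z => Real.exp (δ * ‖g z‖ ^ 2)) E ν) {c : ℝ} (hc : 0 < c)
    {s t : ℝ} (hs : 0 ≤ s) (hst : s ≤ t) (ht : t ≤ T) :
    ‖theta ν g φ t - theta ν g φ s‖ ≤ c⁻¹ * (N + (t - s) * ∫ z, kap (c * ‖g z‖) ∂ν) := by
  rw [theta_sub hφ hg hg2 hgexp hs hst ht]
  refine (norm_integral_le_integral_norm _).trans
    ((setIntegral_mul_sub_one_le hφ hg hg2 hgexp hc _).trans_eq ?_)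
  rw [setIntegral_snd_nuT (fun z => kap (c * ‖g z‖)) measurableSet_Ioc
    (fun x hx => ⟨hs.trans hx.1.le, hx.2.trans ht⟩)]
  simp [hst]

end Controls

/-! ### Convergence of the drift primitives under vague convergence of the controls -/

section ControlConvergence

variable {Z : Type*} [TopologicalSpace Z] [PolishSpace Z] [LocallyCompactSpace Z]
    [MeasurableSpace Z] [BorelSpace Z] {ν : Measure Z} [IsFiniteMeasureOnCompacts ν]
    {T : ℝ} {N : ℕ} {φ : ℝ × Z → ℝ≥0} {φn : ℕ → ℝ × Z → ℝ≥0} {g : Z → ℂ}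

/-- Compactly supported continuous functions are dense in L¹(ν_T), and by `integrable_bdd_mul` a
change of G that is bounded and small in L¹ changes ∫ G φ little, uniformly over S^N. -/
theorem tendsto_integral_bdd_mul (hφn : ∀ n, φn n ∈ controls T ν N) (hφ : φ ∈ controls T ν N)
    (hconv : ControlTendsto T ν φn φ) {G : ℝ × Z → ℝ} {R : ℝ} (hR : 0 ≤ R)
    (hGR : ∀ q, |G q| ≤ R) (hG : Integrable G (nuT T ν)) :
    Tendsto (fun n => ∫ q, G q * φn n q ∂(nuT T ν)) atTop (𝓝 (∫ q, G q * φ q ∂(nuT T ν))) := by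
  have : (nuT T ν).Regular := by unfold nuT; infer_instance
  let _ := TopologicalSpace.upgradeIsCompletelyMetrizable Z
  rw [Metric.tendsto_atTop]
  intro ε hε
  set c : ℝ := 8 * (N + 1) / ε
  have hc : 0 < c := by positivity
  have hcN : c⁻¹ * N ≤ ε / 8 := by
    rw [inv_mul_le_iff₀ hc]
    have : c * (ε / 8) = N + 1 := by simp only [c]; field_simp
    linarith
  -- Clamping f to [−R, R] preserves the compact support and the closeness to G and bounds the
  -- difference by 2R; hence the exponent c · 2R in the required accuracy.
  obtain ⟨f, hfc, hfi, hfcont, hfint⟩ := hG.exists_hasCompactSupport_integral_sub_le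
    (ε := ε / 8 / Real.exp (c * (2 * R))) (by positivity)
  set f' : ℝ × Z → ℝ := fun q => max (-R) (min R (f q))
  have hf'cont : Continuous f' := by fun_prop
  have hf'c : HasCompactSupport f' :=
    hfc.comp_left (g := fun x => max (-R) (min R x)) (by simp [hR])
  have hf'R : ∀ q, |f' q| ≤ R := fun q =>
    abs_le.2 ⟨le_max_left _ _, max_le (by linarith) (min_le_left _ _)⟩
  have hle : ∀ q, |G q - f' q| ≤ ‖G q - f q‖ := by
    intro q
    have h1 := abs_le.1 (hGR q)
    have h2 : G q = max (-R) (min R (G q)) := by rw [min_eq_right h1.2, max_eq_right h1.1]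
    rw [Real.norm_eq_abs]
    calc |G q - f' q| = |max (-R) (min R (G q)) - max (-R) (min R (f q))| := by rw [← h2]
      _ ≤ |min R (G q) - min R (f q)| := by
        simpa using abs_max_sub_max_le_max (-R) (min R (G q)) (-R) (min R (f q))
      _ ≤ |G q - f q| := by
        simpa using abs_min_sub_min_le_max R (G q) R (f q)
  have hf'int : Integrable f' (nuT T ν) := hf'cont.integrable_of_hasCompactSupport hf'c
  have hd : Integrable (fun q => G q - f' q) (nuT T ν) := hG.sub hf'int
  have hdR : ∀ q, |G q - f' q| ≤ 2 * R := fun q => by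
    refine (abs_sub _ _).trans ?_
    linarith [hGR q, hf'R q]
  have hdi : ∫ q, |G q - f' q| ∂(nuT T ν) ≤ ε / 8 / Real.exp (c * (2 * R)) :=
    (integral_mono hd.abs (hG.sub hfint).norm hle).trans hfi
  have key : ∀ ψ ∈ controls T ν N, |∫ q, G q * ψ q ∂(nuT T ν) - ∫ q, f' q * ψ q ∂(nuT T ν)|
      ≤ ε / 4 := by
    intro ψ hψ
    rw [← integral_sub (integrable_bdd_mul hψ hGR hG).1 (integrable_bdd_mul hψ hf'R hf'int).1]
    refine (abs_integral_le_integral_abs).trans ?_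
    have h1 := (integrable_bdd_mul hψ hdR hd).2 c hc
    have h2 : ∀ q, |G q * ψ q - f' q * ψ q| = |G q - f' q| * ψ q := fun q => by
      rw [← sub_mul, abs_mul, abs_of_nonneg (ψ q).coe_nonneg]
    simp_rw [h2]
    refine h1.trans ?_
    have h3 : Real.exp (c * (2 * R)) * ∫ q, |G q - f' q| ∂(nuT T ν) ≤ ε / 8 := by
      have := mul_le_mul_of_nonneg_left hdi (Real.exp_pos (c * (2 * R))).le
      rwa [mul_div_cancel₀ _ (Real.exp_pos _).ne'] at this
    linarith
  have h4 := hconv f' hf'cont hf'c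
  unfold nuTphi at h4
  simp_rw [integral_withDensity_eq_integral_smul hφ.1,
    fun n => integral_withDensity_eq_integral_smul (hφn n).1 (μ := nuT T ν) f'] at h4
  obtain ⟨n₀, hn₀⟩ := Metric.tendsto_atTop.1 h4 (ε / 4) (by positivity)
  refine ⟨n₀, fun n hn => ?_⟩
  have h5 := hn₀ n hn
  have e1 : ∀ ψ : ℝ × Z → ℝ≥0, ∫ q, ψ q • f' q ∂(nuT T ν) = ∫ q, f' q * ψ q ∂(nuT T ν) :=
    fun ψ => integral_congr_ae (ae_of_all _ fun q => by simp [NNReal.smul_def, mul_comm])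
  rw [e1, e1, Real.dist_eq] at h5
  rw [Real.dist_eq]
  have h6 := key _ (hφn n)
  have h7 := key _ hφ
  rw [abs_lt] at *
  rw [abs_le] at *
  constructor <;> linarith

/-- The sets B are members of a compact exhaustion cut down to {|g| ≤ n}. They increase to Z, so the
integral of an integrable function over their complements tends to 0. -/
theorem exists_tail_le (hg : Measurable g) (hg2 : MemLp g 2 ν)
    (hgexp : ∃ δ > 0, ∀ E : Set Z, MeasurableSet E → ν E < ⊤ →
      IntegrableOn (fun z => Real.exp (δ * ‖g z‖ ^ 2)) E ν) {c : ℝ} (hc : 0 < c) {ε : ℝ}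
    (hε : 0 < ε) :
    ∃ (B : Set Z) (R : ℝ), MeasurableSet B ∧ 0 ≤ R ∧ ν B < ⊤ ∧ (∀ z ∈ B, ‖g z‖ ≤ R) ∧
      ∫ z in Bᶜ, kap (c * ‖g z‖) ∂ν ≤ ε := by
  let _ := TopologicalSpace.upgradeIsCompletelyMetrizable Z
  set B : ℕ → Set Z := fun n => compactCovering Z n ∩ {z | ‖g z‖ ≤ n}
  have hBm : ∀ n, MeasurableSet (B n) := fun n =>
    (isCompact_compactCovering Z n).measurableSet.inter (measurableSet_le hg.norm measurable_const)
  have hBmono : Monotone B := fun m n h =>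
    inter_subset_inter (compactCovering_subset Z h) fun z hz =>
      le_trans (show ‖g z‖ ≤ m from hz) (by exact_mod_cast h)
  have hlim := tendsto_setIntegral_of_antitone (μ := ν) (f := fun z => kap (c * ‖g z‖))
    (s := fun n => (B n)ᶜ) (fun n => (hBm n).compl) (fun m n h => compl_subset_compl.2 (hBmono h))
    ⟨0, (integrable_kap hg hg2 hgexp hc).integrableOn⟩
  have hemp : ⋂ n, (B n)ᶜ = ∅ := by
    rw [← compl_iUnion, compl_empty_iff, eq_univ_iff_forall]
    intro z
    obtain ⟨n, hn⟩ := exists_mem_compactCovering z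
    obtain ⟨m, hm⟩ := exists_nat_ge ‖g z‖
    refine mem_iUnion.2 ⟨max n m, compactCovering_subset Z (le_max_left _ _) hn, ?_⟩
    exact hm.trans (by simp)
  rw [hemp] at hlim
  simp only [Measure.restrict_empty, integral_zero_measure] at hlim
  obtain ⟨n, hn⟩ := (hlim.eventually_lt_const hε).exists
  exact ⟨B n, n, hBm n, by positivity,
    (measure_mono inter_subset_left).trans_lt (isCompact_compactCovering Z n).measure_lt_top,
    fun z hz => hz.2, hn.le⟩

/-- Off B the entropy bound is small uniformly over S^N, by the choice of c. On B the function g is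
bounded and the measure is finite, so `tendsto_integral_bdd_mul` applies to its real and imaginary
parts. -/
theorem tendsto_theta (hφn : ∀ n, φn n ∈ controls T ν N) (hφ : φ ∈ controls T ν N)
    (hconv : ControlTendsto T ν φn φ) (hg : Measurable g) (hg2 : MemLp g 2 ν)
    (hgexp : ∃ δ > 0, ∀ E : Set Z, MeasurableSet E → ν E < ⊤ →
      IntegrableOn (fun z => Real.exp (δ * ‖g z‖ ^ 2)) E ν) {t : ℝ} (ht : t ∈ Icc 0 T) :
    Tendsto (fun n => theta ν g (φn n) t) atTop (𝓝 (theta ν g φ t)) := by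
  have hT : 0 ≤ T := ht.1.trans ht.2
  rw [Metric.tendsto_atTop]
  intro ε hε
  set c : ℝ := 8 * (N + 1) / ε
  have hc : 0 < c := by positivity
  have hcN : c⁻¹ * (N + 1) = ε / 8 := by simp only [c]; field_simp
  obtain ⟨B, R, hBm, hR, hBf, hBR, hBi⟩ := exists_tail_le hg hg2 hgexp hc
    (ε := 1 / (T + 1)) (by positivity)
  have hI : Ioc 0 t ⊆ Icc 0 T := fun x hx => ⟨hx.1.le, hx.2.trans ht.2⟩
  -- the contribution of the complement of `B` is uniformly small
  have htail : ∀ ψ ∈ controls T ν N,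
      ‖∫ q in Ioc 0 t ×ˢ Bᶜ, g q.2 * ((ψ q : ℂ) - 1) ∂(nuT T ν)‖ ≤ ε / 8 := by
    intro ψ hψ
    refine (norm_integral_le_integral_norm _).trans
      ((setIntegral_mul_sub_one_le hψ hg hg2 hgexp hc _).trans ?_)
    rw [setIntegral_snd_nuT (fun z => kap (c * ‖g z‖)) measurableSet_Ioc hI, ← hcN]
    gcongr
    simp only [Real.volume_Ioc, sub_zero, ENNReal.toReal_ofReal ht.1]
    calc t * _ ≤ T * (1 / (T + 1)) := by
          gcongr
          · exact setIntegral_nonneg hBm.compl fun z _ => kap_nonneg _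
          · exact ht.2
      _ ≤ 1 := by rw [mul_one_div, div_le_one (by positivity)]; linarith
  have hS : MeasurableSet (Ioc 0 t ×ˢ B) := measurableSet_Ioc.prod hBm
  -- the main contribution converges
  have hfin : nuT T ν (Ioc 0 t ×ˢ B) < ⊤ := by
    unfold nuT
    rw [Measure.prod_prod]
    exact ENNReal.mul_lt_top (measure_lt_top _ _) hBf
  have hpart : ∀ f : Z → ℝ, Measurable f → (∀ z, |f z| ≤ ‖g z‖) →
      Tendsto (fun n => ∫ q in Ioc 0 t ×ˢ B, f q.2 * φn n q ∂(nuT T ν)) atTop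
        (𝓝 (∫ q in Ioc 0 t ×ˢ B, f q.2 * φ q ∂(nuT T ν))) := by
    intro f hf hfg
    set G : ℝ × Z → ℝ := (Ioc 0 t ×ˢ B).indicator (fun q => f q.2)
    have hGR : ∀ q, |G q| ≤ R := by
      intro q
      by_cases hq : q ∈ Ioc 0 t ×ˢ B
      · simp only [G, indicator_of_mem hq]
        exact (hfg _).trans (hBR _ hq.2)
      · simp only [G, indicator_of_notMem hq, abs_zero, hR]
    have hGi : Integrable G (nuT T ν) := by
      refine Integrable.mono' (g := (Ioc 0 t ×ˢ B).indicator fun _ => R)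
        ((integrable_indicator_iff hS).2 (integrableOn_const hfin.ne))
        (Measurable.aestronglyMeasurable ((hf.comp measurable_snd).indicator hS))
        (ae_of_all _ fun q => ?_)
      by_cases hq : q ∈ Ioc 0 t ×ˢ B
      · simp only [G, indicator_of_mem hq, Real.norm_eq_abs]
        exact (hfg _).trans (hBR _ hq.2)
      · simp only [G, indicator_of_notMem hq, norm_zero, le_refl]
    have e : ∀ ψ : ℝ × Z → ℝ≥0, ∫ q in Ioc 0 t ×ˢ B, f q.2 * ψ q ∂(nuT T ν) =
        ∫ q, G q * ψ q ∂(nuT T ν) := by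
      intro ψ
      rw [← integral_indicator hS]
      congr 1
      funext q
      by_cases hq : q ∈ Ioc 0 t ×ˢ B <;> simp [G, hq]
    simp_rw [e]
    exact tendsto_integral_bdd_mul hφn hφ hconv hR hGR hGi
  have hre := hpart (fun z => (g z).re) (by fun_prop) (fun z => Complex.abs_re_le_norm _)
  have him := hpart (fun z => (g z).im) (by fun_prop) (fun z => Complex.abs_im_le_norm _)
  have hint : ∀ ψ ∈ controls T ν N, ∀ f : Z → ℝ, Measurable f → (∀ z, |f z| ≤ ‖g z‖) →
      IntegrableOn (fun q : ℝ × Z => f q.2) (Ioc 0 t ×ˢ B) (nuT T ν) ∧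
      IntegrableOn (fun q => f q.2 * (ψ q : ℝ)) (Ioc 0 t ×ˢ B) (nuT T ν) := by
    intro ψ hψ f hf hfg
    have h1 : IntegrableOn (fun q : ℝ × Z => f q.2) (Ioc 0 t ×ˢ B) (nuT T ν) := by
      refine Integrable.mono' (g := fun _ => R) (integrableOn_const hfin.ne)
        (hf.comp measurable_snd).aestronglyMeasurable
        ((ae_restrict_iff' hS).2 (ae_of_all _ fun q hq => ?_))
      exact (hfg _).trans (hBR _ hq.2)
    refine ⟨h1, ?_⟩
    have h2 := (integrable_mul_sub_one hψ hg hg2 hgexp).integrableOn (s := Ioc 0 t ×ˢ B)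
    have hψm := hψ.1
    refine (h2.norm.add h1.norm).mono' (Measurable.aestronglyMeasurable (by fun_prop))
      (ae_of_all _ fun q => ?_)
    have h3 : ‖(ψ q : ℂ) - 1‖ = |(ψ q : ℝ) - 1| := by
      rw [← Real.norm_eq_abs, ← Complex.norm_real]; push_cast; rfl
    simp only [Pi.add_apply, norm_mul, h3, Real.norm_eq_abs]
    have h4 : f q.2 * (ψ q : ℝ) = f q.2 * ((ψ q : ℝ) - 1) + f q.2 := by ring
    rw [← abs_mul, h4]
    refine (abs_add_le _ _).trans ?_
    rw [abs_mul]
    gcongr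
    exact hfg _
  have hsplit : ∀ ψ ∈ controls T ν N, ∫ q in Ioc 0 t ×ˢ B, g q.2 * ((ψ q : ℂ) - 1) ∂(nuT T ν) =
      ((∫ q in Ioc 0 t ×ˢ B, (g q.2).re * ψ q ∂(nuT T ν) : ℝ) : ℂ) +
      ((∫ q in Ioc 0 t ×ˢ B, (g q.2).im * ψ q ∂(nuT T ν) : ℝ) : ℂ) * Complex.I -
      ∫ q in Ioc 0 t ×ˢ B, g q.2 ∂(nuT T ν) := by
    intro ψ hψ
    obtain ⟨r1, r2⟩ := hint ψ hψ (fun z => (g z).re) (by fun_prop)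
      (fun z => Complex.abs_re_le_norm _)
    obtain ⟨i1, i2⟩ := hint ψ hψ (fun z => (g z).im) (by fun_prop)
      (fun z => Complex.abs_im_le_norm _)
    have r1' : Integrable (fun q : ℝ × Z => (((g q.2).re : ℝ) : ℂ))
      ((nuT T ν).restrict (Ioc 0 t ×ˢ B)) := r1.ofReal
    have i1' : Integrable (fun q : ℝ × Z => (((g q.2).im : ℝ) : ℂ))
      ((nuT T ν).restrict (Ioc 0 t ×ˢ B)) := i1.ofReal
    have hgI : Integrable (fun q : ℝ × Z => g q.2) ((nuT T ν).restrict (Ioc 0 t ×ˢ B)) := by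
      refine (r1'.add (i1'.mul_const Complex.I)).congr (ae_of_all _ fun q => ?_)
      simp [Complex.re_add_im]
    have r2' : Integrable (fun q : ℝ × Z => (((g q.2).re * ψ q : ℝ) : ℂ))
      ((nuT T ν).restrict (Ioc 0 t ×ˢ B)) := r2.ofReal
    have i2' : Integrable (fun q : ℝ × Z => (((g q.2).im * ψ q : ℝ) : ℂ))
      ((nuT T ν).restrict (Ioc 0 t ×ˢ B)) := i2.ofReal
    rw [← integral_complex_ofReal, ← integral_complex_ofReal, ← integral_mul_const,
      ← integral_add r2' (i2'.mul_const _),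
      ← integral_sub (f := fun q : ℝ × Z => (((g q.2).re * ψ q : ℝ) : ℂ) +
        (((g q.2).im * ψ q : ℝ) : ℂ) * Complex.I) (r2'.add (i2'.mul_const _)) hgI]
    congr 1
    funext q
    have h := Complex.re_add_im (g q.2)
    push_cast
    linear_combination (-(ψ q : ℂ)) * h
  have hmain : Tendsto (fun n => ∫ q in Ioc 0 t ×ˢ B, g q.2 * ((φn n q : ℂ) - 1) ∂(nuT T ν)) atTop
      (𝓝 (∫ q in Ioc 0 t ×ˢ B, g q.2 * ((φ q : ℂ) - 1) ∂(nuT T ν))) := by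
    rw [hsplit φ hφ]
    simp_rw [fun n => hsplit (φn n) (hφn n)]
    exact (((Complex.continuous_ofReal.tendsto _).comp hre).add
      (((Complex.continuous_ofReal.tendsto _).comp him).mul_const _)).sub_const _
  have hdec : ∀ ψ ∈ controls T ν N, theta ν g ψ t =
      ∫ q in Ioc 0 t ×ˢ B, g q.2 * ((ψ q : ℂ) - 1) ∂(nuT T ν) +
      ∫ q in Ioc 0 t ×ˢ Bᶜ, g q.2 * ((ψ q : ℂ) - 1) ∂(nuT T ν) := by
    intro ψ hψ
    have h0 : theta ν g ψ 0 = 0 := by simp [theta]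
    have h1 := theta_sub hψ hg hg2 hgexp le_rfl ht.1 ht.2
    have hi := integrable_mul_sub_one hψ hg hg2 hgexp
    rw [h0, sub_zero] at h1
    rw [h1, ← setIntegral_union _ (measurableSet_Ioc.prod hBm.compl) hi.integrableOn
      hi.integrableOn, ← prod_union, union_compl_self]
    exact Disjoint.set_prod_right disjoint_compl_right _ _
  obtain ⟨n₀, hn₀⟩ := Metric.tendsto_atTop.1 hmain (ε / 4) (by positivity)
  refine ⟨n₀, fun n hn => ?_⟩
  rw [hdec _ (hφn n), hdec _ hφ]
  refine (dist_add_add_le _ _ _ _).trans_lt ?_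
  have h1 := hn₀ n hn
  have h2 : dist (∫ q in Ioc 0 t ×ˢ Bᶜ, g q.2 * ((φn n q : ℂ) - 1) ∂(nuT T ν))
      (∫ q in Ioc 0 t ×ˢ Bᶜ, g q.2 * ((φ q : ℂ) - 1) ∂(nuT T ν)) ≤ ε / 8 + ε / 8 := by
    rw [dist_eq_norm]
    exact (norm_sub_le _ _).trans (add_le_add (htail _ (hφn n)) (htail _ hφ))
  linarith

/-- Convergence of the controls in `S^N` implies uniform convergence of the primitives of the
drift coefficients. -/
theorem tendstoUniformlyOn_theta (hT : 0 < T) (hφn : ∀ n, φn n ∈ controls T ν N)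
    (hφ : φ ∈ controls T ν N)
    (hconv : ControlTendsto T ν φn φ) (hg : Measurable g) (hg2 : MemLp g 2 ν)
    (hgexp : ∃ δ > 0, ∀ E : Set Z, MeasurableSet E → ν E < ⊤ →
      IntegrableOn (fun z => Real.exp (δ * ‖g z‖ ^ 2)) E ν) :
    TendstoUniformlyOn (fun n => theta ν g (φn n)) (theta ν g φ) atTop (Icc 0 T) := by
  rw [Metric.tendstoUniformlyOn_iff]
  intro ε hε
  set c : ℝ := 8 * (N + 1) / ε
  have hc : 0 < c := by positivity
  have hcN : c⁻¹ * (N + 1) = ε / 8 := by simp only [c]; field_simp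
  set κ := ∫ z, kap (c * ‖g z‖) ∂ν
  have hκ : 0 ≤ κ := integral_nonneg fun z => kap_nonneg _
  obtain ⟨m, hm⟩ := exists_nat_ge (T * κ)
  have hosc : ∀ ψ ∈ controls T ν N, ∀ s t, 0 ≤ s → s ≤ t → t ≤ T → t - s ≤ T / (m + 1) →
      ‖theta ν g ψ t - theta ν g ψ s‖ ≤ ε / 8 := by
    intro ψ hψ s t hs hst ht hd
    refine (norm_theta_sub_le hψ hg hg2 hgexp hc hs hst ht).trans ?_
    rw [← hcN]
    gcongr
    calc (t - s) * κ ≤ T / (m + 1) * κ := by gcongr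
      _ = T * κ / (m + 1) := by ring
      _ ≤ 1 := by rw [div_le_one (by positivity)]; linarith
  -- There are m + 2 nodes because t = T has index m + 1. The minimum with T places every node in
  -- [0,T] without a case distinction.
  have hgrid : ∀ i ∈ Finset.range (m + 2), ∀ᶠ n in atTop,
      dist (theta ν g (φn n) (min T (i * (T / (m + 1))))) (theta ν g φ (min T (i * (T / (m + 1)))))
        < ε / 4 := fun i _ =>
    Metric.tendsto_nhds.1 (tendsto_theta hφn hφ hconv hg hg2 hgexp
      ⟨le_min hT.le (by positivity), min_le_left _ _⟩) _ (by positivity)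
  rw [← Filter.eventually_all_finset] at hgrid
  filter_upwards [hgrid] with n hn t ht
  have hpos : 0 < T / (m + 1 : ℝ) := by positivity
  set i := ⌊t / (T / (m + 1))⌋₊
  have hi1 : (i : ℝ) * (T / (m + 1)) ≤ t := by
    rw [← le_div_iff₀ hpos]; exact Nat.floor_le (div_nonneg ht.1 hpos.le)
  have hi2 : t < ((i : ℝ) + 1) * (T / (m + 1)) := by
    rw [← div_lt_iff₀ hpos]; exact Nat.lt_floor_add_one _
  have hi3 : i < m + 2 := by
    have : (i : ℝ) * (T / (m + 1)) ≤ (m + 1 : ℕ) * (T / (m + 1)) := by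
      push_cast; rw [mul_div_cancel₀ _ (by positivity)]; exact hi1.trans ht.2
    have := le_of_mul_le_mul_right this hpos
    have := Nat.cast_le.1 this
    omega
  have h1 := hn i (Finset.mem_range.2 hi3)
  rw [min_eq_right (hi1.trans ht.2)] at h1
  set s := (i : ℝ) * (T / (m + 1))
  have hs : 0 ≤ s := by positivity
  have hd : t - s ≤ T / (m + 1) := by simp only [s]; linarith
  have h2 := hosc _ (hφn n) s t hs hi1 ht.2 hd
  have h3 := hosc _ hφ s t hs hi1 ht.2 hd
  rw [← dist_eq_norm] at h2 h3
  have h4 := dist_triangle4 (theta ν g φ t) (theta ν g φ s) (theta ν g (φn n) s)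
    (theta ν g (φn n) t)
  rw [dist_comm (theta ν g φ s), dist_comm (theta ν g (φn n) s) (theta ν g (φn n) t)] at h4
  linarith

end ControlConvergence

/-! ### The spaces H and V, and the density of test functions -/

section FunctionSpace

variable {L₁ L₂ : ℝ}

/-- Lebesgue measure on the rectangle. -/
abbrev dom (L₁ L₂ : ℝ) : Measure (ℝ × ℝ) := volume.restrict (rect L₁ L₂)

theorem measurableSet_rect : MeasurableSet (rect L₁ L₂) :=
  measurableSet_Ioo.prod measurableSet_Ioo

instance : IsFiniteMeasure (dom L₁ L₂) := by
  refine ⟨?_⟩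
  rw [Measure.restrict_apply_univ]
  refine (measure_mono (Set.prod_mono Ioo_subset_Icc_self Ioo_subset_Icc_self)).trans_lt ?_
  exact ((isCompact_Icc (a := (0 : ℝ)) (b := L₁)).prod
    (isCompact_Icc (a := (0 : ℝ)) (b := L₂))).measure_lt_top

/-- `w ↦ w` as a continuous linear map `V → H`. -/
def fnL (L₁ L₂ : ℝ) : V L₁ L₂ →L[ℂ] H L₁ L₂ :=
  (PiLp.proj 2 (fun _ : Fin 3 => H L₁ L₂) (0 : Fin 3)).comp (V L₁ L₂).subtypeL

/-- `w ↦ ∂₁w` as a continuous linear map `V → H`. -/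
def dxL (L₁ L₂ : ℝ) : V L₁ L₂ →L[ℂ] H L₁ L₂ :=
  (PiLp.proj 2 (fun _ : Fin 3 => H L₁ L₂) (1 : Fin 3)).comp (V L₁ L₂).subtypeL

/-- `w ↦ ∂₂w` as a continuous linear map `V → H`. -/
def dyL (L₁ L₂ : ℝ) : V L₁ L₂ →L[ℂ] H L₁ L₂ :=
  (PiLp.proj 2 (fun _ : Fin 3 => H L₁ L₂) (2 : Fin 3)).comp (V L₁ L₂).subtypeL

@[simp] theorem fnL_apply (w : V L₁ L₂) : fnL L₁ L₂ w = fn w := rfl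
@[simp] theorem dxL_apply (w : V L₁ L₂) : dxL L₁ L₂ w = dx w := rfl
@[simp] theorem dyL_apply (w : V L₁ L₂) : dyL L₁ L₂ w = dy w := rfl

@[simp] theorem fn_add (v w : V L₁ L₂) : fn (v + w) = fn v + fn w := rfl
@[simp] theorem fn_sub (v w : V L₁ L₂) : fn (v - w) = fn v - fn w := rfl
@[simp] theorem fn_smul (c : ℂ) (w : V L₁ L₂) : fn (c • w) = c • fn w := rfl
@[simp] theorem fn_zero : fn (0 : V L₁ L₂) = 0 := rfl
@[simp] theorem dx_add (v w : V L₁ L₂) : dx (v + w) = dx v + dx w := rfl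
@[simp] theorem dx_sub (v w : V L₁ L₂) : dx (v - w) = dx v - dx w := rfl
@[simp] theorem dx_smul (c : ℂ) (w : V L₁ L₂) : dx (c • w) = c • dx w := rfl
@[simp] theorem dx_zero : dx (0 : V L₁ L₂) = 0 := rfl
@[simp] theorem dy_add (v w : V L₁ L₂) : dy (v + w) = dy v + dy w := rfl
@[simp] theorem dy_sub (v w : V L₁ L₂) : dy (v - w) = dy v - dy w := rfl
@[simp] theorem dy_smul (c : ℂ) (w : V L₁ L₂) : dy (c • w) = c • dy w := rfl
@[simp] theorem dy_zero : dy (0 : V L₁ L₂) = 0 := rfl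

/-- The Dirichlet energy `‖∇w‖²`. -/
def gr (w : V L₁ L₂) : ℝ := ‖dx w‖ ^ 2 + ‖dy w‖ ^ 2

theorem gr_nonneg (w : V L₁ L₂) : 0 ≤ gr w := by unfold gr; positivity

theorem norm_sq_eq (w : V L₁ L₂) : ‖w‖ ^ 2 = ‖fn w‖ ^ 2 + gr w := by
  rw [Submodule.coe_norm, PiLp.norm_sq_eq_of_L2, Fin.sum_univ_three, add_assoc]
  rfl

theorem norm_fn_le (w : V L₁ L₂) : ‖fn w‖ ≤ ‖w‖ := by
  have := norm_sq_eq w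
  have h := gr_nonneg w
  exact le_of_sq_le_sq (by linarith) (norm_nonneg _)

theorem gr_le (w : V L₁ L₂) : gr w ≤ ‖w‖ ^ 2 := by
  rw [norm_sq_eq]; linarith [sq_nonneg ‖fn w‖]

theorem H.norm_sq_eq (f : H L₁ L₂) : ‖f‖ ^ 2 = ∫ x, ‖f x‖ ^ 2 ∂(dom L₁ L₂) := by
  have h1 : ((‖f‖ ^ 2 : ℝ) : ℂ) = inner ℂ f f := by
    rw [inner_self_eq_norm_sq_to_K]; push_cast; rfl
  have h2 : ((‖f‖ ^ 2 : ℝ) : ℂ) = ((∫ x, ‖f x‖ ^ 2 ∂(dom L₁ L₂) : ℝ) : ℂ) := by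
    rw [h1, L2.inner_def, ← integral_complex_ofReal]
    refine integral_congr_ae (ae_of_all _ fun x => ?_)
    simp only
    rw [inner_self_eq_norm_sq_to_K]; push_cast; rfl
  exact_mod_cast h2

theorem H.integrable_sq (f : H L₁ L₂) : Integrable (fun x => ‖f x‖ ^ 2) (dom L₁ L₂) :=
  (Lp.memLp f).integrable_norm_pow (by norm_num)

theorem H.ofReal_norm_sq (f : H L₁ L₂) :
    ENNReal.ofReal (‖f‖ ^ 2) = ∫⁻ x, ‖f x‖ₑ ^ 2 ∂(dom L₁ L₂) := by
  rw [H.norm_sq_eq, ofReal_integral_eq_lintegral_ofReal (H.integrable_sq f)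
    (ae_of_all _ fun x => by positivity)]
  refine lintegral_congr fun x => ?_
  rw [ENNReal.ofReal_pow (norm_nonneg _), ofReal_norm]

theorem gr_eq_integral (w : V L₁ L₂) :
    gr w = ∫ x, (‖dx w x‖ ^ 2 + ‖dy w x‖ ^ 2) ∂(dom L₁ L₂) := by
  rw [integral_add (H.integrable_sq _) (H.integrable_sq _), ← H.norm_sq_eq, ← H.norm_sq_eq]
  rfl

theorem IsTest.contDiff_d₁ {ψ : ℝ × ℝ → ℂ} (h : IsTest L₁ L₂ ψ) : Continuous (d₁ ψ) :=
  (h.smooth.continuous_fderiv (by simp)).clm_apply continuous_const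

theorem IsTest.contDiff_d₂ {ψ : ℝ × ℝ → ℂ} (h : IsTest L₁ L₂ ψ) : Continuous (d₂ ψ) :=
  (h.smooth.continuous_fderiv (by simp)).clm_apply continuous_const

theorem IsTest.compact_d₁ {ψ : ℝ × ℝ → ℂ} (h : IsTest L₁ L₂ ψ) : HasCompactSupport (d₁ ψ) :=
  h.compact.fderiv_apply ℝ _

theorem IsTest.compact_d₂ {ψ : ℝ × ℝ → ℂ} (h : IsTest L₁ L₂ ψ) : HasCompactSupport (d₂ ψ) :=
  h.compact.fderiv_apply ℝ _

/-- The triple of `L²` functions given by three square integrable functions. -/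
def mkJet (f f₁ f₂ : ℝ × ℝ → ℂ) (h : MemLp f 2 (dom L₁ L₂)) (h₁ : MemLp f₁ 2 (dom L₁ L₂))
    (h₂ : MemLp f₂ 2 (dom L₁ L₂)) : Jet L₁ L₂ :=
  WithLp.toLp 2 ![h.toLp f, h₁.toLp f₁, h₂.toLp f₂]

theorem mkJet_ae (f f₁ f₂ : ℝ × ℝ → ℂ) (h : MemLp f 2 (dom L₁ L₂))
    (h₁ : MemLp f₁ 2 (dom L₁ L₂)) (h₂ : MemLp f₂ 2 (dom L₁ L₂)) :
    mkJet f f₁ f₂ h h₁ h₂ 0 =ᵐ[dom L₁ L₂] f ∧ mkJet f f₁ f₂ h h₁ h₂ 1 =ᵐ[dom L₁ L₂] f₁ ∧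
      mkJet f f₁ f₂ h h₁ h₂ 2 =ᵐ[dom L₁ L₂] f₂ :=
  ⟨h.coeFn_toLp, h₁.coeFn_toLp, h₂.coeFn_toLp⟩

theorem memLp_of_continuous_of_compact {f : ℝ × ℝ → ℂ} (hf : Continuous f)
    (hc : HasCompactSupport f) : MemLp f 2 (dom L₁ L₂) :=
  (hf.memLp_of_hasCompactSupport hc).restrict _

theorem IsTest.exists_jet {ψ : ℝ × ℝ → ℂ} (h : IsTest L₁ L₂ ψ) :
    ∃ w : V L₁ L₂, fn w =ᵐ[dom L₁ L₂] ψ ∧ dx w =ᵐ[dom L₁ L₂] d₁ ψ ∧ dy w =ᵐ[dom L₁ L₂] d₂ ψ := by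
  have h0 := memLp_of_continuous_of_compact (L₁ := L₁) (L₂ := L₂) h.smooth.continuous h.compact
  have h1 := memLp_of_continuous_of_compact (L₁ := L₁) (L₂ := L₂) h.contDiff_d₁ h.compact_d₁
  have h2 := memLp_of_continuous_of_compact (L₁ := L₁) (L₂ := L₂) h.contDiff_d₂ h.compact_d₂
  obtain ⟨e0, e1, e2⟩ := mkJet_ae _ _ _ h0 h1 h2
  exact ⟨⟨mkJet _ _ _ h0 h1 h2, Submodule.le_topologicalClosure _
    (Submodule.subset_span ⟨ψ, h, e0, e1, e2⟩)⟩, e0, e1, e2⟩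

theorem IsTest.zero : IsTest L₁ L₂ 0 :=
  ⟨contDiff_const, HasCompactSupport.zero, by simp⟩

theorem IsTest.add {ψ χ : ℝ × ℝ → ℂ} (h : IsTest L₁ L₂ ψ) (h' : IsTest L₁ L₂ χ) :
    IsTest L₁ L₂ (ψ + χ) :=
  ⟨h.smooth.add h'.smooth, h.compact.add h'.compact,
    (tsupport_add _ _).trans (union_subset h.support h'.support)⟩

theorem IsTest.smul {ψ : ℝ × ℝ → ℂ} (c : ℂ) (h : IsTest L₁ L₂ ψ) :
    IsTest L₁ L₂ (c • ψ) :=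
  ⟨contDiff_const.smul h.smooth, h.compact.smul_left (f := fun _ => c),
    (tsupport_smul_subset_right (fun _ => c) ψ).trans h.support⟩

/-- Thanks to this, elements of V are limits of jets of single test functions, and the span in the
definition of V plays no further role. -/
theorem span_testJets : (Submodule.span ℂ (testJets L₁ L₂) : Set (Jet L₁ L₂)) = testJets L₁ L₂ := by
  refine Subset.antisymm (fun w hw => ?_) Submodule.subset_span
  induction hw using Submodule.span_induction with
  | mem w hw => exact hw
  | zero =>
    refine ⟨0, IsTest.zero, ?_, ?_, ?_⟩
    · exact Lp.coeFn_zero _ _ _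
    · refine (Lp.coeFn_zero _ _ _).trans (Eq.eventuallyEq ?_)
      ext x; simp [d₁]
    · refine (Lp.coeFn_zero _ _ _).trans (Eq.eventuallyEq ?_)
      ext x; simp [d₂]
  | add v w _ _ hv hw =>
    obtain ⟨ψ, hψ, a0, a1, a2⟩ := hv
    obtain ⟨χ, hχ, b0, b1, b2⟩ := hw
    refine ⟨ψ + χ, hψ.add hχ, ?_, ?_, ?_⟩
    · exact (Lp.coeFn_add _ _).trans (a0.add b0)
    · refine ((Lp.coeFn_add _ _).trans (a1.add b1)).trans (Eq.eventuallyEq ?_)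
      ext x
      simp [d₁, fderiv_add (hψ.smooth.differentiable (by simp) x)
        (hχ.smooth.differentiable (by simp) x)]
    · refine ((Lp.coeFn_add _ _).trans (a2.add b2)).trans (Eq.eventuallyEq ?_)
      ext x
      simp [d₂, fderiv_add (hψ.smooth.differentiable (by simp) x)
        (hχ.smooth.differentiable (by simp) x)]
  | smul c w _ hw =>
    obtain ⟨ψ, hψ, a0, a1, a2⟩ := hw
    refine ⟨c • ψ, hψ.smul c, ?_, ?_, ?_⟩
    · exact (Lp.coeFn_smul _ _).trans (a0.const_smul c)
    · refine ((Lp.coeFn_smul _ _).trans (a1.const_smul c)).trans (Eq.eventuallyEq ?_)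
      ext x
      simp [d₁, fderiv_const_smul (hψ.smooth.differentiable (by simp) x)]
    · refine ((Lp.coeFn_smul _ _).trans (a2.const_smul c)).trans (Eq.eventuallyEq ?_)
      ext x
      simp [d₂, fderiv_const_smul (hψ.smooth.differentiable (by simp) x)]

/-- Every element of `V` is a limit of jets of test functions. -/
theorem exists_seq_test (w : V L₁ L₂) : ∃ (wn : ℕ → V L₁ L₂) (ψ : ℕ → ℝ × ℝ → ℂ),
    (∀ n, IsTest L₁ L₂ (ψ n) ∧ fn (wn n) =ᵐ[dom L₁ L₂] ψ n ∧ dx (wn n) =ᵐ[dom L₁ L₂] d₁ (ψ n) ∧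
      dy (wn n) =ᵐ[dom L₁ L₂] d₂ (ψ n)) ∧ Tendsto wn atTop (𝓝 w) := by
  have h := w.2
  rw [← SetLike.mem_coe, Submodule.topologicalClosure_coe, span_testJets,
    mem_closure_iff_seq_limit] at h
  obtain ⟨x, hx, hlim⟩ := h
  have hxV : ∀ n, x n ∈ V L₁ L₂ := fun n =>
    Submodule.le_topologicalClosure _ (Submodule.subset_span (hx n))
  choose ψ hψ using hx
  exact ⟨fun n => ⟨x n, hxV n⟩, ψ, hψ, tendsto_subtype_rng.2 hlim⟩

/-- A property that is closed in the V-norm, such as integration by parts, needs to be checked for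
smooth compactly supported functions only. -/
theorem dense_test_induction {P : V L₁ L₂ → Prop} (hP : IsClosed {w | P w})
    (h : ∀ (w : V L₁ L₂) (ψ : ℝ × ℝ → ℂ), IsTest L₁ L₂ ψ → fn w =ᵐ[dom L₁ L₂] ψ →
      dx w =ᵐ[dom L₁ L₂] d₁ ψ → dy w =ᵐ[dom L₁ L₂] d₂ ψ → P w) (w : V L₁ L₂) : P w := by
  obtain ⟨wn, ψ, hn, hlim⟩ := exists_seq_test w
  exact hP.mem_of_tendsto hlim (Eventually.of_forall fun n =>
    h _ _ (hn n).1 (hn n).2.1 (hn n).2.2.1 (hn n).2.2.2)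

/-! ### The Gagliardo–Nirenberg inequality -/

theorem lintegral_mul_sq_le {α : Type*} [MeasurableSpace α] {μ : Measure α} {f g : α → ENNReal}
    (hf : AEMeasurable f μ) (hg : AEMeasurable g μ) :
    (∫⁻ x, f x * g x ∂μ) ^ 2 ≤ (∫⁻ x, f x ^ 2 ∂μ) * ∫⁻ x, g x ^ 2 ∂μ := by
  have h := ENNReal.lintegral_mul_le_Lp_mul_Lq μ Real.HolderConjugate.two_two hf hg
  simp only [Pi.mul_apply, ENNReal.rpow_two] at h
  calc _ ≤ ((∫⁻ x, f x ^ 2 ∂μ) ^ (1 / 2 : ℝ) * (∫⁻ x, g x ^ 2 ∂μ) ^ (1 / 2 : ℝ)) ^ 2 := by gcongr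
    _ = _ := by
      rw [mul_pow, ← ENNReal.rpow_two, ← ENNReal.rpow_two, ← ENNReal.rpow_mul, ← ENNReal.rpow_mul]
      norm_num

theorem norm_fderiv_le (ψ : ℝ × ℝ → ℂ) (x : ℝ × ℝ) :
    ‖fderiv ℝ ψ x‖ ≤ ‖d₁ ψ x‖ + ‖d₂ ψ x‖ := by
  refine ContinuousLinearMap.opNorm_le_bound _ (by positivity) fun v => ?_
  have : fderiv ℝ ψ x v = v.1 • d₁ ψ x + v.2 • d₂ ψ x := by
    unfold d₁ d₂
    rw [← map_smul, ← map_smul, ← map_add]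
    congr 1
    ext <;> simp
  rw [this, add_mul]
  refine (norm_add_le _ _).trans ?_
  rw [norm_smul, norm_smul, mul_comm, mul_comm ‖v.2‖]
  gcongr
  · exact norm_fst_le v
  · exact norm_snd_le v

/-- Induction on the exponent. The planar Sobolev inequality ‖f‖_{L²} ≤ C‖∇f‖_{L¹} is applied to f =
ψ^{k+2}. Since |∇f| ≤ (k+2)|ψ|^{k+1}|∇ψ|, Cauchy–Schwarz bounds the square of the right-hand side by
the previous case times ∫|∇ψ|², so each step gains one factor of the Dirichlet energy. -/
theorem exists_lintegral_pow_test (k : ℕ) : ∃ C : ℝ≥0, ∀ ψ : ℝ × ℝ → ℂ, ContDiff ℝ ∞ ψ →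
    HasCompactSupport ψ → ∫⁻ x, ‖ψ x‖ₑ ^ (2 * (k + 1)) ≤
      C * (∫⁻ x, ‖ψ x‖ₑ ^ 2) * (∫⁻ x, (‖d₁ ψ x‖ₑ ^ 2 + ‖d₂ ψ x‖ₑ ^ 2)) ^ k := by
  induction k with
  | zero => exact ⟨1, fun ψ _ _ => by simp⟩
  | succ k ih =>
    obtain ⟨C, hC⟩ := ih
    set K := lintegralPowLePowLIntegralFDerivConst (volume : Measure (ℝ × ℝ)) 2
    refine ⟨K * (2 * ((k : ℝ≥0) + 2) ^ 2) * C, fun ψ hψ hc => ?_⟩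
    have hd1 : Continuous (d₁ ψ) := (hψ.continuous_fderiv (by simp)).clm_apply continuous_const
    have hd2 : Continuous (d₂ ψ) := (hψ.continuous_fderiv (by simp)).clm_apply continuous_const
    have hcont := hψ.continuous
    have h1 := lintegral_pow_le_pow_lintegral_fderiv (volume : Measure (ℝ × ℝ))
      (u := fun x => ψ x ^ (k + 2)) ((hψ.pow _).of_le (by simp))
      (hc.comp_left (g := fun z => z ^ (k + 2)) (by simp)) (p := 2)
      (by simp only [Module.finrank_prod, Module.finrank_self]; norm_num
          exact Real.HolderConjugate.two_two)
    have h2 : ∀ x, ‖fderiv ℝ (fun x => ψ x ^ (k + 2)) x‖ₑ ≤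
        ‖ψ x‖ₑ ^ (k + 1) * ((k + 2 : ℕ) * (‖d₁ ψ x‖ₑ + ‖d₂ ψ x‖ₑ)) := by
      intro x
      have e : fderiv ℝ (fun x => ψ x ^ (k + 2)) x = ((k + 2 : ℕ) * ψ x ^ (k + 1)) • fderiv ℝ ψ x := by
        have := (hψ.differentiable (by simp) x).hasFDerivAt.pow (k + 2)
        rw [this.fderiv]
        simp
      rw [e]
      have h3 : ‖((k + 2 : ℕ) * ψ x ^ (k + 1)) • fderiv ℝ ψ x‖ ≤
          ‖ψ x‖ ^ (k + 1) * ((k + 2 : ℕ) * (‖d₁ ψ x‖ + ‖d₂ ψ x‖)) := by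
        rw [norm_smul, norm_mul, norm_pow, Complex.norm_natCast]
        have := norm_fderiv_le ψ x
        calc _ ≤ (k + 2 : ℕ) * ‖ψ x‖ ^ (k + 1) * (‖d₁ ψ x‖ + ‖d₂ ψ x‖) := by gcongr
          _ = _ := by ring
      have h4 := ENNReal.ofReal_le_ofReal h3
      rw [ENNReal.ofReal_mul (by positivity), ENNReal.ofReal_mul (by positivity),
        ENNReal.ofReal_add (by positivity) (by positivity), ENNReal.ofReal_pow (by positivity),
        ENNReal.ofReal_natCast] at h4
      simpa only [ofReal_norm] using h4
    have h5 : (∫⁻ x, ‖fderiv ℝ (fun x => ψ x ^ (k + 2)) x‖ₑ) ^ 2 ≤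
        (∫⁻ x, ‖ψ x‖ₑ ^ (2 * (k + 1))) * ((2 * ((k : ENNReal) + 2) ^ 2) *
          ∫⁻ x, (‖d₁ ψ x‖ₑ ^ 2 + ‖d₂ ψ x‖ₑ ^ 2)) := by
      calc _ ≤ (∫⁻ x, ‖ψ x‖ₑ ^ (k + 1) * ((k + 2 : ℕ) * (‖d₁ ψ x‖ₑ + ‖d₂ ψ x‖ₑ))) ^ 2 := by
            gcongr with x; exact h2 x
        _ ≤ (∫⁻ x, (‖ψ x‖ₑ ^ (k + 1)) ^ 2) *
            ∫⁻ x, ((k + 2 : ℕ) * (‖d₁ ψ x‖ₑ + ‖d₂ ψ x‖ₑ)) ^ 2 :=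
          lintegral_mul_sq_le (by fun_prop) (by fun_prop)
        _ ≤ _ := by
          gcongr ?_ * ?_
          · refine le_of_eq (lintegral_congr fun x => ?_)
            rw [← pow_mul, mul_comm]
          · rw [← lintegral_const_mul _ (by fun_prop)]
            refine lintegral_mono fun x => ?_
            simp only
            rw [mul_pow]
            push_cast
            rw [mul_comm 2, mul_assoc]
            gcongr
            have := add_sq_le (a := ‖d₁ ψ x‖ₑ.toReal) (b := ‖d₂ ψ x‖ₑ.toReal)
            have h6 := ENNReal.ofReal_le_ofReal this
            rw [ENNReal.ofReal_pow (by positivity), ENNReal.ofReal_mul (by norm_num),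
              ENNReal.ofReal_add (by positivity) (by positivity),
              ENNReal.ofReal_add (by positivity) (by positivity),
              ENNReal.ofReal_pow (by positivity), ENNReal.ofReal_pow (by positivity)] at h6
            simpa using h6
    have h7 := hC ψ hψ hc
    calc ∫⁻ x, ‖ψ x‖ₑ ^ (2 * (k + 1 + 1)) = ∫⁻ x, ‖ψ x ^ (k + 2)‖ₑ ^ (2 : ℝ) := by
          refine lintegral_congr fun x => ?_
          rw [ENNReal.rpow_two, enorm_pow, ← pow_mul]; ring_nf
      _ ≤ K * (∫⁻ x, ‖fderiv ℝ (fun x => ψ x ^ (k + 2)) x‖ₑ) ^ 2 := by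
          simpa only [ENNReal.rpow_two] using h1
      _ ≤ K * ((∫⁻ x, ‖ψ x‖ₑ ^ (2 * (k + 1))) * ((2 * ((k : ENNReal) + 2) ^ 2) *
          ∫⁻ x, (‖d₁ ψ x‖ₑ ^ 2 + ‖d₂ ψ x‖ₑ ^ 2))) := by gcongr
      _ ≤ K * ((C * (∫⁻ x, ‖ψ x‖ₑ ^ 2) * (∫⁻ x, (‖d₁ ψ x‖ₑ ^ 2 + ‖d₂ ψ x‖ₑ ^ 2)) ^ k) *
          ((2 * ((k : ENNReal) + 2) ^ 2) * ∫⁻ x, (‖d₁ ψ x‖ₑ ^ 2 + ‖d₂ ψ x‖ₑ ^ 2))) := by gcongr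
      _ = _ := by push_cast; ring

end FunctionSpace

/-! ### Embedding of V into L^q for all finite q -/

section Sobolev

variable {L₁ L₂ : ℝ}

theorem ofReal_gr (w : V L₁ L₂) :
    ENNReal.ofReal (gr w) = ∫⁻ x, (‖dx w x‖ₑ ^ 2 + ‖dy w x‖ₑ ^ 2) ∂(dom L₁ L₂) := by
  unfold gr
  rw [ENNReal.ofReal_add (by positivity) (by positivity), H.ofReal_norm_sq, H.ofReal_norm_sq,
    lintegral_add_left' ((Lp.aestronglyMeasurable _).enorm.pow_const _)]

theorem IsTest.lintegral_eq {ψ : ℝ × ℝ → ℂ} (h : IsTest L₁ L₂ ψ) {f : ℝ × ℝ → ENNReal}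
    (hf : ∀ x ∉ tsupport ψ, f x = 0) : ∫⁻ x, f x = ∫⁻ x, f x ∂(dom L₁ L₂) := by
  rw [← lintegral_indicator measurableSet_rect]
  congr 1
  funext x
  by_cases hx : x ∈ rect L₁ L₂
  · rw [indicator_of_mem hx]
  · rw [indicator_of_notMem hx, hf x fun hx' => hx (h.support hx')]

theorem fderiv_eq_zero_of_notMem {ψ : ℝ × ℝ → ℂ} {x : ℝ × ℝ} (hx : x ∉ tsupport ψ) :
    fderiv ℝ ψ x = 0 := by
  by_contra h
  exact hx (support_fderiv_subset ℝ h)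

theorem tendsto_ae_subseq {wn : ℕ → H L₁ L₂} {w : H L₁ L₂} (h : Tendsto wn atTop (𝓝 w)) :
    ∃ ns : ℕ → ℕ, StrictMono ns ∧ ∀ᵐ x ∂(dom L₁ L₂),
      Tendsto (fun n => wn (ns n) x) atTop (𝓝 (w x)) :=
  (tendstoInMeasure_of_tendsto_Lp h).exists_seq_tendsto_ae

/-- The Gagliardo–Nirenberg inequality on `V`. -/
theorem exists_lintegral_pow (L₁ L₂ : ℝ) (k : ℕ) : ∃ C : ℝ≥0, ∀ w : V L₁ L₂,
    ∫⁻ x, ‖fn w x‖ₑ ^ (2 * (k + 1)) ∂(dom L₁ L₂) ≤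
      C * ENNReal.ofReal (‖fn w‖ ^ 2) * ENNReal.ofReal (gr w) ^ k := by
  obtain ⟨C, hC⟩ := exists_lintegral_pow_test k
  refine ⟨C, fun w => ?_⟩
  obtain ⟨wn, ψ, hn, hlim⟩ := exists_seq_test w
  have hfn : Tendsto (fun n => fn (wn n)) atTop (𝓝 (fn w)) :=
    ((fnL L₁ L₂).continuous.tendsto w).comp hlim
  have hgr : Tendsto (fun n => gr (wn n)) atTop (𝓝 (gr w)) :=
    ((((dxL L₁ L₂).continuous.tendsto w).comp hlim).norm.pow 2).add
      ((((dyL L₁ L₂).continuous.tendsto w).comp hlim).norm.pow 2)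
  have hb : ∀ n, ∫⁻ x, ‖fn (wn n) x‖ₑ ^ (2 * (k + 1)) ∂(dom L₁ L₂) ≤
      C * ENNReal.ofReal (‖fn (wn n)‖ ^ 2) * ENNReal.ofReal (gr (wn n)) ^ k := by
    intro n
    obtain ⟨ht, h0, h1, h2⟩ := hn n
    rw [H.ofReal_norm_sq, ofReal_gr]
    have e0 : ∫⁻ x, ‖fn (wn n) x‖ₑ ^ (2 * (k + 1)) ∂(dom L₁ L₂) =
        ∫⁻ x, ‖ψ n x‖ₑ ^ (2 * (k + 1)) ∂(dom L₁ L₂) :=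
      lintegral_congr_ae (h0.mono fun x hx => by simp only [hx])
    have e1 : ∫⁻ x, ‖fn (wn n) x‖ₑ ^ 2 ∂(dom L₁ L₂) = ∫⁻ x, ‖ψ n x‖ₑ ^ 2 ∂(dom L₁ L₂) :=
      lintegral_congr_ae (h0.mono fun x hx => by simp only [hx])
    have e2 : ∫⁻ x, (‖dx (wn n) x‖ₑ ^ 2 + ‖dy (wn n) x‖ₑ ^ 2) ∂(dom L₁ L₂) =
        ∫⁻ x, (‖d₁ (ψ n) x‖ₑ ^ 2 + ‖d₂ (ψ n) x‖ₑ ^ 2) ∂(dom L₁ L₂) :=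
      lintegral_congr_ae (by filter_upwards [h1, h2] with x hx1 hx2; simp only [hx1, hx2])
    rw [e0, e1, e2, ← ht.lintegral_eq (fun x hx => by simp [image_eq_zero_of_notMem_tsupport hx]),
      ← ht.lintegral_eq (fun x hx => by simp [image_eq_zero_of_notMem_tsupport hx]),
      ← ht.lintegral_eq (fun x hx => by simp [d₁, d₂, fderiv_eq_zero_of_notMem hx])]
    exact hC _ ht.smooth ht.compact
  -- The left-hand side is only known to be lower semicontinuous along the approximation: a
  -- subsequence converges almost everywhere and Fatou's lemma applies. The right-hand side is
  -- continuous on V.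
  obtain ⟨ns, hns, hae⟩ := tendsto_ae_subseq hfn
  have hR : Tendsto (fun n => C * ENNReal.ofReal (‖fn (wn (ns n))‖ ^ 2) *
      ENNReal.ofReal (gr (wn (ns n))) ^ k) atTop
      (𝓝 (C * ENNReal.ofReal (‖fn w‖ ^ 2) * ENNReal.ofReal (gr w) ^ k)) := by
    have t1 := (ENNReal.continuous_ofReal.tendsto _).comp
      ((hfn.norm.pow 2).comp hns.tendsto_atTop)
    have t2 := ((ENNReal.continuous_pow k).tendsto _).comp
      ((ENNReal.continuous_ofReal.tendsto _).comp (hgr.comp hns.tendsto_atTop))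
    exact ENNReal.Tendsto.mul (ENNReal.Tendsto.const_mul t1 (by simp))
      (by simp) t2 (by right; exact ENNReal.mul_ne_top (by simp) (by simp))
  calc ∫⁻ x, ‖fn w x‖ₑ ^ (2 * (k + 1)) ∂(dom L₁ L₂)
      = ∫⁻ x, liminf (fun n => ‖fn (wn (ns n)) x‖ₑ ^ (2 * (k + 1))) atTop ∂(dom L₁ L₂) := by
        refine lintegral_congr_ae (hae.mono fun x hx => ?_)
        exact (((ENNReal.continuous_pow _).tendsto _).comp hx.enorm).liminf_eq.symm
    _ ≤ liminf (fun n => ∫⁻ x, ‖fn (wn (ns n)) x‖ₑ ^ (2 * (k + 1)) ∂(dom L₁ L₂)) atTop :=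
        lintegral_liminf_le' fun n => (Lp.aestronglyMeasurable _).enorm.pow_const _
    _ ≤ liminf (fun n => C * ENNReal.ofReal (‖fn (wn (ns n))‖ ^ 2) *
          ENNReal.ofReal (gr (wn (ns n))) ^ k) atTop :=
        liminf_le_liminf (Eventually.of_forall fun n => hb (ns n))
    _ = _ := hR.liminf_eq

theorem memLp_fn_nat (w : V L₁ L₂) (k : ℕ) : MemLp (fn w) (2 * (k + 1) : ℕ) (dom L₁ L₂) := by
  obtain ⟨C, hC⟩ := exists_lintegral_pow L₁ L₂ k
  refine ⟨Lp.aestronglyMeasurable _, ?_⟩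
  rw [eLpNorm_lt_top_iff_lintegral_rpow_enorm_lt_top (by simp) (ENNReal.natCast_ne_top _)]
  simp only [ENNReal.toReal_natCast, ENNReal.rpow_natCast]
  exact (hC w).trans_lt (ENNReal.mul_lt_top (ENNReal.mul_lt_top (by simp) (by simp))
    (ENNReal.pow_lt_top (by simp)))

/-- `V` embeds into every `L^q`, `q < ∞`. -/
theorem memLp_fn (w : V L₁ L₂) {q : ENNReal} (hq : q ≠ ⊤) : MemLp (fn w) q (dom L₁ L₂) := by
  obtain ⟨k, hk⟩ := ENNReal.exists_nat_gt hq
  refine (memLp_fn_nat w k).mono_exponent (hk.le.trans ?_)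
  exact_mod_cast (by omega : k ≤ 2 * (k + 1))

theorem integrable_rpow (w : V L₁ L₂) {q : ℝ} (hq : 0 ≤ q) :
    Integrable (fun x => ‖fn w x‖ ^ q) (dom L₁ L₂) := by
  have := (memLp_fn w (q := ENNReal.ofReal q) ENNReal.ofReal_ne_top).integrable_norm_rpow'
  simpa [ENNReal.toReal_ofReal hq] using this

theorem integrable_pow (w : V L₁ L₂) (k : ℕ) :
    Integrable (fun x => ‖fn w x‖ ^ k) (dom L₁ L₂) := by
  simpa using integrable_rpow w (q := k) (by positivity)

theorem exists_integral_pow (L₁ L₂ : ℝ) (k : ℕ) : ∃ C : ℝ, 0 ≤ C ∧ ∀ w : V L₁ L₂,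
    ∫ x, ‖fn w x‖ ^ (2 * (k + 1)) ∂(dom L₁ L₂) ≤ C * ‖fn w‖ ^ 2 * gr w ^ k := by
  obtain ⟨C, hC⟩ := exists_lintegral_pow L₁ L₂ k
  refine ⟨C, C.coe_nonneg, fun w => ?_⟩
  have h0 : 0 ≤ (C : ℝ) * ‖fn w‖ ^ 2 * gr w ^ k :=
    mul_nonneg (mul_nonneg C.coe_nonneg (by positivity)) (pow_nonneg (gr_nonneg w) _)
  rw [← ENNReal.ofReal_le_ofReal_iff h0, ofReal_integral_eq_lintegral_ofReal (integrable_pow w _)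
    (ae_of_all _ fun x => by positivity), ENNReal.ofReal_mul (mul_nonneg C.coe_nonneg (by positivity)),
    ENNReal.ofReal_mul C.coe_nonneg, ENNReal.ofReal_pow (gr_nonneg w)]
  simp only [ENNReal.ofReal_coe_nnreal]
  refine (le_of_eq (lintegral_congr fun x => ?_)).trans (hC w)
  rw [ENNReal.ofReal_pow (norm_nonneg _), ofReal_norm]

theorem rpow_le_one_add_pow {r q : ℝ} (hr : 0 ≤ r) (hq : 0 ≤ q) {k : ℕ} (hk : q ≤ k) :
    r ^ q ≤ 1 + r ^ k := by
  rcases le_total r 1 with h | h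
  · have := Real.rpow_le_one hr h hq
    have : 0 ≤ r ^ k := by positivity
    linarith
  · have := Real.rpow_le_rpow_of_exponent_le h hk
    rw [Real.rpow_natCast] at this
    linarith

theorem exists_integral_rpow_le (L₁ L₂ : ℝ) {q : ℝ} (hq : 0 ≤ q) (M : ℝ) :
    ∃ C : ℝ, 0 ≤ C ∧ ∀ w : V L₁ L₂, ‖w‖ ≤ M → ∫ x, ‖fn w x‖ ^ q ∂(dom L₁ L₂) ≤ C := by
  obtain ⟨k, hk⟩ := exists_nat_ge q
  obtain ⟨C, hC0, hC⟩ := exists_integral_pow L₁ L₂ k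
  refine ⟨(dom L₁ L₂).real univ + C * M ^ 2 * (M ^ 2) ^ k, by positivity, fun w hw => ?_⟩
  have hk' : q ≤ (2 * (k + 1) : ℕ) := hk.trans (by exact_mod_cast (by omega))
  calc _ ≤ ∫ x, (1 + ‖fn w x‖ ^ (2 * (k + 1))) ∂(dom L₁ L₂) :=
        integral_mono (integrable_rpow w hq) ((integrable_const _).add (integrable_pow w _))
          fun x => rpow_le_one_add_pow (norm_nonneg _) hq hk'
    _ = (dom L₁ L₂).real univ + ∫ x, ‖fn w x‖ ^ (2 * (k + 1)) ∂(dom L₁ L₂) := by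
        rw [integral_add (integrable_const _) (integrable_pow w _)]; simp
    _ ≤ _ := by
        have h1 : ‖fn w‖ ^ 2 ≤ M ^ 2 := by
          have := (norm_fn_le w).trans hw
          gcongr
        have h2 : gr w ≤ M ^ 2 := (gr_le w).trans (by gcongr)
        have h3 := gr_nonneg w
        gcongr
        exact (hC w).trans (by gcongr)

end Sobolev

section Pointwise

/-! ### The power nonlinearity `z ↦ |z|^r z` on `ℂ` -/

/-- The derivative of `z ↦ |z|^r z` at `c` in direction `w`. -/
def powD (r : ℝ) (c w : ℂ) : ℂ :=
  (r * ‖c‖ ^ (r - 2) * inner ℝ c w) • c + (‖c‖ ^ r) • w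

theorem hasDerivAt_pow_smul {r : ℝ} (hr : 1 < r) {γ : ℝ → ℂ} {γ' : ℂ} {t : ℝ}
    (h : HasDerivAt γ γ' t) : HasDerivAt (fun s => (‖γ s‖ ^ r) • γ s) (powD r (γ t) γ') t := by
  have h1 := ((hasFDerivAt_norm_rpow (γ t) hr).comp_hasDerivAt t h).smul h
  convert! h1 using 1
  unfold powD
  rw [add_comm]
  simp

theorem norm_rpow_sub_two_mul {r : ℝ} (hr : 0 < r) (c : ℂ) :
    ‖c‖ ^ (r - 2) * ‖c‖ ^ 2 = ‖c‖ ^ r := by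
  rcases eq_or_ne c 0 with rfl | hc
  · simp [Real.zero_rpow hr.ne']
  · rw [← Real.rpow_two, ← Real.rpow_add (norm_pos_iff.2 hc)]; ring_nf

theorem norm_powD_le {r : ℝ} (hr : 0 < r) (c w : ℂ) :
    ‖powD r c w‖ ≤ (r + 1) * ‖c‖ ^ r * ‖w‖ := by
  unfold powD
  refine (norm_add_le _ _).trans ?_
  rw [norm_smul, norm_smul, norm_mul, norm_mul, Real.norm_of_nonneg hr.le,
    Real.norm_of_nonneg (by positivity : 0 ≤ ‖c‖ ^ (r - 2)),
    Real.norm_of_nonneg (by positivity : 0 ≤ ‖c‖ ^ r)]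
  have h1 : ‖(inner ℝ c w : ℝ)‖ ≤ ‖c‖ * ‖w‖ := norm_inner_le_norm c w
  calc _ ≤ r * ‖c‖ ^ (r - 2) * (‖c‖ * ‖w‖) * ‖c‖ + ‖c‖ ^ r * ‖w‖ := by gcongr
    _ = r * (‖c‖ ^ (r - 2) * ‖c‖ ^ 2) * ‖w‖ + ‖c‖ ^ r * ‖w‖ := by ring
    _ = _ := by rw [norm_rpow_sub_two_mul hr]; ring

/-- The ellipticity constant of the power nonlinearity. -/
def ellip (r β : ℝ) : ℝ := (1 + r - r ^ 2 * β ^ 2 / 4) / (2 + r)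

/-- The numerator of `ellip (2 * σ) β` is 1 + 2σ − σ²β², so its positivity is exactly the assumed
bound on |β|. -/
theorem ellip_pos {σ β : ℝ} (hσ : 0 < σ) (hβ' : |β| < √(2 * σ + 1) / σ) :
    0 < ellip (2 * σ) β := by
  unfold ellip
  have h1 : |β| * σ < √(2 * σ + 1) := (lt_div_iff₀ hσ).1 hβ'
  have h2 : (|β| * σ) ^ 2 < 2 * σ + 1 := by
    calc (|β| * σ) ^ 2 < √(2 * σ + 1) ^ 2 := by gcongr
      _ = _ := Real.sq_sqrt (by positivity)
  rw [mul_pow, sq_abs] at h2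
  exact div_pos (by nlinarith) (by positivity)

/-- The quadratic form has trace 2 + r and determinant 1 + r − r²β²/4. Their quotient, determinant
over trace, is `ellip r β`, and it never exceeds the smaller eigenvalue. -/
theorem quadratic_ge {r β : ℝ} (hr : 0 < r) (x y : ℝ) :
    ellip r β * (x ^ 2 + y ^ 2) ≤ (1 + r) * x ^ 2 + r * β * x * y + y ^ 2 := by
  set κ := ellip r β
  have hκ : κ * (2 + r) = 1 + r - r ^ 2 * β ^ 2 / 4 := by
    simp only [κ, ellip]; field_simp
  have h1 : 0 < 1 - κ := by nlinarith [sq_nonneg (r * β)]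
  have h2 : r ^ 2 * β ^ 2 / 4 ≤ (1 + r - κ) * (1 - κ) := by nlinarith [sq_nonneg κ]
  have h3 : 0 ≤ (1 - κ) * ((1 + r - κ) * x ^ 2 + r * β * x * y + (1 - κ) * y ^ 2) := by
    nlinarith [sq_nonneg ((1 - κ) * y + r * β * x / 2), sq_nonneg x]
  have h4 := nonneg_of_mul_nonneg_right h3 h1
  linarith

/-- Let x be the real part of c̄w and y the negative of its imaginary part. Then x² + y² = |c|²|w|²,
and the right-hand side is |c|^{r−2} times the quadratic form of `quadratic_ge` at (x, y). -/
theorem re_powD_ge {r : ℝ} (hr : 0 < r) (β : ℝ) (c w : ℂ) :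
    ellip r β * ‖c‖ ^ r * ‖w‖ ^ 2 ≤ ((1 - Complex.I * β) * powD r c w * conj w).re := by
  set x := inner ℝ c w
  set y := c.im * w.re - c.re * w.im
  have hx : x = c.re * w.re + c.im * w.im := by
    simp only [x, Complex.inner, Complex.mul_re, Complex.conj_re, Complex.conj_im]; ring
  have hcw : ‖c‖ ^ 2 * ‖w‖ ^ 2 = x ^ 2 + y ^ 2 := by
    rw [Complex.sq_norm, Complex.sq_norm, Complex.normSq_apply, Complex.normSq_apply, hx]; ring
  have key : ((1 - Complex.I * β) * powD r c w * conj w).re =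
      r * ‖c‖ ^ (r - 2) * x * (x + β * y) + ‖c‖ ^ r * ‖w‖ ^ 2 := by
    unfold powD
    rw [Complex.sq_norm, Complex.normSq_apply]
    simp only [Complex.mul_re, Complex.mul_im, Complex.add_re, Complex.add_im, Complex.sub_re,
      Complex.sub_im, Complex.smul_re, Complex.smul_im, Complex.conj_re, Complex.conj_im,
      Complex.I_re, Complex.I_im, Complex.ofReal_re, Complex.ofReal_im, Complex.one_re,
      Complex.one_im, smul_eq_mul]
    rw [show (inner ℝ c w : ℝ) = x from rfl]
    linear_combination (-(r * ‖c‖ ^ (r - 2) * x)) * hx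
  rw [key, ← norm_rpow_sub_two_mul hr c]
  have h := mul_le_mul_of_nonneg_left (quadratic_ge (β := β) hr x y)
    (by positivity : 0 ≤ ‖c‖ ^ (r - 2))
  calc _ = ‖c‖ ^ (r - 2) * (ellip r β * (‖c‖ ^ 2 * ‖w‖ ^ 2)) := by ring
    _ ≤ _ := by
      rw [hcw]
      refine h.trans (le_of_eq ?_)
      rw [mul_assoc (‖c‖ ^ (r - 2)) (‖c‖ ^ 2), hcw]; ring

theorem hasDerivAt_segment (v w : ℂ) (t : ℝ) :
    HasDerivAt (fun s : ℝ => v + (s : ℂ) * w) w t := by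
  have := ((Complex.ofRealCLM.hasDerivAt (x := t)).mul_const w).const_add v
  simpa using this

theorem norm_pow_smul_sub_le {r : ℝ} (hr : 1 < r) (u v : ℂ) :
    ‖(‖u‖ ^ r) • u - (‖v‖ ^ r) • v‖ ≤ (r + 1) * (‖u‖ + ‖v‖) ^ r * ‖u - v‖ := by
  have h := norm_image_sub_le_of_norm_deriv_le_segment_01'
    (f := fun s : ℝ => (‖v + (s : ℂ) * (u - v)‖ ^ r) • (v + (s : ℂ) * (u - v)))
    (C := (r + 1) * (‖u‖ + ‖v‖) ^ r * ‖u - v‖)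
    (fun t _ => (hasDerivAt_pow_smul hr (hasDerivAt_segment v (u - v) t)).hasDerivWithinAt)
    (fun t ht => by
      refine (norm_powD_le (by linarith) _ _).trans ?_
      have : ‖v + (t : ℂ) * (u - v)‖ ≤ ‖u‖ + ‖v‖ := by
        have e : v + (t : ℂ) * (u - v) = (t : ℂ) * u + ((1 - t : ℝ) : ℂ) * v := by push_cast; ring
        rw [e]
        refine (norm_add_le _ _).trans ?_
        rw [norm_mul, norm_mul, Complex.norm_real, Complex.norm_real, Real.norm_of_nonneg ht.1,
          Real.norm_of_nonneg (by linarith [ht.2])]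
        have := ht.1
        have := ht.2
        gcongr
        · exact mul_le_of_le_one_left (norm_nonneg _) (by linarith)
        · exact mul_le_of_le_one_left (norm_nonneg _) (by linarith)
      gcongr)
  simpa using h

/-- Strong monotonicity of `z ↦ (1 - iβ) |z|^r z`. -/
theorem re_pow_sub_ge {r : ℝ} (hr : 1 < r) {β : ℝ} (hκ : 0 < ellip r β) (u v : ℂ) :
    ellip r β * (3 / 8) ^ r / 8 * (‖u‖ + ‖v‖) ^ r * ‖u - v‖ ^ 2 ≤
      ((1 - Complex.I * β) * ((‖u‖ ^ r) • u - (‖v‖ ^ r) • v) * conj (u - v)).re := by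
  set w := u - v
  set X := ‖u‖ + ‖v‖
  have hX : 0 ≤ X := by positivity
  have hwX : ‖w‖ ≤ X := norm_sub_le _ _
  set c : ℝ → ℂ := fun s => v + (s : ℂ) * w
  set h : ℝ → ℝ := fun s => ((1 - Complex.I * β) * ((‖c s‖ ^ r) • c s) * conj w).re
  have hd : ∀ s, HasDerivAt h (((1 - Complex.I * β) * powD r (c s) w * conj w).re) s := fun s =>
    (Complex.reCLM.hasFDerivAt.comp_hasDerivAt s
      (((hasDerivAt_pow_smul hr (hasDerivAt_segment v w s)).const_mul
        (1 - Complex.I * β)).mul_const (conj w)))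
  have hd' : ∀ s, ellip r β * ‖c s‖ ^ r * ‖w‖ ^ 2 ≤ deriv h s := fun s => by
    rw [(hd s).deriv]; exact re_powD_ge (by linarith) β _ _
  have hdiff : Differentiable ℝ h := fun s => (hd s).differentiableAt
  have hmono : Monotone h := monotone_of_deriv_nonneg hdiff fun s =>
    le_trans (by positivity) (hd' s)
  -- As h is monotone, it suffices to integrate its derivative over a parameter interval of length
  -- 1/8. It is taken at the end of the segment where the modulus is at least X/2; since |w| ≤ X,
  -- the modulus stays above X/2 − X/8 = 3X/8 there.
  have hsub : ∀ a ≤ a + 1 / 8, (∀ s ∈ Icc a (a + 1 / 8), 3 / 8 * X ≤ ‖c s‖) → 0 ≤ a →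
      a + 1 / 8 ≤ 1 → ellip r β * (3 / 8) ^ r / 8 * X ^ r * ‖w‖ ^ 2 ≤ h 1 - h 0 := by
    intro a hab hs ha hb
    have := (convex_Icc a (a + 1 / 8)).mul_sub_le_image_sub_of_le_deriv
      (f := h) hdiff.continuous.continuousOn hdiff.differentiableOn
      (C := ellip r β * (3 / 8 * X) ^ r * ‖w‖ ^ 2)
      (fun s hs' => by
        refine le_trans ?_ (hd' s)
        have := hs s (interior_subset hs')
        gcongr) a ⟨le_rfl, hab⟩ (a + 1 / 8) ⟨hab, le_rfl⟩ hab
    have h1 := hmono ha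
    have h2 := hmono hb
    rw [Real.mul_rpow (by norm_num) hX] at this
    linarith
  have hc1 : c 1 = u := by simp [c, w]
  have hc0 : c 0 = v := by simp [c]
  have hgoal : ((1 - Complex.I * β) * ((‖u‖ ^ r) • u - (‖v‖ ^ r) • v) * conj w).re =
      h 1 - h 0 := by
    simp only [h, hc1, hc0]
    rw [← Complex.sub_re]; ring_nf
  rw [hgoal]
  rcases le_total (X / 2) ‖v‖ with hv | hv
  · refine hsub 0 (by norm_num) (fun s hs => ?_) le_rfl (by norm_num)
    have h1 : ‖v‖ - ‖(s : ℂ) * w‖ ≤ ‖c s‖ := norm_sub_le_norm_add _ _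
    rw [norm_mul, Complex.norm_real, Real.norm_of_nonneg hs.1] at h1
    have h2 : s * ‖w‖ ≤ 1 / 8 * X := by
      have := hs.1
      have := hs.2
      gcongr
      linarith
    linarith
  · refine hsub (7 / 8) (by norm_num) (fun s hs => ?_) (by norm_num) (by norm_num)
    have e : c s = u - ((1 - s : ℝ) : ℂ) * w := by simp only [c, w]; push_cast; ring
    have h1 : ‖u‖ - ‖((1 - s : ℝ) : ℂ) * w‖ ≤ ‖c s‖ := by rw [e]; exact norm_sub_norm_le _ _
    rw [norm_mul, Complex.norm_real, Real.norm_of_nonneg (by linarith [hs.2])] at h1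
    have h2 : (1 - s) * ‖w‖ ≤ 1 / 8 * X := by
      have := hs.1
      have := hs.2
      gcongr
      linarith
    have : X / 2 ≤ ‖u‖ := by simp only [X] at *; linarith
    linarith

/-! ### Elementary Young inequalities -/

/-- Split at y = θx with θⁿ = η: below the threshold yⁿ is at most ηxⁿ, above it xᵐ is at most
θ⁻ᵐyᵐ. -/
theorem threshold_young {m n η : ℝ} (hm : 0 < m) (hn : 0 < n) (hη : 0 < η) :
    ∃ C : ℝ, 0 ≤ C ∧ ∀ x y : ℝ, 0 ≤ x → 0 ≤ y →
      x ^ m * y ^ n ≤ η * x ^ (m + n) + C * y ^ (m + n) := by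
  set θ := η ^ (1 / n)
  have hθ : 0 < θ := by positivity
  have hθn : θ ^ n = η := by
    simp only [θ]; rw [← Real.rpow_mul hη.le]; simp [hn.ne']
  refine ⟨(θ⁻¹) ^ m, by positivity, fun x y hx hy => ?_⟩
  rcases le_total y (θ * x) with h | h
  · have h1 : x ^ m * y ^ n ≤ x ^ m * (θ * x) ^ n := by gcongr
    rw [Real.mul_rpow hθ.le hx, hθn] at h1
    have h2 : x ^ m * (η * x ^ n) = η * x ^ (m + n) := by
      rw [Real.rpow_add_of_nonneg hx hm.le hn.le]; ring
    have : 0 ≤ (θ⁻¹) ^ m * y ^ (m + n) := by positivity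
    linarith
  · have h0 : x ≤ θ⁻¹ * y := by rw [inv_mul_eq_div, le_div_iff₀ hθ]; linarith
    have h1 : x ^ m * y ^ n ≤ (θ⁻¹ * y) ^ m * y ^ n := by gcongr
    rw [Real.mul_rpow (by positivity) hy] at h1
    have h2 : (θ⁻¹) ^ m * y ^ m * y ^ n = (θ⁻¹) ^ m * y ^ (m + n) := by
      rw [Real.rpow_add_of_nonneg hy hm.le hn.le]; ring
    have : 0 ≤ η * x ^ (m + n) := by positivity
    linarith

/-- This is how σ > 2 is exploited: with r = 2σ, the quartic weights produced by the derivative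
nonlinearity are absorbed by the gain |z|^{2σ}. -/
theorem pow_four_le {r : ℝ} (hr : 4 < r) {η : ℝ} (hη : 0 < η) :
    ∃ C : ℝ, 0 ≤ C ∧ ∀ x : ℝ, 0 ≤ x → x ^ 4 ≤ η * x ^ r + C := by
  obtain ⟨C, hC0, hC⟩ := threshold_young (m := 4) (n := r - 4) (by norm_num) (by linarith) hη
  refine ⟨C, hC0, fun x hx => ?_⟩
  have := hC x 1 hx zero_le_one
  rw [Real.one_rpow, Real.one_rpow] at this
  simp only [mul_one, add_sub_cancel] at this
  exact_mod_cast this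

theorem mul_le_eta {η : ℝ} (hη : 0 < η) (x y : ℝ) : x * y ≤ η * x ^ 2 + η⁻¹ * y ^ 2 := by
  have h : 0 ≤ η * (x - η⁻¹ * y / 2) ^ 2 := by positivity
  have e : η * (x - η⁻¹ * y / 2) ^ 2 = η * x ^ 2 - x * y + η⁻¹ * y ^ 2 / 4 := by
    field_simp; ring
  have : 0 ≤ η⁻¹ * y ^ 2 := by positivity
  linarith

theorem mul_mul_le_two_four {x y z : ℝ} : x * y * z ≤ x ^ 2 + y ^ 4 + z ^ 4 := by
  nlinarith [sq_nonneg (x - y * z), sq_nonneg (y ^ 2 - z ^ 2), sq_nonneg x, sq_nonneg (y ^ 2),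
    sq_nonneg (z ^ 2), sq_nonneg (y * z)]

theorem mul_three_le_six {x y z : ℝ} :
    (x * y * z) ^ 2 ≤ x ^ 6 + y ^ 6 + z ^ 6 := by
  have key : ∀ a b c : ℝ, 0 ≤ a → 0 ≤ b → 0 ≤ c → a * b * c ≤ a ^ 3 + b ^ 3 + c ^ 3 := by
    intro a b c ha hb hc
    nlinarith [mul_nonneg (add_nonneg (add_nonneg ha hb) hc)
      (add_nonneg (add_nonneg (sq_nonneg (a - b)) (sq_nonneg (b - c))) (sq_nonneg (a - c))),
      mul_nonneg (mul_nonneg ha hb) hc]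
  have := key (x ^ 2) (y ^ 2) (z ^ 2) (by positivity) (by positivity) (by positivity)
  nlinarith

end Pointwise

/-! ### Pointwise estimates for the density of the weak form -/

section Density

/-- The coefficients of the equation `u' = A Δu - P |u|^{2σ} u + γ u + a·∇(|u|²u) + (b·∇u)|u|²`. -/
structure Par where
  A : ℂ
  P : ℂ
  γ : ℂ
  a₁ : ℂ
  a₂ : ℂ
  b₁ : ℂ
  b₂ : ℂ

/-- All coefficients are bounded by `R`. -/
structure Par.Bdd (q : Par) (R : ℝ) : Prop where
  A : ‖q.A‖ ≤ R
  P : ‖q.P‖ ≤ R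
  γ : ‖q.γ‖ ≤ R
  a₁ : ‖q.a₁‖ ≤ R
  a₂ : ‖q.a₂‖ ≤ R
  b₁ : ‖q.b₁‖ ≤ R
  b₂ : ‖q.b₂‖ ≤ R

/-- `|z|^{2σ} z`. -/
def pw (σ : ℝ) (z : ℂ) : ℂ := ((‖z‖ ^ (2 * σ) : ℝ) : ℂ) * z

/-- `|z|² z`. -/
def cu (z : ℂ) : ℂ := ((‖z‖ ^ 2 : ℝ) : ℂ) * z

/-- The zeroth order part of the nonlinearity. -/
def n₀ (σ : ℝ) (q : Par) (z p₁ p₂ : ℂ) : ℂ :=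
  -q.P * pw σ z + q.γ * z + (q.b₁ * p₁ + q.b₂ * p₂) * ((‖z‖ ^ 2 : ℝ) : ℂ)

/-- The flux in one space direction. -/
def fl (A a z p : ℂ) : ℂ := -A * p - a * cu z

/-- The density of the weak formulation, at the jet `(z, p₁, p₂)` of the solution and the jet
`(y, q₁, q₂)` of the test function. -/
def dens (σ : ℝ) (q : Par) (z p₁ p₂ y q₁ q₂ : ℂ) : ℂ :=
  n₀ σ q z p₁ p₂ * conj y + fl q.A q.a₁ z p₁ * conj q₁ + fl q.A q.a₂ z p₂ * conj q₂

variable {σ : ℝ} {q q' : Par} {R : ℝ}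

theorem norm_pw (hσ : 0 < σ) (z : ℂ) : ‖pw σ z‖ = ‖z‖ ^ (2 * σ + 1) := by
  unfold pw
  rw [norm_mul, Complex.norm_real, Real.norm_of_nonneg (by positivity),
    Real.rpow_add_of_nonneg (norm_nonneg _) (by positivity) zero_le_one, Real.rpow_one]

theorem norm_cu (z : ℂ) : ‖cu z‖ = ‖z‖ ^ 3 := by
  unfold cu
  rw [norm_mul, Complex.norm_real, Real.norm_of_nonneg (by positivity)]; ring

theorem pw_eq (σ : ℝ) (z : ℂ) : pw σ z = (‖z‖ ^ (2 * σ)) • z := by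
  unfold pw; rw [Complex.real_smul]

theorem cu_eq (z : ℂ) : cu z = (‖z‖ ^ (2 : ℝ)) • z := by
  unfold cu; rw [Complex.real_smul, Real.rpow_two]

theorem norm_pw_sub_le (hσ : 1 < σ) (u v : ℂ) :
    ‖pw σ u - pw σ v‖ ≤ (2 * σ + 1) * (‖u‖ + ‖v‖) ^ (2 * σ) * ‖u - v‖ := by
  rw [pw_eq, pw_eq]
  exact norm_pow_smul_sub_le (by linarith) u v

theorem norm_cu_sub_le (u v : ℂ) :
    ‖cu u - cu v‖ ≤ 3 * (‖u‖ + ‖v‖) ^ 2 * ‖u - v‖ := by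
  rw [cu_eq, cu_eq]
  refine (norm_pow_smul_sub_le (by norm_num) u v).trans (le_of_eq ?_)
  rw [Real.rpow_two]; norm_num

theorem norm_sq_sub_le (u v : ℂ) :
    ‖((‖u‖ ^ 2 : ℝ) : ℂ) - ((‖v‖ ^ 2 : ℝ) : ℂ)‖ ≤ (‖u‖ + ‖v‖) * ‖u - v‖ := by
  rw [← Complex.ofReal_sub, Complex.norm_real, Real.norm_eq_abs, sq_sub_sq, abs_mul,
    abs_of_nonneg (by positivity)]
  gcongr
  exact abs_norm_sub_norm_le u v

theorem norm_n₀_le (hσ : 0 < σ) (hq : q.Bdd R) (z p₁ p₂ : ℂ) :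
    ‖n₀ σ q z p₁ p₂‖ ≤ R * (‖z‖ ^ (2 * σ + 1) + ‖z‖ + (‖p₁‖ + ‖p₂‖) * ‖z‖ ^ 2) := by
  unfold n₀
  have h1 := hq.P
  have h2 := hq.γ
  have h3 := hq.b₁
  have h4 := hq.b₂
  have hR : 0 ≤ R := (norm_nonneg _).trans h1
  calc _ ≤ ‖q.P‖ * ‖pw σ z‖ + ‖q.γ‖ * ‖z‖ + (‖q.b₁‖ * ‖p₁‖ + ‖q.b₂‖ * ‖p₂‖) * ‖z‖ ^ 2 := by
        refine (norm_add₃_le).trans ?_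
        rw [norm_mul, norm_mul, norm_mul, norm_neg, Complex.norm_real,
          Real.norm_of_nonneg (by positivity : 0 ≤ ‖z‖ ^ 2), ← norm_mul q.b₁, ← norm_mul q.b₂]
        gcongr
        exact norm_add_le _ _
    _ ≤ R * ‖pw σ z‖ + R * ‖z‖ + (R * ‖p₁‖ + R * ‖p₂‖) * ‖z‖ ^ 2 := by gcongr
    _ = _ := by rw [norm_pw hσ]; ring

theorem norm_fl_le {A a : ℂ} (hA : ‖A‖ ≤ R) (ha : ‖a‖ ≤ R) (z p : ℂ) :
    ‖fl A a z p‖ ≤ R * (‖p‖ + ‖z‖ ^ 3) := by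
  unfold fl
  refine (norm_sub_le _ _).trans ?_
  rw [norm_mul, norm_mul, norm_neg, norm_cu, mul_add]
  gcongr

/-- The increment of the nonlinear terms with derivatives of zeroth order. -/
theorem norm_grad_sub_le (hq : q.Bdd R) (z p₁ p₂ z' p₁' p₂' : ℂ) :
    ‖(q.b₁ * p₁ + q.b₂ * p₂) * ((‖z‖ ^ 2 : ℝ) : ℂ) -
      (q.b₁ * p₁' + q.b₂ * p₂') * ((‖z'‖ ^ 2 : ℝ) : ℂ)‖ ≤
      R * ((‖p₁ - p₁'‖ + ‖p₂ - p₂'‖) * (‖z‖ + ‖z'‖) ^ 2 +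
        (‖p₁'‖ + ‖p₂'‖) * (‖z‖ + ‖z'‖) * ‖z - z'‖) := by
  have h3 := hq.b₁
  have h4 := hq.b₂
  have hR : 0 ≤ R := (norm_nonneg _).trans h3
  have e : (q.b₁ * p₁ + q.b₂ * p₂) * ((‖z‖ ^ 2 : ℝ) : ℂ) -
      (q.b₁ * p₁' + q.b₂ * p₂') * ((‖z'‖ ^ 2 : ℝ) : ℂ) =
      (q.b₁ * (p₁ - p₁') + q.b₂ * (p₂ - p₂')) * ((‖z‖ ^ 2 : ℝ) : ℂ) +
      (q.b₁ * p₁' + q.b₂ * p₂') * (((‖z‖ ^ 2 : ℝ) : ℂ) - ((‖z'‖ ^ 2 : ℝ) : ℂ)) := by ring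
  have hb : ∀ x y : ℂ, ‖q.b₁ * x + q.b₂ * y‖ ≤ R * (‖x‖ + ‖y‖) := fun x y => by
    refine (norm_add_le _ _).trans ?_
    rw [norm_mul, norm_mul, mul_add]; gcongr
  rw [e]
  refine (norm_add_le _ _).trans ?_
  rw [norm_mul, norm_mul, Complex.norm_real, Real.norm_of_nonneg (by positivity : 0 ≤ ‖z‖ ^ 2)]
  have hz : ‖z‖ ^ 2 ≤ (‖z‖ + ‖z'‖) ^ 2 := by
    have := norm_nonneg z'
    gcongr; linarith
  calc _ ≤ R * (‖p₁ - p₁'‖ + ‖p₂ - p₂'‖) * (‖z‖ + ‖z'‖) ^ 2 +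
        R * (‖p₁'‖ + ‖p₂'‖) * ((‖z‖ + ‖z'‖) * ‖z - z'‖) := by
        gcongr
        · exact hb _ _
        · exact hb _ _
        · exact norm_sq_sub_le _ _
    _ = _ := by ring

theorem norm_fl_sub_le {A a : ℂ} (hA : ‖A‖ ≤ R) (ha : ‖a‖ ≤ R) (z p z' p' : ℂ) :
    ‖fl A a z p - fl A a z' p'‖ ≤ R * (‖p - p'‖ + 3 * (‖z‖ + ‖z'‖) ^ 2 * ‖z - z'‖) := by
  have hR : 0 ≤ R := (norm_nonneg _).trans hA
  have e : fl A a z p - fl A a z' p' = -A * (p - p') - a * (cu z - cu z') := by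
    unfold fl; ring
  rw [e]
  refine (norm_sub_le _ _).trans ?_
  rw [norm_mul, norm_mul, norm_neg, mul_add]
  gcongr
  exact norm_cu_sub_le _ _

theorem norm_n₀_sub_le (hσ : 1 < σ) (hq : q.Bdd R) (z p₁ p₂ z' p₁' p₂' : ℂ) :
    ‖n₀ σ q z p₁ p₂ - n₀ σ q z' p₁' p₂'‖ ≤
      R * ((2 * σ + 1) * (‖z‖ + ‖z'‖) ^ (2 * σ) * ‖z - z'‖ + ‖z - z'‖ +
        (‖p₁ - p₁'‖ + ‖p₂ - p₂'‖) * (‖z‖ + ‖z'‖) ^ 2 +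
        (‖p₁'‖ + ‖p₂'‖) * (‖z‖ + ‖z'‖) * ‖z - z'‖) := by
  have h1 := hq.P
  have h2 := hq.γ
  have hR : 0 ≤ R := (norm_nonneg _).trans h1
  have e : n₀ σ q z p₁ p₂ - n₀ σ q z' p₁' p₂' = -q.P * (pw σ z - pw σ z') + q.γ * (z - z') +
      ((q.b₁ * p₁ + q.b₂ * p₂) * ((‖z‖ ^ 2 : ℝ) : ℂ) -
        (q.b₁ * p₁' + q.b₂ * p₂') * ((‖z'‖ ^ 2 : ℝ) : ℂ)) := by
    unfold n₀; ring
  rw [e]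
  refine norm_add₃_le.trans ?_
  rw [norm_mul, norm_mul, norm_neg]
  calc _ ≤ R * ((2 * σ + 1) * (‖z‖ + ‖z'‖) ^ (2 * σ) * ‖z - z'‖) + R * ‖z - z'‖ +
        R * ((‖p₁ - p₁'‖ + ‖p₂ - p₂'‖) * (‖z‖ + ‖z'‖) ^ 2 +
        (‖p₁'‖ + ‖p₂'‖) * (‖z‖ + ‖z'‖) * ‖z - z'‖) := by
        gcongr
        · exact norm_pw_sub_le hσ _ _
        · exact norm_grad_sub_le hq _ _ _ _ _ _
    _ = _ := by ring

/-- The control function for the Lipschitz estimate of the density. -/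
def lipDens (σ X G w E y Q : ℝ) : ℝ :=
  X ^ (4 * σ) + 2 * X ^ 8 + X ^ 6 + G ^ 2 + w ^ 2 + 2 * w ^ 4 + w ^ 6 + 2 * E ^ 2 +
    y ^ 2 + 2 * y ^ 4 + y ^ 6 + 2 * Q ^ 2

theorem mul_le_sq_add_sq (x y : ℝ) : x * y ≤ x ^ 2 + y ^ 2 := by
  linarith [two_mul_le_add_sq x y, sq_nonneg x, sq_nonneg y]

theorem sum_le_mul_sum {a b c d e f : ℝ} (hσ : 1 < σ) (ha : 0 ≤ a) (hb : 0 ≤ b) (hc : 0 ≤ c)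
    (hd : 0 ≤ d) (he : 0 ≤ e) (hf : 0 ≤ f) :
    (2 * σ + 1) * a + b + c + d + e + 3 * f ≤ (2 * σ + 4) * (a + b + c + d + e + f) := by
  have h : 0 ≤ 3 * a + (2 * σ + 3) * (b + c + d + e) + (2 * σ + 1) * f := by positivity
  linarith

-- The scales s and t will be the V-norms of the increment and of the test function. Young's
-- inequality is applied to the normalized quantities, so the product s t survives in front and the
-- integrated estimate is a genuine Lipschitz bound.
set_option maxHeartbeats 1000000 in
theorem norm_dens_sub_le (hσ : 1 < σ) (hq : q.Bdd R) {s t : ℝ} (hs : 0 < s) (ht : 0 < t)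
    (z p₁ p₂ z' p₁' p₂' y q₁ q₂ : ℂ) :
    ‖dens σ q z p₁ p₂ y q₁ q₂ - dens σ q z' p₁' p₂' y q₁ q₂‖ ≤
      R * (2 * σ + 4) * s * t * lipDens σ (‖z‖ + ‖z'‖) (‖p₁'‖ + ‖p₂'‖) (s⁻¹ * ‖z - z'‖)
        (s⁻¹ * (‖p₁ - p₁'‖ + ‖p₂ - p₂'‖)) (t⁻¹ * ‖y‖) (t⁻¹ * (‖q₁‖ + ‖q₂‖)) := by
  have hR : 0 ≤ R := (norm_nonneg _).trans hq.P
  set X := ‖z‖ + ‖z'‖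
  set G := ‖p₁'‖ + ‖p₂'‖
  set w := s⁻¹ * ‖z - z'‖
  set E := s⁻¹ * (‖p₁ - p₁'‖ + ‖p₂ - p₂'‖)
  set Y := t⁻¹ * ‖y‖
  set Q := t⁻¹ * (‖q₁‖ + ‖q₂‖)
  have hX : 0 ≤ X := by positivity
  have hG : 0 ≤ G := by positivity
  have hw : 0 ≤ w := by positivity
  have hE : 0 ≤ E := by positivity
  have hY : 0 ≤ Y := by positivity
  have hQ : 0 ≤ Q := by positivity
  have ew : ‖z - z'‖ = s * w := by simp only [w]; field_simp
  have eE : ‖p₁ - p₁'‖ + ‖p₂ - p₂'‖ = s * E := by simp only [E]; field_simp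
  have eY : ‖y‖ = t * Y := by simp only [Y]; field_simp
  have eQ : ‖q₁‖ + ‖q₂‖ = t * Q := by simp only [Q]; field_simp
  have b0 := norm_n₀_sub_le hσ hq z p₁ p₂ z' p₁' p₂'
  have b1 := norm_fl_sub_le hq.A hq.a₁ z p₁ z' p₁'
  have b2 := norm_fl_sub_le hq.A hq.a₂ z p₂ z' p₂'
  have e : dens σ q z p₁ p₂ y q₁ q₂ - dens σ q z' p₁' p₂' y q₁ q₂ =
      (n₀ σ q z p₁ p₂ - n₀ σ q z' p₁' p₂') * conj y +
      (fl q.A q.a₁ z p₁ - fl q.A q.a₁ z' p₁') * conj q₁ +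
      (fl q.A q.a₂ z p₂ - fl q.A q.a₂ z' p₂') * conj q₂ := by unfold dens; ring
  have step1 : ‖dens σ q z p₁ p₂ y q₁ q₂ - dens σ q z' p₁' p₂' y q₁ q₂‖ ≤
      R * ((2 * σ + 1) * X ^ (2 * σ) * (s * w) + s * w + s * E * X ^ 2 + G * X * (s * w)) * (t * Y) +
      R * (s * E + 3 * X ^ 2 * (s * w)) * (t * Q) := by
    rw [e]
    refine norm_add₃_le.trans ?_
    rw [norm_mul, norm_mul, norm_mul, RCLike.norm_conj, RCLike.norm_conj, RCLike.norm_conj]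
    rw [← ew, ← eE, ← eY, ← eQ]
    have i1 : ‖p₁ - p₁'‖ ≤ ‖p₁ - p₁'‖ + ‖p₂ - p₂'‖ := by linarith [norm_nonneg (p₂ - p₂')]
    have i2 : ‖p₂ - p₂'‖ ≤ ‖p₁ - p₁'‖ + ‖p₂ - p₂'‖ := by linarith [norm_nonneg (p₁ - p₁')]
    have c1 : ‖fl q.A q.a₁ z p₁ - fl q.A q.a₁ z' p₁'‖ ≤
        R * (‖p₁ - p₁'‖ + ‖p₂ - p₂'‖ + 3 * X ^ 2 * ‖z - z'‖) := b1.trans (by gcongr)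
    have c2 : ‖fl q.A q.a₂ z p₂ - fl q.A q.a₂ z' p₂'‖ ≤
        R * (‖p₁ - p₁'‖ + ‖p₂ - p₂'‖ + 3 * X ^ 2 * ‖z - z'‖) := b2.trans (by gcongr)
    have d0 := mul_le_mul_of_nonneg_right b0 (norm_nonneg y)
    have d1 := mul_le_mul_of_nonneg_right c1 (norm_nonneg q₁)
    have d2 := mul_le_mul_of_nonneg_right c2 (norm_nonneg q₂)
    linarith
  have y1 : X ^ (2 * σ) * w * Y ≤ X ^ (4 * σ) + w ^ 4 + Y ^ 4 := by
    have := mul_mul_le_two_four (x := X ^ (2 * σ)) (y := w) (z := Y)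
    rwa [← Real.rpow_two (X ^ (2 * σ)), ← Real.rpow_mul hX,
      show 2 * σ * 2 = 4 * σ by ring] at this
  have y2 : w * Y ≤ w ^ 2 + Y ^ 2 := mul_le_sq_add_sq w Y
  have y3 : E * X ^ 2 * Y ≤ E ^ 2 + X ^ 8 + Y ^ 4 := by
    have := mul_mul_le_two_four (x := E) (y := X ^ 2) (z := Y)
    rwa [← pow_mul] at this
  have y4 : G * X * w * Y ≤ G ^ 2 + X ^ 6 + w ^ 6 + Y ^ 6 := by
    have h6 := mul_three_le_six (x := X) (y := w) (z := Y)
    calc G * X * w * Y = G * (X * w * Y) := by ring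
      _ ≤ G ^ 2 + (X * w * Y) ^ 2 := mul_le_sq_add_sq _ _
      _ ≤ G ^ 2 + (X ^ 6 + w ^ 6 + Y ^ 6) := by gcongr
      _ = _ := by ring
  have y5 : E * Q ≤ E ^ 2 + Q ^ 2 := mul_le_sq_add_sq E Q
  have y6 : X ^ 2 * w * Q ≤ X ^ 8 + w ^ 4 + Q ^ 2 := by
    have := mul_mul_le_two_four (x := Q) (y := X ^ 2) (z := w)
    rw [← pow_mul, show 2 * 4 = 8 from rfl] at this
    linarith [this, show X ^ 2 * w * Q = Q * X ^ 2 * w by ring]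
  have z1 : 0 ≤ X ^ (2 * σ) * w * Y := by positivity
  have z2 : 0 ≤ w * Y := by positivity
  have z3 : 0 ≤ E * X ^ 2 * Y := by positivity
  have z4 : 0 ≤ G * X * w * Y := by positivity
  have z5 : 0 ≤ E * Q := by positivity
  have z6 : 0 ≤ X ^ 2 * w * Q := by positivity
  refine step1.trans ?_
  have e2 : R * ((2 * σ + 1) * X ^ (2 * σ) * (s * w) + s * w + s * E * X ^ 2 + G * X * (s * w)) *
      (t * Y) + R * (s * E + 3 * X ^ 2 * (s * w)) * (t * Q) =
      R * s * t * ((2 * σ + 1) * (X ^ (2 * σ) * w * Y) + w * Y + E * X ^ 2 * Y + G * X * w * Y +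
        E * Q + 3 * (X ^ 2 * w * Q)) := by ring
  rw [e2, show R * (2 * σ + 4) * s * t * lipDens σ X G w E Y Q =
    R * s * t * ((2 * σ + 4) * lipDens σ X G w E Y Q) by ring]
  have hRst : 0 ≤ R * s * t := by positivity
  refine mul_le_mul_of_nonneg_left ?_ hRst
  have y0 : X ^ (2 * σ) * w * Y + w * Y + E * X ^ 2 * Y + G * X * w * Y + E * Q + X ^ 2 * w * Q ≤
      lipDens σ X G w E Y Q := by
    unfold lipDens
    linarith
  refine (sum_le_mul_sum hσ z1 z2 z3 z4 z5 z6).trans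
    (mul_le_mul_of_nonneg_left y0 (by linarith))

/-- The size of the jet `(z, p₁, p₂)`. -/
def szK (σ : ℝ) (z p₁ p₂ : ℂ) : ℝ := 1 + ‖z‖ ^ (2 * σ + 2) + ‖p₁‖ ^ 2 + ‖p₂‖ ^ 2

/-- The size of the test jet `(y, q₁, q₂)`. -/
def szN (σ : ℝ) (y q₁ q₂ : ℂ) : ℝ := ‖y‖ ^ 2 + ‖y‖ ^ (2 * σ + 2) + ‖q₁‖ ^ 2 + ‖q₂‖ ^ 2

theorem pow_six_le_sq_add {r p : ℝ} (hr : 0 ≤ r) (hp : 6 ≤ p) : r ^ 6 ≤ r ^ 2 + r ^ p := by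
  rcases le_total r 1 with h | h
  · have : r ^ 6 ≤ r ^ 2 := pow_le_pow_of_le_one hr h (by norm_num)
    have : 0 ≤ r ^ p := by positivity
    linarith
  · have := Real.rpow_le_rpow_of_exponent_le h hp
    have e : r ^ (6 : ℝ) = r ^ 6 := by exact_mod_cast Real.rpow_natCast r 6
    rw [e] at this
    have : 0 ≤ r ^ 2 := by positivity
    linarith

theorem sq_le_one_add_rpow {r p : ℝ} (hr : 0 ≤ r) (hp : 2 ≤ p) : r ^ 2 ≤ 1 + r ^ p := by
  rcases le_total r 1 with h | h
  · have : r ^ 2 ≤ 1 := pow_le_one₀ hr h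
    have : 0 ≤ r ^ p := by positivity
    linarith
  · have := Real.rpow_le_rpow_of_exponent_le h hp
    rw [Real.rpow_two] at this
    linarith

-- The energy of the solution receives an arbitrarily small factor at the expense of a large one on
-- the test function. Weighted Young inequalities split every product; the sixth powers they produce
-- are controlled by the energy because 6 ≤ 2σ + 2.
set_option maxHeartbeats 1000000 in
theorem exists_norm_dens_le (hσ : 2 < σ) (hR : 0 ≤ R) {η : ℝ} (hη : 0 < η) :
    ∃ C : ℝ, 0 ≤ C ∧ ∀ q : Par, q.Bdd R → ∀ z p₁ p₂ y q₁ q₂ : ℂ,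
      ‖dens σ q z p₁ p₂ y q₁ q₂‖ ≤ η * szK σ z p₁ p₂ + C * szN σ y q₁ q₂ := by
  -- The five products below cost 1 + 1 + 4 + 2 + 2 = 10 multiples of εK, and 10Rε ≤ η.
  set ε := η / (20 * (R + 1))
  have hε : 0 < ε := by positivity
  obtain ⟨C1, hC1, h1⟩ := threshold_young (m := 2 * σ + 1) (n := 1) (by linarith) one_pos hε
  obtain ⟨C2, hC2, h2⟩ := threshold_young (m := 4) (n := 2) (by norm_num) (by norm_num)
    (η := ε * ε) (by positivity)
  set C := C1 + 5 * ε⁻¹ + ε⁻¹ * C2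
  have hC : 0 ≤ C := by positivity
  refine ⟨R * C, by positivity, fun q hq z p₁ p₂ y q₁ q₂ => ?_⟩
  set G := ‖p₁‖ + ‖p₂‖
  set Q := ‖q₁‖ + ‖q₂‖
  have hG : 0 ≤ G := by positivity
  have hQ : 0 ≤ Q := by positivity
  have step1 : ‖dens σ q z p₁ p₂ y q₁ q₂‖ ≤
      R * (‖z‖ ^ (2 * σ + 1) * ‖y‖ + ‖z‖ * ‖y‖ + G * (‖z‖ ^ 2 * ‖y‖) + G * Q + ‖z‖ ^ 3 * Q) := by
    unfold dens
    refine norm_add₃_le.trans ?_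
    rw [norm_mul, norm_mul, norm_mul, RCLike.norm_conj, RCLike.norm_conj, RCLike.norm_conj]
    have b0 := mul_le_mul_of_nonneg_right (norm_n₀_le (σ := σ) (by linarith) hq z p₁ p₂) (norm_nonneg y)
    have i1 : ‖p₁‖ ≤ G := by simp only [G]; linarith [norm_nonneg p₂]
    have i2 : ‖p₂‖ ≤ G := by simp only [G]; linarith [norm_nonneg p₁]
    have c1 : ‖fl q.A q.a₁ z p₁‖ ≤ R * (G + ‖z‖ ^ 3) :=
      (norm_fl_le hq.A hq.a₁ z p₁).trans (by gcongr)
    have c2 : ‖fl q.A q.a₂ z p₂‖ ≤ R * (G + ‖z‖ ^ 3) :=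
      (norm_fl_le hq.A hq.a₂ z p₂).trans (by gcongr)
    have d1 := mul_le_mul_of_nonneg_right c1 (norm_nonneg q₁)
    have d2 := mul_le_mul_of_nonneg_right c2 (norm_nonneg q₂)
    simp only [Q]
    linarith
  have t1 := h1 ‖z‖ ‖y‖ (norm_nonneg _) (norm_nonneg _)
  rw [Real.rpow_one, show 2 * σ + 1 + 1 = 2 * σ + 2 by ring] at t1
  have t2 := mul_le_eta hε ‖z‖ ‖y‖
  have t3 := mul_le_eta hε G (‖z‖ ^ 2 * ‖y‖)
  have t3' := h2 ‖z‖ ‖y‖ (norm_nonneg _) (norm_nonneg _)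
  have r1 : ∀ r : ℝ, r ^ (4 : ℝ) = r ^ 4 := fun r => by exact_mod_cast Real.rpow_natCast r 4
  have r2 : ∀ r : ℝ, r ^ ((4 : ℝ) + 2) = r ^ 6 := fun r => by
    rw [show (4 : ℝ) + 2 = (6 : ℕ) by norm_num, Real.rpow_natCast]
  rw [r1, r2, r2, Real.rpow_two] at t3'
  have t4 := mul_le_eta hε G Q
  have t5 := mul_le_eta hε (‖z‖ ^ 3) Q
  have z6 := pow_six_le_sq_add (norm_nonneg z) (p := 2 * σ + 2) (by linarith)
  have y6 := pow_six_le_sq_add (norm_nonneg y) (p := 2 * σ + 2) (by linarith)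
  have z2 := sq_le_one_add_rpow (norm_nonneg z) (p := 2 * σ + 2) (by linarith)
  have G2 : G ^ 2 ≤ 2 * (‖p₁‖ ^ 2 + ‖p₂‖ ^ 2) := add_sq_le
  have Q2 : Q ^ 2 ≤ 2 * (‖q₁‖ ^ 2 + ‖q₂‖ ^ 2) := add_sq_le
  set K := szK σ z p₁ p₂
  set N := szN σ y q₁ q₂
  have hzp : 0 ≤ ‖z‖ ^ (2 * σ + 2) := by positivity
  have hyp : 0 ≤ ‖y‖ ^ (2 * σ + 2) := by positivity
  have hp : 0 ≤ ‖p₁‖ ^ 2 := by positivity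
  have hp' : 0 ≤ ‖p₂‖ ^ 2 := by positivity
  have hq1 : 0 ≤ ‖q₁‖ ^ 2 := by positivity
  have hq2 : 0 ≤ ‖q₂‖ ^ 2 := by positivity
  have hy2 : 0 ≤ ‖y‖ ^ 2 := by positivity
  have k1 : ‖z‖ ^ (2 * σ + 2) ≤ K := by simp only [K, szK]; linarith
  have k2 : ‖z‖ ^ 2 ≤ K := by simp only [K, szK]; linarith
  have k3 : G ^ 2 ≤ 2 * K := by simp only [K, szK]; linarith
  have k6 : ‖z‖ ^ 6 ≤ 2 * K := by simp only [K, szK]; linarith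
  have m1 : ‖y‖ ^ (2 * σ + 2) ≤ N := by simp only [N, szN]; linarith
  have m2 : ‖y‖ ^ 2 ≤ N := by simp only [N, szN]; linarith
  have m3 : Q ^ 2 ≤ 2 * N := by simp only [N, szN]; linarith
  have m6 : ‖y‖ ^ 6 ≤ N := by simp only [N, szN]; linarith
  have hK : 0 ≤ K := hzp.trans k1
  have hN : 0 ≤ N := hyp.trans m1
  have hεi : 0 < ε⁻¹ := by positivity
  have u1 : ‖z‖ ^ (2 * σ + 1) * ‖y‖ ≤ ε * K + C1 * N := t1.trans (by gcongr)
  have u2 : ‖z‖ * ‖y‖ ≤ ε * K + ε⁻¹ * N := t2.trans (by gcongr)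
  have u3 : G * (‖z‖ ^ 2 * ‖y‖) ≤ 4 * ε * K + ε⁻¹ * C2 * N := by
    have e : (‖z‖ ^ 2 * ‖y‖) ^ 2 = ‖z‖ ^ 4 * ‖y‖ ^ 2 := by ring
    rw [e] at t3
    calc _ ≤ ε * G ^ 2 + ε⁻¹ * (ε * ε * ‖z‖ ^ 6 + C2 * ‖y‖ ^ 6) := t3.trans (by gcongr)
      _ ≤ ε * (2 * K) + ε⁻¹ * (ε * ε * (2 * K) + C2 * N) := by gcongr
      _ = _ := by field_simp; ring
  have u4 : G * Q ≤ 2 * ε * K + ε⁻¹ * (2 * N) := by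
    calc _ ≤ ε * (2 * K) + ε⁻¹ * (2 * N) := t4.trans (by gcongr)
      _ = _ := by ring
  have u5 : ‖z‖ ^ 3 * Q ≤ 2 * ε * K + ε⁻¹ * (2 * N) := by
    rw [← pow_mul] at t5
    calc _ ≤ ε * (2 * K) + ε⁻¹ * (2 * N) := t5.trans (by gcongr)
      _ = _ := by ring
  calc _ ≤ R * ((10 * ε) * K + (C1 + 5 * ε⁻¹ + ε⁻¹ * C2) * N) :=
        step1.trans (mul_le_mul_of_nonneg_left (by linarith) hR)
    _ = (R * (10 * ε)) * K + R * C * N := by simp only [C]; ring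
    _ ≤ _ := by
      gcongr
      have e : R * (10 * ε) = η * ((R * 10) / (20 * (R + 1))) := by simp only [ε]; ring
      rw [e]
      refine mul_le_of_le_one_right hη.le ?_
      rw [div_le_one (by positivity)]
      linarith

set_option maxHeartbeats 2000000 in
/-- The weak monotonicity of the equation, with a perturbation of the coefficients. -/
theorem exists_re_dens_le (hσ : 2 < σ) (hR : 0 ≤ R) {β m : ℝ} (hm : 0 < m)
    (hκ : 0 < ellip (2 * σ) β) : ∃ c K : ℝ, 0 < c ∧ 0 ≤ K ∧ ∀ (q q' : Par) (ϖ δ : ℝ),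
      q.Bdd R → q.A.re = 1 → q.P = ϖ * (1 - Complex.I * β) → m ≤ ϖ → 0 ≤ δ →
      q.A = q'.A → q.γ = q'.γ → ‖q.P - q'.P‖ ≤ δ → ‖q.a₁ - q'.a₁‖ ≤ δ → ‖q.a₂ - q'.a₂‖ ≤ δ →
      ‖q.b₁ - q'.b₁‖ ≤ δ → ‖q.b₂ - q'.b₂‖ ≤ δ → ∀ z p₁ p₂ z' p₁' p₂' : ℂ,
      (dens σ q z p₁ p₂ (z - z') (p₁ - p₁') (p₂ - p₂') -
        dens σ q' z' p₁' p₂' (z - z') (p₁ - p₁') (p₂ - p₂')).re ≤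
      -(1 / 2) * (‖p₁ - p₁'‖ ^ 2 + ‖p₂ - p₂'‖ ^ 2) -
        c * ((‖z‖ + ‖z'‖) ^ (2 * σ) * ‖z - z'‖ ^ 2) + K * ‖z - z'‖ ^ 2 +
        K * ((‖p₁'‖ + ‖p₂'‖) * ((‖z‖ + ‖z'‖) * ‖z - z'‖ ^ 2)) +
        K * δ ^ 2 * (‖z'‖ ^ (4 * σ + 2) + ‖z'‖ ^ 6 + (‖p₁'‖ + ‖p₂'‖) ^ 2) := by
  set c₀ := m * (ellip (2 * σ) β * (3 / 8) ^ (2 * σ) / 8)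
  have hc₀ : 0 < c₀ := by positivity
  -- B is the weight of X⁴|w|² that has to be absorbed: 8 · (4R)² from the products of E with
  -- RX²|w|, and 1 from the perturbation of b₁ and b₂.
  set B := 128 * R ^ 2 + 1
  have hB : 0 < B := by positivity
  obtain ⟨C4, hC4, h4⟩ := pow_four_le (r := 2 * σ) (by linarith) (η := c₀ / 2 / B) (by positivity)
  refine ⟨c₀ / 2, R + 1 + B * C4 + 8, by positivity, by positivity, ?_⟩
  intro q q' ϖ δ hq hA hP hϖ hδ eA eγ hdP hda1 hda2 hdb1 hdb2 z p₁ p₂ z' p₁' p₂'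
  set X := ‖z‖ + ‖z'‖
  set G := ‖p₁'‖ + ‖p₂'‖
  set w := z - z'
  set e₁ := p₁ - p₁'
  set e₂ := p₂ - p₂'
  set E := ‖e₁‖ + ‖e₂‖
  have hX : 0 ≤ X := by positivity
  have hG : 0 ≤ G := by positivity
  have hE : 0 ≤ E := by positivity
  have hzX : ‖z'‖ ≤ X := by simp only [X]; linarith [norm_nonneg z]
  -- the three parts of the increment
  have edec : dens σ q z p₁ p₂ w e₁ e₂ - dens σ q' z' p₁' p₂' w e₁ e₂ =
      -(ϖ : ℂ) * ((1 - Complex.I * β) * (pw σ z - pw σ z') * conj w) + q.γ * (w * conj w) +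
      ((q.b₁ * p₁ + q.b₂ * p₂) * ((‖z‖ ^ 2 : ℝ) : ℂ) -
        (q.b₁ * p₁' + q.b₂ * p₂') * ((‖z'‖ ^ 2 : ℝ) : ℂ)) * conj w -
      q.A * (e₁ * conj e₁ + e₂ * conj e₂) -
      (cu z - cu z') * (q.a₁ * conj e₁ + q.a₂ * conj e₂) +
      (-(q.P - q'.P) * pw σ z' + ((q.b₁ - q'.b₁) * p₁' + (q.b₂ - q'.b₂) * p₂') *
        ((‖z'‖ ^ 2 : ℝ) : ℂ)) * conj w -
      cu z' * ((q.a₁ - q'.a₁) * conj e₁ + (q.a₂ - q'.a₂) * conj e₂) := by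
    unfold dens n₀ fl
    rw [← eA, ← eγ, hP]
    simp only [w, e₁, e₂]
    ring
  have r1 : (-(ϖ : ℂ) * ((1 - Complex.I * β) * (pw σ z - pw σ z') * conj w)).re ≤
      -(c₀ * (X ^ (2 * σ) * ‖w‖ ^ 2)) := by
    rw [← Complex.ofReal_neg, Complex.re_ofReal_mul]
    have := re_pow_sub_ge (r := 2 * σ) (by linarith) hκ z z'
    rw [← pw_eq, ← pw_eq] at this
    have h0 : 0 ≤ ellip (2 * σ) β * (3 / 8) ^ (2 * σ) / 8 * X ^ (2 * σ) * ‖w‖ ^ 2 := by positivity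
    have h1 := mul_le_mul hϖ this h0 (hm.le.trans hϖ)
    simp only [c₀]
    linarith
  have r2 : (q.γ * (w * conj w)).re ≤ R * ‖w‖ ^ 2 := by
    refine (Complex.re_le_norm _).trans ?_
    rw [norm_mul, norm_mul, RCLike.norm_conj, sq]
    have := hq.γ
    gcongr
  have r3 : (((q.b₁ * p₁ + q.b₂ * p₂) * ((‖z‖ ^ 2 : ℝ) : ℂ) -
      (q.b₁ * p₁' + q.b₂ * p₂') * ((‖z'‖ ^ 2 : ℝ) : ℂ)) * conj w).re ≤
      R * (E * X ^ 2 + G * X * ‖w‖) * ‖w‖ := by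
    refine (Complex.re_le_norm _).trans ?_
    rw [norm_mul, RCLike.norm_conj]
    gcongr
    exact norm_grad_sub_le hq _ _ _ _ _ _
  have r4 : (-(q.A * (e₁ * conj e₁ + e₂ * conj e₂))).re = -(‖e₁‖ ^ 2 + ‖e₂‖ ^ 2) := by
    rw [Complex.mul_conj, Complex.mul_conj, ← Complex.ofReal_add, Complex.neg_re, mul_comm,
      Complex.re_ofReal_mul, hA, mul_one, Complex.sq_norm, Complex.sq_norm]
  have r5 : (-((cu z - cu z') * (q.a₁ * conj e₁ + q.a₂ * conj e₂))).re ≤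
      3 * X ^ 2 * ‖w‖ * (R * E) := by
    refine (Complex.re_le_norm _).trans ?_
    rw [norm_neg, norm_mul]
    have h1 := hq.a₁
    have h2 := hq.a₂
    have h3 : ‖q.a₁ * conj e₁ + q.a₂ * conj e₂‖ ≤ R * E := by
      refine (norm_add_le _ _).trans ?_
      rw [norm_mul, norm_mul, RCLike.norm_conj, RCLike.norm_conj, mul_add]
      gcongr
    gcongr
    exact norm_cu_sub_le _ _
  have r6 : ((-(q.P - q'.P) * pw σ z' + ((q.b₁ - q'.b₁) * p₁' + (q.b₂ - q'.b₂) * p₂') *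
        ((‖z'‖ ^ 2 : ℝ) : ℂ)) * conj w).re ≤
      δ * (‖z'‖ ^ (2 * σ + 1) + G * ‖z'‖ ^ 2) * ‖w‖ := by
    refine (Complex.re_le_norm _).trans ?_
    rw [norm_mul, RCLike.norm_conj]
    gcongr
    refine (norm_add_le _ _).trans ?_
    rw [norm_mul, norm_mul, norm_neg, norm_pw (by linarith), Complex.norm_real,
      Real.norm_of_nonneg (by positivity : 0 ≤ ‖z'‖ ^ 2), mul_add, ← mul_assoc]
    gcongr
    refine (norm_add_le _ _).trans ?_
    rw [norm_mul, norm_mul, mul_add]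
    gcongr
  have r7 : (-(cu z' * ((q.a₁ - q'.a₁) * conj e₁ + (q.a₂ - q'.a₂) * conj e₂))).re ≤
      ‖z'‖ ^ 3 * (δ * E) := by
    refine (Complex.re_le_norm _).trans ?_
    rw [norm_neg, norm_mul, norm_cu]
    gcongr
    refine (norm_add_le _ _).trans ?_
    rw [norm_mul, norm_mul, RCLike.norm_conj, RCLike.norm_conj, mul_add]
    gcongr
  -- absorption
  have E2 : E ^ 2 ≤ 2 * (‖e₁‖ ^ 2 + ‖e₂‖ ^ 2) := add_sq_le
  -- This and the next inequality each cost E²/8 ≤ (|e₁|² + |e₂|²)/4, so half of the viscous term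
  -- remains.
  have s1 := mul_le_eta (η := 1 / 8) (by norm_num) E (4 * R * X ^ 2 * ‖w‖)
  have s2 := mul_le_eta (η := 1 / 8) (by norm_num) E (δ * ‖z'‖ ^ 3)
  have s3 := mul_le_sq_add_sq (δ * ‖z'‖ ^ (2 * σ + 1)) ‖w‖
  have s4 : δ * (G * ‖z'‖ ^ 2) * ‖w‖ ≤ (δ * G) ^ 2 + X ^ 4 * ‖w‖ ^ 2 := by
    have h1 := mul_le_sq_add_sq (δ * G) (‖z'‖ ^ 2 * ‖w‖)
    have h2 : (‖z'‖ ^ 2 * ‖w‖) ^ 2 ≤ X ^ 4 * ‖w‖ ^ 2 := by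
      rw [mul_pow, ← pow_mul]; gcongr
    linarith [show δ * (G * ‖z'‖ ^ 2) * ‖w‖ = δ * G * (‖z'‖ ^ 2 * ‖w‖) by ring]
  have s5 : B * (X ^ 4 * ‖w‖ ^ 2) ≤ c₀ / 2 * (X ^ (2 * σ) * ‖w‖ ^ 2) + B * C4 * ‖w‖ ^ 2 := by
    calc _ ≤ B * ((c₀ / 2 / B * X ^ (2 * σ) + C4) * ‖w‖ ^ 2) := by
          gcongr; exact h4 X hX
      _ = _ := by field_simp
  have s6 : (‖z'‖ ^ (2 * σ + 1)) ^ 2 = ‖z'‖ ^ (4 * σ + 2) := by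
    rw [← Real.rpow_two, ← Real.rpow_mul (norm_nonneg _)]; ring_nf
  rw [mul_pow, s6] at s3
  have w0 : 0 ≤ G * (X * ‖w‖ ^ 2) := by positivity
  have w1 : 0 ≤ δ ^ 2 * (‖z'‖ ^ (4 * σ + 2)) := by positivity
  have w2 : 0 ≤ δ ^ 2 * G ^ 2 := by positivity
  have w3 : 0 ≤ δ ^ 2 * (‖z'‖ ^ (4 * σ + 2) + ‖z'‖ ^ 6 + G ^ 2) := by positivity
  have w4 : 0 ≤ ‖w‖ ^ 2 := by positivity
  have w5 : 0 ≤ B * C4 := by positivity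
  have v1 : R * (G * (X * ‖w‖ ^ 2)) ≤ (R + 1 + B * C4 + 8) * (G * (X * ‖w‖ ^ 2)) :=
    mul_le_mul_of_nonneg_right (by linarith) w0
  have v2 : 8 * (δ ^ 2 * (‖z'‖ ^ (4 * σ + 2) + ‖z'‖ ^ 6 + G ^ 2)) ≤
      (R + 1 + B * C4 + 8) * (δ ^ 2 * (‖z'‖ ^ (4 * σ + 2) + ‖z'‖ ^ 6 + G ^ 2)) :=
    mul_le_mul_of_nonneg_right (by linarith) w3
  have v3 : (R + 1 + B * C4) * ‖w‖ ^ 2 ≤ (R + 1 + B * C4 + 8) * ‖w‖ ^ 2 :=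
    mul_le_mul_of_nonneg_right (by linarith) w4
  have vB : B * (X ^ 4 * ‖w‖ ^ 2) = 128 * (R ^ 2 * X ^ 4 * ‖w‖ ^ 2) + X ^ 4 * ‖w‖ ^ 2 := by
    simp only [B]; ring
  have key : (dens σ q z p₁ p₂ w e₁ e₂ - dens σ q' z' p₁' p₂' w e₁ e₂).re ≤
      -(c₀ * (X ^ (2 * σ) * ‖w‖ ^ 2)) + R * ‖w‖ ^ 2 + R * (E * X ^ 2 + G * X * ‖w‖) * ‖w‖ -
      (‖e₁‖ ^ 2 + ‖e₂‖ ^ 2) + 3 * X ^ 2 * ‖w‖ * (R * E) +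
      δ * (‖z'‖ ^ (2 * σ + 1) + G * ‖z'‖ ^ 2) * ‖w‖ + ‖z'‖ ^ 3 * (δ * E) := by
    rw [edec, sub_eq_add_neg _ (cu z' * _), sub_eq_add_neg _ ((cu z - cu z') * _),
      sub_eq_add_neg _ (q.A * _)]
    simp only [Complex.add_re]
    linarith
  clear_value c₀ B
  linarith

end Density

/-! ### The weak form: integrability, linearity in the test function, Lipschitz bounds -/

section Form

variable {L₁ L₂ : ℝ} {σ : ℝ}

/-- The weak form of the right hand side of the equation, conjugate linear in the test function. -/
def form (σ : ℝ) (q : Par) (u ψ : V L₁ L₂) : ℂ :=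
  ∫ x, dens σ q (fn u x) (dx u x) (dy u x) (fn ψ x) (dx ψ x) (dy ψ x) ∂(dom L₁ L₂)

theorem Par.exists_bdd (q : Par) : ∃ R, 0 ≤ R ∧ q.Bdd R := by
  have h1 := norm_nonneg q.A
  have h2 := norm_nonneg q.P
  have h3 := norm_nonneg q.γ
  have h4 := norm_nonneg q.a₁
  have h5 := norm_nonneg q.a₂
  have h6 := norm_nonneg q.b₁
  have h7 := norm_nonneg q.b₂
  exact ⟨‖q.A‖ + ‖q.P‖ + ‖q.γ‖ + ‖q.a₁‖ + ‖q.a₂‖ + ‖q.b₁‖ + ‖q.b₂‖, by positivity,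
    ⟨by linarith, by linarith, by linarith, by linarith, by linarith, by linarith, by linarith⟩⟩

theorem measurable_dens (q : Par) : Measurable (fun p : ℂ × ℂ × ℂ × ℂ × ℂ × ℂ =>
    dens σ q p.1 p.2.1 p.2.2.1 p.2.2.2.1 p.2.2.2.2.1 p.2.2.2.2.2) := by
  have hc : Measurable (fun z : ℂ => conj z) := Complex.continuous_conj.measurable
  unfold dens n₀ fl pw cu
  fun_prop

theorem aemeasurable_dens (q : Par) (u ψ : V L₁ L₂) : AEStronglyMeasurable
    (fun x => dens σ q (fn u x) (dx u x) (dy u x) (fn ψ x) (dx ψ x) (dy ψ x)) (dom L₁ L₂) := by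
  have m : ∀ f : H L₁ L₂, AEMeasurable f (dom L₁ L₂) := fun f =>
    (Lp.aestronglyMeasurable f).aemeasurable
  exact ((measurable_dens (σ := σ) q).comp_aemeasurable ((m (fn u)).prodMk ((m (dx u)).prodMk
    ((m (dy u)).prodMk ((m (fn ψ)).prodMk ((m (dx ψ)).prodMk (m (dy ψ)))))))).aestronglyMeasurable

/-- `∫ (1 + |u|^{2σ+2} + |∇u|²)`. -/
def bigK (σ : ℝ) (u : V L₁ L₂) : ℝ := ∫ x, szK σ (fn u x) (dx u x) (dy u x) ∂(dom L₁ L₂)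

/-- `‖ψ‖_V² + ∫ |ψ|^{2σ+2}`. -/
def bigN (σ : ℝ) (ψ : V L₁ L₂) : ℝ := ∫ x, szN σ (fn ψ x) (dx ψ x) (dy ψ x) ∂(dom L₁ L₂)

theorem integrable_szK (hσ : 2 < σ) (u : V L₁ L₂) :
    Integrable (fun x => szK σ (fn u x) (dx u x) (dy u x)) (dom L₁ L₂) :=
  (((integrable_const _).add (integrable_rpow u (by linarith))).add (H.integrable_sq _)).add
    (H.integrable_sq _)

theorem integrable_szN (hσ : 2 < σ) (u : V L₁ L₂) :
    Integrable (fun x => szN σ (fn u x) (dx u x) (dy u x)) (dom L₁ L₂) :=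
  (((H.integrable_sq _).add (integrable_rpow u (by linarith))).add (H.integrable_sq _)).add
    (H.integrable_sq _)

theorem integral_add₃ {X : Type*} [MeasurableSpace X] {μ : Measure X} {f₁ f₂ f₃ : X → ℝ}
    (h₁ : Integrable f₁ μ) (h₂ : Integrable f₂ μ) (h₃ : Integrable f₃ μ) :
    ∫ x, (f₁ x + f₂ x + f₃ x) ∂μ = ∫ x, f₁ x ∂μ + ∫ x, f₂ x ∂μ + ∫ x, f₃ x ∂μ := by
  have h : Integrable (fun x => f₁ x + f₂ x) μ := h₁.add h₂
  rw [integral_add h h₃, integral_add h₁ h₂]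

theorem integral_add₄ {X : Type*} [MeasurableSpace X] {μ : Measure X} {f₁ f₂ f₃ f₄ : X → ℝ}
    (h₁ : Integrable f₁ μ) (h₂ : Integrable f₂ μ) (h₃ : Integrable f₃ μ) (h₄ : Integrable f₄ μ) :
    ∫ x, (f₁ x + f₂ x + f₃ x + f₄ x) ∂μ =
      ∫ x, f₁ x ∂μ + ∫ x, f₂ x ∂μ + ∫ x, f₃ x ∂μ + ∫ x, f₄ x ∂μ := by
  have h : Integrable (fun x => f₁ x + f₂ x + f₃ x) μ := (h₁.add h₂).add h₃
  rw [integral_add h h₄, integral_add₃ h₁ h₂ h₃]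

theorem bigN_eq (hσ : 2 < σ) (u : V L₁ L₂) :
    bigN σ u = ‖u‖ ^ 2 + ∫ x, ‖fn u x‖ ^ (2 * σ + 2) ∂(dom L₁ L₂) := by
  unfold bigN szN
  rw [integral_add₄ (H.integrable_sq _) (integrable_rpow u (by linarith)) (H.integrable_sq _)
    (H.integrable_sq _), ← H.norm_sq_eq, ← H.norm_sq_eq, ← H.norm_sq_eq, norm_sq_eq u]
  unfold gr
  ring

theorem bigK_eq (hσ : 2 < σ) (u : V L₁ L₂) :
    bigK σ u = (dom L₁ L₂).real univ + ∫ x, ‖fn u x‖ ^ (2 * σ + 2) ∂(dom L₁ L₂) + gr u := by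
  unfold bigK szK
  rw [integral_add₄ (integrable_const _) (integrable_rpow u (by linarith)) (H.integrable_sq _)
    (H.integrable_sq _), ← H.norm_sq_eq, ← H.norm_sq_eq]
  unfold gr
  simp
  ring

theorem bigN_nonneg (hσ : 2 < σ) (u : V L₁ L₂) : 0 ≤ bigN σ u := by
  rw [bigN_eq hσ]
  have : 0 ≤ ∫ x, ‖fn u x‖ ^ (2 * σ + 2) ∂(dom L₁ L₂) := integral_nonneg fun x => by positivity
  positivity

theorem integrable_dens (hσ : 2 < σ) (q : Par) (u ψ : V L₁ L₂) : Integrable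
    (fun x => dens σ q (fn u x) (dx u x) (dy u x) (fn ψ x) (dx ψ x) (dy ψ x)) (dom L₁ L₂) := by
  obtain ⟨R, hR, hq⟩ := q.exists_bdd
  obtain ⟨C, hC0, hC⟩ := exists_norm_dens_le hσ hR one_pos
  exact (((integrable_szK hσ u).const_mul 1).add ((integrable_szN hσ ψ).const_mul C)).mono'
    (aemeasurable_dens q u ψ) (ae_of_all _ fun x => hC q hq _ _ _ _ _ _)

/-- The free factor η is spent in `energy_le_of_weak_derivative`, where the test function is an
increment of the path and the solution terms have to be made negligible. -/
theorem exists_norm_form_le (hσ : 2 < σ) {R : ℝ} (hR : 0 ≤ R) {η : ℝ} (hη : 0 < η) :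
    ∃ C : ℝ, 0 ≤ C ∧ ∀ q : Par, q.Bdd R → ∀ u ψ : V L₁ L₂,
      ‖form σ q u ψ‖ ≤ η * bigK σ u + C * bigN σ ψ := by
  obtain ⟨C, hC0, hC⟩ := exists_norm_dens_le hσ hR hη
  refine ⟨C, hC0, fun q hq u ψ => ?_⟩
  unfold bigK bigN
  rw [← integral_const_mul, ← integral_const_mul, ← integral_add ((integrable_szK hσ u).const_mul _)
    ((integrable_szN hσ ψ).const_mul _)]
  refine (norm_integral_le_integral_norm _).trans (integral_mono (integrable_dens hσ q u ψ).norm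
    (((integrable_szK hσ u).const_mul _).add ((integrable_szN hσ ψ).const_mul _)) fun x => ?_)
  exact hC q hq _ _ _ _ _ _

theorem ae_add (v w : V L₁ L₂) : ∀ᵐ x ∂(dom L₁ L₂), fn (v + w) x = fn v x + fn w x ∧
    dx (v + w) x = dx v x + dx w x ∧ dy (v + w) x = dy v x + dy w x := by
  filter_upwards [Lp.coeFn_add (fn v) (fn w), Lp.coeFn_add (dx v) (dx w),
    Lp.coeFn_add (dy v) (dy w)] with x h0 h1 h2
  exact ⟨h0, h1, h2⟩

theorem ae_sub (v w : V L₁ L₂) : ∀ᵐ x ∂(dom L₁ L₂), fn (v - w) x = fn v x - fn w x ∧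
    dx (v - w) x = dx v x - dx w x ∧ dy (v - w) x = dy v x - dy w x := by
  filter_upwards [Lp.coeFn_sub (fn v) (fn w), Lp.coeFn_sub (dx v) (dx w),
    Lp.coeFn_sub (dy v) (dy w)] with x h0 h1 h2
  exact ⟨h0, h1, h2⟩

theorem ae_smul (c : ℂ) (w : V L₁ L₂) : ∀ᵐ x ∂(dom L₁ L₂), fn (c • w) x = c * fn w x ∧
    dx (c • w) x = c * dx w x ∧ dy (c • w) x = c * dy w x := by
  filter_upwards [Lp.coeFn_smul c (fn w), Lp.coeFn_smul c (dx w),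
    Lp.coeFn_smul c (dy w)] with x h0 h1 h2
  exact ⟨h0, h1, h2⟩

theorem ae_zero : ∀ᵐ x ∂(dom L₁ L₂), fn (0 : V L₁ L₂) x = 0 ∧
    dx (0 : V L₁ L₂) x = 0 ∧ dy (0 : V L₁ L₂) x = 0 := by
  filter_upwards [Lp.coeFn_zero ℂ 2 (dom L₁ L₂)] with x h0
  exact ⟨h0, h0, h0⟩

theorem form_add_right (hσ : 2 < σ) (q : Par) (u ψ χ : V L₁ L₂) :
    form σ q u (ψ + χ) = form σ q u ψ + form σ q u χ := by
  unfold form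
  rw [← integral_add (integrable_dens hσ q u ψ) (integrable_dens hσ q u χ)]
  refine integral_congr_ae ((ae_add ψ χ).mono fun x hx => ?_)
  simp only [hx.1, hx.2.1, hx.2.2]
  unfold dens
  simp only [map_add]
  ring

theorem form_smul_right (q : Par) (u : V L₁ L₂) (c : ℂ) (ψ : V L₁ L₂) :
    form σ q u (c • ψ) = conj c * form σ q u ψ := by
  unfold form
  rw [← integral_const_mul]
  refine integral_congr_ae ((ae_smul c ψ).mono fun x hx => ?_)
  simp only [hx.1, hx.2.1, hx.2.2]
  unfold dens
  simp only [map_mul]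
  ring

theorem form_sub_right (hσ : 2 < σ) (q : Par) (u ψ χ : V L₁ L₂) :
    form σ q u (ψ - χ) = form σ q u ψ - form σ q u χ := by
  rw [sub_eq_add_neg, form_add_right hσ, ← neg_one_smul ℂ χ, form_smul_right]
  simp [sub_eq_add_neg]

theorem form_zero_right (q : Par) (u : V L₁ L₂) : form σ q u 0 = 0 := by
  have := form_smul_right (σ := σ) q u 0 0
  simpa using this

theorem form_sum_right (hσ : 2 < σ) (q : Par) (u : V L₁ L₂) {ι : Type*} (s : Finset ι)
    (f : ι → V L₁ L₂) : form σ q u (∑ i ∈ s, f i) = ∑ i ∈ s, form σ q u (f i) := by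
  classical
  induction s using Finset.induction_on with
  | empty => simp [form_zero_right]
  | insert a s ha ih => rw [Finset.sum_insert ha, Finset.sum_insert ha, form_add_right hσ, ih]

theorem form_zero_left (q : Par) (ψ : V L₁ L₂) : form σ q 0 ψ = 0 := by
  unfold form
  refine integral_eq_zero_of_ae ((ae_zero (L₁ := L₁) (L₂ := L₂)).mono fun x hx => ?_)
  simp only [hx.1, hx.2.1, hx.2.2]
  simp [dens, n₀, fl, pw, cu]

/-! ### The form is locally Lipschitz -/

/-- A sum of powers controlling the Lipschitz constants. -/
def szB (σ : ℝ) (z p₁ p₂ : ℂ) : ℝ :=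
  ‖z‖ ^ (4 * σ) + ‖z‖ ^ 8 + ‖z‖ ^ 6 + ‖z‖ ^ 4 + ‖z‖ ^ 2 + ‖p₁‖ ^ 2 + ‖p₂‖ ^ 2

theorem integrable_szB (hσ : 2 < σ) (u : V L₁ L₂) :
    Integrable (fun x => szB σ (fn u x) (dx u x) (dy u x)) (dom L₁ L₂) :=
  ((((((integrable_rpow u (by linarith)).add (integrable_pow u _)).add (integrable_pow u _)).add
    (integrable_pow u _)).add (integrable_pow u _)).add (H.integrable_sq _)).add (H.integrable_sq _)

theorem exists_integral_szB_le (L₁ L₂ : ℝ) (hσ : 2 < σ) (M : ℝ) : ∃ C : ℝ, 0 ≤ C ∧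
    ∀ u : V L₁ L₂, ‖u‖ ≤ M → ∫ x, szB σ (fn u x) (dx u x) (dy u x) ∂(dom L₁ L₂) ≤ C := by
  have hp : ∀ k : ℕ, ∃ C : ℝ, 0 ≤ C ∧ ∀ w : V L₁ L₂, ‖w‖ ≤ M →
      ∫ x, ‖fn w x‖ ^ k ∂(dom L₁ L₂) ≤ C := fun k => by
    simpa using exists_integral_rpow_le L₁ L₂ (q := k) (by positivity) M
  obtain ⟨C1, h1, H1⟩ := exists_integral_rpow_le L₁ L₂ (q := 4 * σ) (by linarith) M
  obtain ⟨C2, h2, H2⟩ := hp 8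
  obtain ⟨C3, h3, H3⟩ := hp 6
  obtain ⟨C4, h4, H4⟩ := hp 4
  obtain ⟨C5, h5, H5⟩ := hp 2
  refine ⟨C1 + C2 + C3 + C4 + C5 + M ^ 2, by positivity, fun u hu => ?_⟩
  have e : ∫ x, szB σ (fn u x) (dx u x) (dy u x) ∂(dom L₁ L₂) =
      ∫ x, ‖fn u x‖ ^ (4 * σ) ∂(dom L₁ L₂) + ∫ x, ‖fn u x‖ ^ 8 ∂(dom L₁ L₂) +
      ∫ x, ‖fn u x‖ ^ 6 ∂(dom L₁ L₂) + ∫ x, ‖fn u x‖ ^ 4 ∂(dom L₁ L₂) +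
      ∫ x, ‖fn u x‖ ^ 2 ∂(dom L₁ L₂) + ‖dx u‖ ^ 2 + ‖dy u‖ ^ 2 := by
    have i1 := integrable_rpow u (q := 4 * σ) (by linarith)
    have i2 := integrable_pow u 8
    have i3 := integrable_pow u 6
    have i4 := integrable_pow u 4
    have i5 := integrable_pow u 2
    have i14 : Integrable (fun x => ‖fn u x‖ ^ (4 * σ) + ‖fn u x‖ ^ 8 + ‖fn u x‖ ^ 6 +
      ‖fn u x‖ ^ 4) (dom L₁ L₂) := ((i1.add i2).add i3).add i4
    unfold szB
    rw [integral_add₄ i14 i5 (H.integrable_sq _) (H.integrable_sq _), integral_add₄ i1 i2 i3 i4, ← H.norm_sq_eq (dx u), ← H.norm_sq_eq (dy u)]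
  rw [e]
  have hg : ‖dx u‖ ^ 2 + ‖dy u‖ ^ 2 ≤ M ^ 2 := (gr_le u).trans (by gcongr)
  linarith [H1 u hu, H2 u hu, H3 u hu, H4 u hu, H5 u hu]

theorem add_rpow_le {a b q : ℝ} (ha : 0 ≤ a) (hb : 0 ≤ b) (hq : 0 ≤ q) :
    (a + b) ^ q ≤ 2 ^ q * (a ^ q + b ^ q) := by
  wlog h : a ≤ b generalizing a b
  · rw [add_comm a, add_comm (a ^ q)]; exact this hb ha (le_of_not_ge h)
  calc (a + b) ^ q ≤ (2 * b) ^ q := by gcongr; linarith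
    _ = 2 ^ q * b ^ q := Real.mul_rpow (by norm_num) hb
    _ ≤ _ := by
      have : 0 ≤ a ^ q := by positivity
      gcongr; linarith

theorem add_npow_le {a b : ℝ} (ha : 0 ≤ a) (hb : 0 ≤ b) (k : ℕ) :
    (a + b) ^ k ≤ 2 ^ k * (a ^ k + b ^ k) := by
  have := add_rpow_le ha hb (q := k) (by positivity)
  simpa only [Real.rpow_natCast] using this

theorem lipDens_le (hσ : 2 < σ) (z z' p₁ p₂ w e₁ e₂ y q₁ q₂ : ℂ) :
    lipDens σ (‖z‖ + ‖z'‖) (‖p₁‖ + ‖p₂‖) ‖w‖ (‖e₁‖ + ‖e₂‖) ‖y‖ (‖q₁‖ + ‖q₂‖) ≤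
      (2 ^ (4 * σ) + 2 ^ 9) * (szB σ z 0 0 + szB σ z' p₁ p₂ + szB σ w e₁ e₂ + szB σ y q₁ q₂) := by
  have k1 := add_rpow_le (norm_nonneg z) (norm_nonneg z') (q := 4 * σ) (by linarith)
  have k2 := add_npow_le (norm_nonneg z) (norm_nonneg z') 8
  have k3 := add_npow_le (norm_nonneg z) (norm_nonneg z') 6
  have k4 := add_npow_le (norm_nonneg p₁) (norm_nonneg p₂) 2
  have k5 := add_npow_le (norm_nonneg e₁) (norm_nonneg e₂) 2
  have k6 := add_npow_le (norm_nonneg q₁) (norm_nonneg q₂) 2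
  have hA : (0 : ℝ) ≤ 2 ^ (4 * σ) := by positivity
  have hz : ∀ z p₁ p₂ : ℂ, 0 ≤ szB σ z p₁ p₂ := fun z p₁ p₂ => by unfold szB; positivity
  have b1 : ‖z‖ ^ (4 * σ) + ‖z'‖ ^ (4 * σ) ≤
      szB σ z 0 0 + szB σ z' p₁ p₂ + szB σ w e₁ e₂ + szB σ y q₁ q₂ := by
    have h1 : ‖z‖ ^ (4 * σ) ≤ szB σ z 0 0 := by
      unfold szB; rw [← sub_nonneg]; ring_nf; positivity
    have h2 : ‖z'‖ ^ (4 * σ) ≤ szB σ z' p₁ p₂ := by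
      unfold szB; rw [← sub_nonneg]; ring_nf; positivity
    linarith [hz w e₁ e₂, hz y q₁ q₂]
  have b2 : lipDens σ (‖z‖ + ‖z'‖) (‖p₁‖ + ‖p₂‖) ‖w‖ (‖e₁‖ + ‖e₂‖) ‖y‖ (‖q₁‖ + ‖q₂‖) -
      (‖z‖ + ‖z'‖) ^ (4 * σ) ≤
      2 ^ 9 * (szB σ z 0 0 + szB σ z' p₁ p₂ + szB σ w e₁ e₂ + szB σ y q₁ q₂) := by
    unfold lipDens szB
    have g1 : 0 ≤ ‖z‖ ^ (4 * σ) := by positivity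
    have g2 : 0 ≤ ‖z'‖ ^ (4 * σ) := by positivity
    have g3 : 0 ≤ ‖w‖ ^ (4 * σ) := by positivity
    have g4 : 0 ≤ ‖y‖ ^ (4 * σ) := by positivity
    have s : ∀ (x : ℂ) (k : ℕ), 0 ≤ ‖x‖ ^ k := fun x k => by positivity
    simp only [norm_zero]
    linarith [s z 6, s z 4, s z 2, s z' 6, s z' 4, s z' 2, s w 8, s w 6, s w 4, s w 2, s y 8,
      s y 6, s y 4, s y 2, s p₁ 2, s p₂ 2, s e₁ 2, s e₂ 2, s q₁ 2, s q₂ 2]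
  have b3 := mul_le_mul_of_nonneg_left b1 hA
  linarith

/-- This is `norm_dens_sub_le` with s = ‖u − v‖ and t = ‖ψ‖. The normalized increments lie in the
unit ball of V, and by the Sobolev embedding the integral of `szB` is bounded on balls of V. -/
theorem exists_form_lip (L₁ L₂ : ℝ) (hσ : 2 < σ) {R : ℝ} (hR : 0 ≤ R) (M : ℝ) :
    ∃ C : ℝ, 0 ≤ C ∧ ∀ q : Par, q.Bdd R → ∀ u v ψ : V L₁ L₂, ‖u‖ ≤ M → ‖v‖ ≤ M →
      ‖form σ q u ψ - form σ q v ψ‖ ≤ C * ‖u - v‖ * ‖ψ‖ := by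
  obtain ⟨CM, hCM0, hCM⟩ := exists_integral_szB_le L₁ L₂ hσ M
  obtain ⟨C1, hC10, hC1⟩ := exists_integral_szB_le L₁ L₂ hσ 1
  refine ⟨R * (2 * σ + 4) * ((2 ^ (4 * σ) + 2 ^ 9) * (CM + CM + C1 + C1)), by positivity,
    fun q hq u v ψ hu hv => ?_⟩
  rcases eq_or_ne (u - v) 0 with h0 | h0
  · rw [sub_eq_zero.1 h0]; simp
  rcases eq_or_ne ψ 0 with hψ | hψ
  · simp [hψ, form_zero_right]
  have hs : 0 < ‖u - v‖ := norm_pos_iff.2 h0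
  have ht : 0 < ‖ψ‖ := norm_pos_iff.2 hψ
  set s := ‖u - v‖
  set t := ‖ψ‖
  set w : V L₁ L₂ := ((s⁻¹ : ℝ) : ℂ) • (u - v)
  set y : V L₁ L₂ := ((t⁻¹ : ℝ) : ℂ) • ψ
  have hw : ‖w‖ ≤ 1 := by
    simp only [w]
    rw [norm_smul, Complex.norm_real, norm_inv, norm_norm, inv_mul_cancel₀ hs.ne']
  have hy : ‖y‖ ≤ 1 := by
    simp only [y]
    rw [norm_smul, Complex.norm_real, norm_inv, norm_norm, inv_mul_cancel₀ ht.ne']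
  unfold form
  rw [← integral_sub (integrable_dens hσ q u ψ) (integrable_dens hσ q v ψ)]
  have i1 := integrable_szB hσ u
  have i2 := integrable_szB hσ v
  have i3 := integrable_szB hσ w
  have i4 := integrable_szB hσ y
  have hint := (((i1.add i2).add i3).add i4).const_mul
    (R * (2 * σ + 4) * s * t * (2 ^ (4 * σ) + 2 ^ 9))
  calc _ ≤ ∫ x, R * (2 * σ + 4) * s * t * (2 ^ (4 * σ) + 2 ^ 9) *
        (szB σ (fn u x) (dx u x) (dy u x) + szB σ (fn v x) (dx v x) (dy v x) +
        szB σ (fn w x) (dx w x) (dy w x) + szB σ (fn y x) (dx y x) (dy y x)) ∂(dom L₁ L₂) := by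
        refine (norm_integral_le_integral_norm _).trans (integral_mono_ae
          ((integrable_dens hσ q u ψ).sub (integrable_dens hσ q v ψ)).norm hint ?_)
        filter_upwards [ae_sub u v, ae_smul ((s⁻¹ : ℝ) : ℂ) (u - v), ae_smul ((t⁻¹ : ℝ) : ℂ) ψ]
          with x hx1 hx2 hx3
        refine (norm_dens_sub_le (by linarith) hq hs ht _ _ _ _ _ _ _ _ _).trans ?_
        have es : ∀ c : ℂ, s⁻¹ * ‖c‖ = ‖((s⁻¹ : ℝ) : ℂ) * c‖ := fun c => by
          rw [norm_mul, Complex.norm_real, Real.norm_of_nonneg (by positivity)]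
        have et : ∀ c : ℂ, t⁻¹ * ‖c‖ = ‖((t⁻¹ : ℝ) : ℂ) * c‖ := fun c => by
          rw [norm_mul, Complex.norm_real, Real.norm_of_nonneg (by positivity)]
        rw [mul_add s⁻¹, mul_add t⁻¹, es, es, es, et, et, et, ← hx1.1, ← hx1.2.1, ← hx1.2.2,
          ← hx2.1, ← hx2.2.1, ← hx2.2.2, ← hx3.1, ← hx3.2.1, ← hx3.2.2]
        have h1 := lipDens_le hσ (fn u x) (fn v x) (dx v x) (dy v x) (fn w x) (dx w x) (dy w x)
          (fn y x) (dx y x) (dy y x)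
        have h2 : szB σ (fn u x) 0 0 ≤ szB σ (fn u x) (dx u x) (dy u x) := by
          unfold szB; simp only [norm_zero]; gcongr <;> positivity
        have hRst : 0 ≤ R * (2 * σ + 4) * s * t := by positivity
        rw [mul_assoc (R * (2 * σ + 4) * s * t)]
        refine mul_le_mul_of_nonneg_left (h1.trans ?_) hRst
        gcongr
    _ = R * (2 * σ + 4) * s * t * (2 ^ (4 * σ) + 2 ^ 9) *
        (∫ x, szB σ (fn u x) (dx u x) (dy u x) ∂(dom L₁ L₂) +
        ∫ x, szB σ (fn v x) (dx v x) (dy v x) ∂(dom L₁ L₂) +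
        ∫ x, szB σ (fn w x) (dx w x) (dy w x) ∂(dom L₁ L₂) +
        ∫ x, szB σ (fn y x) (dx y x) (dy y x) ∂(dom L₁ L₂)) := by
        rw [integral_const_mul, integral_add₄ i1 i2 i3 i4]
    _ ≤ R * (2 * σ + 4) * s * t * (2 ^ (4 * σ) + 2 ^ 9) * (CM + CM + C1 + C1) := by
        gcongr
        · exact hCM u hu
        · exact hCM v hv
        · exact hC1 w hw
        · exact hC1 y hy
    _ = _ := by ring

end Form

/-! ### Local monotonicity, coercivity and scaling of the form -/

section Mono

variable {L₁ L₂ : ℝ} {σ : ℝ}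

/-- Bounded and uniformly elliptic coefficients. -/
structure Par.Good (q : Par) (β m R : ℝ) : Prop where
  bdd : q.Bdd R
  re_A : q.A.re = 1
  exists_P : ∃ ϖ : ℝ, m ≤ ϖ ∧ q.P = ϖ * (1 - Complex.I * β)

/-- The coefficients of two equations with the same linear part are `δ`-close. -/
structure Par.Close (q q' : Par) (δ : ℝ) : Prop where
  nonneg : 0 ≤ δ
  A : q.A = q'.A
  γ : q.γ = q'.γ
  P : ‖q.P - q'.P‖ ≤ δ
  a₁ : ‖q.a₁ - q'.a₁‖ ≤ δ
  a₂ : ‖q.a₂ - q'.a₂‖ ≤ δ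
  b₁ : ‖q.b₁ - q'.b₁‖ ≤ δ
  b₂ : ‖q.b₂ - q'.b₂‖ ≤ δ

theorem Par.Close.refl (q : Par) : q.Close q 0 := by
  constructor <;> simp

/-- G is the gradient of the regular solution, of which only the L²-norm is under control. Two Young
inequalities isolate G² with weight s and w⁶ with weight s⁻²; for s proportional to ‖w‖² both become
quadratic in w after integration. -/
theorem weighted_young {G X w s E η C : ℝ} (hs : 0 < s) (h4 : X ^ 4 ≤ η * E + C) :
    G * (X * w ^ 2) ≤ s * G ^ 2 + η * (E * w ^ 2) + C * w ^ 2 + (s ^ 2)⁻¹ * w ^ 6 := by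
  have h1 := mul_le_eta hs G (X * w ^ 2)
  have h2 : s⁻¹ * (X * w ^ 2) ^ 2 ≤ X ^ 4 * w ^ 2 + (s ^ 2)⁻¹ * w ^ 6 := by
    have h := sq_nonneg (X ^ 2 * w - s⁻¹ * w ^ 3)
    have e : (s ^ 2)⁻¹ = s⁻¹ ^ 2 := by rw [inv_pow]
    have h0 : 0 ≤ s⁻¹ * (X * w ^ 2) ^ 2 := by positivity
    rw [e]
    nlinarith
  have h3 := mul_le_mul_of_nonneg_right h4 (sq_nonneg w)
  linarith

theorem mono_scalar {c K η C E D T y G B w6 s e : ℝ}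
    (hT : T ≤ s * G + η * D + C * y + w6) (hη : K * η = c / 2) (hK : 0 ≤ K) (hE : E ≤ D)
    (hc : 0 < c) :
    -(1 / 2) * e - c * D + K * y + K * T + B ≤
      -(1 / 2) * e - c / 2 * E + (K + K * C) * y + K * s * G + K * w6 + B := by
  have h1 := mul_le_mul_of_nonneg_left hT hK
  have h2 := mul_le_mul_of_nonneg_left hE hc.le
  have h3 : K * (η * D) = c / 2 * D := by rw [← mul_assoc, hη]
  nlinarith

/-- Monotonicity of the form, with a perturbation of the coefficients, relative to a bounded
set of second arguments. -/
theorem exists_form_mono (L₁ L₂ : ℝ) (hσ : 2 < σ) {R : ℝ} (hR : 0 ≤ R) {β m : ℝ} (hm : 0 < m)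
    (hκ : 0 < ellip (2 * σ) β) (M : ℝ) : ∃ c K : ℝ, 0 < c ∧ 0 ≤ K ∧
      ∀ (q q' : Par) (δ : ℝ), q.Good β m R → q.Close q' δ → ∀ u v : V L₁ L₂, ‖v‖ ≤ M →
      (form σ q u (u - v) - form σ q' v (u - v)).re ≤ -(1 / 4) * gr (u - v) -
        c * ∫ x, ‖fn (u - v) x‖ ^ (2 * σ + 2) ∂(dom L₁ L₂) + K * ‖fn (u - v)‖ ^ 2 + K * δ ^ 2 := by
  obtain ⟨c, K₀, hc, hK₀, hdens⟩ := exists_re_dens_le hσ hR hm hκ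
  set K := K₀ + 1
  have hK : 0 < K := by positivity
  obtain ⟨C4, hC4, h4⟩ := pow_four_le (r := 2 * σ) (by linarith) (η := c / 2 / K) (by positivity)
  obtain ⟨C6, hC6, h6⟩ := exists_integral_pow L₁ L₂ 2
  obtain ⟨D1, hD1, hD1'⟩ := exists_integral_rpow_le L₁ L₂ (q := 4 * σ + 2) (by linarith) M
  obtain ⟨D2, hD2, hD2'⟩ := exists_integral_rpow_le L₁ L₂ (q := (6 : ℕ)) (by positivity) M
  -- Chosen such that 2Ks(M² + 1) = ‖w‖²/4 when s = ε‖w‖². The gradient of v then consumes only half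
  -- of the dissipation gr w / 2.
  set ε := (8 * K * (M ^ 2 + 1))⁻¹
  have hε : 0 < ε := by positivity
  refine ⟨c / 2, (K + K * C4) + 1 + K * (ε ^ 2)⁻¹ * C6 + K * (D1 + D2 + 2 * M ^ 2), by positivity,
    by positivity, fun q q' δ hq hqq u v hv => ?_⟩
  obtain ⟨ϖ, hϖ, hP⟩ := hq.exists_P
  rcases eq_or_ne (u - v) 0 with h0 | h0
  · have hi : ∫ x, ‖fn (u - v) x‖ ^ (2 * σ + 2) ∂(dom L₁ L₂) = 0 := by
      refine integral_eq_zero_of_ae ((ae_zero (L₁ := L₁) (L₂ := L₂)).mono fun x hx => ?_)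
      rw [h0]
      simp only [hx.1, norm_zero, Pi.zero_apply]
      exact Real.zero_rpow (by linarith)
    rw [hi, h0]
    simp only [form_zero_right, gr, dx_zero, dy_zero, fn_zero, norm_zero, sub_zero, Complex.zero_re]
    have : 0 ≤ ((K + K * C4) + 1 + K * (ε ^ 2)⁻¹ * C6 + K * (D1 + D2 + 2 * M ^ 2)) * δ ^ 2 := by
      positivity
    linarith
  set w := u - v
  have hN : 0 < ‖w‖ := norm_pos_iff.2 h0
  set s := ε * ‖w‖ ^ 2
  have hs : 0 < s := by positivity
  have hpt : ∀ᵐ x ∂(dom L₁ L₂), (dens σ q (fn u x) (dx u x) (dy u x) (fn w x) (dx w x) (dy w x) -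
      dens σ q' (fn v x) (dx v x) (dy v x) (fn w x) (dx w x) (dy w x)).re ≤
      (-(1 / 2) * (‖dx w x‖ ^ 2 + ‖dy w x‖ ^ 2) - c / 2 * ‖fn w x‖ ^ (2 * σ + 2) +
      (K + K * C4) * ‖fn w x‖ ^ 2 + K * s * (2 * (‖dx v x‖ ^ 2 + ‖dy v x‖ ^ 2))) +
      K * (s ^ 2)⁻¹ * ‖fn w x‖ ^ 6 + K * δ ^ 2 * (‖fn v x‖ ^ (4 * σ + 2) + ‖fn v x‖ ^ 6 +
        2 * (‖dx v x‖ ^ 2 + ‖dy v x‖ ^ 2)) := by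
    filter_upwards [ae_sub u v] with x hx
    rw [hx.1, hx.2.1, hx.2.2]
    refine (hdens q q' ϖ δ hq.bdd hq.re_A hP hϖ hqq.nonneg hqq.A hqq.γ hqq.P hqq.a₁ hqq.a₂ hqq.b₁ hqq.b₂
      _ _ _ _ _ _).trans ?_
    generalize fn u x = z
    generalize fn v x = z'
    generalize dx v x = p₁'
    generalize dy v x = p₂'
    generalize dx u x = p₁
    generalize dy u x = p₂
    have hX : 0 ≤ ‖z‖ + ‖z'‖ := by positivity
    have hG : (‖p₁'‖ + ‖p₂'‖) ^ 2 ≤ 2 * (‖p₁'‖ ^ 2 + ‖p₂'‖ ^ 2) := by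
      nlinarith [sq_nonneg (‖p₁'‖ - ‖p₂'‖)]
    have hy := weighted_young (G := ‖p₁'‖ + ‖p₂'‖) (w := ‖z - z'‖) hs (h4 _ hX)
    have hy' : (‖p₁'‖ + ‖p₂'‖) * ((‖z‖ + ‖z'‖) * ‖z - z'‖ ^ 2) ≤ s * (2 * (‖p₁'‖ ^ 2 + ‖p₂'‖ ^ 2)) +
        c / 2 / K * ((‖z‖ + ‖z'‖) ^ (2 * σ) * ‖z - z'‖ ^ 2) + C4 * ‖z - z'‖ ^ 2 +
        (s ^ 2)⁻¹ * ‖z - z'‖ ^ 6 := by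
      have := mul_le_mul_of_nonneg_left hG hs.le
      linarith
    have hE : ‖z - z'‖ ^ (2 * σ + 2) ≤ (‖z‖ + ‖z'‖) ^ (2 * σ) * ‖z - z'‖ ^ 2 := by
      rw [Real.rpow_add_of_nonneg (norm_nonneg _) (by linarith) (by norm_num)]
      have := norm_sub_le z z'
      norm_num
      gcongr
    have hms := mono_scalar (B := K * δ ^ 2 * (‖z'‖ ^ (4 * σ + 2) + ‖z'‖ ^ 6 +
        2 * (‖p₁'‖ ^ 2 + ‖p₂'‖ ^ 2))) (e := ‖p₁ - p₁'‖ ^ 2 + ‖p₂ - p₂'‖ ^ 2) hy'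
        (by field_simp) hK.le hE hc
    have hK' : K₀ ≤ K := by simp [K]
    have r1 : K₀ * ‖z - z'‖ ^ 2 ≤ K * ‖z - z'‖ ^ 2 := by gcongr
    have r2 : K₀ * ((‖p₁'‖ + ‖p₂'‖) * ((‖z‖ + ‖z'‖) * ‖z - z'‖ ^ 2)) ≤
      K * ((‖p₁'‖ + ‖p₂'‖) * ((‖z‖ + ‖z'‖) * ‖z - z'‖ ^ 2)) := by gcongr
    have r3 : K₀ * δ ^ 2 * (‖z'‖ ^ (4 * σ + 2) + ‖z'‖ ^ 6 + (‖p₁'‖ + ‖p₂'‖) ^ 2) ≤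
      K * δ ^ 2 * (‖z'‖ ^ (4 * σ + 2) + ‖z'‖ ^ 6 + 2 * (‖p₁'‖ ^ 2 + ‖p₂'‖ ^ 2)) := by gcongr
    linarith
  have iw1 : Integrable (fun x => ‖dx w x‖ ^ 2 + ‖dy w x‖ ^ 2) (dom L₁ L₂) :=
    (H.integrable_sq (dx w)).add (H.integrable_sq (dy w))
  have iwE := integrable_rpow w (q := 2 * σ + 2) (by linarith)
  have iw2 := H.integrable_sq (fn w)
  have iw6 := integrable_pow w 6
  have iv1 : Integrable (fun x => ‖dx v x‖ ^ 2 + ‖dy v x‖ ^ 2) (dom L₁ L₂) :=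
    (H.integrable_sq (dx v)).add (H.integrable_sq (dy v))
  have ivE := integrable_rpow v (q := 4 * σ + 2) (by linarith)
  have iv6 := integrable_pow v 6
  have j1 : Integrable (fun x => -(1 / 2) * (‖dx w x‖ ^ 2 + ‖dy w x‖ ^ 2) -
      c / 2 * ‖fn w x‖ ^ (2 * σ + 2) + (K + K * C4) * ‖fn w x‖ ^ 2 +
      K * s * (2 * (‖dx v x‖ ^ 2 + ‖dy v x‖ ^ 2))) (dom L₁ L₂) :=
    (((iw1.const_mul _).sub (iwE.const_mul _)).add (iw2.const_mul _)).add
      ((iv1.const_mul _).const_mul _)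
  have j3 : Integrable (fun x => K * δ ^ 2 * (‖fn v x‖ ^ (4 * σ + 2) + ‖fn v x‖ ^ 6 +
        2 * (‖dx v x‖ ^ 2 + ‖dy v x‖ ^ 2))) (dom L₁ L₂) :=
    ((ivE.add iv6).add (iv1.const_mul _)).const_mul _
  have j12 : Integrable (fun x => -(1 / 2) * (‖dx w x‖ ^ 2 + ‖dy w x‖ ^ 2) -
      c / 2 * ‖fn w x‖ ^ (2 * σ + 2)) (dom L₁ L₂) := (iw1.const_mul _).sub (iwE.const_mul _)
  have hgw : ∫ x, (‖dx w x‖ ^ 2 + ‖dy w x‖ ^ 2) ∂(dom L₁ L₂) = gr w := (gr_eq_integral w).symm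
  have hgv : ∫ x, (‖dx v x‖ ^ 2 + ‖dy v x‖ ^ 2) ∂(dom L₁ L₂) = gr v := (gr_eq_integral v).symm
  have hmain : (form σ q u w - form σ q' v w).re ≤
      (-(1 / 2) * gr w - c / 2 * ∫ x, ‖fn w x‖ ^ (2 * σ + 2) ∂(dom L₁ L₂) +
      (K + K * C4) * ‖fn w‖ ^ 2 + K * s * (2 * gr v)) +
      K * (s ^ 2)⁻¹ * ∫ x, ‖fn w x‖ ^ 6 ∂(dom L₁ L₂) +
      K * δ ^ 2 * (∫ x, ‖fn v x‖ ^ (4 * σ + 2) ∂(dom L₁ L₂) + ∫ x, ‖fn v x‖ ^ 6 ∂(dom L₁ L₂) +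
        2 * gr v) := by
    have i1 := integrable_dens hσ q u w
    have i2 := integrable_dens hσ q' v w
    have i12 : Integrable (fun x =>
      dens σ q (fn u x) (dx u x) (dy u x) (fn w x) (dx w x) (dy w x) -
      dens σ q' (fn v x) (dx v x) (dy v x) (fn w x) (dx w x) (dy w x)) (dom L₁ L₂) := i1.sub i2
    unfold form
    rw [← integral_sub i1 i2, ← RCLike.re_eq_complex_re, ← integral_re i12]
    refine (integral_mono_ae i12.re ((j1.add (iw6.const_mul (K * (s ^ 2)⁻¹))).add j3)
      hpt).trans (le_of_eq ?_)
    have e3 : ∫ x, K * δ ^ 2 * (‖fn v x‖ ^ (4 * σ + 2) + ‖fn v x‖ ^ 6 +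
        2 * (‖dx v x‖ ^ 2 + ‖dy v x‖ ^ 2)) ∂(dom L₁ L₂) = K * δ ^ 2 *
        (∫ x, ‖fn v x‖ ^ (4 * σ + 2) ∂(dom L₁ L₂) + ∫ x, ‖fn v x‖ ^ 6 ∂(dom L₁ L₂) +
        2 * gr v) := by
      rw [integral_const_mul, integral_add₃ ivE iv6 (iv1.const_mul 2)]
      rw [integral_const_mul, hgv]
    have e1 : ∫ x, (-(1 / 2) * (‖dx w x‖ ^ 2 + ‖dy w x‖ ^ 2) -
      c / 2 * ‖fn w x‖ ^ (2 * σ + 2) + (K + K * C4) * ‖fn w x‖ ^ 2 +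
      K * s * (2 * (‖dx v x‖ ^ 2 + ‖dy v x‖ ^ 2))) ∂(dom L₁ L₂) =
      (-(1 / 2) * gr w - c / 2 * ∫ x, ‖fn w x‖ ^ (2 * σ + 2) ∂(dom L₁ L₂) +
      (K + K * C4) * ‖fn w‖ ^ 2 + K * s * (2 * gr v)) := by
      rw [integral_add₃ j12 (iw2.const_mul _) ((iv1.const_mul _).const_mul _),
        integral_sub (iw1.const_mul _) (iwE.const_mul _)]
      rw [integral_const_mul, integral_const_mul, integral_const_mul, integral_const_mul,
        integral_const_mul, hgv, hgw, ← H.norm_sq_eq]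
    rw [← e1, ← e3, ← integral_const_mul, ← integral_add₃ j1 (iw6.const_mul _) j3]
    rfl
  have b1 := hD1' v hv
  have b2 : ∫ x, ‖fn v x‖ ^ 6 ∂(dom L₁ L₂) ≤ D2 := by
    simpa only [Real.rpow_natCast] using hD2' v hv
  have b3 : gr v ≤ M ^ 2 := (gr_le v).trans (by gcongr)
  have b4 := h6 w
  norm_num at b4
  have hns := norm_sq_eq w
  have hgr := gr_nonneg w
  have hy := sq_nonneg ‖fn w‖
  have c1 : K * s * (2 * gr v) ≤ 1 / 4 * (‖fn w‖ ^ 2 + gr w) := by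
    rw [← hns]
    calc K * s * (2 * gr v) ≤ K * s * (2 * (M ^ 2 + 1)) := by gcongr; linarith
      _ = _ := by simp only [s, ε]; field_simp; ring
  -- The inequality ∫|w|⁶ ≤ C‖w‖_H² gr(w)² contains exactly the fourth power of the V-norm that s² =
  -- ε²‖w‖⁴ cancels, so that only the H-norm is left.
  have c2 : (s ^ 2)⁻¹ * ∫ x, ‖fn w x‖ ^ 6 ∂(dom L₁ L₂) ≤ (ε ^ 2)⁻¹ * C6 * ‖fn w‖ ^ 2 := by
    calc _ ≤ (s ^ 2)⁻¹ * (C6 * ‖fn w‖ ^ 2 * gr w ^ 2) := by gcongr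
      _ ≤ (s ^ 2)⁻¹ * (C6 * ‖fn w‖ ^ 2 * (‖w‖ ^ 2) ^ 2) := by gcongr; linarith
      _ = _ := by simp only [s]; field_simp
  have c3 : K * δ ^ 2 * (∫ x, ‖fn v x‖ ^ (4 * σ + 2) ∂(dom L₁ L₂) + ∫ x, ‖fn v x‖ ^ 6 ∂(dom L₁ L₂) +
        2 * gr v) ≤ K * δ ^ 2 * (D1 + D2 + 2 * M ^ 2) := by gcongr
  have c2' := mul_le_mul_of_nonneg_left c2 hK.le
  have p1 : 0 ≤ K * (D1 + D2 + 2 * M ^ 2) * ‖fn w‖ ^ 2 := by positivity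
  have p2 : 0 ≤ ((K + K * C4) + 1 + K * (ε ^ 2)⁻¹ * C6) * δ ^ 2 := by positivity
  linarith

/-- Coercivity of the form. -/
theorem exists_re_form_self_le (L₁ L₂ : ℝ) (hσ : 2 < σ) {R : ℝ} (hR : 0 ≤ R) {β m : ℝ} (hm : 0 < m)
    (hκ : 0 < ellip (2 * σ) β) : ∃ c K : ℝ, 0 < c ∧ 0 ≤ K ∧
      ∀ (q : Par), q.Good β m R → ∀ u : V L₁ L₂,
      (form σ q u u).re ≤ -(1 / 4) * gr u - c * ∫ x, ‖fn u x‖ ^ (2 * σ + 2) ∂(dom L₁ L₂) +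
        K * ‖fn u‖ ^ 2 := by
  obtain ⟨c, K, hc, hK, H⟩ := exists_form_mono L₁ L₂ hσ hR hm hκ 0
  refine ⟨c, K, hc, hK, fun q hq u => ?_⟩
  have := H q q 0 hq (Par.Close.refl q) u 0 (by simp)
  simpa [form_zero_left] using this

/-- The coefficients seen by `v = e^{-θ} u`, where `r = |e^θ|`. -/
def Par.scale (σ r : ℝ) (q : Par) : Par where
  A := q.A
  P := (r ^ (2 * σ) : ℝ) * q.P
  γ := q.γ
  a₁ := (r ^ 2 : ℝ) * q.a₁
  a₂ := (r ^ 2 : ℝ) * q.a₂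
  b₁ := (r ^ 2 : ℝ) * q.b₁
  b₂ := (r ^ 2 : ℝ) * q.b₂

/-- Replacing v by cv multiplies each nonlinear term by c and by a power of |c|: the phase factors
out and the modulus goes into the coefficients. This covariance allows the control to be removed by
a gauge factor. -/
theorem form_smul_left (σ : ℝ) (q : Par) (c : ℂ) (v ψ : V L₁ L₂) :
    form σ q (c • v) ψ = c * form σ (q.scale σ ‖c‖) v ψ := by
  unfold form
  rw [← integral_const_mul]
  refine integral_congr_ae ((ae_smul c v).mono fun x hx => ?_)
  simp only [hx.1, hx.2.1, hx.2.2]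
  unfold dens n₀ fl pw cu Par.scale
  simp only [norm_mul, mul_pow, Real.mul_rpow (norm_nonneg c) (norm_nonneg (fn v x)),
    Complex.ofReal_mul]
  ring

/-- A coefficient vector with a single nonzero entry selects a term; the form is linear in the
coefficients. -/
def Par.lin (s : ℂ) (q : Par) (s' : ℂ) (q' : Par) : Par where
  A := s * q.A + s' * q'.A
  P := s * q.P + s' * q'.P
  γ := s * q.γ + s' * q'.γ
  a₁ := s * q.a₁ + s' * q'.a₁
  a₂ := s * q.a₂ + s' * q'.a₂
  b₁ := s * q.b₁ + s' * q'.b₁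
  b₂ := s * q.b₂ + s' * q'.b₂

theorem form_lin (hσ : 2 < σ) (s s' : ℂ) (q q' : Par) (u ψ : V L₁ L₂) :
    form σ (Par.lin s q s' q') u ψ = s * form σ q u ψ + s' * form σ q' u ψ := by
  unfold form
  rw [← integral_const_mul, ← integral_const_mul, ← integral_add
    ((integrable_dens hσ q u ψ).const_mul _) ((integrable_dens hσ q' u ψ).const_mul _)]
  refine integral_congr_ae (ae_of_all _ fun x => ?_)
  simp only [dens, n₀, fl, Par.lin]
  ring

end Mono

section Approximation

variable {L₁ L₂ : ℝ}

/-! ### Smooth functions vanishing on the boundary of the rectangle -/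

/-- A smooth function on the plane which vanishes on the lines bounding the rectangle. -/
structure Vanishes (L₁ L₂ : ℝ) (u : ℝ × ℝ → ℂ) : Prop where
  smooth : ContDiff ℝ ∞ u
  zero : ∀ p : ℝ × ℝ, p.1 = 0 ∨ p.1 = L₁ ∨ p.2 = 0 ∨ p.2 = L₂ → u p = 0

/-- The bounds by the distances to the four sides are the mean value inequality on the segment to
the foot point on that side, where u vanishes. -/
theorem Vanishes.exists_bound {u : ℝ × ℝ → ℂ} (hu : Vanishes L₁ L₂ u) : ∃ B : ℝ, 0 ≤ B ∧
    ∀ p ∈ rect L₁ L₂, ‖u p‖ ≤ B ∧ ‖fderiv ℝ u p‖ ≤ B ∧ ‖u p‖ ≤ B * p.1 ∧ ‖u p‖ ≤ B * (L₁ - p.1) ∧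
      ‖u p‖ ≤ B * p.2 ∧ ‖u p‖ ≤ B * (L₂ - p.2) := by
  have hK : IsCompact (Icc (0 : ℝ) L₁ ×ˢ Icc (0 : ℝ) L₂) := isCompact_Icc.prod isCompact_Icc
  have hconv : Convex ℝ (Icc (0 : ℝ) L₁ ×ˢ Icc (0 : ℝ) L₂) := (convex_Icc _ _).prod (convex_Icc _ _)
  obtain ⟨B, hB⟩ := hK.exists_bound_of_continuousOn
    (hu.smooth.continuous_fderiv (by simp)).continuousOn
  obtain ⟨B', hB'⟩ := hK.exists_bound_of_continuousOn hu.smooth.continuous.continuousOn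
  have key : ∀ p ∈ rect L₁ L₂, ∀ p' ∈ Icc (0 : ℝ) L₁ ×ˢ Icc (0 : ℝ) L₂, u p' = 0 →
      ‖u p‖ ≤ max B B' * ‖p - p'‖ := by
    intro p hp p' hp' h0
    have hp1 : p ∈ Icc (0 : ℝ) L₁ ×ˢ Icc (0 : ℝ) L₂ :=
      ⟨Ioo_subset_Icc_self hp.1, Ioo_subset_Icc_self hp.2⟩
    have := hconv.norm_image_sub_le_of_norm_fderiv_le (𝕜 := ℝ) (f := u)
      (fun x _ => (hu.smooth.differentiable (by simp)) x)
      (fun x hx => (hB x hx).trans (le_max_left B B')) hp' hp1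
    rwa [h0, sub_zero] at this
  refine ⟨max B B' ⊔ 0, le_max_right _ _, fun p hp => ?_⟩
  have hp1 : p ∈ Icc (0 : ℝ) L₁ ×ˢ Icc (0 : ℝ) L₂ :=
    ⟨Ioo_subset_Icc_self hp.1, Ioo_subset_Icc_self hp.2⟩
  obtain ⟨⟨h1, h2⟩, ⟨h3, h4⟩⟩ := hp1
  have hm : max B B' ≤ max B B' ⊔ 0 := le_max_left _ _
  refine ⟨(hB' p ⟨⟨h1, h2⟩, ⟨h3, h4⟩⟩).trans ((le_max_right _ _).trans hm),
    (hB p ⟨⟨h1, h2⟩, ⟨h3, h4⟩⟩).trans ((le_max_left _ _).trans hm), ?_, ?_, ?_, ?_⟩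
  · refine (key p hp (0, p.2) ⟨⟨le_rfl, by linarith⟩, ⟨h3, h4⟩⟩ (hu.zero _ (by simp))).trans ?_
    have : ‖p - (0, p.2)‖ = p.1 := by simp [Prod.norm_def, abs_of_nonneg h1, h1]
    rw [this]; gcongr
  · refine (key p hp (L₁, p.2) ⟨⟨by linarith, le_rfl⟩, ⟨h3, h4⟩⟩ (hu.zero _ (by simp))).trans ?_
    have : ‖p - (L₁, p.2)‖ = L₁ - p.1 := by
      simp [Prod.norm_def, abs_sub_comm p.1 L₁, abs_of_nonneg (sub_nonneg.2 h2), h2]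
    rw [this]; gcongr
  · refine (key p hp (p.1, 0) ⟨⟨h1, h2⟩, ⟨le_rfl, by linarith⟩⟩ (hu.zero _ (by simp))).trans ?_
    have : ‖p - (p.1, 0)‖ = p.2 := by simp [Prod.norm_def, abs_of_nonneg h3, h3]
    rw [this]; gcongr
  · refine (key p hp (p.1, L₂) ⟨⟨h1, h2⟩, ⟨by linarith, le_rfl⟩⟩ (hu.zero _ (by simp))).trans ?_
    have : ‖p - (p.1, L₂)‖ = L₂ - p.2 := by
      simp [Prod.norm_def, abs_sub_comm p.2 L₂, abs_of_nonneg (sub_nonneg.2 h4), h4]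
    rw [this]; gcongr

/-- A smooth cutoff, zero where `N t ≤ 1` and one where `N t ≥ 2`. -/
def cutoff (N : ℕ) (t : ℝ) : ℝ := Real.smoothTransition ((N + 1) * t - 1)

theorem cutoff_contDiff (N : ℕ) : ContDiff ℝ ∞ (cutoff N) :=
  Real.smoothTransition.contDiff.comp ((contDiff_const.mul contDiff_id).sub contDiff_const)

theorem abs_cutoff_le (N : ℕ) (t : ℝ) : |cutoff N t| ≤ 1 := by
  unfold cutoff
  rw [abs_of_nonneg (Real.smoothTransition.nonneg _)]
  exact Real.smoothTransition.le_one _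

theorem lt_of_cutoff_ne_zero {N : ℕ} {t : ℝ} (h : cutoff N t ≠ 0) : ((N : ℝ) + 1)⁻¹ ≤ t := by
  by_contra! hlt
  refine h (Real.smoothTransition.zero_of_nonpos ?_)
  have hN : (0 : ℝ) < N + 1 := by positivity
  have := (mul_lt_mul_of_pos_left hlt hN)
  rw [mul_inv_cancel₀ hN.ne'] at this
  linarith

theorem eventually_cutoff_eq_one {t : ℝ} (ht : 0 < t) : ∀ᶠ N : ℕ in atTop, cutoff N =ᶠ[𝓝 t] 1 := by
  obtain ⟨N₀, hN₀⟩ := exists_nat_gt (4 / t)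
  filter_upwards [eventually_ge_atTop N₀] with N hN
  filter_upwards [lt_mem_nhds (half_lt_self ht)] with s hs
  refine Real.smoothTransition.one_of_one_le ?_
  have h1 : (4 / t) < N + 1 := by
    have : (N₀ : ℝ) ≤ N := by exact_mod_cast hN
    linarith
  rw [div_lt_iff₀ ht] at h1
  have hN' : (0 : ℝ) < N + 1 := by positivity
  nlinarith

/-- The derivative of `cutoff N` is of size N + 1, but it is nonzero only where 1 ≤ (N + 1)t ≤ 2, so
the factor t compensates. -/
theorem exists_mul_deriv_cutoff_le : ∃ B : ℝ, 0 ≤ B ∧ ∀ (N : ℕ) (t : ℝ), 0 < t →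
    t * |deriv (cutoff N) t| ≤ B := by
  have hs : ContDiff ℝ ∞ Real.smoothTransition := Real.smoothTransition.contDiff
  have hc : Continuous (deriv Real.smoothTransition) := hs.continuous_deriv (by simp)
  obtain ⟨B, hB⟩ := (isCompact_Icc (a := (0 : ℝ)) (b := 1)).exists_bound_of_continuousOn
    hc.continuousOn
  have hB0 : 0 ≤ B := (norm_nonneg _).trans (hB 0 (by simp))
  refine ⟨2 * B, by positivity, fun N t ht => ?_⟩
  have hN : (0 : ℝ) < N + 1 := by positivity
  have hd : deriv (cutoff N) t = (N + 1) * deriv Real.smoothTransition ((N + 1) * t - 1) := by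
    have h1 : HasDerivAt (fun t : ℝ => ((N : ℝ) + 1) * t - 1) (N + 1) t := by
      simpa using ((hasDerivAt_id t).const_mul ((N : ℝ) + 1)).sub_const 1
    have h2 := (hs.differentiable (by simp) (((N : ℝ) + 1) * t - 1)).hasDerivAt
    have := (h2.comp t h1).deriv
    rw [mul_comm]
    exact this
  by_cases hmem : ((N : ℝ) + 1) * t - 1 ∈ Icc (0 : ℝ) 1
  · have h1 := hB _ hmem
    rw [Real.norm_eq_abs] at h1
    rw [hd, abs_mul, abs_of_pos hN, ← mul_assoc, mul_comm t]
    have : ((N : ℝ) + 1) * t ≤ 2 := by linarith [hmem.2]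
    gcongr
  · have : deriv Real.smoothTransition (((N : ℝ) + 1) * t - 1) = 0 := by
      rw [mem_Icc, not_and_or, not_le, not_le] at hmem
      rcases hmem with h | h
      · have he : Real.smoothTransition =ᶠ[𝓝 (((N : ℝ) + 1) * t - 1)] fun _ => 0 := by
          filter_upwards [gt_mem_nhds h] with s hs
          exact Real.smoothTransition.zero_of_nonpos hs.le
        rw [he.deriv_eq]; simp
      · have he : Real.smoothTransition =ᶠ[𝓝 (((N : ℝ) + 1) * t - 1)] fun _ => 1 := by
          filter_upwards [lt_mem_nhds h] with s hs
          exact Real.smoothTransition.one_of_one_le hs.le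
        rw [he.deriv_eq]; simp
    rw [hd, this]
    simp; positivity

/-- The cutoff composed with a function whose derivative is a contraction. -/
theorem norm_mul_fderiv_cutoff_le {B B' : ℝ} (hB : 0 ≤ B) {N : ℕ}
    (hB' : ∀ t : ℝ, 0 < t → t * |deriv (cutoff N) t| ≤ B') {l : ℝ × ℝ → ℝ} {p : ℝ × ℝ}
    {l' : ℝ × ℝ →L[ℝ] ℝ} (hl : HasFDerivAt l l' p) (hl' : ‖l'‖ ≤ 1) (hp : 0 < l p) {c : ℝ}
    (hc : c ≤ B * l p) : c * ‖fderiv ℝ (fun p => cutoff N (l p)) p‖ ≤ B * B' := by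
  have h1 : HasDerivAt (cutoff N) (deriv (cutoff N) (l p)) (l p) :=
    ((cutoff_contDiff N).differentiable (by simp) _).hasDerivAt
  have h2 := (h1.comp_hasFDerivAt p hl).fderiv
  have h3 : ‖fderiv ℝ (fun p => cutoff N (l p)) p‖ ≤ |deriv (cutoff N) (l p)| := by
    have : fderiv ℝ (fun p => cutoff N (l p)) p = deriv (cutoff N) (l p) • l' := h2
    rw [this, norm_smul, Real.norm_eq_abs]
    calc _ ≤ |deriv (cutoff N) (l p)| * 1 := by gcongr
      _ = _ := mul_one _
  calc c * ‖fderiv ℝ (fun p => cutoff N (l p)) p‖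
      ≤ (B * l p) * ‖fderiv ℝ (fun p => cutoff N (l p)) p‖ := by gcongr
    _ ≤ (B * l p) * |deriv (cutoff N) (l p)| := by gcongr
    _ = B * (l p * |deriv (cutoff N) (l p)|) := by ring
    _ ≤ B * B' := by gcongr; exact hB' _ hp

theorem norm_fderiv_mul_le {f g : ℝ × ℝ → ℝ} {p : ℝ × ℝ} (hf : DifferentiableAt ℝ f p)
    (hg : DifferentiableAt ℝ g p) (hf1 : |f p| ≤ 1) (hg1 : |g p| ≤ 1) :
    ‖fderiv ℝ (fun p => f p * g p) p‖ ≤ ‖fderiv ℝ f p‖ + ‖fderiv ℝ g p‖ := by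
  rw [fderiv_fun_mul hf hg]
  refine (norm_add_le _ _).trans ?_
  rw [norm_smul, norm_smul, Real.norm_eq_abs, Real.norm_eq_abs]
  have h1 : |f p| * ‖fderiv ℝ g p‖ ≤ 1 * ‖fderiv ℝ g p‖ := by gcongr
  have h2 : |g p| * ‖fderiv ℝ f p‖ ≤ 1 * ‖fderiv ℝ f p‖ := by gcongr
  linarith

/-- A cutoff function supported in the rectangle. -/
def rectCutoff (L₁ L₂ : ℝ) (N : ℕ) (p : ℝ × ℝ) : ℝ :=
  (cutoff N p.1 * cutoff N (L₁ - p.1)) * (cutoff N p.2 * cutoff N (L₂ - p.2))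

theorem rectCutoff_contDiff (N : ℕ) : ContDiff ℝ ∞ (rectCutoff L₁ L₂ N) := by
  have h := cutoff_contDiff N
  exact ((h.comp contDiff_fst).mul (h.comp (contDiff_const.sub contDiff_fst))).mul
    ((h.comp contDiff_snd).mul (h.comp (contDiff_const.sub contDiff_snd)))

theorem abs_rectCutoff_le (N : ℕ) (p : ℝ × ℝ) : |rectCutoff L₁ L₂ N p| ≤ 1 := by
  unfold rectCutoff
  have h := abs_cutoff_le N
  rw [abs_mul, abs_mul, abs_mul]
  exact mul_le_one₀ (mul_le_one₀ (h _) (abs_nonneg _) (h _)) (by positivity)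
    (mul_le_one₀ (h _) (abs_nonneg _) (h _))

theorem tsupport_rectCutoff_subset (N : ℕ) : tsupport (rectCutoff L₁ L₂ N) ⊆
    Icc ((N : ℝ) + 1)⁻¹ (L₁ - ((N : ℝ) + 1)⁻¹) ×ˢ Icc ((N : ℝ) + 1)⁻¹ (L₂ - ((N : ℝ) + 1)⁻¹) := by
  refine closure_minimal (fun p hp => ?_) (isClosed_Icc.prod isClosed_Icc)
  have hp' : rectCutoff L₁ L₂ N p ≠ 0 := hp
  unfold rectCutoff at hp'
  have h1 := left_ne_zero_of_mul hp'
  have h2 := right_ne_zero_of_mul hp'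
  have a1 := lt_of_cutoff_ne_zero (left_ne_zero_of_mul h1)
  have a2 := lt_of_cutoff_ne_zero (right_ne_zero_of_mul h1)
  have a3 := lt_of_cutoff_ne_zero (left_ne_zero_of_mul h2)
  have a4 := lt_of_cutoff_ne_zero (right_ne_zero_of_mul h2)
  exact ⟨⟨a1, by linarith⟩, ⟨a3, by linarith⟩⟩

theorem eventually_rectCutoff_eq_one {p : ℝ × ℝ} (hp : p ∈ rect L₁ L₂) :
    ∀ᶠ N : ℕ in atTop, rectCutoff L₁ L₂ N =ᶠ[𝓝 p] 1 := by
  have h1 := eventually_cutoff_eq_one hp.1.1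
  have h2 := eventually_cutoff_eq_one (sub_pos.2 hp.1.2)
  have h3 := eventually_cutoff_eq_one hp.2.1
  have h4 := eventually_cutoff_eq_one (sub_pos.2 hp.2.2)
  filter_upwards [h1, h2, h3, h4] with N k1 k2 k3 k4
  have c1 : Tendsto (fun q : ℝ × ℝ => q.1) (𝓝 p) (𝓝 p.1) := continuous_fst.tendsto p
  have c2 : Tendsto (fun q : ℝ × ℝ => L₁ - q.1) (𝓝 p) (𝓝 (L₁ - p.1)) :=
    (continuous_const.sub continuous_fst).tendsto p
  have c3 : Tendsto (fun q : ℝ × ℝ => q.2) (𝓝 p) (𝓝 p.2) := continuous_snd.tendsto p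
  have c4 : Tendsto (fun q : ℝ × ℝ => L₂ - q.2) (𝓝 p) (𝓝 (L₂ - p.2)) :=
    (continuous_const.sub continuous_snd).tendsto p
  filter_upwards [c1.eventually k1, c2.eventually k2, c3.eventually k3, c4.eventually k4]
    with q e1 e2 e3 e4
  simp only [rectCutoff, e1, e2, e3, e4, Pi.one_apply, mul_one]

/-- Here c is the modulus of a function that vanishes linearly at all four sides. By the product
rule each of the four cutoffs is differentiated once and is paired with the distance to its own
side. -/
theorem exists_mul_fderiv_rectCutoff_le {B : ℝ} (hB : 0 ≤ B) : ∃ C : ℝ, 0 ≤ C ∧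
    ∀ (N : ℕ) (p : ℝ × ℝ) (c : ℝ), p ∈ rect L₁ L₂ → 0 ≤ c → c ≤ B * p.1 → c ≤ B * (L₁ - p.1) →
      c ≤ B * p.2 → c ≤ B * (L₂ - p.2) → c * ‖fderiv ℝ (rectCutoff L₁ L₂ N) p‖ ≤ C := by
  obtain ⟨B', hB'0, hB'⟩ := exists_mul_deriv_cutoff_le
  refine ⟨4 * (B * B'), by positivity, fun N p c hp hc h1 h2 h3 h4 => ?_⟩
  have n1 : ‖ContinuousLinearMap.fst ℝ ℝ ℝ‖ ≤ 1 := ContinuousLinearMap.norm_fst_le ..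
  have n2 : ‖ContinuousLinearMap.snd ℝ ℝ ℝ‖ ≤ 1 := ContinuousLinearMap.norm_snd_le ..
  have f1 : HasFDerivAt (fun p : ℝ × ℝ => p.1) (ContinuousLinearMap.fst ℝ ℝ ℝ) p := hasFDerivAt_fst
  have f2 : HasFDerivAt (fun p : ℝ × ℝ => L₁ - p.1) (-ContinuousLinearMap.fst ℝ ℝ ℝ) p :=
    hasFDerivAt_fst.const_sub L₁
  have f3 : HasFDerivAt (fun p : ℝ × ℝ => p.2) (ContinuousLinearMap.snd ℝ ℝ ℝ) p := hasFDerivAt_snd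
  have f4 : HasFDerivAt (fun p : ℝ × ℝ => L₂ - p.2) (-ContinuousLinearMap.snd ℝ ℝ ℝ) p :=
    hasFDerivAt_snd.const_sub L₂
  have k1 := norm_mul_fderiv_cutoff_le hB (hB' N) f1 n1 hp.1.1 h1
  have k2 := norm_mul_fderiv_cutoff_le hB (hB' N) f2 (by rwa [norm_neg]) (sub_pos.2 hp.1.2) h2
  have k3 := norm_mul_fderiv_cutoff_le hB (hB' N) f3 n2 hp.2.1 h3
  have k4 := norm_mul_fderiv_cutoff_le hB (hB' N) f4 (by rwa [norm_neg]) (sub_pos.2 hp.2.2) h4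
  have hd : Differentiable ℝ (cutoff N) := (cutoff_contDiff N).differentiable (by simp)
  have g1 : DifferentiableAt ℝ (fun p : ℝ × ℝ => cutoff N p.1) p :=
    (hd _).comp p f1.differentiableAt
  have g2 : DifferentiableAt ℝ (fun p : ℝ × ℝ => cutoff N (L₁ - p.1)) p :=
    (hd _).comp p f2.differentiableAt
  have g3 : DifferentiableAt ℝ (fun p : ℝ × ℝ => cutoff N p.2) p :=
    (hd _).comp p f3.differentiableAt
  have g4 : DifferentiableAt ℝ (fun p : ℝ × ℝ => cutoff N (L₂ - p.2)) p :=
    (hd _).comp p f4.differentiableAt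
  have ha := abs_cutoff_le N
  have hab : ∀ s t, |cutoff N s * cutoff N t| ≤ 1 := fun s t => by
    rw [abs_mul]; exact mul_le_one₀ (ha _) (abs_nonneg _) (ha _)
  have m1 := norm_fderiv_mul_le g1 g2 (ha _) (ha _)
  have m2 := norm_fderiv_mul_le g3 g4 (ha _) (ha _)
  have m3 := norm_fderiv_mul_le (g1.fun_mul g2) (g3.fun_mul g4) (hab _ _) (hab _ _)
  have m4 : ‖fderiv ℝ (rectCutoff L₁ L₂ N) p‖ ≤ ‖fderiv ℝ (fun p : ℝ × ℝ => cutoff N p.1) p‖ +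
      ‖fderiv ℝ (fun p : ℝ × ℝ => cutoff N (L₁ - p.1)) p‖ +
      (‖fderiv ℝ (fun p : ℝ × ℝ => cutoff N p.2) p‖ +
      ‖fderiv ℝ (fun p : ℝ × ℝ => cutoff N (L₂ - p.2)) p‖) := m3.trans (add_le_add m1 m2)
  have m5 := mul_le_mul_of_nonneg_left m4 hc
  linarith

/-- A smooth function vanishing on the boundary is the limit of test functions, boundedly together
with the first derivatives. -/
theorem Vanishes.exists_approx {u : ℝ × ℝ → ℂ} (hu : Vanishes L₁ L₂ u) :
    ∃ (un : ℕ → ℝ × ℝ → ℂ) (C : ℝ), (∀ n, IsTest L₁ L₂ (un n)) ∧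
      (∀ n, ∀ p ∈ rect L₁ L₂, ‖un n p‖ ≤ C ∧ ‖fderiv ℝ (un n) p‖ ≤ C) ∧
      ∀ p ∈ rect L₁ L₂, ∀ᶠ n in atTop, un n =ᶠ[𝓝 p] u := by
  obtain ⟨B, hB, hb⟩ := hu.exists_bound
  obtain ⟨C, hC, hc⟩ := exists_mul_fderiv_rectCutoff_le (L₁ := L₁) (L₂ := L₂) hB
  refine ⟨fun N p => rectCutoff L₁ L₂ N p • u p, B + C, fun N => ?_, fun N p hp => ?_,
    fun p hp => ?_⟩
  · have hsub : tsupport (fun p => rectCutoff L₁ L₂ N p • u p) ⊆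
        Icc ((N : ℝ) + 1)⁻¹ (L₁ - ((N : ℝ) + 1)⁻¹) ×ˢ Icc ((N : ℝ) + 1)⁻¹ (L₂ - ((N : ℝ) + 1)⁻¹) :=
      (tsupport_smul_subset_left _ _).trans (tsupport_rectCutoff_subset N)
    have hN : (0 : ℝ) < ((N : ℝ) + 1)⁻¹ := by positivity
    refine ⟨(rectCutoff_contDiff N).smul hu.smooth, ?_, hsub.trans ?_⟩
    · exact (isCompact_Icc.prod isCompact_Icc).of_isClosed_subset (isClosed_tsupport _) hsub
    · exact Set.prod_mono (fun x hx => ⟨by linarith [hx.1], by linarith [hx.2]⟩)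
        (fun x hx => ⟨by linarith [hx.1], by linarith [hx.2]⟩)
  · obtain ⟨b1, b2, b3, b4, b5, b6⟩ := hb p hp
    have h1 := abs_rectCutoff_le (L₁ := L₁) (L₂ := L₂) N p
    constructor
    · rw [norm_smul, Real.norm_eq_abs]
      calc _ ≤ 1 * B := by gcongr
        _ ≤ _ := by linarith
    · rw [fderiv_fun_smul ((rectCutoff_contDiff N).differentiable (by simp) p)
        (hu.smooth.differentiable (by simp) p)]
      refine (norm_add_le _ _).trans ?_
      have k1 : ‖rectCutoff L₁ L₂ N p • fderiv ℝ u p‖ ≤ B := by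
        rw [norm_smul, Real.norm_eq_abs]
        calc _ ≤ 1 * B := by gcongr
          _ = _ := one_mul B
      have k2 : ‖(fderiv ℝ (rectCutoff L₁ L₂ N) p).smulRight (u p)‖ ≤ C := by
        rw [ContinuousLinearMap.norm_smulRight_apply, mul_comm]
        exact hc N p _ hp (norm_nonneg _) b3 b4 b5 b6
      exact add_le_add k1 k2
  · filter_upwards [eventually_rectCutoff_eq_one hp] with N hN
    filter_upwards [hN] with q hq
    simp [hq]

end Approximation

section Parts

variable {L₁ L₂ : ℝ}

/-! ### Integration by parts on the rectangle -/

theorem memLp_dom {f : ℝ × ℝ → ℂ} (hf : Continuous f) : MemLp f 2 (dom L₁ L₂) := by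
  have hK : IsCompact (Icc (0 : ℝ) L₁ ×ˢ Icc (0 : ℝ) L₂) := isCompact_Icc.prod isCompact_Icc
  obtain ⟨B, hB⟩ := hK.exists_bound_of_continuousOn hf.continuousOn
  refine MemLp.of_bound hf.aestronglyMeasurable B ?_
  filter_upwards [ae_restrict_mem measurableSet_rect] with p hp
  exact hB p ⟨Ioo_subset_Icc_self hp.1, Ioo_subset_Icc_self hp.2⟩

theorem integrable_mul_dom (f : H L₁ L₂) {χ : ℝ × ℝ → ℂ} (hχ : Continuous χ) :
    Integrable (fun x => f x * χ x) (dom L₁ L₂) :=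
  (Lp.memLp f).integrable_mul (memLp_dom hχ)

theorem integral_mul_eq_inner (f : H L₁ L₂) {χ : ℝ × ℝ → ℂ} (hχ : Continuous χ) :
    ∫ x, f x * χ x ∂(dom L₁ L₂) =
      inner ℂ ((memLp_dom (L₁ := L₁) (L₂ := L₂) (Complex.continuous_conj.comp hχ)).toLp _) f := by
  rw [L2.inner_def]
  refine integral_congr_ae ?_
  filter_upwards [(memLp_dom (L₁ := L₁) (L₂ := L₂) (Complex.continuous_conj.comp hχ)).coeFn_toLp]
    with x hx
  rw [hx, RCLike.inner_apply]
  simp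

theorem norm_integral_sq_eq {f h : H L₁ L₂} :
    ‖f - h‖ ^ 2 = ∫ x, ‖f x - h x‖ ^ 2 ∂(dom L₁ L₂) := by
  rw [H.norm_sq_eq]
  refine integral_congr_ae ?_
  filter_upwards [Lp.coeFn_sub f h] with x hx
  rw [hx, Pi.sub_apply]

/-- Bounded pointwise convergence implies convergence in `H`. -/
theorem tendsto_H_of_bdd {f : H L₁ L₂} {fs : ℕ → H L₁ L₂} {h : ℝ × ℝ → ℂ} {hs : ℕ → ℝ × ℝ → ℂ}
    {C : ℝ} (hf : f =ᵐ[dom L₁ L₂] h) (hfs : ∀ n, fs n =ᵐ[dom L₁ L₂] hs n)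
    (hC : ∀ n, ∀ x ∈ rect L₁ L₂, ‖hs n x‖ ≤ C)
    (hlim : ∀ x ∈ rect L₁ L₂, Tendsto (fun n => hs n x) atTop (𝓝 (h x))) :
    Tendsto fs atTop (𝓝 f) := by
  rw [tendsto_iff_norm_sub_tendsto_zero]
  have key : Tendsto (fun n => ‖fs n - f‖ ^ 2) atTop (𝓝 0) := by
    simp_rw [norm_integral_sq_eq]
    have : Tendsto (fun n => ∫ x, ‖fs n x - f x‖ ^ 2 ∂(dom L₁ L₂)) atTop
        (𝓝 (∫ _, (0 : ℝ) ∂(dom L₁ L₂))) := by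
      refine tendsto_integral_of_dominated_convergence (fun _ => (2 * C) ^ 2) (fun n => ?_)
        (integrable_const _) (fun n => ?_) ?_
      · exact ((Lp.aestronglyMeasurable _).sub (Lp.aestronglyMeasurable _)).norm.pow 2
      · filter_upwards [hf, hfs n, ae_restrict_mem measurableSet_rect] with x h1 h2 hx
        rw [h1, h2, Real.norm_of_nonneg (by positivity)]
        have h3 : ‖h x‖ ≤ C := le_of_tendsto (hlim x hx).norm (Eventually.of_forall (hC · x hx))
        have h4 := norm_sub_le (hs n x) (h x)
        have h5 := hC n x hx
        gcongr
        linarith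
      · filter_upwards [hf, ae_all_iff.2 hfs, ae_restrict_mem measurableSet_rect] with x h1 h2 hx
        simp only [h1, h2]
        have := ((hlim x hx).sub_const (h x)).norm.pow 2
        simpa using this
    simpa using this
  have := key.sqrt
  simpa [Real.sqrt_sq] using this

theorem Vanishes.continuous_fderiv {u : ℝ × ℝ → ℂ} (hu : Vanishes L₁ L₂ u) (v : ℝ × ℝ) :
    Continuous (fun p => fderiv ℝ u p v) :=
  (hu.smooth.continuous_fderiv (by simp)).clm_apply continuous_const

/-- A smooth function vanishing on the boundary belongs to `V`. -/
theorem Vanishes.exists_jet {u : ℝ × ℝ → ℂ} (hu : Vanishes L₁ L₂ u) : ∃ w : V L₁ L₂,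
    fn w =ᵐ[dom L₁ L₂] u ∧ dx w =ᵐ[dom L₁ L₂] d₁ u ∧ dy w =ᵐ[dom L₁ L₂] d₂ u := by
  obtain ⟨un, C, htest, hbdd, hlim⟩ := hu.exists_approx
  choose wn hwn using fun n => (htest n).exists_jet
  have h0 : MemLp u 2 (dom L₁ L₂) := memLp_dom hu.smooth.continuous
  have h1 : MemLp (d₁ u) 2 (dom L₁ L₂) := memLp_dom (hu.continuous_fderiv _)
  have h2 : MemLp (d₂ u) 2 (dom L₁ L₂) := memLp_dom (hu.continuous_fderiv _)
  obtain ⟨e0, e1, e2⟩ := mkJet_ae _ _ _ h0 h1 h2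
  have hv : ∀ v : ℝ × ℝ, ‖v‖ ≤ 1 → ∀ n, ∀ x ∈ rect L₁ L₂, ‖fderiv ℝ (un n) x v‖ ≤ C :=
    fun v hv n x hx => by
      refine ((fderiv ℝ (un n) x).le_opNorm v).trans ?_
      have := (hbdd n x hx).2
      nlinarith [norm_nonneg v, norm_nonneg (fderiv ℝ (un n) x)]
  have hl : ∀ v : ℝ × ℝ, ∀ x ∈ rect L₁ L₂,
      Tendsto (fun n => fderiv ℝ (un n) x v) atTop (𝓝 (fderiv ℝ u x v)) := fun v x hx =>
    tendsto_const_nhds.congr' ((hlim x hx).mono fun n hn => by simp only [hn.fderiv_eq])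
  have t0 := tendsto_H_of_bdd e0 (fun n => (hwn n).1) (fun n x hx => (hbdd n x hx).1)
    (fun x hx => tendsto_const_nhds.congr' ((hlim x hx).mono fun n hn => hn.eq_of_nhds.symm))
  have t1 := tendsto_H_of_bdd e1 (fun n => (hwn n).2.1) (hv (1, 0) (by simp [Prod.norm_def]))
    (hl (1, 0))
  have t2 := tendsto_H_of_bdd e2 (fun n => (hwn n).2.2) (hv (0, 1) (by simp [Prod.norm_def]))
    (hl (0, 1))
  have hmem : mkJet u (d₁ u) (d₂ u) h0 h1 h2 ∈ V L₁ L₂ := by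
    have hcl : IsClosed (V L₁ L₂ : Set (Jet L₁ L₂)) := Submodule.isClosed_topologicalClosure _
    refine hcl.mem_of_tendsto (f := fun n => (wn n : Jet L₁ L₂)) (b := atTop) ?_
      (Eventually.of_forall fun n => (wn n).2)
    have hpi : Tendsto (fun n => WithLp.ofLp (wn n : Jet L₁ L₂)) atTop
        (𝓝 (WithLp.ofLp (mkJet u (d₁ u) (d₂ u) h0 h1 h2))) := by
      rw [tendsto_pi_nhds]
      intro i
      fin_cases i
      exacts [t0, t1, t2]
    exact ((PiLp.continuous_toLp 2 _).tendsto _).comp hpi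
  exact ⟨⟨_, hmem⟩, e0, e1, e2⟩

/-- Integration by parts for a compactly supported `C¹` function. -/
theorem integral_mul_fderiv_dom {F χ : ℝ × ℝ → ℂ} (hF : Differentiable ℝ F) (v : ℝ × ℝ)
    (hF' : Continuous fun x => fderiv ℝ F x v) (hc : HasCompactSupport F)
    (hs : tsupport F ⊆ rect L₁ L₂) (hχ : ContDiff ℝ ∞ χ) :
    ∫ x, F x * fderiv ℝ χ x v ∂(dom L₁ L₂) = -∫ x, fderiv ℝ F x v * χ x ∂(dom L₁ L₂) := by
  have hχ' : Continuous fun x => fderiv ℝ χ x v :=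
    (hχ.continuous_fderiv (by simp)).clm_apply continuous_const
  have hc' : HasCompactSupport fun x => fderiv ℝ F x v := hc.fderiv_apply ℝ v
  have z : ∀ x ∉ rect L₁ L₂, F x = 0 := fun x hx => image_eq_zero_of_notMem_tsupport
    fun h => hx (hs h)
  have z' : ∀ x ∉ rect L₁ L₂, fderiv ℝ F x v = 0 := fun x hx =>
    image_eq_zero_of_notMem_tsupport (f := fun x => fderiv ℝ F x v) fun h =>
      hx (hs (tsupport_fderiv_apply_subset ℝ v h))
  rw [setIntegral_eq_integral_of_forall_compl_eq_zero fun x hx => by rw [z x hx, zero_mul],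
    setIntegral_eq_integral_of_forall_compl_eq_zero fun x hx => by rw [z' x hx, zero_mul]]
  refine integral_mul_fderiv_eq_neg_fderiv_mul_of_integrable ?_ ?_ ?_ (fun x _ => hF x)
    (fun x _ => hχ.differentiable (by simp) x)
  · exact (hF'.mul hχ.continuous).integrable_of_hasCompactSupport hc'.mul_right
  · exact (hF.continuous.mul hχ').integrable_of_hasCompactSupport hc.mul_right
  · exact (hF.continuous.mul hχ.continuous).integrable_of_hasCompactSupport hc.mul_right

/-- No boundary condition on χ is needed, since elements of V are limits of functions with compact
support in the rectangle. D stands for either weak derivative, selected by the direction v. -/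
theorem integral_fn_mul (v : ℝ × ℝ) (D : V L₁ L₂ →L[ℂ] H L₁ L₂)
    (hD : ∀ (w : V L₁ L₂) (ψ : ℝ × ℝ → ℂ), IsTest L₁ L₂ ψ → dx w =ᵐ[dom L₁ L₂] d₁ ψ →
      dy w =ᵐ[dom L₁ L₂] d₂ ψ → D w =ᵐ[dom L₁ L₂] fun x => fderiv ℝ ψ x v) (w : V L₁ L₂)
    {χ : ℝ × ℝ → ℂ} (hχ : ContDiff ℝ ∞ χ) :
    ∫ x, fn w x * fderiv ℝ χ x v ∂(dom L₁ L₂) = -∫ x, D w x * χ x ∂(dom L₁ L₂) := by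
  have hχ' : Continuous fun x => fderiv ℝ χ x v :=
    (hχ.continuous_fderiv (by simp)).clm_apply continuous_const
  refine dense_test_induction (P := fun w => ∫ x, fn w x * fderiv ℝ χ x v ∂(dom L₁ L₂) =
    -∫ x, D w x * χ x ∂(dom L₁ L₂)) ?_ ?_ w
  · simp_rw [integral_mul_eq_inner _ hχ', integral_mul_eq_inner _ hχ.continuous]
    refine isClosed_eq ?_ ?_
    · exact continuous_const.inner (fnL L₁ L₂).continuous
    · exact (continuous_const.inner D.continuous).neg
  · intro w ψ hψ e0 e1 e2
    have h := integral_mul_fderiv_dom (hψ.smooth.differentiable (by simp)) v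
      ((hψ.smooth.continuous_fderiv (by simp)).clm_apply continuous_const) hψ.compact hψ.support hχ
    have a1 : ∫ x, fn w x * fderiv ℝ χ x v ∂(dom L₁ L₂) =
        ∫ x, ψ x * fderiv ℝ χ x v ∂(dom L₁ L₂) := by
      refine integral_congr_ae ?_
      filter_upwards [e0] with x hx
      rw [hx]
    have a2 : ∫ x, D w x * χ x ∂(dom L₁ L₂) = ∫ x, fderiv ℝ ψ x v * χ x ∂(dom L₁ L₂) := by
      refine integral_congr_ae ?_
      filter_upwards [hD w ψ hψ e1 e2] with x hx
      rw [hx]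
    rw [a1, a2, h]

theorem integral_fn_mul_d₁ (w : V L₁ L₂) {χ : ℝ × ℝ → ℂ} (hχ : ContDiff ℝ ∞ χ) :
    ∫ x, fn w x * d₁ χ x ∂(dom L₁ L₂) = -∫ x, dx w x * χ x ∂(dom L₁ L₂) :=
  integral_fn_mul (1, 0) (dxL L₁ L₂) (fun _ _ _ h _ => h) w hχ

theorem integral_fn_mul_d₂ (w : V L₁ L₂) {χ : ℝ × ℝ → ℂ} (hχ : ContDiff ℝ ∞ χ) :
    ∫ x, fn w x * d₂ χ x ∂(dom L₁ L₂) = -∫ x, dy w x * χ x ∂(dom L₁ L₂) :=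
  integral_fn_mul (0, 1) (dyL L₁ L₂) (fun _ _ _ _ h => h) w hχ

/-- Elements of V are triples. Integration by parts shows that the first entry determines the other
two, so a vanishing function has vanishing weak derivatives. -/
theorem fn_injective : Function.Injective (fn : V L₁ L₂ → H L₁ L₂) := by
  refine (injective_iff_map_eq_zero (fnL L₁ L₂)).2 fun w hw => ?_
  have hw' : fn w = 0 := hw
  have key : ∀ f : H L₁ L₂, (∀ χ : ℝ × ℝ → ℂ, ContDiff ℝ ∞ χ → ∫ x, f x * χ x ∂(dom L₁ L₂) = 0) →
      f = 0 := by
    intro f hf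
    refine (Lp.eq_zero_iff_ae_eq_zero).2 (ae_eq_zero_of_integral_contDiff_smul_eq_zero
      ((Lp.memLp f).locallyIntegrable (by norm_num)) fun χ hχ _ => ?_)
    have := hf (fun x => (χ x : ℂ)) (Complex.ofRealCLM.contDiff.comp hχ)
    simpa [mul_comm] using this
  have z : ∀ χ : ℝ × ℝ → ℂ, ∫ x, fn w x * χ x ∂(dom L₁ L₂) = 0 := fun χ => by
    refine integral_eq_zero_of_ae ?_
    filter_upwards [(Lp.eq_zero_iff_ae_eq_zero).1 hw'] with x hx
    rw [hx]; simp
  have h1 : dx w = 0 := key _ fun χ hχ => by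
    have := integral_fn_mul_d₁ w hχ
    rw [z] at this
    exact neg_eq_zero.1 this.symm
  have h2 : dy w = 0 := key _ fun χ hχ => by
    have := integral_fn_mul_d₂ w hχ
    rw [z] at this
    exact neg_eq_zero.1 this.symm
  have := norm_sq_eq w
  unfold gr at this
  rw [hw', h1, h2] at this
  simpa using this

theorem contDiff_pow_smul {u : ℝ × ℝ → ℂ} {r : ℝ} (hr : 1 < r) (hu : ContDiff ℝ ∞ u) :
    ContDiff ℝ 1 fun x => (‖u x‖ ^ r) • u x := by
  have hu1 : ContDiff ℝ 1 u := hu.of_le (by simp)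
  have hc : ContDiff ℝ 1 fun z : ℂ => ‖z‖ ^ r := contDiff_norm_rpow hr
  exact (hc.comp hu1).smul hu1

theorem fderiv_pow_smul {u : ℝ × ℝ → ℂ} {r : ℝ} (hr : 1 < r) (hu : ContDiff ℝ ∞ u) (x v : ℝ × ℝ) :
    fderiv ℝ (fun x => (‖u x‖ ^ r) • u x) x v = powD r (u x) (fderiv ℝ u x v) := by
  have h1 : HasDerivAt (fun t : ℝ => u (x + t • v)) (fderiv ℝ u x v) 0 :=
    (hu.differentiable (by simp) x).hasFDerivAt.hasLineDerivAt v
  have h2 := hasDerivAt_pow_smul hr h1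
  have h3 : HasDerivAt (fun t : ℝ => (‖u (x + t • v)‖ ^ r) • u (x + t • v))
      (fderiv ℝ (fun x => (‖u x‖ ^ r) • u x) x v) 0 :=
    ((contDiff_pow_smul hr hu).differentiable (by simp) x).hasFDerivAt.hasLineDerivAt v
  have := h3.unique h2
  simpa using this

/-- Integration by parts for the power nonlinearity. -/
theorem Vanishes.integral_powD {u : ℝ × ℝ → ℂ} (hu : Vanishes L₁ L₂ u) {r : ℝ} (hr : 1 < r)
    (v : ℝ × ℝ) {χ : ℝ × ℝ → ℂ} (hχ : ContDiff ℝ ∞ χ) :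
    ∫ x, ((‖u x‖ ^ r) • u x) * fderiv ℝ χ x v ∂(dom L₁ L₂) =
      -∫ x, powD r (u x) (fderiv ℝ u x v) * χ x ∂(dom L₁ L₂) := by
  -- The formula holds for the test functions of the approximation. They are bounded together with
  -- their gradients and eventually coincide with u near each interior point, so dominated
  -- convergence transfers it to u.
  obtain ⟨un, C, htest, hbdd, hlim⟩ := hu.exists_approx
  have hχ' : Continuous fun x => fderiv ℝ χ x v :=
    (hχ.continuous_fderiv (by simp)).clm_apply continuous_const
  have hd : ∀ n, Differentiable ℝ fun x => (‖un n x‖ ^ r) • un n x := fun n =>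
    (contDiff_pow_smul hr (htest n).smooth).differentiable (by simp)
  have hf : ∀ n x, fderiv ℝ (fun x => (‖un n x‖ ^ r) • un n x) x v =
      powD r (un n x) (fderiv ℝ (un n) x v) := fun n x => fderiv_pow_smul hr (htest n).smooth x v
  have hr0 : 0 < r := by linarith
  have hcont : ∀ n, Continuous fun x => fderiv ℝ (fun x => (‖un n x‖ ^ r) • un n x) x v := fun n =>
    ((contDiff_pow_smul hr (htest n).smooth).continuous_fderiv (by simp)).clm_apply continuous_const
  have hn : ∀ n, ∫ x, ((‖un n x‖ ^ r) • un n x) * fderiv ℝ χ x v ∂(dom L₁ L₂) =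
      -∫ x, powD r (un n x) (fderiv ℝ (un n) x v) * χ x ∂(dom L₁ L₂) := fun n => by
    have hsupp : Function.support (fun x => (‖un n x‖ ^ r) • un n x) ⊆ Function.support (un n) :=
      fun x hx h0 => hx (by simp only [h0, smul_zero])
    have h := integral_mul_fderiv_dom (L₁ := L₁) (L₂ := L₂) (hd n) v (hcont n)
      ((htest n).compact.mono hsupp) ((closure_mono hsupp).trans (htest n).support) hχ
    rw [h]
    simp only [hf]
  have hK : IsCompact (Icc (0 : ℝ) L₁ ×ˢ Icc (0 : ℝ) L₂) := isCompact_Icc.prod isCompact_Icc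
  obtain ⟨B, hB⟩ := hK.exists_bound_of_continuousOn hχ.continuous.continuousOn
  obtain ⟨B', hB'⟩ := hK.exists_bound_of_continuousOn hχ'.continuousOn
  have hsub : ∀ x ∈ rect L₁ L₂, x ∈ Icc (0 : ℝ) L₁ ×ˢ Icc (0 : ℝ) L₂ := fun x hx =>
    ⟨Ioo_subset_Icc_self hx.1, Ioo_subset_Icc_self hx.2⟩
  have lim1 : Tendsto (fun n => ∫ x, ((‖un n x‖ ^ r) • un n x) * fderiv ℝ χ x v ∂(dom L₁ L₂)) atTop
      (𝓝 (∫ x, ((‖u x‖ ^ r) • u x) * fderiv ℝ χ x v ∂(dom L₁ L₂))) := by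
    refine tendsto_integral_of_dominated_convergence (fun _ => (C ^ r * C) * B')
      (fun n => ((hd n).continuous.mul hχ').aestronglyMeasurable) (integrable_const _)
      (fun n => ?_) ?_
    · filter_upwards [ae_restrict_mem measurableSet_rect] with x hx
      have h1 := (hbdd n x hx).1
      have hC : 0 ≤ C := (norm_nonneg _).trans h1
      have h2 := hB' x (hsub x hx)
      rw [norm_mul, norm_smul, Real.norm_of_nonneg (by positivity)]
      gcongr
    · filter_upwards [ae_restrict_mem measurableSet_rect] with x hx
      exact tendsto_const_nhds.congr' ((hlim x hx).mono fun n hn => by simp only [hn.eq_of_nhds])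
  have lim2 : Tendsto (fun n => ∫ x, powD r (un n x) (fderiv ℝ (un n) x v) * χ x ∂(dom L₁ L₂)) atTop
      (𝓝 (∫ x, powD r (u x) (fderiv ℝ u x v) * χ x ∂(dom L₁ L₂))) := by
    refine tendsto_integral_of_dominated_convergence (fun _ => ((r + 1) * C ^ r * (C * ‖v‖)) * B)
      (fun n => ?_) (integrable_const _) (fun n => ?_) ?_
    · have hm : Continuous fun x => fderiv ℝ (fun x => (‖un n x‖ ^ r) • un n x) x v * χ x :=
        (hcont n).mul hχ.continuous
      simp only [hf] at hm
      exact hm.aestronglyMeasurable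
    · filter_upwards [ae_restrict_mem measurableSet_rect] with x hx
      obtain ⟨h1, h2⟩ := hbdd n x hx
      have hC : 0 ≤ C := (norm_nonneg _).trans h1
      have h3 := hB x (hsub x hx)
      have h4 : ‖fderiv ℝ (un n) x v‖ ≤ C * ‖v‖ :=
        ((fderiv ℝ (un n) x).le_opNorm v).trans (by gcongr)
      rw [norm_mul]
      have h5 := norm_powD_le hr0 (un n x) (fderiv ℝ (un n) x v)
      have h6 : (r + 1) * ‖un n x‖ ^ r * ‖fderiv ℝ (un n) x v‖ ≤ (r + 1) * C ^ r * (C * ‖v‖) := by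
        gcongr
      exact mul_le_mul (h5.trans h6) h3 (norm_nonneg _) (by positivity)
    · filter_upwards [ae_restrict_mem measurableSet_rect] with x hx
      exact tendsto_const_nhds.congr' ((hlim x hx).mono fun n hn => by
        simp only [hn.eq_of_nhds, hn.fderiv_eq])
  refine tendsto_nhds_unique lim1 ?_
  simp_rw [hn]
  exact lim2.neg

theorem d₁_conj {f : ℝ × ℝ → ℂ} (x : ℝ × ℝ) : d₁ (fun x => conj (f x)) x = conj (d₁ f x) := by
  have := Complex.conjCLE.comp_fderiv (f := f) (x := x)
  exact congrArg (fun L : ℝ × ℝ →L[ℝ] ℂ => L (1, 0)) this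

theorem d₂_conj {f : ℝ × ℝ → ℂ} (x : ℝ × ℝ) : d₂ (fun x => conj (f x)) x = conj (d₂ f x) := by
  have := Complex.conjCLE.comp_fderiv (f := f) (x := x)
  exact congrArg (fun L : ℝ × ℝ →L[ℝ] ℂ => L (0, 1)) this

theorem contDiff_conj {f : ℝ × ℝ → ℂ} (hf : ContDiff ℝ ∞ f) : ContDiff ℝ ∞ fun x => conj (f x) :=
  Complex.conjCLE.contDiff.comp hf

theorem contDiff_d₁ {f : ℝ × ℝ → ℂ} (hf : ContDiff ℝ ∞ f) : ContDiff ℝ ∞ (d₁ f) :=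
  (hf.fderiv_right (m := ∞) (by simp)).clm_apply contDiff_const

theorem contDiff_d₂ {f : ℝ × ℝ → ℂ} (hf : ContDiff ℝ ∞ f) : ContDiff ℝ ∞ (d₂ f) :=
  (hf.fderiv_right (m := ∞) (by simp)).clm_apply contDiff_const

theorem H.inner_eq_integral (f h : H L₁ L₂) {k : ℝ × ℝ → ℂ} (hk : f =ᵐ[dom L₁ L₂] k) :
    inner ℂ f h = ∫ x, h x * conj (k x) ∂(dom L₁ L₂) := by
  rw [L2.inner_def]
  refine integral_congr_ae ?_
  filter_upwards [hk] with x hx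
  rw [hx, RCLike.inner_apply]

/-- Green's formula with a smooth function. -/
theorem inner_dx_eq {e : V L₁ L₂} {s : ℝ × ℝ → ℂ} (hs : ContDiff ℝ ∞ s)
    (he : dx e =ᵐ[dom L₁ L₂] d₁ s) (w : V L₁ L₂) :
    inner ℂ (dx e) (dx w) = -∫ x, fn w x * conj (d₁ (d₁ s) x) ∂(dom L₁ L₂) := by
  rw [H.inner_eq_integral _ _ he, ← neg_eq_iff_eq_neg,
    ← integral_fn_mul_d₁ w (contDiff_conj (contDiff_d₁ hs))]
  simp_rw [d₁_conj]

theorem inner_dy_eq {e : V L₁ L₂} {s : ℝ × ℝ → ℂ} (hs : ContDiff ℝ ∞ s)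
    (he : dy e =ᵐ[dom L₁ L₂] d₂ s) (w : V L₁ L₂) :
    inner ℂ (dy e) (dy w) = -∫ x, fn w x * conj (d₂ (d₂ s) x) ∂(dom L₁ L₂) := by
  rw [H.inner_eq_integral _ _ he, ← neg_eq_iff_eq_neg,
    ← integral_fn_mul_d₂ w (contDiff_conj (contDiff_d₂ hs))]
  simp_rw [d₂_conj]

end Parts

section Sine

variable {L₁ L₂ : ℝ}

/-! ### The sine basis -/

/-- `sin (jπx/L)`. -/
def sn (L : ℝ) (j : ℕ) (x : ℝ) : ℝ := Real.sin (j * (Real.pi / L) * x)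

/-- Products of sines. -/
def sn₂ (L₁ L₂ : ℝ) (i : ℕ × ℕ) (p : ℝ × ℝ) : ℝ := sn L₁ (i.1 + 1) p.1 * sn L₂ (i.2 + 1) p.2

theorem sn_zero (L x : ℝ) : sn L 0 x = 0 := by simp [sn]

/-- Multiplication by the lowest cosine maps the span of the sines into itself, the term of index
zero being zero. Completeness of the sines rests on this. -/
theorem cos_mul_sn (L : ℝ) (j : ℕ) (x : ℝ) : Real.cos (Real.pi / L * x) * sn L (j + 1) x =
    2⁻¹ * sn L (j + 2) x + 2⁻¹ * sn L j x := by
  unfold sn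
  have h1 : ((j + 2 : ℕ) : ℝ) * (Real.pi / L) * x =
      ((j + 1 : ℕ) : ℝ) * (Real.pi / L) * x + Real.pi / L * x := by push_cast; ring
  have h2 : (j : ℝ) * (Real.pi / L) * x =
      ((j + 1 : ℕ) : ℝ) * (Real.pi / L) * x - Real.pi / L * x := by push_cast; ring
  rw [h1, h2, Real.sin_add, Real.sin_sub]
  ring

theorem sn_pos {L x : ℝ} (hx : x ∈ Ioo 0 L) : 0 < sn L 1 x := by
  have hL : 0 < L := hx.1.trans hx.2
  unfold sn
  refine Real.sin_pos_of_pos_of_lt_pi (by have := hx.1; positivity) ?_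
  have : Real.pi / L * x < Real.pi / L * L := by gcongr; exact hx.2
  rw [div_mul_cancel₀ _ hL.ne'] at this
  simpa using this

theorem contDiff_sn (L : ℝ) (j : ℕ) : ContDiff ℝ ∞ (sn L j) :=
  Real.contDiff_sin.comp (contDiff_const.mul contDiff_id)

theorem contDiff_sn₂ (i : ℕ × ℕ) : ContDiff ℝ ∞ (sn₂ L₁ L₂ i) :=
  ((contDiff_sn _ _).comp contDiff_fst).mul ((contDiff_sn _ _).comp contDiff_snd)

theorem continuous_of_mem_span {h : ℝ × ℝ → ℝ}
    (hh : h ∈ Submodule.span ℝ (range (sn₂ L₁ L₂))) : Continuous h := by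
  induction hh using Submodule.span_induction with
  | mem x hx =>
    obtain ⟨i, rfl⟩ := hx
    exact (contDiff_sn₂ i).continuous
  | zero => exact continuous_const
  | add x y _ _ hx hy => exact hx.add hy
  | smul a x _ hx => exact continuous_const.smul hx

theorem cos_fst_mul_mem {h : ℝ × ℝ → ℝ} (hh : h ∈ Submodule.span ℝ (range (sn₂ L₁ L₂))) :
    (fun p => Real.cos (Real.pi / L₁ * p.1) * h p) ∈ Submodule.span ℝ (range (sn₂ L₁ L₂)) := by
  induction hh using Submodule.span_induction with
  | mem x hx =>
    obtain ⟨⟨j, k⟩, rfl⟩ := hx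
    have e : (fun p => Real.cos (Real.pi / L₁ * p.1) * sn₂ L₁ L₂ (j, k) p) =
        (2⁻¹ : ℝ) • sn₂ L₁ L₂ (j + 1, k) + (2⁻¹ : ℝ) • fun p => sn L₁ j p.1 * sn L₂ (k + 1) p.2 := by
      funext p
      simp only [Pi.add_apply, Pi.smul_apply, smul_eq_mul, sn₂]
      rw [← mul_assoc, cos_mul_sn]; ring
    rw [e]
    refine Submodule.add_mem _ (Submodule.smul_mem _ _ (Submodule.subset_span ⟨_, rfl⟩))
      (Submodule.smul_mem _ _ ?_)
    rcases j with _ | j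
    · simp only [sn_zero, zero_mul]; exact Submodule.zero_mem _
    · exact Submodule.subset_span ⟨(j, k), rfl⟩
  | zero => simp only [Pi.zero_apply, mul_zero]; exact Submodule.zero_mem _
  | add x y _ _ hx hy => simp only [Pi.add_apply, mul_add]; exact Submodule.add_mem _ hx hy
  | smul a x _ hx =>
    have := Submodule.smul_mem _ a hx
    convert this using 1
    funext p
    simp only [Pi.smul_apply, smul_eq_mul]; ring

theorem cos_snd_mul_mem {h : ℝ × ℝ → ℝ} (hh : h ∈ Submodule.span ℝ (range (sn₂ L₁ L₂))) :
    (fun p => Real.cos (Real.pi / L₂ * p.2) * h p) ∈ Submodule.span ℝ (range (sn₂ L₁ L₂)) := by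
  induction hh using Submodule.span_induction with
  | mem x hx =>
    obtain ⟨⟨j, k⟩, rfl⟩ := hx
    have e : (fun p => Real.cos (Real.pi / L₂ * p.2) * sn₂ L₁ L₂ (j, k) p) =
        (2⁻¹ : ℝ) • sn₂ L₁ L₂ (j, k + 1) + (2⁻¹ : ℝ) • fun p => sn L₁ (j + 1) p.1 * sn L₂ k p.2 := by
      funext p
      simp only [Pi.add_apply, Pi.smul_apply, smul_eq_mul, sn₂]
      rw [mul_left_comm, cos_mul_sn]; ring
    rw [e]
    refine Submodule.add_mem _ (Submodule.smul_mem _ _ (Submodule.subset_span ⟨_, rfl⟩))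
      (Submodule.smul_mem _ _ ?_)
    rcases k with _ | k
    · simp only [sn_zero, mul_zero]; exact Submodule.zero_mem _
    · exact Submodule.subset_span ⟨(j, k), rfl⟩
  | zero => simp only [Pi.zero_apply, mul_zero]; exact Submodule.zero_mem _
  | add x y _ _ hx hy => simp only [Pi.add_apply, mul_add]; exact Submodule.add_mem _ hx hy
  | smul a x _ hx =>
    have := Submodule.smul_mem _ a hx
    convert this using 1
    funext p
    simp only [Pi.smul_apply, smul_eq_mul]; ring

/-- The continuous functions whose products with sine sums are sine sums. -/
def multipliers (L₁ L₂ : ℝ) : Subalgebra ℝ C(↥(Icc (0 : ℝ) L₁ ×ˢ Icc (0 : ℝ) L₂), ℝ) where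
  carrier := {G | ∀ h ∈ Submodule.span ℝ (range (sn₂ L₁ L₂)),
    ∃ h' ∈ Submodule.span ℝ (range (sn₂ L₁ L₂)), ∀ p, h' p.1 = G p * h p.1}
  mul_mem' := by
    intro F G hF hG h hh
    obtain ⟨h', hh', e'⟩ := hG h hh
    obtain ⟨h'', hh'', e''⟩ := hF h' hh'
    exact ⟨h'', hh'', fun p => by rw [e'', e', ContinuousMap.mul_apply, mul_assoc]⟩
  add_mem' := by
    intro F G hF hG h hh
    obtain ⟨h', hh', e'⟩ := hF h hh
    obtain ⟨h'', hh'', e''⟩ := hG h hh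
    exact ⟨h' + h'', Submodule.add_mem _ hh' hh'', fun p => by
      rw [Pi.add_apply, e'', e', ContinuousMap.add_apply, add_mul]⟩
  algebraMap_mem' := by
    intro r h hh
    exact ⟨r • h, Submodule.smul_mem _ _ hh, fun p => by simp⟩

theorem cos_injOn {L x y : ℝ} (hx : x ∈ Icc 0 L) (hy : y ∈ Icc 0 L)
    (h : Real.cos (Real.pi / L * x) = Real.cos (Real.pi / L * y)) : x = y := by
  rcases eq_or_lt_of_le (hx.1.trans hx.2) with rfl | hL
  · exact (le_antisymm hx.2 hx.1).trans (le_antisymm hy.2 hy.1).symm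
  have key : ∀ z ∈ Icc 0 L, Real.pi / L * z ∈ Icc 0 Real.pi := fun z hz => by
    have h0 := hz.1
    refine ⟨by positivity, ?_⟩
    calc Real.pi / L * z ≤ Real.pi / L * L := by gcongr; exact hz.2
      _ = _ := div_mul_cancel₀ _ hL.ne'
  have := Real.injOn_cos (key x hx) (key y hy) h
  have hpi : Real.pi / L ≠ 0 := (div_pos Real.pi_pos hL).ne'
  exact mul_left_cancel₀ hpi this

theorem multipliers_separatesPoints : (multipliers L₁ L₂).SeparatesPoints := by
  intro x y hxy
  by_cases h1 : x.1.1 = y.1.1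
  · have h2 : x.1.2 ≠ y.1.2 := fun h2 => hxy (Subtype.ext (Prod.ext h1 h2))
    refine ⟨_, ⟨⟨fun p => Real.cos (Real.pi / L₂ * p.1.2), by fun_prop⟩, ?_, rfl⟩, fun h => h2
      (cos_injOn x.2.2 y.2.2 h)⟩
    exact fun h hh => ⟨_, cos_snd_mul_mem hh, fun p => rfl⟩
  · refine ⟨_, ⟨⟨fun p => Real.cos (Real.pi / L₁ * p.1.1), by fun_prop⟩, ?_, rfl⟩, fun h => h1
      (cos_injOn x.2.1 y.2.1 h)⟩
    exact fun h hh => ⟨_, cos_fst_mul_mem hh, fun p => rfl⟩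

theorem integral_span_eq_zero {f : H L₁ L₂}
    (hf : ∀ i, ∫ x, f x * (sn₂ L₁ L₂ i x : ℂ) ∂(dom L₁ L₂) = 0) {h : ℝ × ℝ → ℝ}
    (hh : h ∈ Submodule.span ℝ (range (sn₂ L₁ L₂))) :
    ∫ x, f x * (h x : ℂ) ∂(dom L₁ L₂) = 0 := by
  induction hh using Submodule.span_induction with
  | mem x hx => obtain ⟨i, rfl⟩ := hx; exact hf i
  | zero => simp
  | add x y hx hy h1 h2 =>
    have i1 := integrable_mul_dom f (Complex.continuous_ofReal.comp (continuous_of_mem_span hx))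
    have i2 := integrable_mul_dom f (Complex.continuous_ofReal.comp (continuous_of_mem_span hy))
    simp only [Function.comp_apply] at i1 i2
    simp only [Pi.add_apply, Complex.ofReal_add, mul_add]
    rw [integral_add i1 i2, h1, h2, add_zero]
  | smul a x _ h1 =>
    simp only [Pi.smul_apply, smul_eq_mul, Complex.ofReal_mul, mul_left_comm _ (a : ℂ)]
    rw [integral_const_mul, h1, mul_zero]

/-- The sines are complete. -/
theorem eq_zero_of_orthogonal_sines {f : H L₁ L₂}
    (hf : ∀ i, ∫ x, f x * (sn₂ L₁ L₂ i x : ℂ) ∂(dom L₁ L₂) = 0) : f = 0 := by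
  have hfi : Integrable f (dom L₁ L₂) := (Lp.memLp f).integrable (by norm_num)
  have hs0 : sn₂ L₁ L₂ (0, 0) ∈ Submodule.span ℝ (range (sn₂ L₁ L₂)) :=
    Submodule.subset_span ⟨_, rfl⟩
  have hsle : ∀ i p, |sn₂ L₁ L₂ i p| ≤ 1 := fun i p => by
    unfold sn₂ sn
    rw [abs_mul]
    exact mul_le_one₀ (Real.abs_sin_le_one _) (abs_nonneg _) (Real.abs_sin_le_one _)
  have hsc : Continuous fun x => (sn₂ L₁ L₂ (0, 0) x : ℂ) :=
    Complex.continuous_ofReal.comp (contDiff_sn₂ (0, 0)).continuous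
  have : CompactSpace ↥(Icc (0 : ℝ) L₁ ×ˢ Icc (0 : ℝ) L₂) :=
    isCompact_iff_compactSpace.1 (isCompact_Icc.prod isCompact_Icc)
  -- The multipliers contain the cosines in both variables and are uniformly dense by
  -- Stone–Weierstrass. A multiplier times the lowest sine product is a sine sum, which f
  -- annihilates. Hence f times the lowest sine product annihilates all continuous functions, and
  -- this sine product is positive on the rectangle.
  have key : ∀ g : ℝ × ℝ → ℝ, Continuous g →
      ∫ x, g x • (f x * (sn₂ L₁ L₂ (0, 0) x : ℂ)) ∂(dom L₁ L₂) = 0 := by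
    intro g hg
    have hbound : ∀ ε : ℝ, 0 < ε → ‖∫ x, g x • (f x * (sn₂ L₁ L₂ (0, 0) x : ℂ)) ∂(dom L₁ L₂)‖ ≤
        ε * ∫ x, ‖f x‖ ∂(dom L₁ L₂) := by
      intro ε hε
      obtain ⟨⟨G, hG⟩, hGg⟩ :=
        ContinuousMap.exists_mem_subalgebra_near_continuous_of_separatesPoints (multipliers L₁ L₂)
          multipliers_separatesPoints (fun p => g p.1) (by fun_prop) ε hε
      obtain ⟨h', hh', e'⟩ := hG _ hs0
      have z := integral_span_eq_zero hf hh'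
      have i1 : Integrable (fun x => f x * (h' x : ℂ)) (dom L₁ L₂) := by
        have := integrable_mul_dom f (Complex.continuous_ofReal.comp (continuous_of_mem_span hh'))
        simpa only [Function.comp_apply] using this
      have i2 : Integrable (fun x => g x • (f x * (sn₂ L₁ L₂ (0, 0) x : ℂ))) (dom L₁ L₂) := by
        have := integrable_mul_dom f ((Complex.continuous_ofReal.comp hg).mul hsc)
        refine this.congr (ae_of_all _ fun x => ?_)
        simp only [Pi.mul_apply, Function.comp_apply, Complex.real_smul]; ring
      rw [← sub_zero (∫ x, g x • (f x * (sn₂ L₁ L₂ (0, 0) x : ℂ)) ∂(dom L₁ L₂)), ← z,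
        ← integral_sub i2 i1, ← integral_const_mul]
      refine norm_integral_le_of_norm_le (hfi.norm.const_mul ε) ?_
      filter_upwards [ae_restrict_mem measurableSet_rect] with x hx
      have hx' : x ∈ Icc (0 : ℝ) L₁ ×ˢ Icc (0 : ℝ) L₂ :=
        ⟨Ioo_subset_Icc_self hx.1, Ioo_subset_Icc_self hx.2⟩
      have h1 := e' ⟨x, hx'⟩
      have h2 : |G ⟨x, hx'⟩ - g x| < ε := hGg ⟨x, hx'⟩
      simp only at h1
      rw [h1]
      have e : g x • (f x * (sn₂ L₁ L₂ (0, 0) x : ℂ)) -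
          f x * ((G ⟨x, hx'⟩ * sn₂ L₁ L₂ (0, 0) x : ℝ) : ℂ) =
          ((g x - G ⟨x, hx'⟩ : ℝ) : ℂ) * f x * (sn₂ L₁ L₂ (0, 0) x : ℂ) := by
        simp only [Complex.real_smul]; push_cast; ring
      rw [e, norm_mul, norm_mul, Complex.norm_real, Complex.norm_real, Real.norm_eq_abs,
        Real.norm_eq_abs, abs_sub_comm]
      calc _ ≤ ε * ‖f x‖ * 1 := by gcongr; exact hsle _ _
        _ = _ := mul_one _
    refine norm_le_zero_iff.1 (le_of_forall_pos_le_add fun δ hδ => ?_)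
    have hI : 0 ≤ ∫ x, ‖f x‖ ∂(dom L₁ L₂) := integral_nonneg fun x => norm_nonneg _
    refine (hbound (δ / (∫ x, ‖f x‖ ∂(dom L₁ L₂) + 1)) (by positivity)).trans ?_
    rw [zero_add, div_mul_eq_mul_div, div_le_iff₀ (by positivity)]
    nlinarith
  have hz := ae_eq_zero_of_integral_contDiff_smul_eq_zero
    (f := fun x => f x * (sn₂ L₁ L₂ (0, 0) x : ℂ)) (μ := dom L₁ L₂)
    (integrable_mul_dom f hsc).locallyIntegrable (fun g hg _ => key g hg.continuous)
  refine (Lp.eq_zero_iff_ae_eq_zero).2 ?_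
  filter_upwards [hz, ae_restrict_mem measurableSet_rect] with x h0 hx
  rcases mul_eq_zero.1 h0 with h | h
  · exact h
  · have : 0 < sn₂ L₁ L₂ (0, 0) x := mul_pos (sn_pos hx.1) (sn_pos hx.2)
    exact absurd (Complex.ofReal_eq_zero.1 h) this.ne'

theorem d₁_eq {ψ : ℝ × ℝ → ℂ} {p : ℝ × ℝ} (hψ : DifferentiableAt ℝ ψ p) {c : ℂ}
    (h : HasDerivAt (fun t => ψ (t, p.2)) c p.1) : d₁ ψ p = c := by
  have h1 : HasDerivAt (fun t : ℝ => (t, p.2)) ((1 : ℝ), (0 : ℝ)) p.1 :=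
    (hasDerivAt_id p.1).prodMk (hasDerivAt_const p.1 p.2)
  exact (HasFDerivAt.comp_hasDerivAt p.1 (l := ψ) hψ.hasFDerivAt h1).unique h

theorem d₂_eq {ψ : ℝ × ℝ → ℂ} {p : ℝ × ℝ} (hψ : DifferentiableAt ℝ ψ p) {c : ℂ}
    (h : HasDerivAt (fun t => ψ (p.1, t)) c p.2) : d₂ ψ p = c := by
  have h1 : HasDerivAt (fun t : ℝ => (p.1, t)) ((0 : ℝ), (1 : ℝ)) p.2 :=
    (hasDerivAt_const p.2 p.1).prodMk (hasDerivAt_id p.2)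
  exact (HasFDerivAt.comp_hasDerivAt p.2 (l := ψ) hψ.hasFDerivAt h1).unique h

/-- The normalized sines, as complex functions. -/
def sineFn (L₁ L₂ : ℝ) (ν : ℝ) (i : ℕ × ℕ) (p : ℝ × ℝ) : ℂ := (ν * sn₂ L₁ L₂ i p : ℝ)

theorem contDiff_sineFn (ν : ℝ) (i : ℕ × ℕ) : ContDiff ℝ ∞ (sineFn L₁ L₂ ν i) :=
  Complex.ofRealCLM.contDiff.comp (contDiff_const.mul (contDiff_sn₂ i))

/-- The frequencies. -/
def freq (L : ℝ) (j : ℕ) : ℝ := (j + 1) * (Real.pi / L)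

theorem d₁_d₁_sineFn (ν : ℝ) (i : ℕ × ℕ) (p : ℝ × ℝ) :
    d₁ (d₁ (sineFn L₁ L₂ ν i)) p = -(freq L₁ i.1 ^ 2 : ℝ) * sineFn L₁ L₂ ν i p := by
  have e : ∀ p : ℝ × ℝ, d₁ (sineFn L₁ L₂ ν i) p = ((ν * (freq L₁ i.1 *
      Real.cos (freq L₁ i.1 * p.1) * sn L₂ (i.2 + 1) p.2) : ℝ) : ℂ) := fun p => by
    refine d₁_eq ((contDiff_sineFn ν i).differentiable (by simp) p) (HasDerivAt.ofReal_comp ?_)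
    have h := ((hasDerivAt_id p.1).const_mul (freq L₁ i.1)).sin
    have h' := (h.mul_const (sn L₂ (i.2 + 1) p.2)).const_mul ν
    convert! h' using 1
    · funext t; simp [sn₂, sn, freq]
    · simp only [id]; ring
  refine d₁_eq ((contDiff_d₁ (contDiff_sineFn ν i)).differentiable (by simp) p) ?_
  have h := ((hasDerivAt_id p.1).const_mul (freq L₁ i.1)).cos
  have h' := (((h.const_mul (freq L₁ i.1)).mul_const (sn L₂ (i.2 + 1) p.2)).const_mul ν).ofReal_comp
  convert! h' using 1
  · funext t; rw [e]; simp
  · simp [sineFn, sn₂, sn, freq]; ring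

theorem d₂_d₂_sineFn (ν : ℝ) (i : ℕ × ℕ) (p : ℝ × ℝ) :
    d₂ (d₂ (sineFn L₁ L₂ ν i)) p = -(freq L₂ i.2 ^ 2 : ℝ) * sineFn L₁ L₂ ν i p := by
  have e : ∀ p : ℝ × ℝ, d₂ (sineFn L₁ L₂ ν i) p = ((ν * (sn L₁ (i.1 + 1) p.1 * (freq L₂ i.2 *
      Real.cos (freq L₂ i.2 * p.2))) : ℝ) : ℂ) := fun p => by
    refine d₂_eq ((contDiff_sineFn ν i).differentiable (by simp) p) (HasDerivAt.ofReal_comp ?_)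
    have h := ((hasDerivAt_id p.2).const_mul (freq L₂ i.2)).sin
    have h' := (h.const_mul (sn L₁ (i.1 + 1) p.1)).const_mul ν
    convert! h' using 1
    · funext t; simp [sn₂, sn, freq]
    · simp only [id]; ring
  refine d₂_eq ((contDiff_d₂ (contDiff_sineFn ν i)).differentiable (by simp) p) ?_
  have h := ((hasDerivAt_id p.2).const_mul (freq L₂ i.2)).cos
  have h' := (((h.const_mul (freq L₂ i.2)).const_mul (sn L₁ (i.1 + 1) p.1)).const_mul ν).ofReal_comp
  convert! h' using 1
  · funext t; rw [e]; simp
  · simp [sineFn, sn₂, sn, freq]; ring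

theorem sn_length {L : ℝ} (hL : 0 < L) (j : ℕ) : sn L j L = 0 := by
  unfold sn
  rw [mul_assoc, div_mul_cancel₀ _ hL.ne']
  exact Real.sin_nat_mul_pi j

theorem sn_at_zero (L : ℝ) (j : ℕ) : sn L j 0 = 0 := by simp [sn]

theorem vanishes_sineFn (hL₁ : 0 < L₁) (hL₂ : 0 < L₂) (ν : ℝ) (i : ℕ × ℕ) :
    Vanishes L₁ L₂ (sineFn L₁ L₂ ν i) where
  smooth := contDiff_sineFn ν i
  zero := by
    rintro p (h | h | h | h) <;> simp [sineFn, sn₂, h, sn_at_zero, sn_length hL₁, sn_length hL₂]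

/-- An orthonormal basis of `H` of smooth Dirichlet eigenfunctions of the Laplacian. -/
structure IsEigenbasis {ι : Type*} (e : ι → V L₁ L₂) (s : ι → ℝ × ℝ → ℂ) (lam : ι → ℝ) : Prop where
  vanishes : ∀ i, Vanishes L₁ L₂ (s i)
  fn_ae : ∀ i, fn (e i) =ᵐ[dom L₁ L₂] s i
  dx_ae : ∀ i, dx (e i) =ᵐ[dom L₁ L₂] d₁ (s i)
  dy_ae : ∀ i, dy (e i) =ᵐ[dom L₁ L₂] d₂ (s i)
  laplace : ∀ i p, d₁ (d₁ (s i)) p + d₂ (d₂ (s i)) p = -(lam i : ℂ) * s i p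
  orthonormal : Orthonormal ℂ fun i => fn (e i)
  pos : ∀ i, 0 < lam i
  finite : ∀ Λ : ℝ, {i | lam i ≤ Λ}.Finite
  complete : ∀ w : V L₁ L₂, (∀ i, inner ℂ (fn (e i)) (fn w) = 0) → w = 0

theorem freq_pos {L : ℝ} (hL : 0 < L) (j : ℕ) : 0 < freq L j := by
  unfold freq; positivity

theorem freq_injective {L : ℝ} (hL : 0 < L) {j k : ℕ} (h : freq L j ^ 2 = freq L k ^ 2) : j = k := by
  have h1 := (pow_left_inj₀ (freq_pos hL j).le (freq_pos hL k).le two_ne_zero).1 h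
  unfold freq at h1
  have h2 := mul_right_cancel₀ (by positivity) h1
  have h3 : (j : ℝ) = k := by linarith
  exact_mod_cast h3

theorem le_ceil_of_freq_le {L : ℝ} (hL : 0 < L) {j : ℕ} {Λ : ℝ} (h : freq L j ^ 2 ≤ Λ) :
    j ≤ ⌈Λ / (Real.pi / L) ^ 2⌉₊ := by
  unfold freq at h
  have hp : 0 < (Real.pi / L) ^ 2 := by positivity
  have h1 : (j : ℝ) ≤ Λ / (Real.pi / L) ^ 2 := by
    rw [le_div_iff₀ hp]
    refine le_trans ?_ h
    rw [mul_pow]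
    gcongr
    have : (0 : ℝ) ≤ j := by positivity
    nlinarith
  exact_mod_cast h1.trans (Nat.le_ceil _)

/-- The normalized sine products form an eigenbasis. -/
theorem exists_isEigenbasis (hL₁ : 0 < L₁) (hL₂ : 0 < L₂) :
    ∃ (e : ℕ × ℕ → V L₁ L₂) (s : ℕ × ℕ → ℝ × ℝ → ℂ) (lam : ℕ × ℕ → ℝ), IsEigenbasis e s lam := by
  choose E hE0 hE1 hE2 using fun i => (vanishes_sineFn hL₁ hL₂ 1 i).exists_jet
  have hne : ∀ i, fn (E i) ≠ 0 := fun i h0 => by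
    have h1 : sineFn L₁ L₂ 1 i =ᵐ[dom L₁ L₂] fun _ => 0 := by
      filter_upwards [hE0 i, (Lp.eq_zero_iff_ae_eq_zero).1 h0] with x h1 h2
      rw [← h1, h2]; rfl
    have hopen : IsOpen (rect L₁ L₂) := isOpen_Ioo.prod isOpen_Ioo
    have h2 := Measure.eqOn_open_of_ae_eq h1 hopen
      (contDiff_sineFn 1 i).continuous.continuousOn continuousOn_const
    -- The sine of index j + 1 takes the value 1 at L/(2(j+1)); as it is continuous, the sine
    -- product is not zero almost everywhere.
    have hsin : ∀ (L : ℝ), 0 < L → ∀ j : ℕ, L / (2 * (j + 1)) ∈ Ioo 0 L ∧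
        sn L (j + 1) (L / (2 * (j + 1))) = 1 := fun L hL j => by
      refine ⟨⟨by positivity, ?_⟩, ?_⟩
      · rw [div_lt_iff₀ (by positivity)]
        have : (0 : ℝ) ≤ j := by positivity
        nlinarith
      · unfold sn
        refine Eq.trans (congrArg Real.sin ?_) Real.sin_pi_div_two
        push_cast
        field_simp
    obtain ⟨m1, s1⟩ := hsin L₁ hL₁ i.1
    obtain ⟨m2, s2⟩ := hsin L₂ hL₂ i.2
    have h3 := h2 (show (L₁ / (2 * (i.1 + 1)), L₂ / (2 * (i.2 + 1))) ∈ rect L₁ L₂ from ⟨m1, m2⟩)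
    simp [sineFn, sn₂, s1, s2] at h3
  set ν : ℕ × ℕ → ℝ := fun i => ‖fn (E i)‖⁻¹
  have hν : ∀ i, 0 < ν i := fun i => inv_pos.2 (norm_pos_iff.2 (hne i))
  choose e he0 he1 he2 using fun i => (vanishes_sineFn hL₁ hL₂ (ν i) i).exists_jet
  have hfe : ∀ i, fn (e i) = (ν i : ℂ) • fn (E i) := fun i => by
    refine Lp.ext ?_
    filter_upwards [he0 i, hE0 i, Lp.coeFn_smul (ν i : ℂ) (fn (E i))] with x h1 h2 h3
    rw [h1, h3, Pi.smul_apply, h2]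
    simp [sineFn]
  have hint : ∀ i (w : V L₁ L₂), inner ℂ (fn (e i)) (fn w) =
      ∫ x, fn w x * sineFn L₁ L₂ (ν i) i x ∂(dom L₁ L₂) := fun i w => by
    rw [H.inner_eq_integral _ _ (he0 i)]
    simp [sineFn, Complex.conj_ofReal]
  have gx : ∀ i (w : V L₁ L₂), inner ℂ (dx (e i)) (dx w) =
      (freq L₁ i.1 ^ 2 : ℝ) * inner ℂ (fn (e i)) (fn w) := fun i w => by
    rw [inner_dx_eq (contDiff_sineFn (ν i) i) (he1 i), hint, ← integral_const_mul, ← integral_neg]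
    refine integral_congr_ae (ae_of_all _ fun x => ?_)
    simp only [d₁_d₁_sineFn]
    simp [sineFn, Complex.conj_ofReal]
    ring
  have gy : ∀ i (w : V L₁ L₂), inner ℂ (dy (e i)) (dy w) =
      (freq L₂ i.2 ^ 2 : ℝ) * inner ℂ (fn (e i)) (fn w) := fun i w => by
    rw [inner_dy_eq (contDiff_sineFn (ν i) i) (he2 i), hint, ← integral_const_mul, ← integral_neg]
    refine integral_congr_ae (ae_of_all _ fun x => ?_)
    simp only [d₂_d₂_sineFn]
    simp [sineFn, Complex.conj_ofReal]
    ring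
  -- Different indices may share the same eigenvalue of −Δ, for instance on a square. Orthogonality
  -- is therefore derived from −∂₁² or −∂₂² alone, according to the index in which i and j differ.
  have orth : ∀ (a b : ℝ) (A : V L₁ L₂ → H L₁ L₂) (i j : ℕ × ℕ), a ≠ b →
      inner ℂ (A (e i)) (A (e j)) = (a : ℂ) * inner ℂ (fn (e i)) (fn (e j)) →
      inner ℂ (A (e j)) (A (e i)) = (b : ℂ) * inner ℂ (fn (e j)) (fn (e i)) →
      inner ℂ (fn (e i)) (fn (e j)) = 0 := fun a b A i j hab h1 h2 => by
    have h3 := congrArg conj h2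
    rw [map_mul, inner_conj_symm, inner_conj_symm, Complex.conj_ofReal, h1] at h3
    rcases mul_eq_mul_right_iff.1 h3 with h | h
    · exact absurd (Complex.ofReal_inj.1 h) hab
    · exact h
  refine ⟨e, fun i => sineFn L₁ L₂ (ν i) i, fun i => freq L₁ i.1 ^ 2 + freq L₂ i.2 ^ 2,
    fun i => vanishes_sineFn hL₁ hL₂ _ i, he0, he1, he2, fun i p => ?_, ⟨fun i => ?_, fun i j hij => ?_⟩,
    fun i => ?_, fun Λ => ?_, fun w hw => ?_⟩
  · rw [d₁_d₁_sineFn, d₂_d₂_sineFn]; push_cast; ring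
  · simp only [hfe]
    rw [norm_smul, Complex.norm_real, Real.norm_of_nonneg (hν i).le]
    exact inv_mul_cancel₀ (norm_ne_zero_iff.2 (hne i))
  · by_cases h1 : i.1 = j.1
    · have h2 : i.2 ≠ j.2 := fun h2 => hij (Prod.ext h1 h2)
      exact orth _ _ dy i j (fun h => h2 (freq_injective hL₂ h)) (gy i (e j)) (gy j (e i))
    · exact orth _ _ dx i j (fun h => h1 (freq_injective hL₁ h)) (gx i (e j)) (gx j (e i))
  · have := freq_pos hL₁ i.1
    positivity
  · refine ((finite_Iic ⌈Λ / (Real.pi / L₁) ^ 2⌉₊).prod (finite_Iic ⌈Λ / (Real.pi / L₂) ^ 2⌉₊)).subset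
      fun i hi => ⟨le_ceil_of_freq_le hL₁ ?_, le_ceil_of_freq_le hL₂ ?_⟩
    · exact le_trans (le_add_of_nonneg_right (sq_nonneg _)) hi
    · exact le_trans (le_add_of_nonneg_left (sq_nonneg _)) hi
  · refine fn_injective ((eq_zero_of_orthogonal_sines fun i => ?_).trans fn_zero.symm)
    have h1 := hw i
    rw [hint] at h1
    have h2 : ∫ x, fn w x * sineFn L₁ L₂ (ν i) i x ∂(dom L₁ L₂) =
        (ν i : ℂ) * ∫ x, fn w x * (sn₂ L₁ L₂ i x : ℂ) ∂(dom L₁ L₂) := by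
      rw [← integral_const_mul]
      refine integral_congr_ae (ae_of_all _ fun x => ?_)
      simp only [sineFn]; push_cast; ring
    rw [h2] at h1
    exact (mul_eq_zero.1 h1).resolve_left (Complex.ofReal_ne_zero.2 (hν i).ne')

end Sine

section Spectral

variable {L₁ L₂ : ℝ} {ι : Type*} {e : ι → V L₁ L₂} {s : ι → ℝ × ℝ → ℂ} {lam : ι → ℝ}

/-! ### Spectral calculus in the eigenbasis -/

theorem V.inner_eq (v w : V L₁ L₂) : inner ℂ v w =
    inner ℂ (fn v) (fn w) + (inner ℂ (dx v) (dx w) + inner ℂ (dy v) (dy w)) := by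
  rw [Submodule.coe_inner, PiLp.inner_apply, Fin.sum_univ_three, add_assoc]
  rfl

theorem V.inner_smul_left (c : ℂ) (v w : V L₁ L₂) : inner ℂ (c • v) w = conj c * inner ℂ v w :=
  _root_.inner_smul_left v w c

theorem V.inner_smul_right (c : ℂ) (v w : V L₁ L₂) : inner ℂ v (c • w) = c * inner ℂ v w :=
  _root_.inner_smul_right v w c

/-- The sum `∑ c_i e_i`. -/
def synth (e : ι → V L₁ L₂) (S : Finset ι) (c : ι → ℂ) : V L₁ L₂ := ∑ i ∈ S, c i • e i

theorem fn_synth (S : Finset ι) (c : ι → ℂ) : fn (synth e S c) = ∑ i ∈ S, c i • fn (e i) := by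
  exact map_sum (fnL L₁ L₂) (fun i => c i • e i) S

theorem ae_sum_eq (S : Finset ι) (c : ι → ℂ) (f : ι → H L₁ L₂) (h : ι → ℝ × ℝ → ℂ)
    (hf : ∀ i, f i =ᵐ[dom L₁ L₂] h i) :
    (∑ i ∈ S, c i • f i : H L₁ L₂) =ᵐ[dom L₁ L₂] fun x => ∑ i ∈ S, c i * h i x := by
  classical
  induction S using Finset.induction_on with
  | empty =>
    simp only [Finset.sum_empty]
    exact Lp.coeFn_zero _ _ _
  | insert a S ha ih =>
    rw [Finset.sum_insert ha]
    filter_upwards [Lp.coeFn_add (c a • f a) (∑ i ∈ S, c i • f i), Lp.coeFn_smul (c a) (f a), hf a,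
      ih] with x h1 h2 h3 h4
    rw [h1, Pi.add_apply, h2, Pi.smul_apply, h3, h4, Finset.sum_insert ha, smul_eq_mul]

/-- The pointwise version of `synth`. -/
def synthFn (s : ι → ℝ × ℝ → ℂ) (S : Finset ι) (c : ι → ℂ) (x : ℝ × ℝ) : ℂ :=
  ∑ i ∈ S, c i * s i x

theorem contDiff_synthFn (hs : ∀ i, ContDiff ℝ ∞ (s i)) (S : Finset ι) (c : ι → ℂ) :
    ContDiff ℝ ∞ (synthFn s S c) :=
  ContDiff.sum fun i _ => contDiff_const.mul (hs i)

theorem fderiv_synthFn (hs : ∀ i, ContDiff ℝ ∞ (s i)) (S : Finset ι) (c : ι → ℂ) (x v : ℝ × ℝ) :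
    fderiv ℝ (synthFn s S c) x v = ∑ i ∈ S, c i * fderiv ℝ (s i) x v := by
  have h : HasFDerivAt (synthFn s S c) (∑ i ∈ S, c i • fderiv ℝ (s i) x) x :=
    HasFDerivAt.fun_sum fun i _ => ((hs i).differentiable (by simp) x).hasFDerivAt.const_mul (c i)
  rw [h.fderiv]
  simp

namespace IsEigenbasis

variable (he : IsEigenbasis e s lam)
include he

theorem vanishes_synthFn (S : Finset ι) (c : ι → ℂ) : Vanishes L₁ L₂ (synthFn s S c) where
  smooth := contDiff_synthFn (fun i => (he.vanishes i).smooth) S c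
  zero p hp := Finset.sum_eq_zero fun i _ => by rw [(he.vanishes i).zero p hp, mul_zero]

theorem synth_ae (S : Finset ι) (c : ι → ℂ) : fn (synth e S c) =ᵐ[dom L₁ L₂] synthFn s S c ∧
    dx (synth e S c) =ᵐ[dom L₁ L₂] d₁ (synthFn s S c) ∧
    dy (synth e S c) =ᵐ[dom L₁ L₂] d₂ (synthFn s S c) := by
  have hs := fun i => (he.vanishes i).smooth
  refine ⟨?_, ?_, ?_⟩
  · rw [fn_synth]; exact ae_sum_eq S c _ _ he.fn_ae
  · have h1 : dx (synth e S c) = ∑ i ∈ S, c i • dx (e i) := by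
      exact map_sum (dxL L₁ L₂) (fun i => c i • e i) S
    have h2 : d₁ (synthFn s S c) = fun x => ∑ i ∈ S, c i * d₁ (s i) x :=
      funext fun x => fderiv_synthFn hs S c x _
    rw [h1, h2]; exact ae_sum_eq S c _ _ he.dx_ae
  · have h1 : dy (synth e S c) = ∑ i ∈ S, c i • dy (e i) := by
      exact map_sum (dyL L₁ L₂) (fun i => c i • e i) S
    have h2 : d₂ (synthFn s S c) = fun x => ∑ i ∈ S, c i * d₂ (s i) x :=
      funext fun x => fderiv_synthFn hs S c x _
    rw [h1, h2]; exact ae_sum_eq S c _ _ he.dy_ae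

theorem laplace_synthFn (S : Finset ι) (c : ι → ℂ) (x : ℝ × ℝ) :
    d₁ (d₁ (synthFn s S c)) x + d₂ (d₂ (synthFn s S c)) x =
      -synthFn s S (fun i => lam i * c i) x := by
  have hs := fun i => (he.vanishes i).smooth
  have h1 : d₁ (synthFn s S c) = synthFn (fun i => d₁ (s i)) S c :=
    funext fun x => fderiv_synthFn hs S c x _
  have h2 : d₂ (synthFn s S c) = synthFn (fun i => d₂ (s i)) S c :=
    funext fun x => fderiv_synthFn hs S c x _
  have h3 : d₁ (synthFn (fun i => d₁ (s i)) S c) x = ∑ i ∈ S, c i * d₁ (d₁ (s i)) x :=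
    fderiv_synthFn (fun i => contDiff_d₁ (hs i)) S c x _
  have h4 : d₂ (synthFn (fun i => d₂ (s i)) S c) x = ∑ i ∈ S, c i * d₂ (d₂ (s i)) x :=
    fderiv_synthFn (fun i => contDiff_d₂ (hs i)) S c x _
  rw [h1, h2, h3, h4, ← Finset.sum_add_distrib, synthFn, ← Finset.sum_neg_distrib]
  refine Finset.sum_congr rfl fun i _ => ?_
  rw [← mul_add, he.laplace]; ring

/-- Green's formula for a finite sum of eigenfunctions. -/
theorem green (S : Finset ι) (c : ι → ℂ) (w : V L₁ L₂) :
    inner ℂ (dx (synth e S c)) (dx w) + inner ℂ (dy (synth e S c)) (dy w) =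
      inner ℂ (fn (synth e S fun i => lam i * c i)) (fn w) := by
  obtain ⟨-, h1, h2⟩ := he.synth_ae S c
  obtain ⟨h0, -, -⟩ := he.synth_ae S fun i => lam i * c i
  have hs := (he.vanishes_synthFn S c).smooth
  have c1 : Continuous fun x => conj (d₁ (d₁ (synthFn s S c)) x) :=
    Complex.continuous_conj.comp (contDiff_d₁ (contDiff_d₁ hs)).continuous
  have c2 : Continuous fun x => conj (d₂ (d₂ (synthFn s S c)) x) :=
    Complex.continuous_conj.comp (contDiff_d₂ (contDiff_d₂ hs)).continuous
  rw [inner_dx_eq hs h1, inner_dy_eq hs h2, H.inner_eq_integral _ _ h0, ← neg_add,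
    ← integral_add (integrable_mul_dom _ c1) (integrable_mul_dom _ c2), ← integral_neg]
  refine integral_congr_ae (ae_of_all _ fun x => ?_)
  simp only
  rw [← mul_add, ← map_add, he.laplace_synthFn, map_neg, mul_neg, neg_neg]

theorem green_single (i : ι) (w : V L₁ L₂) : inner ℂ (dx (e i)) (dx w) + inner ℂ (dy (e i)) (dy w) =
    lam i * inner ℂ (fn (e i)) (fn w) := by
  have h := he.green {i} 1 w
  simp only [synth, Finset.sum_singleton, Pi.one_apply, one_smul, mul_one, fn_smul,
    inner_smul_left, Complex.conj_ofReal] at h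
  exact h

/-- Consequently the eigenfunctions are orthogonal in V as well, with squared norms 1 + lam i, and
truncating the expansion is a projection for both inner products. -/
theorem inner_single (i : ι) (w : V L₁ L₂) :
    inner ℂ (e i) w = (1 + lam i : ℝ) * inner ℂ (fn (e i)) (fn w) := by
  rw [V.inner_eq, he.green_single]; push_cast; ring

theorem inner_fn_synth (S : Finset ι) (c : ι → ℂ) {i : ι} (hi : i ∈ S) :
    inner ℂ (fn (e i)) (fn (synth e S c)) = c i := by
  rw [fn_synth, he.orthonormal.inner_right_sum _ hi]

theorem norm_fn_synth (S : Finset ι) (c : ι → ℂ) :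
    ‖fn (synth e S c)‖ ^ 2 = ∑ i ∈ S, ‖c i‖ ^ 2 := by
  have h := he.orthonormal.inner_sum c c S
  rw [← fn_synth, inner_self_eq_norm_sq_to_K] at h
  have h2 : ((‖fn (synth e S c)‖ ^ 2 : ℝ) : ℂ) = ((∑ i ∈ S, ‖c i‖ ^ 2 : ℝ) : ℂ) := by
    push_cast
    refine h.trans (Finset.sum_congr rfl fun i _ => ?_)
    rw [mul_comm, Complex.mul_conj, Complex.normSq_eq_norm_sq]; push_cast; rfl
  exact_mod_cast h2

theorem inner_fn_lapl (S : Finset ι) (c : ι → ℂ) :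
    inner ℂ (fn (synth e S fun i => lam i * c i)) (fn (synth e S c)) =
      ((∑ i ∈ S, lam i * ‖c i‖ ^ 2 : ℝ) : ℂ) := by
  have h := he.orthonormal.inner_sum (fun i => lam i * c i) c S
  rw [fn_synth, fn_synth, h]
  push_cast
  refine Finset.sum_congr rfl fun i _ => ?_
  rw [map_mul, Complex.conj_ofReal, mul_assoc, mul_comm (conj (c i)), Complex.mul_conj,
    Complex.normSq_eq_norm_sq]
  push_cast; rfl

theorem gr_synth (S : Finset ι) (c : ι → ℂ) :
    gr (synth e S c) = ∑ i ∈ S, lam i * ‖c i‖ ^ 2 := by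
  have h := he.green S c (synth e S c)
  rw [he.inner_fn_lapl, inner_self_eq_norm_sq_to_K, inner_self_eq_norm_sq_to_K] at h
  have h2 : ((gr (synth e S c) : ℝ) : ℂ) = ((∑ i ∈ S, lam i * ‖c i‖ ^ 2 : ℝ) : ℂ) := by
    rw [← h]; unfold gr; push_cast; rfl
  exact Complex.ofReal_inj.1 h2

theorem norm_synth (S : Finset ι) (c : ι → ℂ) :
    ‖synth e S c‖ ^ 2 = ∑ i ∈ S, (1 + lam i) * ‖c i‖ ^ 2 := by
  rw [norm_sq_eq, he.norm_fn_synth, he.gr_synth, ← Finset.sum_add_distrib]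
  exact Finset.sum_congr rfl fun i _ => by ring

/-- Every element of `V` is the sum of its eigenfunction expansion, in `V`. -/
theorem hasSum (w : V L₁ L₂) : HasSum (fun i => inner ℂ (fn (e i)) (fn w) • e i) w := by
  classical
  have hpos : ∀ i, 0 < 1 + lam i := fun i => by have := he.pos i; linarith
  -- With these factors the e i become orthonormal in V, and `complete` makes them a Hilbert basis
  -- of V. In its expansion the factors cancel against 1 + lam i and leave the H-coefficients.
  set ν : ι → ℝ := fun i => (√(1 + lam i))⁻¹
  have hν2 : ∀ i, ν i * ν i = (1 + lam i)⁻¹ := fun i => by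
    simp only [ν]; rw [← mul_inv, Real.mul_self_sqrt (hpos i).le]
  have hon : Orthonormal ℂ fun i => (ν i : ℂ) • e i := by
    rw [orthonormal_iff_ite]
    intro i j
    have h1 := orthonormal_iff_ite.1 he.orthonormal i j
    rw [V.inner_smul_left, V.inner_smul_right, he.inner_single, h1, Complex.conj_ofReal]
    split_ifs with h
    · subst h
      rw [mul_one, ← mul_assoc, ← Complex.ofReal_mul, hν2, ← Complex.ofReal_mul,
        inv_mul_cancel₀ (hpos i).ne', Complex.ofReal_one]
    · simp
  have hbot : (Submodule.span ℂ (range fun i => (ν i : ℂ) • e i))ᗮ = ⊥ := by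
    rw [Submodule.eq_bot_iff]
    intro w hw
    refine he.complete w fun i => ?_
    have h1 : inner ℂ ((ν i : ℂ) • e i) w = 0 := hw _ (Submodule.subset_span ⟨i, rfl⟩)
    rw [V.inner_smul_left, he.inner_single] at h1
    have hν : (ν i : ℂ) ≠ 0 := by
      simp only [ν]
      exact Complex.ofReal_ne_zero.2 (inv_ne_zero (Real.sqrt_pos.2 (hpos i)).ne')
    rw [Complex.conj_ofReal] at h1
    exact (mul_eq_zero.1 ((mul_eq_zero.1 h1).resolve_left hν)).resolve_left
      (Complex.ofReal_ne_zero.2 (hpos i).ne')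
  have h := (HilbertBasis.mkOfOrthogonalEqBot hon hbot).hasSum_repr w
  refine h.congr_fun fun i => ?_
  rw [HilbertBasis.repr_apply_apply, HilbertBasis.coe_mkOfOrthogonalEqBot]
  simp only
  rw [V.inner_smul_left, he.inner_single, smul_smul, Complex.conj_ofReal]
  congr 1
  have : ((ν i : ℂ)) * ((1 + lam i : ℝ) : ℂ) * (ν i : ℂ) = 1 := by
    rw [mul_right_comm, ← Complex.ofReal_mul, hν2, ← Complex.ofReal_mul,
      inv_mul_cancel₀ (hpos i).ne', Complex.ofReal_one]
  linear_combination (-inner ℂ (fn (e i)) (fn w)) * this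

end IsEigenbasis

end Spectral

/-! ### The H¹ estimate: testing with the negative Laplacian -/

section VEstimate

variable {L₁ L₂ : ℝ} {ι : Type*} {e : ι → V L₁ L₂} {s : ι → ℝ × ℝ → ℂ} {lam : ι → ℝ} {σ : ℝ}

/-- The density of the form, tested with the negative Laplacian `y`, after integration by parts. -/
def densL (σ : ℝ) (q : Par) (z p₁ p₂ y : ℂ) : ℂ :=
  -q.P * (powD (2 * σ) z p₁ * conj p₁ + powD (2 * σ) z p₂ * conj p₂) +
    ((q.b₁ * p₁ + q.b₂ * p₂) * ((‖z‖ ^ 2 : ℝ) : ℂ) * conj y +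
    (q.a₁ * (powD 2 z p₁ * conj y) + q.a₂ * (powD 2 z p₂ * conj y)))

/-- By `re_powD_ge` the leading term is at most −mκ|z|^{2σ}|∇z|². The derivative terms are bounded
by a multiple of |z|²|∇z||y|; Young's inequality turns them into |y|²/2 and a multiple of |z|⁴|∇z|²,
and the quartic weight is absorbed because σ > 2. -/
theorem exists_re_densL_le (hσ : 2 < σ) {R : ℝ} (hR : 0 ≤ R) {β m : ℝ} (hm : 0 < m)
    (hκ : 0 < ellip (2 * σ) β) : ∃ K : ℝ, 0 ≤ K ∧ ∀ q : Par, q.Good β m R → ∀ z p₁ p₂ y : ℂ,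
      (densL σ q z p₁ p₂ y).re ≤ 1 / 2 * ‖y‖ ^ 2 + K * (‖p₁‖ ^ 2 + ‖p₂‖ ^ 2) := by
  set κ := ellip (2 * σ) β
  obtain ⟨C, hC, h4⟩ := pow_four_le (r := 2 * σ) (by linarith) (η := m * κ / (16 * R ^ 2 + 1))
    (by positivity)
  refine ⟨(16 * R ^ 2 + 1) * C, by positivity, fun q hq z p₁ p₂ y => ?_⟩
  obtain ⟨ϖ, hϖ, hP⟩ := hq.exists_P
  have hz : 0 ≤ ‖z‖ ^ (2 * σ) := by positivity
  have k1 : ∀ p : ℂ, (-q.P * (powD (2 * σ) z p * conj p)).re ≤ -(m * κ * ‖z‖ ^ (2 * σ) * ‖p‖ ^ 2) := by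
    intro p
    have h := re_powD_ge (r := 2 * σ) (by linarith) β z p
    have e : -q.P * (powD (2 * σ) z p * conj p) =
        ((-ϖ : ℝ) : ℂ) * ((1 - Complex.I * β) * powD (2 * σ) z p * conj p) := by
      rw [hP]; push_cast; ring
    rw [e, Complex.re_ofReal_mul]
    have h1 : m * (κ * ‖z‖ ^ (2 * σ) * ‖p‖ ^ 2) ≤ ϖ * (κ * ‖z‖ ^ (2 * σ) * ‖p‖ ^ 2) := by gcongr
    have h2 := mul_le_mul_of_nonneg_left h (hm.le.trans hϖ)
    linarith
  have hpd : ∀ p : ℂ, ‖powD 2 z p‖ ≤ 3 * ‖z‖ ^ 2 * ‖p‖ := fun p => by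
    have := norm_powD_le (r := 2) (by norm_num) z p
    rw [Real.rpow_two] at this
    linarith
  have k2 : ((q.b₁ * p₁ + q.b₂ * p₂) * ((‖z‖ ^ 2 : ℝ) : ℂ) * conj y +
      (q.a₁ * (powD 2 z p₁ * conj y) + q.a₂ * (powD 2 z p₂ * conj y))).re ≤
      4 * R * ‖z‖ ^ 2 * (‖p₁‖ + ‖p₂‖) * ‖y‖ := by
    refine (Complex.re_le_norm _).trans ?_
    have n1 : ‖(q.b₁ * p₁ + q.b₂ * p₂) * ((‖z‖ ^ 2 : ℝ) : ℂ) * conj y‖ ≤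
        (R * ‖p₁‖ + R * ‖p₂‖) * ‖z‖ ^ 2 * ‖y‖ := by
      rw [norm_mul, norm_mul, Complex.norm_conj, Complex.norm_real,
        Real.norm_of_nonneg (by positivity)]
      gcongr
      refine (norm_add_le _ _).trans ?_
      rw [norm_mul, norm_mul]
      have := hq.bdd.b₁
      have := hq.bdd.b₂
      gcongr
    have n2 : ‖q.a₁ * (powD 2 z p₁ * conj y)‖ ≤ R * (3 * ‖z‖ ^ 2 * ‖p₁‖ * ‖y‖) := by
      rw [norm_mul, norm_mul, Complex.norm_conj]
      have := hq.bdd.a₁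
      have := hpd p₁
      gcongr
    have n3 : ‖q.a₂ * (powD 2 z p₂ * conj y)‖ ≤ R * (3 * ‖z‖ ^ 2 * ‖p₂‖ * ‖y‖) := by
      rw [norm_mul, norm_mul, Complex.norm_conj]
      have := hq.bdd.a₂
      have := hpd p₂
      gcongr
    have n4 := norm_add_le ((q.b₁ * p₁ + q.b₂ * p₂) * ((‖z‖ ^ 2 : ℝ) : ℂ) * conj y)
      (q.a₁ * (powD 2 z p₁ * conj y) + q.a₂ * (powD 2 z p₂ * conj y))
    have n5 := norm_add_le (q.a₁ * (powD 2 z p₁ * conj y)) (q.a₂ * (powD 2 z p₂ * conj y))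
    linarith
  have k3 : 4 * R * ‖z‖ ^ 2 * (‖p₁‖ + ‖p₂‖) * ‖y‖ ≤
      1 / 2 * ‖y‖ ^ 2 + 8 * R ^ 2 * ‖z‖ ^ 4 * (‖p₁‖ + ‖p₂‖) ^ 2 := by
    nlinarith [sq_nonneg (‖y‖ - 4 * R * ‖z‖ ^ 2 * (‖p₁‖ + ‖p₂‖))]
  have k4 : 8 * R ^ 2 * ‖z‖ ^ 4 * (‖p₁‖ + ‖p₂‖) ^ 2 ≤
      (16 * R ^ 2 + 1) * ‖z‖ ^ 4 * (‖p₁‖ ^ 2 + ‖p₂‖ ^ 2) := by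
    have h1 : (‖p₁‖ + ‖p₂‖) ^ 2 ≤ 2 * (‖p₁‖ ^ 2 + ‖p₂‖ ^ 2) := by
      nlinarith [sq_nonneg (‖p₁‖ - ‖p₂‖)]
    calc _ ≤ 8 * R ^ 2 * ‖z‖ ^ 4 * (2 * (‖p₁‖ ^ 2 + ‖p₂‖ ^ 2)) := by gcongr
      _ = 16 * R ^ 2 * ‖z‖ ^ 4 * (‖p₁‖ ^ 2 + ‖p₂‖ ^ 2) := by ring
      _ ≤ _ := by gcongr; linarith
  have k5 : (16 * R ^ 2 + 1) * ‖z‖ ^ 4 * (‖p₁‖ ^ 2 + ‖p₂‖ ^ 2) ≤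
      (m * κ * ‖z‖ ^ (2 * σ) + (16 * R ^ 2 + 1) * C) * (‖p₁‖ ^ 2 + ‖p₂‖ ^ 2) := by
    have h1 := mul_le_mul_of_nonneg_left (h4 ‖z‖ (norm_nonneg _))
      (by positivity : 0 ≤ 16 * R ^ 2 + 1)
    have h2 : (16 * R ^ 2 + 1) * (m * κ / (16 * R ^ 2 + 1) * ‖z‖ ^ (2 * σ) + C) =
        m * κ * ‖z‖ ^ (2 * σ) + (16 * R ^ 2 + 1) * C := by field_simp
    rw [h2] at h1
    gcongr
  have k6 := k1 p₁
  have k7 := k1 p₂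
  unfold densL
  rw [Complex.add_re, mul_add (-q.P), Complex.add_re]
  linarith

theorem integrable_dom {f : ℝ × ℝ → ℂ} (hf : Continuous f) : Integrable f (dom L₁ L₂) :=
  (memLp_dom hf).integrable (by norm_num)

theorem integrable_mul_conj {f g : ℝ × ℝ → ℂ} (hf : Continuous f) (hg : Continuous g) :
    Integrable (fun x => f x * conj (g x)) (dom L₁ L₂) :=
  integrable_dom (hf.mul (Complex.continuous_conj.comp hg))

theorem continuous_powD_comp {u : ℝ × ℝ → ℂ} {r : ℝ} (hr : 1 < r) (hu : ContDiff ℝ ∞ u)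
    (v : ℝ × ℝ) : Continuous fun x => powD r (u x) (fderiv ℝ u x v) := by
  have h : Continuous fun x => fderiv ℝ (fun x => (‖u x‖ ^ r) • u x) x v :=
    ((contDiff_pow_smul hr hu).continuous_fderiv (by simp)).clm_apply continuous_const
  simpa only [fderiv_pow_smul hr hu] using h

theorem continuous_pw : Continuous (pw σ) ∨ σ < 0 := by
  rcases le_or_gt 0 σ with h | h
  · left
    unfold pw
    have : Continuous fun z : ℂ => ‖z‖ ^ (2 * σ) :=
      continuous_norm.rpow_const fun _ => Or.inr (by linarith)
    exact (Complex.continuous_ofReal.comp this).mul continuous_id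
  · exact Or.inr h

/-- The form tested with the negative Laplacian, after integration by parts. -/
theorem IsEigenbasis.form_lapl_eq (he : IsEigenbasis e s lam) (hσ : 2 < σ) (q : Par)
    (S : Finset ι) (c : ι → ℂ) :
    form σ q (synth e S c) (synth e S fun i => lam i * c i) =
      ∫ x, densL σ q (synthFn s S c x) (d₁ (synthFn s S c) x) (d₂ (synthFn s S c) x)
        (synthFn s S (fun i => lam i * c i) x) ∂(dom L₁ L₂) +
      (q.γ * (gr (synth e S c) : ℂ) -
        q.A * ((‖fn (synth e S fun i => lam i * c i)‖ ^ 2 : ℝ) : ℂ)) := by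
  set c' : ι → ℂ := fun i => lam i * c i
  set U := synthFn s S c
  set L := synthFn s S c'
  have hU : Vanishes L₁ L₂ U := he.vanishes_synthFn S c
  have hL : Vanishes L₁ L₂ L := he.vanishes_synthFn S c'
  obtain ⟨eu0, eu1, eu2⟩ := he.synth_ae S c
  obtain ⟨el0, el1, el2⟩ := he.synth_ae S c'
  have hlap : ∀ x, d₁ (d₁ U) x + d₂ (d₂ U) x = -L x := he.laplace_synthFn S c
  have cU := hU.smooth.continuous
  have cU1 := (contDiff_d₁ hU.smooth).continuous
  have cU2 := (contDiff_d₂ hU.smooth).continuous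
  have cL := hL.smooth.continuous
  have cL1 := (contDiff_d₁ hL.smooth).continuous
  have cL2 := (contDiff_d₂ hL.smooth).continuous
  have conjc : ∀ {f : ℝ × ℝ → ℂ}, Continuous f → Continuous fun x => conj (f x) := fun hf =>
    Complex.continuous_conj.comp hf
  have cpw : Continuous fun x => pw σ (U x) :=
    ((continuous_pw (σ := σ)).resolve_right (by linarith)).comp cU
  have ccu : Continuous fun x => cu (U x) := by unfold cu; fun_prop
  have cb : Continuous fun x => (q.b₁ * d₁ U x + q.b₂ * d₂ U x) * ((‖U x‖ ^ 2 : ℝ) : ℂ) := by fun_prop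
  have cP1 : Continuous fun x => powD (2 * σ) (U x) (d₁ U x) :=
    continuous_powD_comp (by linarith) hU.smooth _
  have cP2 : Continuous fun x => powD (2 * σ) (U x) (d₂ U x) :=
    continuous_powD_comp (by linarith) hU.smooth _
  have cQ1 : Continuous fun x => powD 2 (U x) (d₁ U x) :=
    continuous_powD_comp (by norm_num) hU.smooth _
  have cQ2 : Continuous fun x => powD 2 (U x) (d₂ U x) :=
    continuous_powD_comp (by norm_num) hU.smooth _
  have j1 : Integrable (fun x => pw σ (U x) * conj (L x)) (dom L₁ L₂) :=
    integrable_dom (cpw.mul (conjc cL))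
  have j2 : Integrable (fun x => U x * conj (L x)) (dom L₁ L₂) := integrable_dom (cU.mul (conjc cL))
  have j3 : Integrable (fun x => (q.b₁ * d₁ U x + q.b₂ * d₂ U x) * ((‖U x‖ ^ 2 : ℝ) : ℂ) *
    conj (L x)) (dom L₁ L₂) := integrable_dom (cb.mul (conjc cL))
  have j4 : Integrable (fun x => d₁ U x * conj (d₁ L x) + d₂ U x * conj (d₂ L x)) (dom L₁ L₂) :=
    integrable_dom ((cU1.mul (conjc cL1)).add (cU2.mul (conjc cL2)))
  have j5 : Integrable (fun x => cu (U x) * conj (d₁ L x)) (dom L₁ L₂) :=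
    integrable_dom (ccu.mul (conjc cL1))
  have j6 : Integrable (fun x => cu (U x) * conj (d₂ L x)) (dom L₁ L₂) :=
    integrable_dom (ccu.mul (conjc cL2))
  have j7 : Integrable (fun x => powD (2 * σ) (U x) (d₁ U x) * conj (d₁ U x) +
      powD (2 * σ) (U x) (d₂ U x) * conj (d₂ U x)) (dom L₁ L₂) :=
    integrable_dom ((cP1.mul (conjc cU1)).add (cP2.mul (conjc cU2)))
  have j8 : Integrable (fun x => powD 2 (U x) (d₁ U x) * conj (L x)) (dom L₁ L₂) :=
    integrable_dom (cQ1.mul (conjc cL))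
  have j9 : Integrable (fun x => powD 2 (U x) (d₂ U x) * conj (L x)) (dom L₁ L₂) :=
    integrable_dom (cQ2.mul (conjc cL))
  -- As L = −ΔU for a finite sum of eigenfunctions, this is an integration by parts of |U|^{2σ}U
  -- against ΔU; there is no boundary term because U vanishes on the boundary.
  have e1 : ∫ x, pw σ (U x) * conj (L x) ∂(dom L₁ L₂) =
      ∫ x, (powD (2 * σ) (U x) (d₁ U x) * conj (d₁ U x) +
        powD (2 * σ) (U x) (d₂ U x) * conj (d₂ U x)) ∂(dom L₁ L₂) := by
    have p1 := hU.integral_powD (r := 2 * σ) (by linarith) (1, 0) (contDiff_conj (contDiff_d₁ hU.smooth))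
    have p2 := hU.integral_powD (r := 2 * σ) (by linarith) (0, 1) (contDiff_conj (contDiff_d₂ hU.smooth))
    have q1 : ∫ x, pw σ (U x) * conj (d₁ (d₁ U) x) ∂(dom L₁ L₂) =
        -∫ x, powD (2 * σ) (U x) (d₁ U x) * conj (d₁ U x) ∂(dom L₁ L₂) := by
      refine Eq.trans (integral_congr_ae (ae_of_all _ fun x => ?_)) p1
      simp only; rw [pw_eq, ← d₁_conj]; rfl
    have q2 : ∫ x, pw σ (U x) * conj (d₂ (d₂ U) x) ∂(dom L₁ L₂) =
        -∫ x, powD (2 * σ) (U x) (d₂ U x) * conj (d₂ U x) ∂(dom L₁ L₂) := by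
      refine Eq.trans (integral_congr_ae (ae_of_all _ fun x => ?_)) p2
      simp only; rw [pw_eq, ← d₂_conj]; rfl
    rw [integral_add (integrable_mul_conj cP1 cU1) (integrable_mul_conj cP2 cU2),
      ← neg_inj, neg_add, ← q1, ← q2, ← integral_add
      (integrable_mul_conj cpw (contDiff_d₁ (contDiff_d₁ hU.smooth)).continuous)
      (integrable_mul_conj cpw (contDiff_d₂ (contDiff_d₂ hU.smooth)).continuous),
      ← integral_neg]
    refine integral_congr_ae (ae_of_all _ fun x => ?_)
    simp only
    rw [← mul_add, ← map_add, hlap, map_neg, mul_neg]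
  have e2 : ∫ x, U x * conj (L x) ∂(dom L₁ L₂) = (gr (synth e S c) : ℂ) := by
    rw [he.gr_synth, ← he.inner_fn_lapl, H.inner_eq_integral _ _ el0]
    refine integral_congr_ae ?_
    filter_upwards [eu0] with x hx
    rw [hx]
  have e4 : ∫ x, (d₁ U x * conj (d₁ L x) + d₂ U x * conj (d₂ L x)) ∂(dom L₁ L₂) =
      ((‖fn (synth e S c')‖ ^ 2 : ℝ) : ℂ) := by
    have h := congrArg conj (he.green S c (synth e S c'))
    rw [map_add, inner_conj_symm, inner_conj_symm, inner_conj_symm, inner_self_eq_norm_sq_to_K,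
      H.inner_eq_integral _ _ el1, H.inner_eq_integral _ _ el2] at h
    rw [integral_add (integrable_mul_conj cU1 cL1) (integrable_mul_conj cU2 cL2)]
    push_cast
    refine Eq.trans ?_ h
    congr 1
    · refine integral_congr_ae ?_
      filter_upwards [eu1] with x hx
      rw [hx]
    · refine integral_congr_ae ?_
      filter_upwards [eu2] with x hx
      rw [hx]
  have e5 : ∫ x, cu (U x) * conj (d₁ L x) ∂(dom L₁ L₂) =
      -∫ x, powD 2 (U x) (d₁ U x) * conj (L x) ∂(dom L₁ L₂) := by
    refine Eq.trans (integral_congr_ae (ae_of_all _ fun x => ?_))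
      (hU.integral_powD (r := 2) (by norm_num) (1, 0) (contDiff_conj hL.smooth))
    simp only; rw [cu_eq, ← d₁_conj]; rfl
  have e6 : ∫ x, cu (U x) * conj (d₂ L x) ∂(dom L₁ L₂) =
      -∫ x, powD 2 (U x) (d₂ U x) * conj (L x) ∂(dom L₁ L₂) := by
    refine Eq.trans (integral_congr_ae (ae_of_all _ fun x => ?_))
      (hU.integral_powD (r := 2) (by norm_num) (0, 1) (contDiff_conj hL.smooth))
    simp only; rw [cu_eq, ← d₂_conj]; rfl
  have hform : form σ q (synth e S c) (synth e S c') =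
      ∫ x, ((-q.P * (pw σ (U x) * conj (L x)) + q.γ * (U x * conj (L x))) +
        ((q.b₁ * d₁ U x + q.b₂ * d₂ U x) * ((‖U x‖ ^ 2 : ℝ) : ℂ) * conj (L x) +
        -q.A * (d₁ U x * conj (d₁ L x) + d₂ U x * conj (d₂ L x))) +
        (-q.a₁ * (cu (U x) * conj (d₁ L x)) + -q.a₂ * (cu (U x) * conj (d₂ L x)))) ∂(dom L₁ L₂) := by
    unfold form
    refine integral_congr_ae ?_
    filter_upwards [eu0, eu1, eu2, el0, el1, el2] with x h1 h2 h3 h4 h5 h6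
    rw [h1, h2, h3, h4, h5, h6]
    simp only [dens, n₀, fl]
    ring
  have hdens : ∫ x, densL σ q (U x) (d₁ U x) (d₂ U x) (L x) ∂(dom L₁ L₂) =
      -q.P * (∫ x, (powD (2 * σ) (U x) (d₁ U x) * conj (d₁ U x) +
        powD (2 * σ) (U x) (d₂ U x) * conj (d₂ U x)) ∂(dom L₁ L₂)) +
      (∫ x, (q.b₁ * d₁ U x + q.b₂ * d₂ U x) * ((‖U x‖ ^ 2 : ℝ) : ℂ) * conj (L x) ∂(dom L₁ L₂) +
      (q.a₁ * ∫ x, powD 2 (U x) (d₁ U x) * conj (L x) ∂(dom L₁ L₂) +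
        q.a₂ * ∫ x, powD 2 (U x) (d₂ U x) * conj (L x) ∂(dom L₁ L₂))) := by
    have k1 : Integrable (fun x => q.a₁ * (powD 2 (U x) (d₁ U x) * conj (L x)) +
      q.a₂ * (powD 2 (U x) (d₂ U x) * conj (L x))) (dom L₁ L₂) :=
      (j8.const_mul _).add (j9.const_mul _)
    have k2 : Integrable (fun x => (q.b₁ * d₁ U x + q.b₂ * d₂ U x) * ((‖U x‖ ^ 2 : ℝ) : ℂ) *
      conj (L x) + (q.a₁ * (powD 2 (U x) (d₁ U x) * conj (L x)) +
      q.a₂ * (powD 2 (U x) (d₂ U x) * conj (L x)))) (dom L₁ L₂) := j3.add k1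
    unfold densL
    rw [integral_add (j7.const_mul _) k2, integral_add j3 k1, integral_add (j8.const_mul _)
      (j9.const_mul _), integral_const_mul, integral_const_mul, integral_const_mul]
  have k1 : Integrable (fun x => -q.P * (pw σ (U x) * conj (L x)) + q.γ * (U x * conj (L x)))
    (dom L₁ L₂) := (j1.const_mul _).add (j2.const_mul _)
  have k2 : Integrable (fun x => (q.b₁ * d₁ U x + q.b₂ * d₂ U x) * ((‖U x‖ ^ 2 : ℝ) : ℂ) *
    conj (L x) + -q.A * (d₁ U x * conj (d₁ L x) + d₂ U x * conj (d₂ L x))) (dom L₁ L₂) :=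
    j3.add (j4.const_mul _)
  have k3 : Integrable (fun x => -q.a₁ * (cu (U x) * conj (d₁ L x)) +
    -q.a₂ * (cu (U x) * conj (d₂ L x))) (dom L₁ L₂) := (j5.const_mul _).add (j6.const_mul _)
  have k12 : Integrable (fun x => (-q.P * (pw σ (U x) * conj (L x)) + q.γ * (U x * conj (L x))) +
    ((q.b₁ * d₁ U x + q.b₂ * d₂ U x) * ((‖U x‖ ^ 2 : ℝ) : ℂ) * conj (L x) +
    -q.A * (d₁ U x * conj (d₁ L x) + d₂ U x * conj (d₂ L x)))) (dom L₁ L₂) := k1.add k2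
  rw [hform, hdens, integral_add k12 k3, integral_add k1 k2, integral_add (j1.const_mul _)
    (j2.const_mul _), integral_add j3 (j4.const_mul _), integral_add (j5.const_mul _)
    (j6.const_mul _), integral_const_mul, integral_const_mul, integral_const_mul, integral_const_mul,
    integral_const_mul, e1, e2, e4, e5, e6]
  ring

/-- The `H¹` estimate for finite sums of eigenfunctions. -/
theorem exists_re_form_lapl_le (hσ : 2 < σ) {R : ℝ} (hR : 0 ≤ R) {β m : ℝ} (hm : 0 < m)
    (hκ : 0 < ellip (2 * σ) β) (he : IsEigenbasis e s lam) : ∃ K : ℝ, 0 ≤ K ∧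
      ∀ q : Par, q.Good β m R → ∀ (S : Finset ι) (c : ι → ℂ),
      (form σ q (synth e S c) (synth e S fun i => lam i * c i)).re ≤
        -(1 / 2) * ‖fn (synth e S fun i => lam i * c i)‖ ^ 2 + K * gr (synth e S c) := by
  obtain ⟨K, hK, h⟩ := exists_re_densL_le hσ hR hm hκ
  refine ⟨K + R, by positivity, fun q hq S c => ?_⟩
  rw [he.form_lapl_eq hσ]
  set c' : ι → ℂ := fun i => lam i * c i
  set U := synthFn s S c
  set L := synthFn s S c'
  have hU : Vanishes L₁ L₂ U := he.vanishes_synthFn S c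
  have hL : Vanishes L₁ L₂ L := he.vanishes_synthFn S c'
  obtain ⟨eu0, eu1, eu2⟩ := he.synth_ae S c
  obtain ⟨el0, el1, el2⟩ := he.synth_ae S c'
  have cU := hU.smooth.continuous
  have cU1 := (contDiff_d₁ hU.smooth).continuous
  have cU2 := (contDiff_d₂ hU.smooth).continuous
  have cL := hL.smooth.continuous
  have cP1 : Continuous fun x => powD (2 * σ) (U x) (d₁ U x) :=
    continuous_powD_comp (by linarith) hU.smooth _
  have cP2 : Continuous fun x => powD (2 * σ) (U x) (d₂ U x) :=
    continuous_powD_comp (by linarith) hU.smooth _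
  have cQ1 : Continuous fun x => powD 2 (U x) (d₁ U x) :=
    continuous_powD_comp (by norm_num) hU.smooth _
  have cQ2 : Continuous fun x => powD 2 (U x) (d₂ U x) :=
    continuous_powD_comp (by norm_num) hU.smooth _
  have hcd : Continuous fun x => densL σ q (U x) (d₁ U x) (d₂ U x) (L x) := by
    have conjc : ∀ {f : ℝ × ℝ → ℂ}, Continuous f → Continuous fun x => conj (f x) := fun hf =>
      Complex.continuous_conj.comp hf
    have := conjc cU1
    have := conjc cU2
    have := conjc cL
    unfold densL
    fun_prop
  have hid : Integrable (fun x => densL σ q (U x) (d₁ U x) (d₂ U x) (L x)) (dom L₁ L₂) :=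
    integrable_dom hcd
  have hfl : ∫ x, ‖L x‖ ^ 2 ∂(dom L₁ L₂) = ‖fn (synth e S c')‖ ^ 2 := by
    rw [H.norm_sq_eq]
    refine integral_congr_ae ?_
    filter_upwards [el0] with x hx
    rw [hx]
  have hgr : ∫ x, (‖d₁ U x‖ ^ 2 + ‖d₂ U x‖ ^ 2) ∂(dom L₁ L₂) = gr (synth e S c) := by
    rw [gr_eq_integral]
    refine integral_congr_ae ?_
    filter_upwards [eu1, eu2] with x h1 h2
    rw [h1, h2]
  have hiL : Integrable (fun x => ‖L x‖ ^ 2) (dom L₁ L₂) := (memLp_dom cL).integrable_norm_pow (by simp)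
  have hiU : Integrable (fun x => ‖d₁ U x‖ ^ 2 + ‖d₂ U x‖ ^ 2) (dom L₁ L₂) :=
    ((memLp_dom cU1).integrable_norm_pow (by simp)).add
      ((memLp_dom cU2).integrable_norm_pow (by simp))
  have hmain : (∫ x, densL σ q (U x) (d₁ U x) (d₂ U x) (L x) ∂(dom L₁ L₂)).re ≤
      1 / 2 * ‖fn (synth e S c')‖ ^ 2 + K * gr (synth e S c) := by
    rw [← RCLike.re_eq_complex_re, ← integral_re hid, ← hfl, ← hgr, ← integral_const_mul,
      ← integral_const_mul, ← integral_add (hiL.const_mul _) (hiU.const_mul _)]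
    exact integral_mono hid.re ((hiL.const_mul _).add (hiU.const_mul _)) fun x => h q hq _ _ _ _
  rw [Complex.add_re, Complex.sub_re, Complex.re_mul_ofReal, Complex.re_mul_ofReal, hq.re_A]
  have hγ : q.γ.re * gr (synth e S c) ≤ R * gr (synth e S c) :=
    mul_le_mul_of_nonneg_right ((Complex.re_le_norm _).trans hq.bdd.γ) (gr_nonneg _)
  linarith

end VEstimate

/-! ### Differential inequalities and global solutions of ordinary differential equations -/

section ODE

variable {E : Type*} [NormedAddCommGroup E] [InnerProductSpace ℂ E] [NormedSpace ℝ E]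

theorem hasDerivWithinAt_norm_sq {u : ℝ → E} {u' : E} {s : Set ℝ} {t : ℝ}
    (h : HasDerivWithinAt u u' s t) :
    HasDerivWithinAt (fun t => ‖u t‖ ^ 2) (2 * (inner ℂ (u t) u').re) s t := by
  have h1 := (h.inner ℂ h)
  have h2 := Complex.reCLM.hasFDerivAt.comp_hasDerivWithinAt t h1
  have e : (fun t => ‖u t‖ ^ 2) = Complex.reCLM ∘ fun t => inner ℂ (u t) (u t) := by
    funext t
    simp only [Function.comp_apply, Complex.reCLM_apply]
    exact (inner_self_eq_norm_sq (𝕜 := ℂ) (u t)).symm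
  rw [e]
  convert! h2 using 1
  rw [Complex.reCLM_apply, Complex.add_re, ← inner_conj_symm (𝕜 := ℂ) u' (u t), Complex.conj_re]
  ring

/-- A Gronwall estimate on `[0,T]`. -/
theorem le_mul_exp_of_hasDerivWithinAt {y y' : ℝ → ℝ} {T k : ℝ}
    (hy : ∀ t ∈ Icc 0 T, HasDerivWithinAt y (y' t) (Icc 0 T) t)
    (hle : ∀ t ∈ Icc 0 T, y' t ≤ k * y t) {t : ℝ} (ht : t ∈ Icc 0 T) :
    y t ≤ y 0 * Real.exp (k * t) := by
  have hd : ∀ t ∈ Icc 0 T, HasDerivWithinAt (fun t => y t * Real.exp (-(k * t)))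
      (y' t * Real.exp (-(k * t)) + y t * (Real.exp (-(k * t)) * -k)) (Icc 0 T) t := fun t ht => by
    have h1 : HasDerivAt (fun t => Real.exp (-(k * t))) (Real.exp (-(k * t)) * -k) t := by
      have := ((hasDerivAt_id t).const_mul k).neg.exp
      simpa using this
    exact (hy t ht).mul h1.hasDerivWithinAt
  have hanti : AntitoneOn (fun t => y t * Real.exp (-(k * t))) (Icc 0 T) := by
    refine antitoneOn_of_hasDerivWithinAt_nonpos (convex_Icc 0 T)
      (fun t ht => (hd t ht).continuousWithinAt)
      (fun t ht => (hd t (interior_subset ht)).mono interior_subset) fun t ht => ?_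
    have h1 := hle t (interior_subset ht)
    have h2 := Real.exp_pos (-(k * t))
    nlinarith
  have h := hanti (⟨le_rfl, ht.1.trans ht.2⟩ : (0 : ℝ) ∈ Icc 0 T) ht ht.1
  simp only [mul_zero, neg_zero, Real.exp_zero, mul_one] at h
  calc y t = y t * Real.exp (-(k * t)) * Real.exp (k * t) := by
        rw [mul_assoc, ← Real.exp_add]; simp
    _ ≤ _ := by gcongr

/-- A Lipschitz cutoff, one for `r ≤ M` and zero for `r ≥ 2M`. -/
def ramp (M r : ℝ) : ℝ := max 0 (min 1 (2 - r / M))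

theorem ramp_nonneg (M r : ℝ) : 0 ≤ ramp M r := le_max_left _ _

theorem ramp_le_one (M r : ℝ) : ramp M r ≤ 1 := max_le zero_le_one (min_le_left _ _)

theorem ramp_eq_one {M r : ℝ} (hM : 0 < M) (hr : r ≤ M) : ramp M r = 1 := by
  have : 1 ≤ 2 - r / M := by
    have := (div_le_one hM).2 hr
    linarith
  unfold ramp
  rw [min_eq_left this]; simp

theorem ramp_eq_zero {M r : ℝ} (hM : 0 < M) (hr : 2 * M ≤ r) : ramp M r = 0 := by
  have : 2 - r / M ≤ 0 := by
    have := (le_div_iff₀ hM).2 hr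
    linarith
  unfold ramp
  exact max_eq_left ((min_le_right _ _).trans this)

theorem abs_ramp_sub_le {M : ℝ} (hM : 0 < M) (r r' : ℝ) : |ramp M r - ramp M r'| ≤ |r - r'| / M := by
  have h1 : |ramp M r - ramp M r'| ≤ |(2 - r / M) - (2 - r' / M)| := by
    unfold ramp
    refine (abs_max_sub_max_le_max _ _ _ _).trans ?_
    rw [sub_self, abs_zero, max_eq_right (abs_nonneg _)]
    refine (abs_min_sub_min_le_max _ _ _ _).trans ?_
    rw [sub_self, abs_zero, max_eq_right (abs_nonneg _)]
  refine h1.trans (le_of_eq ?_)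
  rw [show (2 - r / M) - (2 - r' / M) = -((r - r') / M) by ring, abs_neg, abs_div, abs_of_pos hM]

/-- The difference of the cutoffs is multiplied by F at the point of smaller norm, where ‖F‖ ≤ 2MK
compensates the Lipschitz constant 1/M of the cutoff and gives 2K. The increment of F contributes
the remaining K. -/
theorem lipschitzWith_ramp_smul {E : Type*} [NormedAddCommGroup E] [NormedSpace ℝ E] {M K : ℝ} (hM : 0 < M) (hK : 0 ≤ K) {F : E → E} (h0 : F 0 = 0)
    (hF : ∀ u v, ‖u‖ ≤ 2 * M → ‖v‖ ≤ 2 * M → ‖F u - F v‖ ≤ K * ‖u - v‖) (u v : E) :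
    ‖ramp M ‖u‖ • F u - ramp M ‖v‖ • F v‖ ≤ 3 * K * ‖u - v‖ := by
  have hb : ∀ u, ‖u‖ ≤ 2 * M → ‖F u‖ ≤ K * (2 * M) := fun u hu => by
    have := hF u 0 hu (by simp; positivity)
    rw [h0, sub_zero, sub_zero] at this
    exact this.trans (by gcongr)
  wlog huv : ‖u‖ ≤ ‖v‖ generalizing u v
  · rw [norm_sub_rev, norm_sub_rev u]
    exact this v u (le_of_not_ge huv)
  have hr := abs_ramp_sub_le hM ‖u‖ ‖v‖
  have hr' : |ramp M ‖u‖ - ramp M ‖v‖| ≤ ‖u - v‖ / M :=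
    hr.trans (by gcongr; exact abs_norm_sub_norm_le u v)
  rcases le_or_gt (2 * M) ‖u‖ with hu | hu
  · rw [ramp_eq_zero hM hu, ramp_eq_zero hM (hu.trans huv)]
    simp; positivity
  have k1 : ‖(ramp M ‖u‖ - ramp M ‖v‖) • F u‖ ≤ 2 * K * ‖u - v‖ := by
    rw [norm_smul, Real.norm_eq_abs]
    calc _ ≤ ‖u - v‖ / M * (K * (2 * M)) := by gcongr; exact hb u hu.le
      _ = _ := by field_simp
  have k2 : ‖ramp M ‖v‖ • (F u - F v)‖ ≤ K * ‖u - v‖ := by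
    rcases le_or_gt (2 * M) ‖v‖ with hv | hv
    · rw [ramp_eq_zero hM hv]; simp; positivity
    · rw [norm_smul, Real.norm_of_nonneg (ramp_nonneg _ _)]
      calc _ ≤ 1 * (K * ‖u - v‖) := by
            gcongr
            · exact ramp_le_one _ _
            · exact hF u v hu.le hv.le
        _ = _ := one_mul _
  have e : ramp M ‖u‖ • F u - ramp M ‖v‖ • F v =
      (ramp M ‖u‖ - ramp M ‖v‖) • F u + ramp M ‖v‖ • (F u - F v) := by module
  rw [e]
  refine (norm_add_le _ _).trans ?_
  linarith

variable [CompleteSpace E]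

/-- Global existence for a locally Lipschitz equation with an a priori estimate on an invariant
subspace. -/
theorem exists_global_solution {F : ℝ → E → E} {T k : ℝ} (hT : 0 ≤ T) (hk : 0 ≤ k)
    (h0 : ∀ t, F t 0 = 0)
    (hF : ∀ M : ℝ, ∃ K : ℝ, 0 ≤ K ∧ ∀ t ∈ Icc 0 T, ∀ u v, ‖u‖ ≤ M → ‖v‖ ≤ M →
      ‖F t u - F t v‖ ≤ K * ‖u - v‖)
    (hc : ∀ u, ContinuousOn (fun t => F t u) (Icc 0 T)) (p : E →L[ℝ] E)
    (hp : ∀ t u, p (F t u) = F t u)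
    (hle : ∀ t ∈ Icc 0 T, ∀ u, p u = u → (inner ℂ u (F t u)).re ≤ k * ‖u‖ ^ 2) {u₀ : E}
    (hu₀ : p u₀ = u₀) : ∃ u : ℝ → E, u 0 = u₀ ∧
      (∀ t ∈ Icc 0 T, HasDerivWithinAt u (F t (u t)) (Icc 0 T) t) ∧
      (∀ t ∈ Icc 0 T, p (u t) = u t) ∧ ∀ t ∈ Icc 0 T, ‖u t‖ ≤ ‖u₀‖ * Real.exp (k * T) := by
  -- M exceeds the a priori bound, so the cutoff is inactive along the solution. The cut-off field
  -- is bounded and globally Lipschitz, hence Picard–Lindelöf reaches time T at once.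
  set M := ‖u₀‖ * Real.exp (k * T) + 1
  have hM : 0 < M := by positivity
  obtain ⟨K, hK, hFK⟩ := hF (2 * M)
  set G : ℝ → E → E := fun t u => ramp M ‖u‖ • F t u
  have hG : ∀ t ∈ Icc 0 T, ∀ u v, ‖G t u - G t v‖ ≤ 3 * K * ‖u - v‖ := fun t ht =>
    lipschitzWith_ramp_smul hM hK (h0 t) (hFK t ht)
  have hGb : ∀ t ∈ Icc 0 T, ∀ u, ‖G t u‖ ≤ K * (2 * M) := fun t ht u => by
    simp only [G]
    rcases le_or_gt (2 * M) ‖u‖ with hu | hu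
    · rw [ramp_eq_zero hM hu]; simp; positivity
    · rw [norm_smul, Real.norm_of_nonneg (ramp_nonneg _ _)]
      have h1 := hFK t ht u 0 hu.le (by simp; positivity)
      rw [h0, sub_zero, sub_zero] at h1
      calc _ ≤ 1 * (K * ‖u‖) := by gcongr; exact ramp_le_one _ _
        _ ≤ _ := by rw [one_mul]; gcongr
  have hPL : IsPicardLindelof G (⟨0, le_rfl, hT⟩ : Icc (0 : ℝ) T) u₀
      (⟨K * (2 * M) * T, by positivity⟩ : ℝ≥0) 0 ⟨K * (2 * M), by positivity⟩
      ⟨3 * K, by positivity⟩ := by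
    refine ⟨fun t ht => LipschitzWith.lipschitzOnWith ?_, fun x _ => ?_, fun t ht x _ => hGb t ht x, ?_⟩
    · refine LipschitzWith.of_dist_le_mul fun u v => ?_
      rw [dist_eq_norm, dist_eq_norm]
      exact hG t ht u v
    · exact (hc x).const_smul (ramp M ‖x‖)
    · simp [max_eq_left hT]
      exact le_rfl
  obtain ⟨u, hu0, hu⟩ := hPL.exists_eq_forall_mem_Icc_hasDerivWithinAt₀
  -- The a priori estimate is available only on the subspace fixed by p. Since p fixes the values of
  -- the field, p u − u has zero derivative and starts at zero.
  have hpu : ∀ t ∈ Icc 0 T, p (u t) = u t := by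
    have hd : ∀ t ∈ Icc 0 T, HasDerivWithinAt (fun t => p (u t) - u t) 0 (Icc 0 T) t :=
      fun t ht => by
        have h1 := (p.hasFDerivAt.comp_hasDerivWithinAt t (hu t ht)).sub (hu t ht)
        have h2 : p (G t (u t)) - G t (u t) = 0 := by
          simp only [G]
          rw [map_smul, hp, sub_self]
        rw [h2] at h1
        exact h1
    intro t ht
    have h := (convex_Icc 0 T).norm_image_sub_le_of_norm_hasDerivWithin_le (C := 0)
      (fun t ht => hd t ht) (fun t _ => by simp) (⟨le_rfl, hT⟩ : (0 : ℝ) ∈ Icc 0 T) ht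
    have hu0' : u 0 = u₀ := hu0
    rw [hu0', hu₀, sub_self, sub_zero, zero_mul] at h
    exact sub_eq_zero.1 (norm_le_zero_iff.1 h)
  have hn : ∀ t ∈ Icc 0 T, ‖u t‖ ≤ ‖u₀‖ * Real.exp (k * T) := by
    intro t ht
    have h := le_mul_exp_of_hasDerivWithinAt (y := fun t => ‖u t‖ ^ 2) (k := 2 * k)
      (fun t ht => hasDerivWithinAt_norm_sq (hu t ht)) (fun t ht => ?_) ht
    · have hu0' : u 0 = u₀ := hu0
      simp only [hu0'] at h
      have h2 : ‖u t‖ ^ 2 ≤ (‖u₀‖ * Real.exp (k * T)) ^ 2 := by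
        refine h.trans ?_
        rw [mul_pow, ← Real.exp_nat_mul]
        refine mul_le_mul_of_nonneg_left (Real.exp_le_exp.2 ?_) (sq_nonneg _)
        have := mul_le_mul_of_nonneg_left ht.2 hk
        push_cast
        linarith
      exact (pow_le_pow_iff_left₀ (norm_nonneg _) (by positivity) two_ne_zero).1 h2
    · have h1 := hle t ht (u t) (hpu t ht)
      have h2 : (inner ℂ (u t) (G t (u t))).re = ramp M ‖u t‖ * (inner ℂ (u t) (F t (u t))).re := by
        simp only [G]
        have : inner ℂ (u t) (ramp M ‖u t‖ • F t (u t)) =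
            ((ramp M ‖u t‖ : ℝ) : ℂ) * inner ℂ (u t) (F t (u t)) := by
          rw [← inner_smul_right]
          congr 1
          exact (algebraMap_smul ℂ (ramp M ‖u t‖) (F t (u t))).symm
        rw [this, Complex.re_ofReal_mul]
      rw [h2]
      have h3 : ramp M ‖u t‖ * (inner ℂ (u t) (F t (u t))).re ≤ k * ‖u t‖ ^ 2 := by
        calc _ ≤ ramp M ‖u t‖ * (k * ‖u t‖ ^ 2) :=
              mul_le_mul_of_nonneg_left h1 (ramp_nonneg _ _)
          _ ≤ 1 * (k * ‖u t‖ ^ 2) := by gcongr; exact ramp_le_one _ _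
          _ = _ := one_mul _
      linarith
  refine ⟨u, hu0, fun t ht => ?_, hpu, hn⟩
  have h1 := hu t ht
  simp only [G] at h1
  rwa [ramp_eq_one hM ((hn t ht).trans (by simp [M])), one_smul] at h1

end ODE

section Galerkin

variable {L₁ L₂ σ : ℝ} {ι : Type*} {e : ι → V L₁ L₂} {s : ι → ℝ × ℝ → ℂ} {lam : ι → ℝ}

/-! ### The Galerkin equations -/

/-- The coefficients of `w` in the eigenbasis. -/
def coef (e : ι → V L₁ L₂) (w : V L₁ L₂) (i : ι) : ℂ := inner ℂ (fn (e i)) (fn w)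

/-- The truncated eigenfunction expansion. -/
def trunc (e : ι → V L₁ L₂) (S : Finset ι) : V L₁ L₂ →L[ℂ] V L₁ L₂ :=
  ∑ i ∈ S, ((innerSL ℂ (fn (e i))).comp (fnL L₁ L₂)).smulRight (e i)

theorem trunc_apply (S : Finset ι) (w : V L₁ L₂) : trunc e S w = synth e S (coef e w) := by
  simp [trunc, synth, coef]

/-- The truncation of `-Δw`. -/
def lapl (e : ι → V L₁ L₂) (lam : ι → ℝ) (S : Finset ι) (w : V L₁ L₂) : V L₁ L₂ :=
  synth e S fun i => lam i * coef e w i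

theorem continuous_coef (i : ι) : Continuous fun w => coef e w i :=
  ((innerSL ℂ (fn (e i))).comp (fnL L₁ L₂)).continuous

theorem continuous_lapl (S : Finset ι) : Continuous (lapl e lam S) :=
  continuous_finsetSum _ fun i _ => (continuous_const.mul (continuous_coef i)).smul continuous_const

/-- The vector field of the Galerkin equations. -/
def galerkin (σ : ℝ) (e : ι → V L₁ L₂) (S : Finset ι) (q : Par) (u : V L₁ L₂) : V L₁ L₂ :=
  synth e S fun i => form σ q u (e i)

theorem form_synth (hσ : 2 < σ) (q : Par) (u : V L₁ L₂) (S : Finset ι) (c : ι → ℂ) :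
    form σ q u (synth e S c) = ∑ i ∈ S, conj (c i) * form σ q u (e i) := by
  rw [synth, form_sum_right hσ]
  exact Finset.sum_congr rfl fun i _ => form_smul_right q u _ _

/-- The truncation moves from the vector field to the test function: the Galerkin equation is the
weak equation tested in the span of S. -/
theorem inner_fn_galerkin (hσ : 2 < σ) (S : Finset ι) (q : Par) (u ψ : V L₁ L₂) :
    inner ℂ (fn ψ) (fn (galerkin σ e S q u)) = form σ q u (trunc e S ψ) := by
  rw [trunc_apply, form_synth hσ, galerkin, fn_synth, inner_sum]
  refine Finset.sum_congr rfl fun i _ => ?_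
  rw [inner_smul_right, coef, inner_conj_symm, mul_comm]

theorem norm_galerkin_sub_le {q : Par} {C : ℝ} {u v : V L₁ L₂} (S : Finset ι)
    (h : ∀ ψ : V L₁ L₂, ‖form σ q u ψ - form σ q v ψ‖ ≤ C * ‖u - v‖ * ‖ψ‖) :
    ‖galerkin σ e S q u - galerkin σ e S q v‖ ≤ (C * ∑ i ∈ S, ‖e i‖ ^ 2) * ‖u - v‖ := by
  unfold galerkin synth
  rw [← Finset.sum_sub_distrib, Finset.mul_sum, Finset.sum_mul]
  refine (norm_sum_le _ _).trans (Finset.sum_le_sum fun i _ => ?_)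
  rw [← sub_smul, norm_smul]
  calc _ ≤ C * ‖u - v‖ * ‖e i‖ * ‖e i‖ := by gcongr; exact h _
    _ = _ := by ring

namespace IsEigenbasis

variable (he : IsEigenbasis e s lam)
include he

theorem trunc_synth {S S' : Finset ι} (h : S' ⊆ S) (c : ι → ℂ) :
    trunc e S' (synth e S c) = synth e S' c := by
  rw [trunc_apply]
  refine Finset.sum_congr rfl fun i hi => ?_
  rw [coef, he.inner_fn_synth _ _ (h hi)]

/-- In V each e i carries the weight 1 + lam i, so the V inner product with w amounts to testing the
form with w − Δw. Coercivity controls the first part and the H¹ estimate the second. -/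
theorem inner_galerkin (hσ : 2 < σ) (S : Finset ι) (q : Par) (u w : V L₁ L₂) (hw : trunc e S w = w) :
    inner ℂ w (galerkin σ e S q u) = form σ q u w + form σ q u (lapl e lam S w) := by
  have h1 : form σ q u w = form σ q u (trunc e S w) := by rw [hw]
  rw [h1, trunc_apply, lapl, form_synth hσ, form_synth hσ, ← Finset.sum_add_distrib, galerkin, synth,
    inner_sum]
  refine Finset.sum_congr rfl fun i _ => ?_
  have h2 : inner ℂ w (e i) = conj (inner ℂ (e i) w) := (inner_conj_symm (𝕜 := ℂ) w (e i)).symm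
  rw [V.inner_smul_right, h2, he.inner_single, map_mul, Complex.conj_ofReal, map_mul,
    Complex.conj_ofReal, coef]
  push_cast
  ring

/-- The V-norm of the part of high frequency. -/
theorem norm_sub_trunc_le {S S' : Finset ι} (h : S' ⊆ S) {Λ : ℝ} (hΛ : 1 ≤ Λ)
    (hlam : ∀ i ∈ S, i ∉ S' → Λ ≤ lam i) {w : V L₁ L₂} (hw : trunc e S w = w) :
    ‖w - trunc e S' w‖ ≤ √(2 / Λ) * ‖fn (lapl e lam S w)‖ := by
  classical
  have h1 : w - trunc e S' w = synth e (S \ S') (coef e w) := by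
    have h2 : w = synth e S (coef e w) := by rw [← trunc_apply, hw]
    have h3 : synth e S (coef e w) = synth e (S \ S') (coef e w) + synth e S' (coef e w) :=
      (Finset.sum_sdiff h).symm
    rw [trunc_apply, sub_eq_iff_eq_add, ← h3, ← h2]
  refine (pow_le_pow_iff_left₀ (norm_nonneg _) (by positivity) two_ne_zero).1 ?_
  rw [mul_pow, Real.sq_sqrt (by positivity), h1, he.norm_synth, lapl, he.norm_fn_synth,
    Finset.mul_sum]
  -- Termwise, 1 + λ ≤ 2λ ≤ 2λ²/Λ for λ ≥ Λ ≥ 1.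
  refine (Finset.sum_le_sum fun i hi => ?_).trans
    (Finset.sum_le_sum_of_subset_of_nonneg Finset.sdiff_subset fun i _ _ => by positivity)
  obtain ⟨hi1, hi2⟩ := Finset.mem_sdiff.1 hi
  have hl := hlam i hi1 hi2
  rw [norm_mul, mul_pow, Complex.norm_real, Real.norm_eq_abs, sq_abs, ← mul_assoc]
  refine mul_le_mul_of_nonneg_right ?_ (sq_nonneg _)
  rw [div_mul_eq_mul_div, le_div_iff₀ (by linarith)]
  nlinarith

end IsEigenbasis

/-- Uniform estimates for the solutions of the Galerkin equations. -/
theorem exists_galerkin (hσ : 2 < σ) {R : ℝ} (hR : 0 ≤ R) {β m : ℝ} (hm : 0 < m)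
    (hκ : 0 < ellip (2 * σ) β) (he : IsEigenbasis e s lam) : ∃ k : ℝ, 0 ≤ k ∧
    ∀ q : ℝ → Par, (∀ t, (q t).Good β m R) →
      (∀ u ψ : V L₁ L₂, Continuous fun t => form σ (q t) u ψ) → ∀ T : ℝ, 0 ≤ T →
      ∀ (S : Finset ι) (u₀ : V L₁ L₂), trunc e S u₀ = u₀ → ∃ u : ℝ → V L₁ L₂, u 0 = u₀ ∧
      (∀ t ∈ Icc 0 T, HasDerivWithinAt u (galerkin σ e S (q t) (u t)) (Icc 0 T) t) ∧
      (∀ t ∈ Icc 0 T, trunc e S (u t) = u t) ∧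
      (∀ t ∈ Icc 0 T, ‖u t‖ ≤ ‖u₀‖ * Real.exp (k * T)) ∧
      ∫ t in (0 : ℝ)..T, ‖fn (lapl e lam S (u t))‖ ^ 2 ≤
        ‖u₀‖ ^ 2 + 2 * k * (‖u₀‖ * Real.exp (k * T)) ^ 2 * T := by
  obtain ⟨c, K₁, hc, hK₁, h₁⟩ := exists_re_form_self_le L₁ L₂ hσ hR hm hκ
  obtain ⟨K₂, hK₂, h₂⟩ := exists_re_form_lapl_le hσ hR hm hκ he
  refine ⟨K₁ + K₂, by positivity, fun q hq hqc T hT S u₀ hu₀ => ?_⟩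
  -- The dissipation −‖Δu‖²/2 is not needed for the bound in V. It is kept because its time integral
  -- controls the high frequencies in the Cauchy estimate.
  have hle : ∀ t, ∀ u, trunc e S u = u → (inner ℂ u (galerkin σ e S (q t) u)).re ≤
      (K₁ + K₂) * ‖u‖ ^ 2 - 1 / 2 * ‖fn (lapl e lam S u)‖ ^ 2 := fun t u hu => by
    rw [he.inner_galerkin hσ S _ _ _ hu, Complex.add_re]
    have a1 := h₁ (q t) (hq t) u
    have a2 := h₂ (q t) (hq t) S (coef e u)
    rw [← trunc_apply, hu] at a2
    have a3 : 0 ≤ ∫ x, ‖fn u x‖ ^ (2 * σ + 2) ∂(dom L₁ L₂) :=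
      integral_nonneg fun x => by positivity
    have a4 := mul_nonneg hc.le a3
    have a5 := gr_nonneg u
    have a6 := norm_sq_eq u
    have a7 := mul_nonneg hK₁ a5
    have a8 := mul_nonneg hK₂ (sq_nonneg ‖fn u‖)
    change _ + (form σ (q t) u (synth e S fun i => lam i * coef e u i)).re ≤ _
    unfold lapl
    rw [a6]
    linarith
  obtain ⟨u, hu0, hud, hup, hub⟩ := exists_global_solution (F := fun t u => galerkin σ e S (q t) u)
    (k := K₁ + K₂) hT (by positivity) (fun t => by
      unfold galerkin synth
      simp [form_zero_left])
    (fun M => by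
      obtain ⟨C, hC, h⟩ := exists_form_lip L₁ L₂ hσ hR M
      exact ⟨C * ∑ i ∈ S, ‖e i‖ ^ 2, by positivity, fun t _ u v hu hv =>
        norm_galerkin_sub_le S fun ψ => h _ (hq t).bdd u v ψ hu hv⟩)
    (fun u => (continuous_finsetSum _ fun i _ =>
      (hqc u (e i)).smul continuous_const).continuousOn)
    ((trunc e S).restrictScalars ℝ) (fun t u => by
      rw [ContinuousLinearMap.coe_restrictScalars']
      exact he.trunc_synth subset_rfl _)
    (fun t _ u hu => (hle t u hu).trans (by linarith [sq_nonneg ‖fn (lapl e lam S u)‖])) hu₀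
  have hcu : ContinuousOn u (Icc 0 T) := fun t ht => (hud t ht).continuousWithinAt
  refine ⟨u, hu0, hud, hup, hub, ?_⟩
  have hcl : ContinuousOn (fun t => ‖fn (lapl e lam S (u t))‖ ^ 2) (Icc 0 T) :=
    (((fnL L₁ L₂).continuous.comp (continuous_lapl S)).comp_continuousOn hcu).norm.pow 2
  set B := ‖u₀‖ * Real.exp ((K₁ + K₂) * T)
  have h := intervalIntegral.sub_le_integral_of_hasDeriv_right_of_le hT
    (g := fun t => ‖u t‖ ^ 2) (φ := fun t => 2 * (K₁ + K₂) * B ^ 2 - ‖fn (lapl e lam S (u t))‖ ^ 2)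
    (hcu.norm.pow 2)
    (fun t ht => (hasDerivWithinAt_norm_sq ((hud t (Ioo_subset_Icc_self ht)))).mono_of_mem_nhdsWithin
      (mem_nhdsWithin_of_mem_nhds (Icc_mem_nhds ht.1 ht.2)))
    ((continuousOn_const.sub hcl).integrableOn_Icc)
    (fun t ht => by
      have ht' := Ioo_subset_Icc_self ht
      have a1 := hle t (u t) (hup t ht')
      have a2 : ‖u t‖ ^ 2 ≤ B ^ 2 := by
        have := hub t ht'
        gcongr
      have a3 : (K₁ + K₂) * ‖u t‖ ^ 2 ≤ (K₁ + K₂) * B ^ 2 := by gcongr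
      linarith)
  rw [intervalIntegral.integral_sub intervalIntegrable_const
    (hcl.intervalIntegrable_of_Icc hT), intervalIntegral.integral_const] at h
  simp only [hu0, sub_zero, smul_eq_mul] at h
  have := sq_nonneg ‖u T‖
  linarith

end Galerkin

/-! ### Measurability of superpositions and joint continuity of the form -/

section Measurability

/-- Superposition with a Carathéodory function preserves measurability. -/
theorem aestronglyMeasurable_superposition {Ω X : Type*} [MeasurableSpace Ω] [TopologicalSpace X]
    {μ : Measure Ω} {Φ : Ω → X → ℂ} (hc : ∀ s, Continuous (Φ s))
    (hm : ∀ x, AEStronglyMeasurable (fun s => Φ s x) μ) {f : Ω → X}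
    (hf : AEStronglyMeasurable f μ) : AEStronglyMeasurable (fun s => Φ s (f s)) μ := by
  obtain ⟨g, hg, hfg⟩ := hf
  have hsimple : ∀ k : SimpleFunc Ω X, AEStronglyMeasurable (fun s => Φ s (k s)) μ := fun k => by
    have hu : (⋃ y : k.range, k ⁻¹' {(y : X)}) = univ := by
      refine eq_univ_of_forall fun s => mem_iUnion.2 ⟨⟨k s, k.mem_range_self s⟩, rfl⟩
    rw [← Measure.restrict_univ (μ := μ), ← hu, aestronglyMeasurable_iUnion_iff]
    intro y
    refine ((hm y).mono_measure Measure.restrict_le_self).congr ?_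
    filter_upwards [ae_restrict_mem (k.measurableSet_fiber y)] with s hs
    have : k s = y := hs
    rw [this]
  refine (aestronglyMeasurable_of_tendsto_ae atTop (fun n => hsimple (hg.approx n))
    (ae_of_all _ fun s => ((hc s).tendsto _).comp (hg.tendsto_approx s))).congr ?_
  filter_upwards [hfg] with s hs
  rw [hs]

theorem aestronglyMeasurable_superposition₂ {Ω X Y : Type*} [MeasurableSpace Ω] [TopologicalSpace X]
    [TopologicalSpace Y] {μ : Measure Ω} {Φ : Ω → X → Y → ℂ}
    (hc : ∀ s, Continuous fun p : X × Y => Φ s p.1 p.2)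
    (hm : ∀ x y, AEStronglyMeasurable (fun s => Φ s x y) μ) {f : Ω → X} {g : Ω → Y}
    (hf : AEStronglyMeasurable f μ) (hg : AEStronglyMeasurable g μ) :
    AEStronglyMeasurable (fun s => Φ s (f s) (g s)) μ :=
  aestronglyMeasurable_superposition (Φ := fun s (p : X × Y) => Φ s p.1 p.2) hc
    (fun p => hm p.1 p.2) (hf.prodMk hg)

variable {L₁ L₂ σ : ℝ}

theorem exists_norm_form_le_mul (L₁ L₂ : ℝ) (hσ : 2 < σ) {R : ℝ} (hR : 0 ≤ R) {M : ℝ} (hM : 0 ≤ M) :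
    ∃ C : ℝ, 0 ≤ C ∧ ∀ q : Par, q.Bdd R → ∀ u ψ : V L₁ L₂, ‖u‖ ≤ M →
      ‖form σ q u ψ‖ ≤ C * ‖ψ‖ := by
  obtain ⟨C, hC, h⟩ := exists_form_lip L₁ L₂ hσ hR M
  refine ⟨C * M, by positivity, fun q hq u ψ hu => ?_⟩
  have := h q hq u 0 ψ hu (by simpa using hM)
  rw [form_zero_left, sub_zero, sub_zero] at this
  exact this.trans (by gcongr)

theorem continuous_form (hσ : 2 < σ) (q : Par) :
    Continuous fun p : V L₁ L₂ × V L₁ L₂ => form σ q p.1 p.2 := by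
  obtain ⟨R, hR, hq⟩ := q.exists_bdd
  rw [continuous_iff_continuousAt]
  rintro ⟨u, ψ⟩
  obtain ⟨C, hC, h⟩ := exists_form_lip L₁ L₂ hσ hR (‖u‖ + 1)
  obtain ⟨C', hC', h'⟩ := exists_norm_form_le_mul L₁ L₂ hσ hR (norm_nonneg u)
  have hlim : Tendsto (fun p : V L₁ L₂ × V L₁ L₂ => C * ‖p.1 - u‖ * ‖p.2‖ + C' * ‖p.2 - ψ‖)
      (𝓝 (u, ψ)) (𝓝 0) := by
    have hcont : Continuous fun p : V L₁ L₂ × V L₁ L₂ =>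
        C * ‖p.1 - u‖ * ‖p.2‖ + C' * ‖p.2 - ψ‖ := by fun_prop
    have := hcont.tendsto (u, ψ)
    simpa using this
  rw [ContinuousAt, tendsto_iff_norm_sub_tendsto_zero]
  refine squeeze_zero' (Eventually.of_forall fun _ => norm_nonneg _) ?_ hlim
  have hev : ∀ᶠ p : V L₁ L₂ × V L₁ L₂ in 𝓝 (u, ψ), ‖p.1‖ < ‖u‖ + 1 :=
    (continuous_fst.norm.tendsto (u, ψ)).eventually_lt_const (lt_add_one _)
  filter_upwards [hev] with p hp
  have e : form σ q p.1 p.2 - form σ q u ψ =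
      (form σ q p.1 p.2 - form σ q u p.2) + form σ q u (p.2 - ψ) := by
    rw [form_sub_right hσ]; ring
  rw [e]
  exact (norm_add_le _ _).trans (add_le_add (h q hq _ _ _ hp.le (by linarith)) (h' q hq _ _ le_rfl))

theorem aestronglyMeasurable_form (hσ : 2 < σ) {q : ℝ → Par}
    (hqc : ∀ u ψ : V L₁ L₂, Continuous fun t => form σ (q t) u ψ) {μ : Measure ℝ}
    {U W : ℝ → V L₁ L₂} (hU : AEStronglyMeasurable U μ) (hW : AEStronglyMeasurable W μ) :
    AEStronglyMeasurable (fun t => form σ (q t) (U t) (W t)) μ :=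
  aestronglyMeasurable_superposition₂ (fun t => continuous_form hσ (q t))
    (fun x y => (hqc x y).aestronglyMeasurable) hU hW

end Measurability

/-! ### Gronwall's inequality in integral form -/

section Gronwall

/-- The integral form of Gronwall's inequality, with a dissipation term. -/
theorem add_integral_le_mul_exp {y g : ℝ → ℝ} {T k a : ℝ} (hT : 0 ≤ T) (hk : 0 ≤ k) (ha : 0 ≤ a)
    (hy : ContinuousOn y (Icc 0 T)) (hg : ∀ t, 0 ≤ g t)
    (h : ∀ t ∈ Icc 0 T, y t + ∫ s in (0 : ℝ)..t, g s ≤ a + k * ∫ s in (0 : ℝ)..t, y s) :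
    ∀ t ∈ Icc 0 T, y t + ∫ s in (0 : ℝ)..t, g s ≤ a * Real.exp (k * T) := by
  -- Extending y by its endpoint values makes the primitive differentiable at every point, including
  -- 0 and T.
  set Y : ℝ → ℝ := fun t => y (projIcc 0 T hT t)
  have hY : Continuous Y := hy.comp_continuous
    (continuous_subtype_val.comp continuous_projIcc) fun t => (projIcc 0 T hT t).2
  have hYe : ∀ t ∈ Icc 0 T, Y t = y t := fun t ht => by
    simp only [Y]; rw [projIcc_of_mem hT ht]
  have hint : ∀ t ∈ Icc 0 T, ∫ s in (0 : ℝ)..t, Y s = ∫ s in (0 : ℝ)..t, y s := fun t ht => by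
    refine intervalIntegral.integral_congr fun s hs => ?_
    rw [uIcc_of_le ht.1] at hs
    exact hYe s ⟨hs.1, hs.2.trans ht.2⟩
  have hyl : ∀ t ∈ Icc 0 T, y t ≤ a + k * ∫ s in (0 : ℝ)..t, Y s := fun t ht => by
    have h1 := h t ht
    have h2 : 0 ≤ ∫ s in (0 : ℝ)..t, g s := intervalIntegral.integral_nonneg ht.1 fun s _ => hg s
    rw [hint t ht]
    linarith
  intro t ht
  refine (h t ht).trans ?_
  have hz := le_mul_exp_of_hasDerivWithinAt (y := fun t => a + k * ∫ s in (0 : ℝ)..t, Y s)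
    (y' := fun t => k * Y t) (k := k) (T := T) (fun t _ => by
      have := (hY.integral_hasStrictDerivAt 0 t).hasDerivAt
      exact ((this.const_mul k).const_add a).hasDerivWithinAt) (fun t ht => by
      refine mul_le_mul_of_nonneg_left ?_ hk
      rw [hYe t ht]; exact hyl t ht) ht
  simp only [intervalIntegral.integral_same, mul_zero, add_zero] at hz
  rw [hint t ht] at hz
  refine hz.trans (mul_le_mul_of_nonneg_left (Real.exp_le_exp.2 ?_) ha)
  exact mul_le_mul_of_nonneg_left ht.2 hk

end Gronwall

/-! ### Distance between two Galerkin approximations -/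

section Cauchy

variable {L₁ L₂ σ : ℝ} {ι : Type*} {e : ι → V L₁ L₂} {s : ι → ℝ × ℝ → ℂ} {lam : ι → ℝ}

theorem IsEigenbasis.trunc_eq_of_subset (he : IsEigenbasis e s lam) {S S' : Finset ι} (h : S' ⊆ S)
    {w : V L₁ L₂} (hw : trunc e S' w = w) : trunc e S w = w := by
  classical
  have h1 : w = synth e S fun i => if i ∈ S' then coef e w i else 0 := by
    conv_lhs => rw [← hw, trunc_apply]
    unfold synth
    rw [← Finset.sum_subset h (f := fun i => (if i ∈ S' then coef e w i else 0) • e i)]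
    · exact Finset.sum_congr rfl fun i hi => by simp only [hi, if_true]
    · intro i _ hi
      simp [hi]
  rw [h1, he.trunc_synth subset_rfl]

/-- The difference of two Galerkin approximations. -/
theorem exists_galerkin_sub_le (hσ : 2 < σ) {R : ℝ} (hR : 0 ≤ R) {β m : ℝ} (hm : 0 < m)
    (hκ : 0 < ellip (2 * σ) β) (he : IsEigenbasis e s lam) {M : ℝ} (hM : 0 ≤ M) :
    ∃ K C : ℝ, 0 ≤ K ∧ 0 ≤ C ∧ ∀ q : ℝ → Par, (∀ t, (q t).Good β m R) → ∀ T : ℝ, 0 ≤ T →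
      ∀ (S S' : Finset ι) (Λ : ℝ), S' ⊆ S → 1 ≤ Λ → (∀ i ∈ S, i ∉ S' → Λ ≤ lam i) →
      ∀ u v : ℝ → V L₁ L₂,
      (∀ t ∈ Icc 0 T, HasDerivWithinAt u (galerkin σ e S' (q t) (u t)) (Icc 0 T) t) →
      (∀ t ∈ Icc 0 T, HasDerivWithinAt v (galerkin σ e S (q t) (v t)) (Icc 0 T) t) →
      (∀ t ∈ Icc 0 T, trunc e S' (u t) = u t) → (∀ t ∈ Icc 0 T, trunc e S (v t) = v t) →
      (∀ t ∈ Icc 0 T, ‖u t‖ ≤ M) → (∀ t ∈ Icc 0 T, ‖v t‖ ≤ M) →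
      ∀ t ∈ Icc 0 T, ‖fn (u t - v t)‖ ^ 2 + ∫ r in (0 : ℝ)..t, 1 / 2 * gr (u r - v r) ≤
        (‖fn (u 0 - v 0)‖ ^ 2 + C * √(2 / Λ) *
          (T + ∫ r in (0 : ℝ)..T, ‖fn (lapl e lam S (v r))‖ ^ 2)) * Real.exp (2 * K * T) := by
  obtain ⟨c, K, hc, hK, hmono⟩ := exists_form_mono L₁ L₂ hσ hR hm hκ M
  obtain ⟨C, hC, hform⟩ := exists_norm_form_le_mul L₁ L₂ hσ hR hM
  refine ⟨K, 2 * C, hK, by positivity, fun q hq T hT S S' Λ hS hΛ hlam u v hu hv hu' hv' huM hvM => ?_⟩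
  have hcu : ContinuousOn u (Icc 0 T) := fun t ht => (hu t ht).continuousWithinAt
  have hcv : ContinuousOn v (Icc 0 T) := fun t ht => (hv t ht).continuousWithinAt
  have hcl : ContinuousOn (fun t => ‖fn (lapl e lam S (v t))‖ ^ 2) (Icc 0 T) :=
    (((fnL L₁ L₂).continuous.comp (continuous_lapl S)).comp_continuousOn hcv).norm.pow 2
  have hcw : ContinuousOn (fun t => ‖fn (u t - v t)‖ ^ 2) (Icc 0 T) :=
    ((fnL L₁ L₂).continuous.comp_continuousOn (hcu.sub hcv)).norm.pow 2
  have hcg : ContinuousOn (fun t => gr (u t - v t)) (Icc 0 T) :=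
    (((dxL L₁ L₂).continuous.comp_continuousOn (hcu.sub hcv)).norm.pow 2).add
      (((dyL L₁ L₂).continuous.comp_continuousOn (hcu.sub hcv)).norm.pow 2)
  have hmonotone : ∀ {f : ℝ → ℝ} {t}, t ∈ Icc 0 T → ContinuousOn f (Icc 0 T) →
      IntervalIntegrable f volume 0 t := fun ht hf =>
    (hf.mono (Icc_subset_Icc_right ht.2)).intervalIntegrable_of_Icc ht.1
  set D := ∫ r in (0 : ℝ)..T, ‖fn (lapl e lam S (v r))‖ ^ 2
  have hD : 0 ≤ D := intervalIntegral.integral_nonneg hT fun _ _ => by positivity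
  have hderiv : ∀ t ∈ Icc 0 T, 2 * (inner ℂ (fn (u t - v t))
      (fn (galerkin σ e S' (q t) (u t)) - fn (galerkin σ e S (q t) (v t)))).re ≤
      2 * K * ‖fn (u t - v t)‖ ^ 2 - 1 / 2 * gr (u t - v t) +
        2 * C * √(2 / Λ) * (1 + ‖fn (lapl e lam S (v t))‖ ^ 2) := fun t ht => by
    set w := u t - v t
    have t1 : trunc e S w = w := by
      simp only [w]; rw [map_sub, he.trunc_eq_of_subset hS (hu' t ht), hv' t ht]
    -- The equation for u may be tested only in the smaller span S′. Using w instead of its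
    -- truncation costs the part of v of high frequency, which is at most √(2/Λ)‖Δv‖ in V. This
    -- replaces a compactness argument.
    have t2 : trunc e S' w = w + (v t - trunc e S' (v t)) := by
      simp only [w]; rw [map_sub, hu' t ht]; abel
    rw [inner_sub_right, inner_fn_galerkin hσ, inner_fn_galerkin hσ, t1, t2, form_add_right hσ]
    have a1 := hmono (q t) (q t) 0 (hq t) (Par.Close.refl _) (u t) (v t) (hvM t ht)
    have a2 : ‖form σ (q t) (u t) (v t - trunc e S' (v t))‖ ≤
        C * (√(2 / Λ) * (1 + ‖fn (lapl e lam S (v t))‖ ^ 2)) := by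
      refine (hform _ (hq t).bdd _ _ (huM t ht)).trans ?_
      have b1 := he.norm_sub_trunc_le hS hΛ hlam (hv' t ht)
      have b2 : ‖fn (lapl e lam S (v t))‖ ≤ 1 + ‖fn (lapl e lam S (v t))‖ ^ 2 := by
        nlinarith [sq_nonneg (‖fn (lapl e lam S (v t))‖ - 1)]
      gcongr
      exact b1.trans (by gcongr)
    have a3 := (Complex.re_le_norm _).trans a2
    have a4 : 0 ≤ c * ∫ x, ‖fn (u t - v t) x‖ ^ (2 * σ + 2) ∂(dom L₁ L₂) :=
      mul_nonneg hc.le (integral_nonneg fun x => by positivity)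
    have e1 : (form σ (q t) (u t) w + form σ (q t) (u t) (v t - trunc e S' (v t)) -
        form σ (q t) (v t) w).re = (form σ (q t) (u t) w - form σ (q t) (v t) w).re +
        (form σ (q t) (u t) (v t - trunc e S' (v t))).re := by
      simp only [Complex.add_re, Complex.sub_re]; ring
    rw [e1]
    linarith
  refine add_integral_le_mul_exp hT (by positivity) (by positivity) hcw
    (fun t => by have := gr_nonneg (u t - v t); positivity) fun t ht => ?_
  have hsub : Icc 0 t ⊆ Icc 0 T := Icc_subset_Icc_right ht.2
  have i1 := (hmonotone ht hcw).const_mul (2 * K)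
  have i2 := (hmonotone ht hcg).const_mul (1 / 2)
  have i3 : IntervalIntegrable (fun t => 2 * C * √(2 / Λ) *
      (1 + ‖fn (lapl e lam S (v t))‖ ^ 2)) volume 0 t :=
    ((intervalIntegrable_const).add (hmonotone ht hcl)).const_mul _
  have i12 : IntervalIntegrable (fun t => 2 * K * ‖fn (u t - v t)‖ ^ 2 - 1 / 2 * gr (u t - v t))
      volume 0 t := i1.sub i2
  have h := intervalIntegral.sub_le_integral_of_hasDeriv_right_of_le ht.1
    (g := fun t => ‖fn (u t - v t)‖ ^ 2) (hcw.mono hsub)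
    (fun r hr => ((hasDerivWithinAt_norm_sq (u := fun t => fn (u t - v t))
      (((fnL L₁ L₂).restrictScalars ℝ).hasFDerivAt.comp_hasDerivWithinAt r
        ((hu r (hsub (Ioo_subset_Icc_self hr))).sub (hv r (hsub (Ioo_subset_Icc_self hr)))))
      ).mono_of_mem_nhdsWithin (mem_nhdsWithin_of_mem_nhds
        (Icc_mem_nhds hr.1 (hr.2.trans_le ht.2)))))
    ((intervalIntegrable_iff_integrableOn_Icc_of_le ht.1 (by simp)).1 (i12.add i3))
    (fun r hr => hderiv r (hsub (Ioo_subset_Icc_self hr)))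
  rw [intervalIntegral.integral_add i12 i3, intervalIntegral.integral_sub i1 i2,
    intervalIntegral.integral_const_mul, intervalIntegral.integral_const_mul (2 * C * √(2 / Λ)),
    intervalIntegral.integral_add intervalIntegrable_const (hmonotone ht hcl),
    intervalIntegral.integral_const, smul_eq_mul, mul_one, sub_zero] at h
  have h2 : ∫ r in (0 : ℝ)..t, ‖fn (lapl e lam S (v r))‖ ^ 2 ≤ D :=
    intervalIntegral.integral_mono_interval le_rfl ht.1 ht.2 (ae_of_all _ fun r => sq_nonneg _)
      (hmonotone ⟨hT, le_rfl⟩ hcl)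
  have h3 : 2 * C * √(2 / Λ) * (t + ∫ r in (0 : ℝ)..t, ‖fn (lapl e lam S (v r))‖ ^ 2) ≤
      2 * C * √(2 / Λ) * (T + D) := by
    have := ht.2
    gcongr
  linarith

end Cauchy

/-! ### Existence of a weak solution bounded in V -/

section Existence

variable {L₁ L₂ σ : ℝ}

/-- Weak solutions of `u' = form (q t) u`, in the class of the skeleton equation. -/
structure IsWeak (T σ : ℝ) (q : ℝ → Par) (u₀ : V L₁ L₂) (u : ℝ → H L₁ L₂) (U : ℝ → V L₁ L₂) :
    Prop where
  continuousOn : ContinuousOn u (Icc 0 T)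
  memLp : MemLp U 2 (volume.restrict (Icc 0 T))
  eq_ae : ∀ᵐ s ∂(volume.restrict (Icc 0 T)), fn (U s) = u s
  energy : LpLpEnergy T (2 * σ + 2) u < ⊤
  equation : ∀ ψ : V L₁ L₂, ∀ t ∈ Icc 0 T, inner ℂ (fn ψ) (u t) = inner ℂ (fn ψ) (fn u₀) +
    ∫ s in (0 : ℝ)..t, form σ (q s) (U s) ψ

theorem LpLpEnergy_eq {T p : ℝ} (hp : 0 ≤ p) {u : ℝ → H L₁ L₂} {U : ℝ → V L₁ L₂}
    (h : ∀ᵐ s ∂(volume.restrict (Icc 0 T)), fn (U s) = u s) : LpLpEnergy T p u =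
      ∫⁻ s in Icc 0 T, ENNReal.ofReal (∫ x, ‖fn (U s) x‖ ^ p ∂(dom L₁ L₂)) := by
  refine lintegral_congr_ae (h.mono fun s hs => ?_)
  simp only
  rw [← hs, ofReal_integral_eq_lintegral_ofReal (integrable_rpow (U s) hp)
    (ae_of_all _ fun x => by positivity)]
  refine lintegral_congr fun x => ?_
  rw [← ENNReal.ofReal_rpow_of_nonneg (norm_nonneg _) hp, ofReal_norm]

theorem LpLpEnergy_lt_top_of_bdd {T p M : ℝ} (hp : 0 ≤ p) {u : ℝ → H L₁ L₂} {U : ℝ → V L₁ L₂}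
    (h : ∀ᵐ s ∂(volume.restrict (Icc 0 T)), fn (U s) = u s)
    (hM : ∀ᵐ s ∂(volume.restrict (Icc 0 T)), ‖U s‖ ≤ M) : LpLpEnergy T p u < ⊤ := by
  obtain ⟨C, hC, hb⟩ := exists_integral_rpow_le L₁ L₂ hp M
  rw [LpLpEnergy_eq hp h]
  calc _ ≤ ∫⁻ _ in Icc 0 T, ENNReal.ofReal C :=
        lintegral_mono_ae (hM.mono fun s hs => ENNReal.ofReal_le_ofReal (hb _ hs))
    _ < ⊤ := by
        rw [lintegral_const]
        exact ENNReal.mul_lt_top ENNReal.ofReal_lt_top (by simp)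

theorem sq_norm_toLp {X E : Type*} [MeasurableSpace X] {μ : Measure X} [NormedAddCommGroup E]
    {f : X → E} (hf : MemLp f 2 μ) : ‖hf.toLp f‖ ^ 2 = ∫ x, ‖f x‖ ^ 2 ∂μ := by
  rw [Lp.norm_toLp, hf.eLpNorm_eq_integral_rpow_norm (by simp) (by simp),
    ENNReal.toReal_ofReal (by positivity)]
  simp only [ENNReal.toReal_ofNat, Real.rpow_ofNat]
  rw [← Real.rpow_natCast, ← Real.rpow_mul (integral_nonneg fun x => by positivity)]
  simp

theorem aestronglyMeasurable_path {E : Type*} [NormedAddCommGroup E] {f : ℝ → E} {s : Set ℝ}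
    (hf : ContinuousOn f s) (hs : MeasurableSet s) : AEStronglyMeasurable f (volume.restrict s) :=
  hf.aestronglyMeasurable hs

theorem tendsto_uncurry_of_continuous {X Y Z α : Type*} [TopologicalSpace X] [TopologicalSpace Y]
    [TopologicalSpace Z] {F : X → Y → Z} (hF : Continuous fun p : X × Y => F p.1 p.2) {l : Filter α}
    {f : α → X} {g : α → Y} {x : X} {y : Y} (hf : Tendsto f l (𝓝 x)) (hg : Tendsto g l (𝓝 y)) :
    Tendsto (fun a => F (f a) (g a)) l (𝓝 (F x y)) :=
  (hF.tendsto (x, y)).comp (hf.prodMk_nhds hg)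

theorem tendsto_form (hσ : 2 < σ) (q : Par) {α : Type*} {l : Filter α} {un ψn : α → V L₁ L₂}
    {u ψ : V L₁ L₂} (hu : Tendsto un l (𝓝 u)) (hψ : Tendsto ψn l (𝓝 ψ)) :
    Tendsto (fun a => form σ q (un a) (ψn a)) l (𝓝 (form σ q u ψ)) :=
  tendsto_uncurry_of_continuous (continuous_form hσ q) hu hψ

/-- A sequence of continuous `V`-valued paths that is Cauchy in `C(H) ∩ L²(V)` and bounded in
`V` converges along a subsequence. -/
theorem exists_limit_of_cauchy {T M : ℝ} (hT : 0 ≤ T) {v : ℕ → ℝ → V L₁ L₂}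
    (hv : ∀ n, ContinuousOn (v n) (Icc 0 T)) (hM : ∀ n, ∀ t ∈ Icc 0 T, ‖v n t‖ ≤ M)
    (hcau : ∀ ε > 0, ∃ N, ∀ n, N ≤ n → ∀ k, n ≤ k → ∀ t ∈ Icc 0 T, ‖fn (v n t - v k t)‖ ^ 2 +
      ∫ r in (0 : ℝ)..t, 1 / 2 * gr (v n r - v k r) ≤ ε) :
    ∃ (u : ℝ → H L₁ L₂) (U : ℝ → V L₁ L₂) (ns : ℕ → ℕ), StrictMono ns ∧
      ContinuousOn u (Icc 0 T) ∧ MemLp U 2 (volume.restrict (Icc 0 T)) ∧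
      (∀ t ∈ Icc 0 T, Tendsto (fun n => fn (v (ns n) t)) atTop (𝓝 (u t))) ∧
      ∀ᵐ s ∂(volume.restrict (Icc 0 T)), Tendsto (fun n => v (ns n) s) atTop (𝓝 (U s)) := by
  have hcg : ∀ n k, ContinuousOn (fun t => gr (v n t - v k t)) (Icc 0 T) := fun n k =>
    (((dxL L₁ L₂).continuous.comp_continuousOn ((hv n).sub (hv k))).norm.pow 2).add
      (((dyL L₁ L₂).continuous.comp_continuousOn ((hv n).sub (hv k))).norm.pow 2)
  have hcf : ∀ n k, ContinuousOn (fun t => ‖fn (v n t - v k t)‖ ^ 2) (Icc 0 T) := fun n k =>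
    ((fnL L₁ L₂).continuous.comp_continuousOn ((hv n).sub (hv k))).norm.pow 2
  have hpt : ∀ ε > 0, ∃ N, ∀ n, N ≤ n → ∀ k, n ≤ k → ∀ t ∈ Icc 0 T,
      ‖fn (v n t) - fn (v k t)‖ < ε := fun ε hε => by
    obtain ⟨N, hN⟩ := hcau ((ε / 2) ^ 2) (by positivity)
    refine ⟨N, fun n hn k hk t ht => ?_⟩
    have h1 := hN n hn k hk t ht
    have h2 : 0 ≤ ∫ r in (0 : ℝ)..t, 1 / 2 * gr (v n r - v k r) :=
      intervalIntegral.integral_nonneg ht.1 fun r _ => by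
        have := gr_nonneg (v n r - v k r); positivity
    have h3 : ‖fn (v n t) - fn (v k t)‖ ^ 2 ≤ (ε / 2) ^ 2 := by
      rw [← fn_sub]; linarith
    have h4 := (pow_le_pow_iff_left₀ (norm_nonneg _) (by positivity) two_ne_zero).1 h3
    linarith
  have hunif : UniformCauchySeqOn (fun n t => fn (v n t)) atTop (Icc 0 T) := by
    rw [Metric.uniformCauchySeqOn_iff]
    intro ε hε
    obtain ⟨N, hN⟩ := hpt ε hε
    refine ⟨N, fun n hn k hk t ht => ?_⟩
    rw [dist_eq_norm]
    rcases le_total n k with h | h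
    · exact hN n hn k h t ht
    · rw [norm_sub_rev]; exact hN k hk n h t ht
  have hlim : ∀ t, ∃ l, t ∈ Icc 0 T → Tendsto (fun n => fn (v n t)) atTop (𝓝 l) := fun t => by
    by_cases ht : t ∈ Icc 0 T
    · obtain ⟨l, hl⟩ := cauchySeq_tendsto_of_complete (hunif.cauchySeq ht)
      exact ⟨l, fun _ => hl⟩
    · exact ⟨0, fun h => absurd h ht⟩
  choose u hu using hlim
  have huu := hunif.tendstoUniformlyOn_of_tendsto fun t ht => hu t ht
  have hmem : ∀ n, MemLp (v n) 2 (volume.restrict (Icc 0 T)) := fun n =>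
    MemLp.of_bound (aestronglyMeasurable_path (hv n) measurableSet_Icc) M
      ((ae_restrict_mem measurableSet_Icc).mono fun t ht => hM n t ht)
  have hLp : CauchySeq fun n => (hmem n).toLp (v n) := by
    rw [Metric.cauchySeq_iff']
    intro ε hε
    -- The squared L²(V) distance is at most T + 2 times this bound: T from integrating the H-part
    -- over time, 2 from removing the factor 1/2 in front of the gradient part.
    obtain ⟨N, hN⟩ := hcau ((ε / 2) ^ 2 / (T + 2)) (by positivity)
    refine ⟨N, fun k hk => ?_⟩
    have h1 := hN N le_rfl k hk
    rw [dist_comm, dist_eq_norm, ← MemLp.toLp_sub]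
    have h2 : ‖((hmem N).sub (hmem k)).toLp (v N - v k)‖ ^ 2 ≤ (ε / 2) ^ 2 := by
      rw [sq_norm_toLp, integral_Icc_eq_integral_Ioc,
        ← intervalIntegral.integral_of_le hT]
      have e : ∫ r in (0 : ℝ)..T, ‖(v N - v k) r‖ ^ 2 =
          (∫ r in (0 : ℝ)..T, ‖fn (v N r - v k r)‖ ^ 2) +
            2 * ∫ r in (0 : ℝ)..T, 1 / 2 * gr (v N r - v k r) := by
        rw [intervalIntegral.integral_const_mul, ← mul_assoc, mul_one_div_cancel two_ne_zero, one_mul,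
          ← intervalIntegral.integral_add ((hcf N k).intervalIntegrable_of_Icc hT)
            ((hcg N k).intervalIntegrable_of_Icc hT)]
        exact intervalIntegral.integral_congr fun r _ => norm_sq_eq _
      have h3 : ∫ r in (0 : ℝ)..T, ‖fn (v N r - v k r)‖ ^ 2 ≤ ∫ r in (0 : ℝ)..T,
          (ε / 2) ^ 2 / (T + 2) := by
        refine intervalIntegral.integral_mono_on hT ((hcf N k).intervalIntegrable_of_Icc hT)
          intervalIntegrable_const fun t ht => ?_
        have h2 : 0 ≤ ∫ r in (0 : ℝ)..t, 1 / 2 * gr (v N r - v k r) :=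
          intervalIntegral.integral_nonneg ht.1 fun r _ => by
            have := gr_nonneg (v N r - v k r); positivity
        linarith [h1 t ht]
      rw [intervalIntegral.integral_const, smul_eq_mul, sub_zero] at h3
      have h4 : ∫ r in (0 : ℝ)..T, 1 / 2 * gr (v N r - v k r) ≤ (ε / 2) ^ 2 / (T + 2) := by
        linarith [h1 T ⟨hT, le_rfl⟩, sq_nonneg ‖fn (v N T - v k T)‖]
      have h5 : T * ((ε / 2) ^ 2 / (T + 2)) + 2 * ((ε / 2) ^ 2 / (T + 2)) = (ε / 2) ^ 2 := by
        field_simp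
      rw [e]
      linarith
    have h3 := le_of_sq_le_sq h2 (half_pos hε).le
    exact h3.trans_lt (half_lt_self hε)
  obtain ⟨U, hU⟩ := cauchySeq_tendsto_of_complete hLp
  obtain ⟨ns, hns, hae⟩ := (tendstoInMeasure_of_tendsto_Lp hU).exists_seq_tendsto_ae
  refine ⟨u, U, ns, hns, huu.continuousOn (Frequently.of_forall fun n =>
    (fnL L₁ L₂).continuous.comp_continuousOn (hv n)), Lp.memLp U,
    fun t ht => (hu t ht).comp hns.tendsto_atTop, ?_⟩
  filter_upwards [hae, ae_all_iff.2 fun n => (hmem n).coeFn_toLp] with s h1 h2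
  simpa only [h2] using h1

set_option maxHeartbeats 800000 in
/-- Existence of a solution that is bounded in `V`. -/
theorem exists_isWeak (hL₁ : 0 < L₁) (hL₂ : 0 < L₂) (hσ : 2 < σ) {R : ℝ} (hR : 0 ≤ R) {β m : ℝ}
    (hm : 0 < m) (hκ : 0 < ellip (2 * σ) β) {q : ℝ → Par} (hq : ∀ t, (q t).Good β m R)
    (hqc : ∀ u ψ : V L₁ L₂, Continuous fun t => form σ (q t) u ψ) {T : ℝ} (hT : 0 ≤ T)
    (u₀ : V L₁ L₂) : ∃ (M : ℝ) (u : ℝ → H L₁ L₂) (U : ℝ → V L₁ L₂), IsWeak T σ q u₀ u U ∧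
      ∀ᵐ s ∂(volume.restrict (Icc 0 T)), ‖U s‖ ≤ M := by
  obtain ⟨e, s, lam, he⟩ := exists_isEigenbasis hL₁ hL₂
  obtain ⟨k, hk, hgal⟩ := exists_galerkin hσ hR hm hκ he
  -- Spectral truncation; the shift by one ensures that the tail estimate applies with Λ = n + 1 ≥
  -- 1.
  set S : ℕ → Finset (ℕ × ℕ) := fun n => (he.finite (n + 1)).toFinset
  have hSmem : ∀ n i, i ∈ S n ↔ lam i ≤ n + 1 := fun n i => by simp [S]
  have hSmono : Monotone S := fun n n' hn i hi => by
    rw [hSmem] at hi ⊢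
    have : (n : ℝ) ≤ n' := by exact_mod_cast hn
    linarith
  have hStop : Tendsto S atTop atTop := tendsto_atTop_finset_of_monotone hSmono fun i => by
    obtain ⟨n, hn⟩ := exists_nat_ge (lam i)
    exact ⟨n, (hSmem n i).2 (by linarith)⟩
  have htr : ∀ w : V L₁ L₂, Tendsto (fun n => trunc e (S n) w) atTop (𝓝 w) := fun w => by
    have := (he.hasSum w).comp hStop
    refine this.congr fun n => ?_
    rw [trunc_apply]; rfl
  have hbd : ∀ w : V L₁ L₂, ∃ B, 0 ≤ B ∧ ∀ n, ‖trunc e (S n) w‖ ≤ B := fun w => by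
    obtain ⟨B, hB⟩ := (Metric.isBounded_range_of_tendsto _ (htr w)).exists_norm_le
    exact ⟨B, (norm_nonneg _).trans (hB _ ⟨0, rfl⟩), fun n => hB _ ⟨n, rfl⟩⟩
  obtain ⟨B, hB0, hB⟩ := hbd u₀
  choose v hv0 hvd hvt hvM hvl using fun n => hgal q hq hqc T hT (S n) (trunc e (S n) u₀)
    (by rw [trunc_apply (w := u₀), he.trunc_synth subset_rfl])
  set M := B * Real.exp (k * T)
  have hM0 : 0 ≤ M := by positivity
  have hM : ∀ n, ∀ t ∈ Icc 0 T, ‖v n t‖ ≤ M := fun n t ht =>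
    (hvM n t ht).trans (by simp only [M]; gcongr; exact hB n)
  set D := B ^ 2 + 2 * k * M ^ 2 * T
  have hD : ∀ n, ∫ t in (0 : ℝ)..T, ‖fn (lapl e lam (S n) (v n t))‖ ^ 2 ≤ D := fun n =>
    (hvl n).trans (by simp only [D, M]; gcongr <;> exact hB n)
  have hvc : ∀ n, ContinuousOn (v n) (Icc 0 T) := fun n t ht => (hvd n t ht).continuousWithinAt
  obtain ⟨K, C, hK, hC, hsub⟩ := exists_galerkin_sub_le hσ hR hm hκ he hM0
  obtain ⟨u, U, ns, hns, huc, hUL, hu, hU⟩ := exists_limit_of_cauchy hT hvc hM fun ε hε => by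
    have l1 : Tendsto (fun n : ℕ => C * √(2 / ((n : ℝ) + 1)) * (T + D)) atTop (𝓝 0) := by
      have h1 : Tendsto (fun n : ℕ => 2 / ((n : ℝ) + 1)) atTop (𝓝 0) := by
        have := (tendsto_one_div_add_atTop_nhds_zero_nat (𝕜 := ℝ)).const_mul 2
        simpa [div_eq_mul_inv] using this
      have h2 := ((Real.continuous_sqrt.tendsto 0).comp h1)
      rw [Real.sqrt_zero] at h2
      simpa using (h2.const_mul C).mul_const (T + D)
    set E := Real.exp (2 * K * T)
    have hE : 0 < E := Real.exp_pos _
    have hε' : 0 < ε / (2 * E) := by positivity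
    obtain ⟨N₁, hN₁⟩ := Metric.cauchySeq_iff.1 (htr u₀).cauchySeq _ (Real.sqrt_pos.2 hε')
    obtain ⟨N₂, hN₂⟩ := (l1.eventually_le_const hε').exists_forall_of_atTop
    refine ⟨max N₁ N₂, fun n hn j hj t ht => ?_⟩
    have h := hsub q hq T hT (S j) (S n) (n + 1) (hSmono hj) (by simp) (fun i _ hi => by
      rw [hSmem, not_le] at hi; exact hi.le) (v n) (v j) (hvd n) (hvd j) (hvt n) (hvt j) (hM n)
      (hM j) t ht
    refine h.trans ?_
    rw [hv0, hv0]
    have a1 : ‖fn (trunc e (S n) u₀ - trunc e (S j) u₀)‖ ^ 2 ≤ ε / (2 * E) := by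
      rw [← Real.sq_sqrt hε'.le]
      have := hN₁ n ((le_max_left _ _).trans hn) j ((le_max_left _ _).trans (hn.trans hj))
      rw [dist_eq_norm] at this
      exact pow_le_pow_left₀ (norm_nonneg _) ((norm_fn_le _).trans this.le) 2
    have a2 := hN₂ n ((le_max_right _ _).trans hn)
    have a3 : C * √(2 / ((n : ℝ) + 1)) *
        (T + ∫ r in (0 : ℝ)..T, ‖fn (lapl e lam (S j) (v j r))‖ ^ 2) ≤ ε / (2 * E) :=
      (mul_le_mul_of_nonneg_left (by linarith [hD j]) (by positivity)).trans a2
    calc _ ≤ (ε / (2 * E) + ε / (2 * E)) * E := by gcongr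
      _ = ε := by field_simp; ring
  have hUM : ∀ᵐ s ∂(volume.restrict (Icc 0 T)), ‖U s‖ ≤ M := by
    filter_upwards [hU, ae_restrict_mem measurableSet_Icc] with t h1 ht
    exact le_of_tendsto h1.norm (Eventually.of_forall fun n => hM _ t ht)
  have hfn : ∀ᵐ s ∂(volume.restrict (Icc 0 T)), fn (U s) = u s := by
    filter_upwards [hU, ae_restrict_mem measurableSet_Icc] with t h1 ht
    exact tendsto_nhds_unique (((fnL L₁ L₂).continuous.tendsto _).comp h1) (hu t ht)
  refine ⟨M, u, U, ⟨huc, hUL, hfn, LpLpEnergy_lt_top_of_bdd (by linarith) hfn hUM,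
    fun ψ t ht => ?_⟩, hUM⟩
  obtain ⟨C', hC', hform⟩ := exists_norm_form_le_mul L₁ L₂ hσ hR hM0
  obtain ⟨B', hB0', hB'⟩ := hbd ψ
  have hsubt : Icc 0 t ⊆ Icc 0 T := Icc_subset_Icc_right ht.2
  have hbound : ∀ n, ∀ r ∈ Icc 0 T, ‖form σ (q r) (v n r) (trunc e (S n) ψ)‖ ≤ C' * B' :=
    fun n r hr => (hform _ (hq r).bdd _ _ (hM n r hr)).trans (by gcongr; exact hB' n)
  have hmeas : ∀ n, AEStronglyMeasurable (fun r => form σ (q r) (v n r) (trunc e (S n) ψ))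
      (volume.restrict (Ioc 0 t)) := fun n =>
    aestronglyMeasurable_form hσ hqc (aestronglyMeasurable_path ((hvc n).mono (Ioc_subset_Icc_self.trans
      hsubt)) measurableSet_Ioc) aestronglyMeasurable_const
  have hIoc : uIoc 0 t = Ioc 0 t := uIoc_of_le ht.1
  have heqn : ∀ n, inner ℂ (fn ψ) (fn (v n t)) = inner ℂ (fn ψ) (fn (trunc e (S n) u₀)) +
      ∫ r in (0 : ℝ)..t, form σ (q r) (v n r) (trunc e (S n) ψ) := fun n => by
    have hint : IntervalIntegrable (fun r => form σ (q r) (v n r) (trunc e (S n) ψ)) volume 0 t := by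
      rw [intervalIntegrable_iff_integrableOn_Ioc_of_le ht.1]
      exact Integrable.of_bound (hmeas n) (C' * B') ((ae_restrict_mem measurableSet_Ioc).mono
        fun r hr => hbound n r (hsubt (Ioc_subset_Icc_self hr)))
    rw [intervalIntegral.integral_eq_sub_of_hasDeriv_right_of_le ht.1
      (f := fun r => inner ℂ (fn ψ) (fn (v n r))) ?_ (fun r hr => ?_) hint, hv0]
    · ring
    · exact ((innerSL ℂ (fn ψ)).continuous.comp (fnL L₁ L₂).continuous).comp_continuousOn
        ((hvc n).mono hsubt)
    · rw [← inner_fn_galerkin hσ]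
      exact ((((innerSL ℂ (fn ψ)).comp (fnL L₁ L₂)).restrictScalars ℝ).hasFDerivAt.comp_hasDerivWithinAt
        r (hvd n r (hsubt (Ioo_subset_Icc_self hr)))).mono_of_mem_nhdsWithin
          (mem_nhdsWithin_of_mem_nhds (Icc_mem_nhds hr.1 (hr.2.trans_le ht.2)))
  have lim1 : Tendsto (fun n => inner ℂ (fn ψ) (fn (v (ns n) t))) atTop (𝓝 (inner ℂ (fn ψ) (u t))) :=
    ((innerSL ℂ (fn ψ)).continuous.tendsto _).comp (hu t ht)
  have lim2 : Tendsto (fun n => inner ℂ (fn ψ) (fn (trunc e (S (ns n)) u₀))) atTop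
      (𝓝 (inner ℂ (fn ψ) (fn u₀))) :=
    (((innerSL ℂ (fn ψ)).continuous.comp (fnL L₁ L₂).continuous).tendsto _).comp
      ((htr u₀).comp hns.tendsto_atTop)
  -- Along the subsequence the approximations converge strongly in V at almost every time, and the
  -- forms are bounded by C'B'. So the nonlinear terms pass to the limit by dominated convergence,
  -- without identifying weak limits.
  have lim3 : Tendsto (fun n => ∫ r in (0 : ℝ)..t, form σ (q r) (v (ns n) r) (trunc e (S (ns n)) ψ))
      atTop (𝓝 (∫ r in (0 : ℝ)..t, form σ (q r) (U r) ψ)) := by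
    refine intervalIntegral.tendsto_integral_filter_of_dominated_convergence (fun _ => C' * B')
      (Eventually.of_forall fun n => by rw [hIoc]; exact hmeas _)
      (Eventually.of_forall fun n => ae_of_all _ fun r hr => ?_) intervalIntegrable_const ?_
    · rw [hIoc] at hr
      exact hbound _ r (hsubt (Ioc_subset_Icc_self hr))
    · have := ae_imp_of_ae_restrict hU
      filter_upwards [this] with r hr hr'
      rw [hIoc] at hr'
      exact tendsto_form hσ (q r) (hr (hsubt (Ioc_subset_Icc_self hr')))
        ((htr ψ).comp hns.tendsto_atTop)
  exact tendsto_nhds_unique lim1 ((lim2.add lim3).congr fun n => (heqn (ns n)).symm)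

end Existence

/-! ### Continuity of translations, and functions with small mean increments -/

section Translation

variable {E : Type*} [NormedAddCommGroup E]

/-- Continuity of translations in `L^p(ℝ; E)`. -/
theorem tendsto_eLpNorm_translation {p : ENNReal} [Fact (1 ≤ p)] [Fact (p ≠ ⊤)] {f : ℝ → E}
    (hf : MemLp f p volume) :
    Tendsto (fun r : ℝ => eLpNorm (fun t => f t - f (t - r)) p volume) (𝓝 0) (𝓝 0) := by
  set F := hf.toLp f
  have he : ∀ r : ℝ, edist F (DomAddAct.mk (-r) +ᵥ F) =
      eLpNorm (fun t => f t - f (t - r)) p volume := fun r => by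
    simp only [F]
    rw [DomAddAct.mk_vadd_toLp, Lp.edist_toLp_toLp]
    congr 1
    funext t
    simp only [Pi.sub_apply, vadd_eq_add]
    rw [neg_add_eq_sub]
  have hc : Continuous fun r : ℝ => edist F (DomAddAct.mk (-r) +ᵥ F) := by
    have h1 : Continuous fun r : ℝ => DomAddAct.mk (-r) := DomAddAct.continuous_mk.comp continuous_neg
    have h2 : Continuous fun r : ℝ => DomAddAct.mk (-r) +ᵥ F := h1.vadd continuous_const
    exact continuous_const.edist h2
  have h := hc.tendsto 0
  simp only [he, sub_zero, sub_self] at h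
  simpa using h

theorem aemeasurable_translation {f : ℝ → E} (hf : AEStronglyMeasurable f volume) (p h : ℝ) :
    AEMeasurable (fun z : ℝ × ℝ => ‖f z.1 - f (z.1 - z.2)‖ₑ ^ p)
      (volume.prod (volume.restrict (Ioc 0 h))) := by
  have m1 : AEStronglyMeasurable (fun z : ℝ × ℝ => f z.1 - f (z.1 - z.2))
      ((volume : Measure ℝ).prod volume) :=
    (hf.comp_fst (ν := volume)).sub
      (hf.comp_quasiMeasurePreserving (quasiMeasurePreserving_sub volume volume))
  have m2 : (volume : Measure ℝ).prod (volume.restrict (Ioc 0 h)) ≤ volume.prod volume := by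
    have := Measure.prod_restrict (μ := (volume : Measure ℝ)) (ν := (volume : Measure ℝ)) univ
      (Ioc 0 h)
    rw [Measure.restrict_univ] at this
    rw [this]
    exact Measure.restrict_le_self
  exact (m1.mono_measure m2).enorm.pow_const _

/-- For each small shift r the integral over t is at most ε by continuity of translations; Tonelli's
theorem then sums over r in (0, h]. -/
theorem exists_translation_average_le {p : ℝ} (hp : 1 ≤ p) {f : ℝ → E}
    (hf : MemLp f (ENNReal.ofReal p) volume) {ε : ℝ} (hε : 0 < ε) : ∃ δ > 0, ∀ h : ℝ, 0 < h → h < δ →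
      ∫⁻ t, ∫⁻ r in Ioc 0 h, ‖f t - f (t - r)‖ₑ ^ p ≤ ENNReal.ofReal (ε * h) := by
  have hp0 : 0 < p := by linarith
  have : Fact (1 ≤ ENNReal.ofReal p) := ⟨by simpa using ENNReal.ofReal_le_ofReal hp⟩
  have : Fact (ENNReal.ofReal p ≠ ⊤) := ⟨ENNReal.ofReal_ne_top⟩
  have h1 := (tendsto_eLpNorm_translation hf).ennrpow_const p
  rw [ENNReal.zero_rpow_of_pos hp0] at h1
  have h2 : ∀ᶠ r : ℝ in 𝓝 0, ∫⁻ t, ‖f t - f (t - r)‖ₑ ^ p ≤ ENNReal.ofReal ε := by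
    filter_upwards [h1.eventually_le_const (ENNReal.ofReal_pos.2 hε)] with r hr
    rw [eLpNorm_eq_lintegral_rpow_enorm_toReal (by simpa using hp0) ENNReal.ofReal_ne_top,
      ENNReal.toReal_ofReal hp0.le, ← ENNReal.rpow_mul, one_div_mul_cancel hp0.ne',
      ENNReal.rpow_one] at hr
    exact hr
  obtain ⟨δ, hδ, hb⟩ := Metric.eventually_nhds_iff.1 h2
  refine ⟨δ, hδ, fun h hh hhδ => ?_⟩
  rw [lintegral_lintegral_swap (aemeasurable_translation hf.1 p h)]
  calc _ ≤ ∫⁻ _ in Ioc 0 h, ENNReal.ofReal ε := by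
        refine setLIntegral_mono measurable_const fun r hr => hb ?_
        rw [Real.dist_eq, sub_zero, abs_of_pos hr.1]
        exact hr.2.trans_lt hhδ
    _ = _ := by
        rw [setLIntegral_const, Real.volume_Ioc, sub_zero, ENNReal.ofReal_mul hε.le]

theorem exists_translation_average_add_le {F : Type*} [NormedAddCommGroup F] {p p' : ℝ} (hp : 1 ≤ p)
    (hp' : 1 ≤ p') {f : ℝ → E} {g : ℝ → F} (hf : MemLp f (ENNReal.ofReal p) volume)
    (hg : MemLp g (ENNReal.ofReal p') volume) {A : ℝ} (hA : 0 ≤ A) {ε : ℝ} (hε : 0 < ε) :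
    ∃ δ > 0, ∀ h : ℝ, 0 < h → h < δ → ∫⁻ t, ∫⁻ r in Ioc 0 h, ENNReal.ofReal A *
      (‖f t - f (t - r)‖ₑ ^ p + ‖g t - g (t - r)‖ₑ ^ p') ≤ ENNReal.ofReal (ε * h) := by
  obtain ⟨δ₁, hδ₁, h₁⟩ := exists_translation_average_le hp hf (ε := ε / (2 * (A + 1))) (by positivity)
  obtain ⟨δ₂, hδ₂, h₂⟩ := exists_translation_average_le hp' hg (ε := ε / (2 * (A + 1))) (by positivity)
  refine ⟨min δ₁ δ₂, lt_min hδ₁ hδ₂, fun h hh hhδ => ?_⟩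
  have b₁ := h₁ h hh (hhδ.trans_le (min_le_left _ _))
  have b₂ := h₂ h hh (hhδ.trans_le (min_le_right _ _))
  have m₁ := aemeasurable_translation hf.1 p h
  have m₂ := aemeasurable_translation hg.1 p' h
  rw [← lintegral_prod _ m₁] at b₁
  rw [← lintegral_prod _ m₂] at b₂
  rw [← lintegral_prod (fun z : ℝ × ℝ => ENNReal.ofReal A *
      (‖f z.1 - f (z.1 - z.2)‖ₑ ^ p + ‖g z.1 - g (z.1 - z.2)‖ₑ ^ p')) ((m₁.add m₂).const_mul _),
    lintegral_const_mul' _ _ ENNReal.ofReal_ne_top, lintegral_add_left' m₁]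
  refine (mul_le_mul_right (add_le_add b₁ b₂) _).trans ?_
  rw [← ENNReal.ofReal_add (by positivity) (by positivity), ← ENNReal.ofReal_mul hA]
  refine ENNReal.ofReal_le_ofReal ?_
  have : A * (ε / (2 * (A + 1)) * h + ε / (2 * (A + 1)) * h) = ε * h * (A / (A + 1)) := by
    field_simp; ring
  rw [this]
  exact mul_le_of_le_one_right (by positivity) ((div_le_one (by positivity)).2 (by linarith))

theorem ofReal_integral_le {X : Type*} [MeasurableSpace X] {μ : Measure X} {f : X → ℝ}
    (hf : Integrable f μ) : ENNReal.ofReal (∫ x, f x ∂μ) ≤ ∫⁻ x, ENNReal.ofReal (f x) ∂μ := by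
  rw [integral_eq_lintegral_pos_part_sub_lintegral_neg_part hf]
  exact (ENNReal.ofReal_le_ofReal (sub_le_self _ ENNReal.toReal_nonneg)).trans
    ENNReal.ofReal_toReal_le

/-- A continuous function whose increments over intervals of length `h` are `o(h)` from above, on
average, does not increase. -/
theorem nonpos_of_increment_le {E : ℝ → ℝ} (hE : Continuous E) (h0 : ∀ t ≤ 0, E t = 0)
    {n : ℝ → ℝ → ENNReal} (hn : ∀ ε > 0, ∃ δ > 0, ∀ h : ℝ, 0 < h → h < δ →
      ∫⁻ t, ∫⁻ r in Ioc 0 h, n t r ≤ ENNReal.ofReal (ε * h)) {T : ℝ}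
    (hinc : ∀ h > 0, ∀ᵐ t, t ∈ Icc 0 T → ENNReal.ofReal (E t - E (t - h)) ≤ ∫⁻ r in Ioc 0 h, n t r)
    {τ : ℝ} (hτ : τ ∈ Icc 0 T) : E τ ≤ 0 := by
  by_contra! hpos
  obtain ⟨δ₁, hδ₁, hb⟩ := Metric.continuous_iff.1 hE τ (E τ / 2) (by positivity)
  obtain ⟨δ₂, hδ₂, hn'⟩ := hn (E τ / 4) (by positivity)
  obtain ⟨h, hh0, hh⟩ := exists_between (lt_min hδ₁ hδ₂)
  have hhδ₁ := hh.trans_le (min_le_left _ _)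
  have hhδ₂ := hh.trans_le (min_le_right _ _)
  have hi : ∀ a b, IntervalIntegrable E volume a b := fun a b => hE.intervalIntegrable a b
  have hE' : Continuous fun t => E t - E (t - h) := hE.sub (hE.comp (continuous_id.sub continuous_const))
  -- The integrated increments telescope to a window of length h before τ minus one before 0, where
  -- E vanishes. By continuity the first is at least hE(τ)/2, while the hypothesis bounds it by
  -- hE(τ)/4.
  have e1 : ∫ t in (0 : ℝ)..τ, (E t - E (t - h)) = (∫ t in (τ - h)..τ, E t) - ∫ t in (-h)..0, E t := by
    rw [intervalIntegral.integral_sub (hi _ _)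
      (Continuous.intervalIntegrable (u := fun t => E (t - h)) (by fun_prop) _ _),
      intervalIntegral.integral_comp_sub_right (fun t => E t) h, zero_sub,
      ← intervalIntegral.integral_add_adjacent_intervals (hi (-h) 0) (hi 0 (τ - h)),
      ← intervalIntegral.integral_add_adjacent_intervals (hi 0 (τ - h)) (hi (τ - h) τ)]
    ring
  have e2 : ∫ t in (-h)..0, E t = 0 := by
    rw [intervalIntegral.integral_congr (g := fun _ => (0 : ℝ)) fun t ht => ?_,
      intervalIntegral.integral_zero]
    rw [uIcc_of_le (by linarith)] at ht
    exact h0 t ht.2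
  have e3 : E τ / 2 * h ≤ ∫ t in (τ - h)..τ, E t := by
    have : ∫ t in (τ - h)..τ, E τ / 2 = E τ / 2 * h := by
      rw [intervalIntegral.integral_const, smul_eq_mul]; ring
    rw [← this]
    refine intervalIntegral.integral_mono_on (by linarith) intervalIntegrable_const (hi _ _)
      fun t ht => ?_
    have h1 := hb t (by rw [Real.dist_eq, abs_lt]; constructor <;> linarith [ht.1, ht.2])
    rw [Real.dist_eq, abs_lt] at h1
    linarith [h1.1]
  have e4 : ENNReal.ofReal (∫ t in (0 : ℝ)..τ, (E t - E (t - h))) ≤ ENNReal.ofReal (E τ / 4 * h) := by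
    rw [intervalIntegral.integral_of_le hτ.1]
    calc _ ≤ ∫⁻ t in Ioc 0 τ, ENNReal.ofReal (E t - E (t - h)) :=
          ofReal_integral_le ((intervalIntegrable_iff_integrableOn_Ioc_of_le hτ.1).1
            (hE'.intervalIntegrable _ _))
      _ ≤ ∫⁻ t in Ioc 0 τ, ∫⁻ r in Ioc 0 h, n t r := by
          refine lintegral_mono_ae ?_
          filter_upwards [ae_restrict_of_ae (hinc h hh0), ae_restrict_mem measurableSet_Ioc] with t h1 ht
          exact h1 ⟨ht.1.le, ht.2.trans hτ.2⟩
      _ ≤ ∫⁻ t, ∫⁻ r in Ioc 0 h, n t r := setLIntegral_le_lintegral _ _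
      _ ≤ _ := hn' h hh0 hhδ₂
  rw [e1, e2, sub_zero] at e4
  have e5 := (ENNReal.ofReal_le_ofReal_iff (by positivity)).1 e4
  have := mul_pos hpos hh0
  linarith

end Translation

/-! ### The path class L²(V) ∩ L^{2σ+2}(L^{2σ+2}) -/

section PathClass

variable {L₁ L₂ σ : ℝ}

/-- The integral `∫ |w|^{2σ+2}`. -/
def mass (σ : ℝ) (w : V L₁ L₂) : ℝ := ∫ x, ‖fn w x‖ ^ (2 * σ + 2) ∂(dom L₁ L₂)

theorem mass_nonneg (σ : ℝ) (w : V L₁ L₂) : 0 ≤ mass σ w := integral_nonneg fun x => by positivity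

/-- The embedding of `V` into `L^p`. -/
theorem exists_embedding (L₁ L₂ : ℝ) {p : ℝ} (hp : 0 < p) [Fact (1 ≤ ENNReal.ofReal p)] :
    ∃ J : V L₁ L₂ →L[ℂ] Lp ℂ (ENNReal.ofReal p) (dom L₁ L₂), ∀ w : V L₁ L₂,
      ‖J w‖ ^ p = ∫ x, ‖fn w x‖ ^ p ∂(dom L₁ L₂) := by
  have hne : ENNReal.ofReal p ≠ ⊤ := ENNReal.ofReal_ne_top
  have h0 : ENNReal.ofReal p ≠ 0 := by simpa using hp
  set Λ : V L₁ L₂ →ₗ[ℂ] Lp ℂ (ENNReal.ofReal p) (dom L₁ L₂) :=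
    { toFun := fun w => (memLp_fn w hne).toLp (fn w)
      map_add' := fun v w => by
        rw [← MemLp.toLp_add, MemLp.toLp_eq_toLp_iff]
        exact Lp.coeFn_add (fn v) (fn w)
      map_smul' := fun c w => by
        rw [RingHom.id_apply, ← MemLp.toLp_const_smul, MemLp.toLp_eq_toLp_iff]
        exact Lp.coeFn_smul c (fn w) }
  have hΛ : ∀ w, ‖Λ w‖ = (∫ x, ‖fn w x‖ ^ p ∂(dom L₁ L₂)) ^ p⁻¹ := fun w => by
    change ‖(memLp_fn w hne).toLp (fn w)‖ = _
    rw [Lp.norm_toLp, (memLp_fn w hne).eLpNorm_eq_integral_rpow_norm h0 hne,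
      ENNReal.toReal_ofReal (by positivity), ENNReal.toReal_ofReal hp.le]
  obtain ⟨C, hC, hb⟩ := exists_integral_rpow_le L₁ L₂ hp.le 1
  refine ⟨Λ.mkContinuous (C ^ p⁻¹) fun w => ?_, fun w => ?_⟩
  · have hb1 : ∀ z : V L₁ L₂, ‖z‖ ≤ 1 → ‖Λ z‖ ≤ C ^ p⁻¹ := fun z hz => by
      rw [hΛ]
      exact Real.rpow_le_rpow (integral_nonneg fun x => by positivity) (hb z hz) (by positivity)
    rcases eq_or_ne w 0 with rfl | hw
    · rw [map_zero, norm_zero, norm_zero, mul_zero]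
    have hw' : 0 < ‖w‖ := norm_pos_iff.2 hw
    have h1 := hb1 (((‖w‖⁻¹ : ℝ) : ℂ) • w) (by
      rw [norm_smul, Complex.norm_real, norm_inv, norm_norm, inv_mul_cancel₀ hw'.ne'])
    rw [map_smul, norm_smul, Complex.norm_real, norm_inv, norm_norm, inv_mul_le_iff₀ hw'] at h1
    rwa [mul_comm]
  · rw [LinearMap.mkContinuous_apply, hΛ, ← Real.rpow_mul (integral_nonneg fun x => by positivity),
      inv_mul_cancel₀ hp.ne', Real.rpow_one]

/-- Paths in `L²(V) ∩ L^{2σ+2}(L^{2σ+2})`. -/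
structure InClass (σ : ℝ) (μ : Measure ℝ) (U : ℝ → V L₁ L₂) : Prop where
  memLp : MemLp U 2 μ
  integrable : Integrable (fun s => mass σ (U s)) μ

/-- Through J the mass condition becomes an L^p condition on a path with values in a Banach space,
which makes differences and translations of paths accessible. -/
theorem memLp_embedding (hσ : 2 < σ) {μ : Measure ℝ} [Fact (1 ≤ ENNReal.ofReal (2 * σ + 2))]
    {J : V L₁ L₂ →L[ℂ] Lp ℂ (ENNReal.ofReal (2 * σ + 2)) (dom L₁ L₂)}
    (hJ : ∀ w : V L₁ L₂, ‖J w‖ ^ (2 * σ + 2) = mass σ w) {U : ℝ → V L₁ L₂}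
    (hU : AEStronglyMeasurable U μ) :
    MemLp (fun s => J (U s)) (ENNReal.ofReal (2 * σ + 2)) μ ↔ Integrable (fun s => mass σ (U s)) μ := by
  rw [← integrable_norm_rpow_iff (J.continuous.comp_aestronglyMeasurable hU)
    (by simp; linarith) ENNReal.ofReal_ne_top, ENNReal.toReal_ofReal (by linarith)]
  simp only [hJ]

theorem fact_one_le (hσ : 2 < σ) : Fact (1 ≤ ENNReal.ofReal (2 * σ + 2)) :=
  ⟨by simpa using ENNReal.ofReal_le_ofReal (by linarith : (1 : ℝ) ≤ 2 * σ + 2)⟩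

theorem InClass.sub (hσ : 2 < σ) {μ : Measure ℝ} {U W : ℝ → V L₁ L₂} (hU : InClass σ μ U)
    (hW : InClass σ μ W) : InClass σ μ fun s => U s - W s := by
  have := fact_one_le hσ
  obtain ⟨J, hJ⟩ := exists_embedding L₁ L₂ (p := 2 * σ + 2) (by linarith)
  refine ⟨hU.memLp.sub hW.memLp, ?_⟩
  have h := ((memLp_embedding hσ hJ hU.memLp.1).2 hU.integrable).sub
    ((memLp_embedding hσ hJ hW.memLp.1).2 hW.integrable)
  refine (memLp_embedding hσ hJ (hU.memLp.1.sub hW.memLp.1)).1 (h.ae_eq ?_)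
  exact ae_of_all _ fun s => (map_sub J (U s) (W s)).symm

theorem InClass.integrable_sq {μ : Measure ℝ} {U : ℝ → V L₁ L₂} (hU : InClass σ μ U) :
    Integrable (fun s => ‖U s‖ ^ 2) μ := hU.memLp.integrable_norm_pow (by simp)

theorem InClass.integrable_gr {μ : Measure ℝ} {U : ℝ → V L₁ L₂} (hU : InClass σ μ U) :
    Integrable (fun s => gr (U s)) μ := by
  refine hU.integrable_sq.mono' ?_ (ae_of_all _ fun s => ?_)
  · exact (((dxL L₁ L₂).continuous.comp_aestronglyMeasurable hU.memLp.1).norm.pow 2).add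
      (((dyL L₁ L₂).continuous.comp_aestronglyMeasurable hU.memLp.1).norm.pow 2)
  · rw [Real.norm_of_nonneg (gr_nonneg _)]; exact gr_le _

theorem InClass.integrable_bigK (hσ : 2 < σ) {μ : Measure ℝ} [IsFiniteMeasure μ] {U : ℝ → V L₁ L₂}
    (hU : InClass σ μ U) : Integrable (fun s => bigK σ (U s)) μ := by
  simp only [bigK_eq hσ]
  exact ((integrable_const _).add hU.integrable).add hU.integrable_gr

theorem InClass.integrable_bigN (hσ : 2 < σ) {μ : Measure ℝ} {U : ℝ → V L₁ L₂}
    (hU : InClass σ μ U) : Integrable (fun s => bigN σ (U s)) μ := by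
  simp only [bigN_eq hσ]
  exact hU.integrable_sq.add hU.integrable

theorem InClass.integrable_form (hσ : 2 < σ) {μ : Measure ℝ} [IsFiniteMeasure μ] {U W : ℝ → V L₁ L₂}
    (hU : InClass σ μ U) (hW : InClass σ μ W) {R : ℝ} (hR : 0 ≤ R) {q : ℝ → Par}
    (hq : ∀ t, (q t).Bdd R) (hqc : ∀ u ψ : V L₁ L₂, Continuous fun t => form σ (q t) u ψ) :
    Integrable (fun s => form σ (q s) (U s) (W s)) μ := by
  obtain ⟨C, hC, h⟩ := exists_norm_form_le (L₁ := L₁) (L₂ := L₂) hσ hR one_pos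
  exact (((hU.integrable_bigK hσ).const_mul 1).add ((hW.integrable_bigN hσ).const_mul C)).mono'
    (aestronglyMeasurable_form hσ hqc hU.memLp.1 hW.memLp.1) (ae_of_all _ fun s => h _ (hq s) _ _)

theorem InClass.const (σ : ℝ) {μ : Measure ℝ} [IsFiniteMeasure μ] (w : V L₁ L₂) :
    InClass σ μ fun _ => w :=
  ⟨memLp_const w, integrable_const _⟩

theorem lintegral_mass_eq (hσ : 2 < σ) {T : ℝ} {u : ℝ → H L₁ L₂} {U : ℝ → V L₁ L₂}
    (h : ∀ᵐ s ∂(volume.restrict (Icc 0 T)), fn (U s) = u s) : LpLpEnergy T (2 * σ + 2) u =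
      ∫⁻ s in Icc 0 T, ENNReal.ofReal (mass σ (U s)) :=
  LpLpEnergy_eq (by linarith) h

theorem inClass_of_energy (hσ : 2 < σ) {T : ℝ} {u : ℝ → H L₁ L₂} {U : ℝ → V L₁ L₂}
    (hU : MemLp U 2 (volume.restrict (Icc 0 T)))
    (h : ∀ᵐ s ∂(volume.restrict (Icc 0 T)), fn (U s) = u s)
    (he : LpLpEnergy T (2 * σ + 2) u < ⊤) : InClass σ (volume.restrict (Icc 0 T)) U := by
  have := fact_one_le hσ
  obtain ⟨J, hJ⟩ := exists_embedding L₁ L₂ (p := 2 * σ + 2) (by linarith)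
  refine ⟨hU, ?_, ?_⟩
  · have h1 := ((J.continuous.comp_aestronglyMeasurable hU.1).norm.aemeasurable.pow_const
      (2 * σ + 2)).aestronglyMeasurable
    exact h1.congr (ae_of_all _ fun s => hJ (U s))
  · rw [hasFiniteIntegral_iff_ofReal (ae_of_all _ fun s => mass_nonneg _ _), ← lintegral_mass_eq hσ h]
    exact he

end PathClass

/-! ### Energy inequality for differences of weak solutions -/

section Energy

variable {L₁ L₂ σ : ℝ}

theorem setLIntegral_Ioc_sub_left (F : ℝ → ENNReal) (t h : ℝ) :
    ∫⁻ s in Ioc (t - h) t, F s = ∫⁻ r in Ioc 0 h, F (t - r) := by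
  rw [← lintegral_indicator measurableSet_Ioc, ← lintegral_sub_left_eq_self _ t,
    ← restrict_Ico_eq_restrict_Ioc (a := (0 : ℝ)), ← lintegral_indicator measurableSet_Ico]
  refine lintegral_congr fun r => ?_
  by_cases hr : r ∈ Ico 0 h
  · rw [indicator_of_mem hr, indicator_of_mem (show t - r ∈ Ioc (t - h) t from
      ⟨by linarith [hr.2], by linarith [hr.1]⟩)]
  · rw [indicator_of_notMem hr, indicator_of_notMem fun h' => hr ⟨by linarith [h'.2], by
      linarith [h'.1]⟩]

theorem sq_norm_sub_sq_norm_le {E : Type*} [NormedAddCommGroup E] [InnerProductSpace ℂ E] (x y : E) :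
    ‖x‖ ^ 2 - ‖y‖ ^ 2 ≤ 2 * (inner ℂ x (x - y)).re := by
  have h := norm_sub_sq (𝕜 := ℂ) x y
  have h1 := sq_nonneg ‖x - y‖
  have h2 : (inner ℂ x (x - y)).re = ‖x‖ ^ 2 - (inner ℂ x y).re := by
    rw [inner_sub_right, Complex.sub_re]
    congr 1
    exact inner_self_eq_norm_sq (𝕜 := ℂ) x
  have h3 : RCLike.re (inner ℂ x y) = (inner ℂ x y).re := rfl
  rw [h3] at h
  linarith

/-- The energy inequality for a path with a distributional time derivative `ℓ`. -/
theorem energy_le_of_weak_derivative (hσ : 2 < σ) {T : ℝ} (hT : 0 < T) {w : ℝ → H L₁ L₂}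
    (hw : ContinuousOn w (Icc 0 T)) {D : ℝ → V L₁ L₂} (hD : InClass σ (volume.restrict (Icc 0 T)) D)
    (hDw : ∀ᵐ s ∂(volume.restrict (Icc 0 T)), fn (D s) = w s) {ℓ : ℝ → V L₁ L₂ → ℂ}
    (hsub : ∀ s ψ χ, ℓ s (ψ - χ) = ℓ s ψ - ℓ s χ) {k : ℝ → ℝ}
    (hk : Integrable k (volume.restrict (Icc 0 T)))
    (hb : ∀ η > 0, ∃ C : ℝ, 0 ≤ C ∧ ∀ s ψ, ‖ℓ s ψ‖ ≤ η * k s + C * bigN σ ψ)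
    (hiψ : ∀ ψ, Integrable (fun s => ℓ s ψ) (volume.restrict (Icc 0 T)))
    (hiD : Integrable (fun s => ℓ s (D s)) (volume.restrict (Icc 0 T)))
    (heq : ∀ ψ, ∀ t ∈ Icc 0 T, inner ℂ (fn ψ) (w t) = ∫ s in (0 : ℝ)..t, ℓ s ψ) {τ : ℝ}
    (hτ : τ ∈ Icc 0 T) : ‖w τ‖ ^ 2 ≤ 2 * ∫ s in (0 : ℝ)..τ, (ℓ s (D s)).re := by
  -- The equation at t = 0 gives ⟨ψ, w 0⟩ = 0 for ψ in V only. Almost every w t comes from V, and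
  -- continuity in t allows w 0 itself as a test.
  have hw0 : w 0 = 0 := by
    have h1 : (fun t => inner ℂ (w t) (w 0)) =ᵐ[volume.restrict (Icc 0 T)] fun _ => 0 := by
      filter_upwards [hDw] with t ht
      rw [← ht, heq _ 0 ⟨le_rfl, hT.le⟩, intervalIntegral.integral_same]
    have h2 := Measure.eqOn_Icc_of_ae_eq volume hT.ne h1 (hw.inner continuousOn_const)
      continuousOn_const (⟨le_rfl, hT.le⟩ : (0 : ℝ) ∈ Icc 0 T)
    exact inner_self_eq_zero.1 h2
  set w' : ℝ → H L₁ L₂ := fun t => w (projIcc 0 T hT.le t)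
  have hw' : Continuous w' := hw.comp_continuous
    (continuous_subtype_val.comp continuous_projIcc) fun t => (projIcc 0 T hT.le t).2
  have hw'0 : ∀ t ≤ 0, w' t = 0 := fun t ht => by
    simp only [w']
    rw [projIcc_of_le_left hT.le ht, hw0]
  have hw'e : ∀ t ∈ Icc 0 T, w' t = w t := fun t ht => by
    simp only [w']; rw [projIcc_of_mem hT.le ht]
  set I : Set ℝ := Ioc 0 T
  have hI : MeasurableSet I := measurableSet_Ioc
  have hIr : volume.restrict (Icc 0 T) = volume.restrict I := (restrict_Ioc_eq_restrict_Icc).symm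
  rw [hIr] at hk hiψ hiD
  have hnot : ∀ {s : ℝ}, s ≤ 0 → s ∉ I := fun hs h => absurd h.1 (not_lt.2 hs)
  have hweak : ∀ ψ, ∀ t ≤ T, inner ℂ (fn ψ) (w' t) = ∫ s in (0 : ℝ)..t, I.indicator (fun s => ℓ s ψ) s :=
    fun ψ t ht => by
    rcases le_total t 0 with h | h
    · rw [hw'0 t h, inner_zero_right, intervalIntegral.integral_congr (g := fun _ => (0 : ℂ))
        fun s hs => ?_, intervalIntegral.integral_zero]
      rw [uIcc_of_ge h] at hs
      exact indicator_of_notMem (hnot hs.2) _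
    · rw [hw'e t ⟨h, ht⟩, heq ψ t ⟨h, ht⟩]
      refine intervalIntegral.integral_congr_ae (ae_of_all _ fun s hs => ?_)
      rw [uIoc_of_le h] at hs
      have hsI : s ∈ I := ⟨hs.1, hs.2.trans ht⟩
      rw [indicator_of_mem hsI]
  have hiL : ∀ ψ a b, IntervalIntegrable (I.indicator fun s => ℓ s ψ) volume a b := fun ψ a b =>
    ((integrable_indicator_iff hI).2 (hiψ ψ)).intervalIntegrable
  have := fact_one_le hσ
  obtain ⟨J, hJ⟩ := exists_embedding L₁ L₂ (p := 2 * σ + 2) (by linarith)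
  set D' : ℝ → V L₁ L₂ := I.indicator D
  have hD'2 : MemLp D' (ENNReal.ofReal 2) volume := by
    rw [show ENNReal.ofReal 2 = 2 by simp]
    exact (memLp_indicator_iff_restrict hI).2 (hIr ▸ hD.memLp)
  have hD'p : MemLp (fun t => J (D' t)) (ENNReal.ofReal (2 * σ + 2)) volume := by
    have h1 := (memLp_embedding hσ hJ hD.memLp.1).2 hD.integrable
    rw [hIr] at h1
    refine ((memLp_indicator_iff_restrict hI).2 h1).ae_eq (ae_of_all _ fun t => ?_)
    by_cases ht : t ∈ I
    · simp only [D', indicator_of_mem ht]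
    · simp only [D', indicator_of_notMem ht, map_zero]
  -- The increment ‖w(t)‖² − ‖w(t−h)‖² is at most twice the integral of Re ℓ_s(D t) over (t−h, t].
  -- Replacing D t by D s costs ηk(s) + C bigN(D t − D s). The second error is o(h) on average by
  -- continuity of translations; the first disappears when η tends to 0.
  have hη : ∀ η > 0, ‖w τ‖ ^ 2 ≤ 2 * (∫ s in (0 : ℝ)..τ, (ℓ s (D s)).re) +
      η * (2 * ∫ s in (0 : ℝ)..τ, k s) := fun η hη => by
    obtain ⟨C, hC, hbC⟩ := hb η hη
    set g : ℝ → ℝ := I.indicator fun s => (ℓ s (D s)).re + η * k s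
    have hig : Integrable g := (integrable_indicator_iff hI).2 (hiD.re.add (hk.const_mul η))
    have hig' : ∀ a b, IntervalIntegrable g volume a b := fun a b => hig.intervalIntegrable
    set G : ℝ → ℝ := fun t => ∫ s in (0 : ℝ)..t, g s
    have hG : Continuous G := intervalIntegral.continuous_primitive hig' 0
    set N : ℝ → ℝ → ENNReal := fun t s => ENNReal.ofReal (2 * C) *
      (‖D' t - D' s‖ₑ ^ (2 : ℝ) + ‖J (D' t) - J (D' s)‖ₑ ^ (2 * σ + 2))
    have hN : ∀ t s, ENNReal.ofReal (2 * (C * bigN σ (D' t - D' s))) = N t s := fun t s => by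
      have h1 : bigN σ (D' t - D' s) = ‖D' t - D' s‖ ^ 2 + ‖J (D' t) - J (D' s)‖ ^ (2 * σ + 2) := by
        rw [bigN_eq hσ, ← map_sub, hJ]
      rw [← mul_assoc, h1, ENNReal.ofReal_mul (by positivity),
        ENNReal.ofReal_add (by positivity) (by positivity),
        ← ENNReal.ofReal_rpow_of_nonneg (norm_nonneg _) (by linarith), ofReal_norm,
        ← Real.rpow_two, ← ENNReal.ofReal_rpow_of_nonneg (norm_nonneg _) (by norm_num), ofReal_norm]
    have hE := nonpos_of_increment_le (E := fun t => ‖w' t‖ ^ 2 - 2 * G t)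
      (n := fun t r => N t (t - r)) (T := T) ((hw'.norm.pow 2).sub (hG.const_mul 2)) (fun t ht => by
        have : G t = 0 := by
          simp only [G]
          rw [intervalIntegral.integral_congr (g := fun _ => (0 : ℝ)) fun s hs => ?_,
            intervalIntegral.integral_zero]
          rw [uIcc_of_ge ht] at hs
          exact indicator_of_notMem (hnot hs.2) _
        simp [hw'0 t ht, this])
      (fun ε hε => exists_translation_average_add_le (by norm_num) (by linarith) hD'2 hD'p
        (by positivity) hε) (fun h hh => ?_) hτ
    · have hGτ : G τ = (∫ s in (0 : ℝ)..τ, (ℓ s (D s)).re) + η * ∫ s in (0 : ℝ)..τ, k s := by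
        have hsubτ : Ioc 0 τ ⊆ I := Ioc_subset_Ioc_right hτ.2
        have i1 : IntervalIntegrable (fun s => (ℓ s (D s)).re) volume 0 τ :=
          (intervalIntegrable_iff_integrableOn_Ioc_of_le hτ.1).2
            (IntegrableOn.mono_set (t := I) hiD.re hsubτ)
        have i2 : IntervalIntegrable (fun s => η * k s) volume 0 τ :=
          (intervalIntegrable_iff_integrableOn_Ioc_of_le hτ.1).2
            (IntegrableOn.mono_set (t := I) (hk.const_mul η) hsubτ)
        rw [← intervalIntegral.integral_const_mul, ← intervalIntegral.integral_add i1 i2]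
        refine intervalIntegral.integral_congr_ae (ae_of_all _ fun s hs => ?_)
        rw [uIoc_of_le hτ.1] at hs
        exact indicator_of_mem (hsubτ hs) _
      rw [hw'e τ hτ, hGτ] at hE
      linarith
    · have hDw' := (ae_restrict_iff' measurableSet_Icc).1 hDw
      have h0 : ∀ᵐ t : ℝ, t ≠ 0 := by
        simp [ae_iff]
      filter_upwards [hDw', h0] with t h1 h2 ht
      have htI : t ∈ I := ⟨lt_of_le_of_ne ht.1 h2.symm, ht.2⟩
      have hfn : fn (D' t) = w' t := by
        simp only [D', indicator_of_mem htI]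
        rw [h1 ht, hw'e t ht]
      have e1 : inner ℂ (w' t) (w' t - w' (t - h)) =
          ∫ s in (t - h)..t, I.indicator (fun s => ℓ s (D' t)) s := by
        have h3 := hweak (D' t) t ht.2
        have h4 := hweak (D' t) (t - h) (by linarith [ht.2])
        rw [hfn] at h3 h4
        rw [inner_sub_right, h3, h4,
          intervalIntegral.integral_interval_sub_left (hiL _ _ _) (hiL _ _ _)]
      have e2 : (∫ s in (t - h)..t, I.indicator (fun s => ℓ s (D' t)) s).re =
          ∫ s in (t - h)..t, (I.indicator (fun s => ℓ s (D' t)) s).re :=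
        (Complex.reCLM.intervalIntegral_comp_comm (hiL _ _ _)).symm
      have e3 : G t - G (t - h) = ∫ s in (t - h)..t, g s :=
        intervalIntegral.integral_interval_sub_left (hig' _ _) (hig' _ _)
      have hire : IntervalIntegrable (fun s => (I.indicator (fun s => ℓ s (D' t)) s).re) volume
          (t - h) t := ⟨(hiL (D' t) (t - h) t).1.re, (hiL (D' t) (t - h) t).2.re⟩
      have hiall : IntervalIntegrable
          (fun s => 2 * ((I.indicator (fun s => ℓ s (D' t)) s).re - g s)) volume (t - h) t :=
        (hire.sub (hig' _ _)).const_mul 2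
      have e4 : (‖w' t‖ ^ 2 - 2 * G t) - (‖w' (t - h)‖ ^ 2 - 2 * G (t - h)) ≤
          ∫ s in (t - h)..t, 2 * ((I.indicator (fun s => ℓ s (D' t)) s).re - g s) := by
        have h3 := sq_norm_sub_sq_norm_le (w' t) (w' (t - h))
        rw [e1, e2] at h3
        rw [intervalIntegral.integral_const_mul, intervalIntegral.integral_sub hire (hig' _ _), ← e3]
        linarith
      have hth : t - h ≤ t := by linarith
      rw [← setLIntegral_Ioc_sub_left (fun s => N t s)]
      refine (ENNReal.ofReal_le_ofReal e4).trans ?_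
      rw [intervalIntegral.integral_of_le hth]
      refine (ofReal_integral_le ((intervalIntegrable_iff_integrableOn_Ioc_of_le hth).1 hiall)).trans
        (lintegral_mono fun s => ?_)
      simp only
      rw [← hN]
      refine ENNReal.ofReal_le_ofReal (mul_le_mul_of_nonneg_left ?_ zero_le_two)
      by_cases hs : s ∈ I
      · simp only [g, indicator_of_mem hs]
        have h3 : ℓ s (D' t - D' s) = ℓ s (D' t) - ℓ s (D s) := by
          rw [hsub]; simp only [D', indicator_of_mem hs]
        have h4 := (Complex.re_le_norm _).trans (hbC s (D' t - D' s))
        rw [h3, Complex.sub_re] at h4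
        linarith
      · simp only [g, indicator_of_notMem hs]
        have := bigN_nonneg hσ (D' t - D' s)
        simp; positivity
  refine le_of_forall_pos_le_add fun ε hε => ?_
  set b := 2 * ∫ s in (0 : ℝ)..τ, k s
  refine (hη (ε / (|b| + 1)) (by positivity)).trans (add_le_add_right ?_ _)
  rw [div_mul_eq_mul_div, div_le_iff₀ (by positivity)]
  have := le_abs_self b
  nlinarith

/-- The energy inequality for the difference of two weak solutions. -/
theorem IsWeak.energy_sub_le (hσ : 2 < σ) {R : ℝ} (hR : 0 ≤ R) {q q' : ℝ → Par}
    (hq : ∀ t, (q t).Bdd R) (hq' : ∀ t, (q' t).Bdd R)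
    (hqc : ∀ u ψ : V L₁ L₂, Continuous fun t => form σ (q t) u ψ)
    (hqc' : ∀ u ψ : V L₁ L₂, Continuous fun t => form σ (q' t) u ψ) {T : ℝ} (hT : 0 < T)
    {u₀ : V L₁ L₂} {u v : ℝ → H L₁ L₂} {U W : ℝ → V L₁ L₂} (hu : IsWeak T σ q u₀ u U)
    (hv : IsWeak T σ q' u₀ v W) {τ : ℝ} (hτ : τ ∈ Icc 0 T) : ‖u τ - v τ‖ ^ 2 ≤
      2 * ∫ s in (0 : ℝ)..τ, (form σ (q s) (U s) (U s - W s) - form σ (q' s) (W s) (U s - W s)).re := by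
  have cU := inClass_of_energy hσ hu.memLp hu.eq_ae hu.energy
  have cW := inClass_of_energy hσ hv.memLp hv.eq_ae hv.energy
  have i1 : ∀ ψ, Integrable (fun s => form σ (q s) (U s) ψ) (volume.restrict (Icc 0 T)) := fun ψ =>
    cU.integrable_form hσ (InClass.const σ ψ) hR hq hqc
  have i2 : ∀ ψ, Integrable (fun s => form σ (q' s) (W s) ψ) (volume.restrict (Icc 0 T)) := fun ψ =>
    cW.integrable_form hσ (InClass.const σ ψ) hR hq' hqc'
  refine energy_le_of_weak_derivative hσ hT (hu.continuousOn.sub hv.continuousOn)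
    (cU.sub hσ cW) ?_ (ℓ := fun s ψ => form σ (q s) (U s) ψ - form σ (q' s) (W s) ψ)
    (k := fun s => bigK σ (U s) + bigK σ (W s)) (fun s ψ χ => ?_)
    ((cU.integrable_bigK hσ).add (cW.integrable_bigK hσ)) (fun η hη => ?_)
    (fun ψ => (i1 ψ).sub (i2 ψ)) ((cU.integrable_form hσ (cU.sub hσ cW) hR hq hqc).sub
      (cW.integrable_form hσ (cU.sub hσ cW) hR hq' hqc')) (fun ψ t ht => ?_) hτ
  · filter_upwards [hu.eq_ae, hv.eq_ae] with s h1 h2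
    rw [fn_sub, h1, h2, Pi.sub_apply]
  · rw [form_sub_right hσ, form_sub_right hσ]; ring
  · obtain ⟨C, hC, h⟩ := exists_norm_form_le (L₁ := L₁) (L₂ := L₂) hσ hR hη
    refine ⟨2 * C, by positivity, fun s ψ => (norm_sub_le _ _).trans ?_⟩
    have h1 := h (q s) (hq s) (U s) ψ
    have h2 := h (q' s) (hq' s) (W s) ψ
    linarith
  · have hi : ∀ {f : ℝ → ℂ}, Integrable f (volume.restrict (Icc 0 T)) →
        IntervalIntegrable f volume 0 t := fun hf =>
      (intervalIntegrable_iff_integrableOn_Icc_of_le ht.1 (by simp)).2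
        (IntegrableOn.mono_set (t := Icc 0 T) hf (Icc_subset_Icc_right ht.2))
    rw [intervalIntegral.integral_sub (hi (i1 ψ)) (hi (i2 ψ)), Pi.sub_apply, inner_sub_right, hu.equation ψ t ht,
      hv.equation ψ t ht]
    ring

end Energy

/-! ### Variation of constants with integrable coefficients -/

section Gauge

/-- Two comparison functions are allowed so that a complex primitive can be compared with its real
and imaginary parts; for the exponential of a primitive both are taken equal. -/
theorem absolutelyContinuousOnInterval_of_dist_le {X Y W : Type*} [PseudoMetricSpace X]
    [PseudoMetricSpace Y] [PseudoMetricSpace W] {f : ℝ → X} {g : ℝ → Y} {k : ℝ → W} {a b K : ℝ}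
    (hg : AbsolutelyContinuousOnInterval g a b) (hk : AbsolutelyContinuousOnInterval k a b)
    (h : ∀ s ∈ uIcc a b, ∀ t ∈ uIcc a b, dist (f s) (f t) ≤ K * (dist (g s) (g t) + dist (k s) (k t))) :
    AbsolutelyContinuousOnInterval f a b := by
  have h1 : Tendsto (fun E : ℕ × (ℕ → ℝ × ℝ) => K *
      (∑ i ∈ Finset.range E.1, dist (g (E.2 i).1) (g (E.2 i).2) +
        ∑ i ∈ Finset.range E.1, dist (k (E.2 i).1) (k (E.2 i).2)))
      (AbsolutelyContinuousOnInterval.totalLengthFilter ⊓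
        𝓟 (AbsolutelyContinuousOnInterval.disjWithin a b)) (𝓝 0) := by
    simpa using (Tendsto.add hg hk).const_mul K
  refine squeeze_zero' (Eventually.of_forall fun E => Finset.sum_nonneg fun i _ => dist_nonneg)
    ?_ h1
  filter_upwards [mem_inf_of_right (mem_principal_self _)] with E hE
  rw [← Finset.sum_add_distrib, Finset.mul_sum]
  exact Finset.sum_le_sum fun i hi => h _ (hE.1 i hi).1 _ (hE.1 i hi).2

theorem absolutelyContinuousOnInterval_integral_complex {f : ℝ → ℂ} {a b : ℝ}
    (hf : IntervalIntegrable f volume a b) :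
    AbsolutelyContinuousOnInterval (fun t => ∫ s in a..t, f s) a b := by
  have h1 : IntervalIntegrable (fun s => (f s).re) volume a b := ⟨hf.1.re, hf.2.re⟩
  have h2 : IntervalIntegrable (fun s => (f s).im) volume a b := ⟨hf.1.im, hf.2.im⟩
  refine absolutelyContinuousOnInterval_of_dist_le (K := 1)
    (h1.absolutelyContinuousOnInterval_intervalIntegral left_mem_uIcc)
    (h2.absolutelyContinuousOnInterval_intervalIntegral left_mem_uIcc) fun s hs t ht => ?_
  have hi : ∀ r ∈ uIcc a b, IntervalIntegrable f volume a r := fun r hr =>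
    hf.mono_set (uIcc_subset_uIcc_left hr)
  have hr : ∀ r ∈ uIcc a b, (∫ s in a..r, (f s).re) = (∫ s in a..r, f s).re := fun r hr =>
    Complex.reCLM.intervalIntegral_comp_comm (hi r hr)
  have hm : ∀ r ∈ uIcc a b, (∫ s in a..r, (f s).im) = (∫ s in a..r, f s).im := fun r hr =>
    Complex.imCLM.intervalIntegral_comp_comm (hi r hr)
  rw [hr s hs, hr t ht, hm s hs, hm t ht, one_mul, Complex.dist_eq, Real.dist_eq, Real.dist_eq]
  have := Complex.norm_le_abs_re_add_abs_im ((∫ s in a..s, f s) - ∫ s in a..t, f s)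
  rwa [Complex.sub_re, Complex.sub_im] at this

theorem norm_cexp_sub_cexp_le {z w : ℂ} {B : ℝ} (hz : z.re ≤ B) (hw : w.re ≤ B) :
    ‖Complex.exp z - Complex.exp w‖ ≤ Real.exp B * ‖z - w‖ := by
  have hc : Convex ℝ {z : ℂ | z.re ≤ B} := convex_halfSpace_re_le B
  refine hc.norm_image_sub_le_of_norm_hasDerivWithin_le
    (f' := Complex.exp) (fun x _ => (Complex.hasDerivAt_exp x).hasDerivWithinAt) (fun x hx => ?_) hw hz
  rw [Complex.norm_exp]
  exact Real.exp_le_exp.2 hx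

theorem abs_exp_sub_exp_le {x y B : ℝ} (hx : x ≤ B) (hy : y ≤ B) :
    |Real.exp x - Real.exp y| ≤ Real.exp B * |x - y| := by
  have h := norm_cexp_sub_cexp_le (z := x) (w := y) (B := B) (by simpa) (by simpa)
  rwa [← Complex.ofReal_exp, ← Complex.ofReal_exp, ← Complex.ofReal_sub, ← Complex.ofReal_sub,
    Complex.norm_real, Complex.norm_real] at h

/-- Variation of constants. -/
theorem exp_integral_mul_eq {T : ℝ} (hT : 0 ≤ T) {F h x : ℝ → ℂ} {x₀ : ℂ}
    (hF : IntegrableOn F (Icc 0 T)) (hh : IntegrableOn h (Icc 0 T))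
    (hx : ∀ t ∈ Icc 0 T, x t = x₀ + ∫ s in (0 : ℝ)..t, F s) : ∀ t ∈ Icc 0 T,
      Complex.exp (∫ s in (0 : ℝ)..t, h s) * x t = x₀ +
        ∫ s in (0 : ℝ)..t, Complex.exp (∫ r in (0 : ℝ)..s, h r) * (F s + h s * x s) := by
  have hu : uIcc 0 T = Icc 0 T := uIcc_of_le hT
  have iF : IntervalIntegrable F volume 0 T :=
    (intervalIntegrable_iff_integrableOn_Icc_of_le hT (by simp)).2 hF
  have ih : IntervalIntegrable h volume 0 T :=
    (intervalIntegrable_iff_integrableOn_Icc_of_le hT (by simp)).2 hh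
  set X : ℝ → ℂ := fun t => x₀ + ∫ s in (0 : ℝ)..t, F s
  set θ : ℝ → ℂ := fun t => ∫ s in (0 : ℝ)..t, h s
  have aX : AbsolutelyContinuousOnInterval X 0 T :=
    (LipschitzWith.const x₀).lipschitzOnWith.absolutelyContinuousOnInterval.add
      (absolutelyContinuousOnInterval_integral_complex iF)
  have aθ : AbsolutelyContinuousOnInterval θ 0 T := absolutelyContinuousOnInterval_integral_complex ih
  have aE : AbsolutelyContinuousOnInterval (fun t => Complex.exp (θ t)) 0 T := by
    obtain ⟨B, hB⟩ := aθ.exists_bound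
    refine absolutelyContinuousOnInterval_of_dist_le (K := Real.exp B) aθ aθ fun s hs t ht => ?_
    rw [Complex.dist_eq, Complex.dist_eq]
    refine (norm_cexp_sub_cexp_le ((Complex.re_le_norm _).trans (hB s hs))
      ((Complex.re_le_norm _).trans (hB t ht))).trans ?_
    have := norm_nonneg (θ s - θ t)
    have := Real.exp_pos B
    nlinarith
  have iG : IntervalIntegrable (fun s => Complex.exp (θ s) * (F s + h s * X s)) volume 0 T :=
    (iF.add (ih.mul_continuousOn aX.continuousOn)).continuousOn_mul aE.continuousOn
  -- F and h are only integrable, so the product rule holds only almost everywhere. The difference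
  -- of both sides is absolutely continuous with derivative zero almost everywhere, hence constant.
  have aD : AbsolutelyContinuousOnInterval (fun t => Complex.exp (θ t) * X t -
      ∫ s in (0 : ℝ)..t, Complex.exp (θ s) * (F s + h s * X s)) 0 T :=
    (aE.fun_smul aX).fun_sub (absolutelyContinuousOnInterval_integral_complex iG)
  obtain ⟨C, hC⟩ := aD.const_of_ae_hasDerivAt_zero (by
    filter_upwards [iF.ae_hasDerivAt_integral, ih.ae_hasDerivAt_integral,
      iG.ae_hasDerivAt_integral] with t h1 h2 h3 ht
    have d1 : HasDerivAt X (F t) t := (h1 ht 0 left_mem_uIcc).const_add x₀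
    have d2 : HasDerivAt (fun t => Complex.exp (θ t)) (Complex.exp (θ t) * h t) t :=
      (Complex.hasDerivAt_exp _).comp t (h2 ht 0 left_mem_uIcc)
    refine ((d2.mul d1).sub (h3 ht 0 left_mem_uIcc)).congr_deriv ?_
    ring)
  have hC0 : C = x₀ := by
    rw [← hC 0 left_mem_uIcc]
    simp [X, θ]
  intro t ht
  have h1 := hC t (hu ▸ ht)
  have e : ∫ s in (0 : ℝ)..t, Complex.exp (θ s) * (F s + h s * x s) =
      ∫ s in (0 : ℝ)..t, Complex.exp (θ s) * (F s + h s * X s) := by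
    refine intervalIntegral.integral_congr fun s hs => ?_
    rw [uIcc_of_le ht.1] at hs
    simp only [X]
    rw [hx s ⟨hs.1, hs.2.trans ht.2⟩]
  rw [hx t ht, e]
  change Complex.exp (θ t) * X t = _
  linear_combination h1.trans hC0

end Gauge

/-! ### Dependence of the scaled coefficients on the gauge -/

section GaugePar

variable {L₁ L₂ σ β R B : ℝ} {q : Par}

/-- The gauge multiplies P by a positive real number between e^{−2σB} and e^{2σB}. The direction 1 −
iβ, and with it the ellipticity constant, is unchanged. -/
theorem Par.good_scale_exp (hσ : 2 < σ) (hR : 0 ≤ R) (hq : q.Good β 1 R) {x : ℝ} (hx : |x| ≤ B) :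
    (q.scale σ (Real.exp x)).Good β (Real.exp (-(2 * σ * B))) (Real.exp (2 * σ * B) * R) := by
  have hB : 0 ≤ B := (abs_nonneg x).trans hx
  obtain ⟨hx1, hx2⟩ := abs_le.1 hx
  have h1 : 1 ≤ Real.exp (2 * σ * B) := Real.one_le_exp (by positivity)
  have e1 : Real.exp x ^ (2 * σ) = Real.exp (2 * σ * x) := by rw [← Real.exp_mul]; ring_nf
  have e2 : Real.exp x ^ 2 = Real.exp (2 * x) := by rw [← Real.exp_nat_mul]; norm_num
  have h2 : Real.exp (2 * σ * x) ≤ Real.exp (2 * σ * B) := Real.exp_le_exp.2 (by gcongr)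
  have h3 : Real.exp (2 * x) ≤ Real.exp (2 * σ * B) := Real.exp_le_exp.2 (by nlinarith)
  have k1 : ∀ z : ℂ, ‖z‖ ≤ R → ‖z‖ ≤ Real.exp (2 * σ * B) * R := fun z hz => by nlinarith
  have k2 : ∀ (y : ℝ) (z : ℂ), y ≤ Real.exp (2 * σ * B) → 0 ≤ y → ‖z‖ ≤ R →
      ‖(y : ℂ) * z‖ ≤ Real.exp (2 * σ * B) * R := fun y z hy hy0 hz => by
    rw [norm_mul, Complex.norm_real, Real.norm_of_nonneg hy0]; gcongr
  refine ⟨⟨k1 _ hq.bdd.A, ?_, k1 _ hq.bdd.γ, ?_, ?_, ?_, ?_⟩, hq.re_A, ?_⟩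
  · exact k2 _ _ (by rw [e1]; exact h2) (by positivity) hq.bdd.P
  · exact k2 _ _ (by rw [e2]; exact h3) (by positivity) hq.bdd.a₁
  · exact k2 _ _ (by rw [e2]; exact h3) (by positivity) hq.bdd.a₂
  · exact k2 _ _ (by rw [e2]; exact h3) (by positivity) hq.bdd.b₁
  · exact k2 _ _ (by rw [e2]; exact h3) (by positivity) hq.bdd.b₂
  · obtain ⟨ϖ, h, e⟩ := hq.exists_P
    refine ⟨Real.exp (2 * σ * x) * ϖ, ?_, ?_⟩
    · have : Real.exp (-(2 * σ * B)) ≤ Real.exp (2 * σ * x) := Real.exp_le_exp.2 (by nlinarith)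
      nlinarith [Real.exp_pos (2 * σ * x)]
    · simp only [Par.scale]
      rw [e, e1]; push_cast; ring

/-- The scaling factors are e^{2x} and e^{2σx}. Their arguments are at most 2σB, where the
exponential has Lipschitz constant e^{2σB}. -/
theorem Par.close_scale_exp (hσ : 2 < σ) (hR : 0 ≤ R) (hq : q.Bdd R) {x y ε : ℝ} (hx : |x| ≤ B)
    (hy : |y| ≤ B) (hxy : |x - y| ≤ ε) : (q.scale σ (Real.exp x)).Close (q.scale σ (Real.exp y))
      (Real.exp (2 * σ * B) * (2 * σ) * R * ε) := by
  have hB : 0 ≤ B := (abs_nonneg x).trans hx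
  have hε : 0 ≤ ε := (abs_nonneg _).trans hxy
  obtain ⟨hx1, hx2⟩ := abs_le.1 hx
  obtain ⟨hy1, hy2⟩ := abs_le.1 hy
  have e1 : ∀ x, Real.exp x ^ (2 * σ) = Real.exp (2 * σ * x) := fun x => by
    rw [← Real.exp_mul]; ring_nf
  have e2 : ∀ x, Real.exp x ^ 2 = Real.exp (2 * x) := fun x => by
    rw [← Real.exp_nat_mul]; norm_num
  have k : ∀ (c : ℝ) (z : ℂ), 0 ≤ c → c ≤ 2 * σ → ‖z‖ ≤ R →
      ‖((Real.exp (c * x) : ℝ) : ℂ) * z - ((Real.exp (c * y) : ℝ) : ℂ) * z‖ ≤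
        Real.exp (2 * σ * B) * (2 * σ) * R * ε := fun c z hc hc' hz => by
    rw [← sub_mul, norm_mul, ← Complex.ofReal_sub, Complex.norm_real, Real.norm_eq_abs]
    have h1 := abs_exp_sub_exp_le (x := c * x) (y := c * y) (B := 2 * σ * B) (by nlinarith) (by nlinarith)
    rw [← mul_sub, abs_mul, abs_of_nonneg hc] at h1
    have h2 : |Real.exp (c * x) - Real.exp (c * y)| ≤ Real.exp (2 * σ * B) * (2 * σ * ε) :=
      h1.trans (by gcongr)
    calc _ ≤ Real.exp (2 * σ * B) * (2 * σ * ε) * R := by gcongr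
      _ = _ := by ring
  refine ⟨by positivity, rfl, rfl, ?_, ?_, ?_, ?_, ?_⟩ <;> simp only [Par.scale, e1, e2]
  · exact k _ _ (by positivity) le_rfl hq.P
  · exact k _ _ (by positivity) (by linarith) hq.a₁
  · exact k _ _ (by positivity) (by linarith) hq.a₂
  · exact k _ _ (by positivity) (by linarith) hq.b₁
  · exact k _ _ (by positivity) (by linarith) hq.b₂

/-- The form is linear in the coefficients, which fall into three groups with the factors 1, r^{2σ}
and r²; time enters through these scalars only. -/
theorem continuous_form_scale (hσ : 2 < σ) {r : ℝ → ℝ} (hr : Continuous r) (hr0 : ∀ t, 0 < r t)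
    (q : Par) (u ψ : V L₁ L₂) : Continuous fun t => form σ (q.scale σ (r t)) u ψ := by
  have e : ∀ t, q.scale σ (r t) = Par.lin 1 (Par.lin 1 ⟨q.A, 0, q.γ, 0, 0, 0, 0⟩
      ((r t ^ (2 * σ) : ℝ) : ℂ) ⟨0, q.P, 0, 0, 0, 0, 0⟩) ((r t ^ 2 : ℝ) : ℂ)
      ⟨0, 0, 0, q.a₁, q.a₂, q.b₁, q.b₂⟩ := fun t => by
    simp [Par.scale, Par.lin]
  simp only [e, form_lin hσ]
  have h1 : Continuous fun t => r t ^ (2 * σ) := hr.rpow_const fun t => Or.inl (hr0 t).ne'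
  fun_prop

end GaugePar

/-! ### Scalar multiples of paths, and passage from test functions to V -/

section Scalar

variable {L₁ L₂ σ : ℝ}

theorem mass_smul (c : ℂ) (w : V L₁ L₂) :
    mass σ (c • w) = ‖c‖ ^ (2 * σ + 2) * mass σ w := by
  unfold mass
  rw [← integral_const_mul]
  refine integral_congr_ae ((ae_smul c w).mono fun x hx => ?_)
  simp only [hx.1]
  rw [norm_mul, Real.mul_rpow (norm_nonneg _) (norm_nonneg _)]

theorem InClass.smul (hσ : 2 < σ) {μ : Measure ℝ} {U : ℝ → V L₁ L₂} (hU : InClass σ μ U) {c : ℝ → ℂ}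
    (hc : AEStronglyMeasurable c μ) {B : ℝ} (hB : ∀ᵐ s ∂μ, ‖c s‖ ≤ B) :
    InClass σ μ fun s => c s • U s := by
  refine ⟨?_, ?_⟩
  · refine (hU.memLp.norm.const_mul B).mono' (hc.smul hU.memLp.1) (hB.mono fun s hs => ?_)
    rw [norm_smul]
    exact mul_le_mul_of_nonneg_right hs (norm_nonneg _)
  · simp only [mass_smul]
    refine hU.integrable.bdd_mul (c := B ^ (2 * σ + 2))
      (hc.norm.aemeasurable.pow_const _).aestronglyMeasurable (hB.mono fun s hs => ?_)
    rw [Real.norm_of_nonneg (by positivity)]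
    exact Real.rpow_le_rpow (norm_nonneg _) hs (by linarith)

theorem InClass.energy (hσ : 2 < σ) {T : ℝ} {U : ℝ → V L₁ L₂}
    (hU : InClass σ (volume.restrict (Icc 0 T)) U) {u : ℝ → H L₁ L₂}
    (h : ∀ᵐ s ∂(volume.restrict (Icc 0 T)), fn (U s) = u s) : LpLpEnergy T (2 * σ + 2) u < ⊤ := by
  rw [lintegral_mass_eq hσ h,
    ← hasFiniteIntegral_iff_ofReal (ae_of_all _ fun s => mass_nonneg _ _)]
  exact hU.integrable.2

theorem exists_bigN_le (hσ : 2 < σ) {wn : ℕ → V L₁ L₂} {w : V L₁ L₂} (h : Tendsto wn atTop (𝓝 w)) :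
    ∃ C : ℝ, ∀ n, bigN σ (wn n) ≤ C := by
  obtain ⟨M, hM⟩ := h.norm.bddAbove_range
  have hM' : ∀ n, ‖wn n‖ ≤ M := fun n => hM ⟨n, rfl⟩
  obtain ⟨C, hC, hb⟩ := exists_integral_rpow_le L₁ L₂ (q := 2 * σ + 2) (by linarith) M
  refine ⟨M ^ 2 + C, fun n => ?_⟩
  rw [bigN_eq hσ]
  exact add_le_add (pow_le_pow_left₀ (norm_nonneg _) (hM' n) 2) (hb _ (hM' n))

/-- A weak equation tested with test functions can be tested with elements of `V`. -/
theorem weak_equation_of_test (hσ : 2 < σ) {R : ℝ} (hR : 0 ≤ R) {q : ℝ → Par}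
    (hq : ∀ t, (q t).Bdd R) (hqc : ∀ u ψ : V L₁ L₂, Continuous fun t => form σ (q t) u ψ) {T : ℝ}
    {U : ℝ → V L₁ L₂} (hU : InClass σ (volume.restrict (Icc 0 T)) U) {x y : H L₁ L₂} {t : ℝ}
    (ht : t ∈ Icc 0 T) (h : ∀ (ψ : ℝ × ℝ → ℂ) (w : V L₁ L₂), IsTest L₁ L₂ ψ → fn w =ᵐ[dom L₁ L₂] ψ →
      dx w =ᵐ[dom L₁ L₂] d₁ ψ → dy w =ᵐ[dom L₁ L₂] d₂ ψ →
        inner ℂ (fn w) x = inner ℂ (fn w) y + ∫ s in (0 : ℝ)..t, form σ (q s) (U s) w)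
    (w : V L₁ L₂) : inner ℂ (fn w) x = inner ℂ (fn w) y + ∫ s in (0 : ℝ)..t, form σ (q s) (U s) w := by
  obtain ⟨wn, ψ, hψ, hlim⟩ := exists_seq_test w
  have hfn : Tendsto (fun n => fn (wn n)) atTop (𝓝 (fn w)) :=
    ((fnL L₁ L₂).continuous.tendsto w).comp hlim
  obtain ⟨C, hC⟩ := exists_bigN_le hσ hlim
  obtain ⟨C', hC', hf⟩ := exists_norm_form_le (L₁ := L₁) (L₂ := L₂) hσ hR one_pos
  have hsub : volume.restrict (uIoc 0 t) ≤ volume.restrict (Icc 0 T) := by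
    rw [uIoc_of_le ht.1]
    exact Measure.restrict_mono (show Ioc 0 t ⊆ Icc 0 T from
      fun s hs => ⟨hs.1.le, hs.2.trans ht.2⟩) le_rfl
  have h1 : Tendsto (fun n => ∫ s in (0 : ℝ)..t, form σ (q s) (U s) (wn n)) atTop
      (𝓝 (∫ s in (0 : ℝ)..t, form σ (q s) (U s) w)) := by
    refine intervalIntegral.tendsto_integral_filter_of_dominated_convergence
      (fun s => 1 * bigK σ (U s) + C' * C) (Eventually.of_forall fun n => ?_)
      (Eventually.of_forall fun n => ae_of_all _ fun s _ => ?_) ?_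
      (ae_of_all _ fun s _ => tendsto_form hσ (q s) tendsto_const_nhds hlim)
    · exact (aestronglyMeasurable_form hσ hqc hU.memLp.1 aestronglyMeasurable_const).mono_measure hsub
    · exact (hf _ (hq s) _ _).trans (add_le_add le_rfl (mul_le_mul_of_nonneg_left (hC n) hC'))
    · rw [intervalIntegrable_iff]
      exact (((hU.integrable_bigK hσ).const_mul 1).add (integrable_const _)).mono_measure hsub
  refine tendsto_nhds_unique (hfn.inner tendsto_const_nhds)
    (((hfn.inner tendsto_const_nhds).add h1).congr fun n => ?_)
  exact (h _ _ (hψ n).1 (hψ n).2.1 (hψ n).2.2.1 (hψ n).2.2.2).symm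

end Scalar

/-! ### Identification of the distributional pairings with the form -/

section Pairing

variable {L₁ L₂ σ : ℝ} {ψ : ℝ × ℝ → ℂ} {w : V L₁ L₂}

/-- The coefficients of the complex Ginzburg–Landau equation. -/
def glPar (α β γ : ℝ) (a b : ℂ × ℂ) : Par :=
  ⟨1 + Complex.I * α, 1 - Complex.I * β, γ, a.1, a.2, b.1, b.2⟩

/-- The coefficients of the nonlinear part. -/
def glParB (β γ : ℝ) (a b : ℂ × ℂ) : Par := ⟨0, 1 - Complex.I * β, γ, a.1, a.2, b.1, b.2⟩

theorem IsTest.conj (h : IsTest L₁ L₂ ψ) : IsTest L₁ L₂ fun x => conj (ψ x) := by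
  have e : (fun x => conj (ψ x)) = Complex.conjCLE ∘ ψ := rfl
  refine ⟨contDiff_conj h.smooth, ?_, ?_⟩
  · rw [e]; exact h.compact.comp_left (map_zero _)
  · rw [e]; exact (closure_mono (Function.support_comp_subset (map_zero _) ψ)).trans h.support

/-- The pairings of the statement are bilinear, while the inner product and `form` are conjugate
linear in one argument. Conjugating the test function translates between them. -/
theorem pair_conj (v : H L₁ L₂) (h : fn w =ᵐ[dom L₁ L₂] ψ) :
    pair v (fun x => conj (ψ x)) = inner ℂ (fn w) v := (H.inner_eq_integral _ _ h).symm

theorem pairA_conj (α : ℝ) (u : V L₁ L₂) (h₁ : dx w =ᵐ[dom L₁ L₂] d₁ ψ)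
    (h₂ : dy w =ᵐ[dom L₁ L₂] d₂ ψ) :
    pairA α u (fun x => conj (ψ x)) = form σ ⟨1 + Complex.I * α, 0, 0, 0, 0, 0, 0⟩ u w := by
  unfold pairA form
  rw [← integral_const_mul]
  refine integral_congr_ae ?_
  filter_upwards [h₁, h₂] with x hx₁ hx₂
  rw [hx₁, hx₂, d₁_conj, d₂_conj]
  simp only [dens, n₀, fl]
  ring

theorem pairB_conj (hσ : 2 < σ) (β γ : ℝ) (a b : ℂ × ℂ) (u : V L₁ L₂) (h₀ : fn w =ᵐ[dom L₁ L₂] ψ)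
    (h₁ : dx w =ᵐ[dom L₁ L₂] d₁ ψ) (h₂ : dy w =ᵐ[dom L₁ L₂] d₂ ψ) :
    pairB β γ σ a b u (fun x => conj (ψ x)) = form σ (glParB β γ a b) u w := by
  -- Each term of the equation is the form with all other coefficients set to zero; linearity in the
  -- coefficients puts the terms together.
  have eP : -(1 - Complex.I * β) * (∫ x in rect L₁ L₂, ((‖fn u x‖ ^ (2 * σ) : ℝ) : ℂ) * fn u x * conj (ψ x)) =
      form σ ⟨0, 1 - Complex.I * β, 0, 0, 0, 0, 0⟩ u w := by
    unfold form
    rw [← integral_const_mul]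
    refine integral_congr_ae ?_
    filter_upwards [h₀] with x hx
    rw [hx]
    simp only [dens, n₀, fl, pw]
    ring
  have eγ : γ * pair (fn u) (fun x => conj (ψ x)) = form σ ⟨0, 0, γ, 0, 0, 0, 0⟩ u w := by
    unfold form pair
    rw [← integral_const_mul]
    refine integral_congr_ae ?_
    filter_upwards [h₀] with x hx
    rw [hx]
    simp only [dens, n₀, fl]
    ring
  have ea : -(∫ x in rect L₁ L₂, ((‖fn u x‖ ^ 2 : ℝ) : ℂ) * fn u x *
      (a.1 * d₁ (fun x => conj (ψ x)) x + a.2 * d₂ (fun x => conj (ψ x)) x)) =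
      form σ ⟨0, 0, 0, a.1, a.2, 0, 0⟩ u w := by
    unfold form
    rw [← integral_neg]
    refine integral_congr_ae ?_
    filter_upwards [h₁, h₂] with x hx₁ hx₂
    rw [hx₁, hx₂, d₁_conj, d₂_conj]
    simp only [dens, n₀, fl, cu]
    ring
  have eb : (∫ x in rect L₁ L₂, (b.1 * dx u x + b.2 * dy u x) * ((‖fn u x‖ ^ 2 : ℝ) : ℂ) * conj (ψ x)) =
      form σ ⟨0, 0, 0, 0, 0, b.1, b.2⟩ u w := by
    unfold form
    refine integral_congr_ae ?_
    filter_upwards [h₀] with x hx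
    rw [hx]
    simp only [dens, n₀, fl]
    ring
  have e : glParB β γ a b = Par.lin 1 (Par.lin 1 ⟨0, 1 - Complex.I * β, 0, 0, 0, 0, 0⟩ 1
      ⟨0, 0, γ, 0, 0, 0, 0⟩) 1 (Par.lin 1 ⟨0, 0, 0, a.1, a.2, 0, 0⟩ 1 ⟨0, 0, 0, 0, 0, b.1, b.2⟩) := by
    simp [glParB, Par.lin]
  unfold pairB pairF
  rw [eP, eγ, ea, eb, e, form_lin hσ, form_lin hσ, form_lin hσ]
  ring

theorem form_glPar (hσ : 2 < σ) (α β γ : ℝ) (a b : ℂ × ℂ) (u w : V L₁ L₂) :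
    form σ (glPar α β γ a b) u w =
      form σ ⟨1 + Complex.I * α, 0, 0, 0, 0, 0, 0⟩ u w + form σ (glParB β γ a b) u w := by
  have e : glPar α β γ a b = Par.lin 1 ⟨1 + Complex.I * α, 0, 0, 0, 0, 0, 0⟩ 1 (glParB β γ a b) := by
    simp [glPar, glParB, Par.lin]
  rw [e, form_lin hσ, one_mul, one_mul]

end Pairing

/-! ### The skeleton equation as an equation with a scalar linear forcing -/

section Forced

variable {L₁ L₂ σ T : ℝ} {q : Par} {h : ℝ → ℂ} {u₀ : V L₁ L₂} {u v : ℝ → H L₁ L₂} {U W : ℝ → V L₁ L₂}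

/-- Weak solutions of `u' = [form of q](u) + h u`, tested with test functions. -/
structure IsForced (T σ : ℝ) (q : Par) (h : ℝ → ℂ) (u₀ : V L₁ L₂) (u : ℝ → H L₁ L₂)
    (U : ℝ → V L₁ L₂) : Prop where
  continuousOn : ContinuousOn u (Icc 0 T)
  memLp : MemLp U 2 (volume.restrict (Icc 0 T))
  eq_ae : ∀ᵐ s ∂(volume.restrict (Icc 0 T)), fn (U s) = u s
  energy : LpLpEnergy T (2 * σ + 2) u < ⊤
  equation : ∀ (ψ : ℝ × ℝ → ℂ) (w : V L₁ L₂), IsTest L₁ L₂ ψ → fn w =ᵐ[dom L₁ L₂] ψ →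
    dx w =ᵐ[dom L₁ L₂] d₁ ψ → dy w =ᵐ[dom L₁ L₂] d₂ ψ → ∀ t ∈ Icc 0 T,
      inner ℂ (fn w) (u t) = inner ℂ (fn w) (fn u₀) +
        ∫ s in (0 : ℝ)..t, (form σ q (U s) w + h s * inner ℂ (fn w) (u s))

theorem intervalIntegrable_of_integrableOn_Icc {E : Type*} [NormedAddCommGroup E] {f : ℝ → E} {t : ℝ}
    (hf : IntegrableOn f (Icc 0 T)) (ht : t ∈ Icc 0 T) : IntervalIntegrable f volume 0 t :=
  (intervalIntegrable_iff_integrableOn_Icc_of_le ht.1 (by simp)).2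
    (hf.mono_set (Icc_subset_Icc_right ht.2))

theorem InClass.integrable_form_const (hσ : 2 < σ) {μ : Measure ℝ} [IsFiniteMeasure μ]
    (hU : InClass σ μ U) (q : Par) (w : V L₁ L₂) : Integrable (fun s => form σ q (U s) w) μ := by
  obtain ⟨R, hR, hq⟩ := q.exists_bdd
  exact hU.integrable_form hσ (InClass.const σ w) hR (fun _ => hq) fun _ _ => continuous_const

theorem integrableOn_mul_inner (hh : IntegrableOn h (Icc 0 T)) (hu : ContinuousOn u (Icc 0 T))
    (f : H L₁ L₂) : IntegrableOn (fun s => h s * inner ℂ f (u s)) (Icc 0 T) :=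
  hh.mul_continuousOn (continuousOn_const.inner hu) isCompact_Icc

/-- As u(s) does not depend on z, the control integral is the drift coefficient times u(s).
Conjugation maps test functions onto test functions, so the bilinear and the sesquilinear families
of equations are equivalent. -/
theorem isSkeletonSolution_iff {Z : Type*} [MeasurableSpace Z] (hσ : 2 < σ) (α β γ : ℝ)
    (a b : ℂ × ℂ) {ν : Measure Z} {g : Z → ℂ} {φ : ℝ × Z → ℝ≥0}
    (hd : IntegrableOn (drift ν g φ) (Icc 0 T)) :
    IsSkeletonSolution T α β γ σ a b ν g u₀ φ u U ↔
      IsForced T σ (glPar α β γ a b) (drift ν g φ) u₀ u U := by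
  have key : ContinuousOn u (Icc 0 T) → InClass σ (volume.restrict (Icc 0 T)) U →
      ∀ (ψ : ℝ × ℝ → ℂ) (w : V L₁ L₂), fn w =ᵐ[dom L₁ L₂] ψ → dx w =ᵐ[dom L₁ L₂] d₁ ψ →
      dy w =ᵐ[dom L₁ L₂] d₂ ψ → ∀ t ∈ Icc 0 T,
      pair (fn u₀) (fun x => conj (ψ x)) +
        (∫ s in (0 : ℝ)..t, pairA α (U s) fun x => conj (ψ x)) +
        (∫ s in (0 : ℝ)..t, pairB β γ σ a b (U s) fun x => conj (ψ x)) +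
        (∫ s in (0 : ℝ)..t, ∫ z, pair (u s) (fun x => conj (ψ x)) * g z * ((φ (s, z) : ℂ) - 1) ∂ν) =
      inner ℂ (fn w) (fn u₀) + ∫ s in (0 : ℝ)..t,
        (form σ (glPar α β γ a b) (U s) w + drift ν g φ s * inner ℂ (fn w) (u s)) := by
    intro hu hU ψ w h₀ h₁ h₂ t ht
    have hz : ∀ s, ∫ z, pair (u s) (fun x => conj (ψ x)) * g z * ((φ (s, z) : ℂ) - 1) ∂ν =
        drift ν g φ s * inner ℂ (fn w) (u s) := fun s => by
      simp only [mul_assoc]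
      rw [integral_const_mul, pair_conj _ h₀, mul_comm]; rfl
    simp only [hz]
    simp only [pairA_conj (σ := σ) α _ h₁ h₂, pairB_conj hσ β γ a b _ h₀ h₁ h₂, pair_conj _ h₀,
      form_glPar hσ]
    have i1 := intervalIntegrable_of_integrableOn_Icc (hU.integrable_form_const hσ
      ⟨1 + Complex.I * α, 0, 0, 0, 0, 0, 0⟩ w) ht
    have i2 := intervalIntegrable_of_integrableOn_Icc (hU.integrable_form_const hσ
      (glParB β γ a b) w) ht
    have i3 := intervalIntegrable_of_integrableOn_Icc (integrableOn_mul_inner hd hu (fn w)) ht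
    rw [intervalIntegral.integral_add (i1.add i2) i3, intervalIntegral.integral_add i1 i2]
    ring
  constructor
  · intro hs
    refine ⟨hs.continuousOn, hs.memLp, hs.eq_ae, hs.energy, fun ψ w hψ h₀ h₁ h₂ t ht => ?_⟩
    rw [← key hs.continuousOn (inClass_of_energy hσ hs.memLp hs.eq_ae hs.energy) ψ w h₀ h₁ h₂ t ht,
      ← hs.equation _ hψ.conj t ht, pair_conj _ h₀]
  · intro hs
    refine ⟨hs.continuousOn, hs.memLp, hs.eq_ae, hs.energy, fun χ hχ t ht => ?_⟩
    obtain ⟨w, h₀, h₁, h₂⟩ := hχ.conj.exists_jet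
    have h := key hs.continuousOn (inClass_of_energy hσ hs.memLp hs.eq_ae hs.energy) _ w h₀ h₁ h₂ t ht
    have h' := pair_conj (u t) h₀
    simp only [Complex.conj_conj] at h h'
    rw [h, ← hs.equation _ w hχ.conj h₀ h₁ h₂ t ht, h']

end Forced

/-! ### Removing the forcing by a gauge factor -/

section GaugeTransform

variable {L₁ L₂ σ T β R B : ℝ} {q : Par} {h : ℝ → ℂ} {u₀ : V L₁ L₂} {u : ℝ → H L₁ L₂}
  {U : ℝ → V L₁ L₂}

/-- The coefficients of the equation for `e^{-θ} u`, where `θ' = h`. -/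
def gaugePar (σ : ℝ) (q : Par) (hT : 0 ≤ T) (h : ℝ → ℂ) (t : ℝ) : Par :=
  q.scale σ (Real.exp (∫ s in (0 : ℝ)..projIcc 0 T hT t, h s).re)

theorem continuousOn_integral (hT : 0 ≤ T) (hh : IntegrableOn h (Icc 0 T)) :
    ContinuousOn (fun t => ∫ s in (0 : ℝ)..t, h s) (Icc 0 T) := by
  have := intervalIntegral.continuousOn_primitive_interval (μ := volume) (f := h) (a := 0) (b := T)
    (by rwa [uIcc_of_le hT])
  rwa [uIcc_of_le hT] at this

theorem good_gaugePar (hσ : 2 < σ) (hR : 0 ≤ R) (hq : q.Good β 1 R) (hT : 0 ≤ T)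
    (hB : ∀ t ∈ Icc 0 T, ‖∫ s in (0 : ℝ)..t, h s‖ ≤ B) (t : ℝ) : (gaugePar σ q hT h t).Good β
      (Real.exp (-(2 * σ * B))) (Real.exp (2 * σ * B) * R) :=
  Par.good_scale_exp hσ hR hq ((Complex.abs_re_le_norm _).trans (hB _ (projIcc 0 T hT t).2))

theorem continuous_form_gaugePar (hσ : 2 < σ) (hT : 0 ≤ T) (hh : IntegrableOn h (Icc 0 T)) (q : Par)
    (u ψ : V L₁ L₂) : Continuous fun t => form σ (gaugePar σ q hT h t) u ψ := by
  refine continuous_form_scale hσ (Real.continuous_exp.comp (Complex.continuous_re.comp ?_))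
    (fun t => Real.exp_pos _) q u ψ
  exact (continuousOn_integral hT hh).comp_continuous
    (continuous_subtype_val.comp continuous_projIcc) fun t => (projIcc 0 T hT t).2

theorem gaugePar_of_mem (hT : 0 ≤ T) {t : ℝ} (ht : t ∈ Icc 0 T) :
    gaugePar σ q hT h t = q.scale σ ‖Complex.exp (∫ s in (0 : ℝ)..t, h s)‖ := by
  unfold gaugePar
  rw [projIcc_of_mem hT ht, Complex.norm_exp]

theorem exists_norm_cexp_le (hT : 0 ≤ T) (hh : IntegrableOn h (Icc 0 T)) :
    ∃ C, ∀ t ∈ Icc 0 T, ‖Complex.exp (∫ s in (0 : ℝ)..t, h s)‖ ≤ C :=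
  isCompact_Icc.exists_bound_of_continuousOn (continuousOn_integral hT hh).cexp

theorem ae_smul_eq {c : ℝ → ℂ} (hU : ∀ᵐ s ∂(volume.restrict (Icc 0 T)), fn (U s) = u s) :
    ∀ᵐ s ∂(volume.restrict (Icc 0 T)), fn (c s • U s) = c s • u s :=
  hU.mono fun s hs => by rw [fn_smul, hs]

theorem inClass_cexp_smul (hσ : 2 < σ) (hT : 0 ≤ T) (hh : IntegrableOn h (Icc 0 T))
    (hU : InClass σ (volume.restrict (Icc 0 T)) U) : InClass σ (volume.restrict (Icc 0 T))
      fun s => Complex.exp (∫ r in (0 : ℝ)..s, h r) • U s := by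
  obtain ⟨C, hC⟩ := exists_norm_cexp_le hT hh
  exact hU.smul hσ (aestronglyMeasurable_path (continuousOn_integral hT hh).cexp measurableSet_Icc)
    ((ae_restrict_iff' measurableSet_Icc).2 (ae_of_all _ hC))

/-- Multiplication by e^{−θ}, θ the primitive of h, cancels the forcing by variation of constants.
Covariance of the form then replaces q by the coefficients scaled with |e^θ|. The equation is
obtained for test functions first and extended to V by density. -/
theorem IsForced.isWeak (hσ : 2 < σ) (hR : 0 ≤ R) (hq : q.Good β 1 R) (hT : 0 ≤ T)
    (hh : IntegrableOn h (Icc 0 T)) (hu : IsForced T σ q h u₀ u U) :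
    IsWeak T σ (gaugePar σ q hT h) u₀ (fun t => Complex.exp (∫ s in (0 : ℝ)..t, -h s) • u t)
      (fun t => Complex.exp (∫ s in (0 : ℝ)..t, -h s) • U t) := by
  have cU := inClass_of_energy hσ hu.memLp hu.eq_ae hu.energy
  have cW := inClass_cexp_smul (h := fun s => -h s) hσ hT hh.neg cU
  obtain ⟨B, hB⟩ := isCompact_Icc.exists_bound_of_continuousOn (continuousOn_integral hT hh)
  refine ⟨(continuousOn_integral hT hh.neg).cexp.smul hu.continuousOn, cW.memLp,
    ae_smul_eq hu.eq_ae, cW.energy hσ (ae_smul_eq hu.eq_ae), fun w t ht => ?_⟩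
  refine weak_equation_of_test hσ (by positivity) (fun t => (good_gaugePar hσ hR hq hT hB t).bdd)
    (continuous_form_gaugePar hσ hT hh q) cW ht (fun ψ w hψ h₀ h₁ h₂ => ?_) w
  have h1 := exp_integral_mul_eq hT (h := fun s => -h s)
    (F := fun s => form σ q (U s) w + h s * inner ℂ (fn w) (u s))
    (x := fun t => inner ℂ (fn w) (u t))
    ((cU.integrable_form_const hσ q w).add (integrableOn_mul_inner hh hu.continuousOn (fn w)))
    hh.neg (hu.equation ψ w hψ h₀ h₁ h₂) t ht
  rw [inner_smul_right, h1]
  congr 1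
  refine intervalIntegral.integral_congr fun s hs => ?_
  rw [uIcc_of_le ht.1] at hs
  have hs' : s ∈ Icc 0 T := ⟨hs.1, hs.2.trans ht.2⟩
  simp only [form_smul_left σ (gaugePar σ q hT h s)]
  have e : gaugePar σ q hT h s = q.scale σ ‖Complex.exp (∫ r in (0 : ℝ)..s, h r)‖ :=
    gaugePar_of_mem hT hs'
  -- Scalings by reciprocal moduli cancel, so the form of the gauged path is again a multiple of the
  -- original form.
  have e1 : (gaugePar σ q hT h s).scale σ ‖Complex.exp (∫ r in (0 : ℝ)..s, -h r)‖ = q := by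
    have : ‖Complex.exp (∫ r in (0 : ℝ)..s, -h r)‖ = ‖Complex.exp (∫ r in (0 : ℝ)..s, h r)‖⁻¹ := by
      rw [intervalIntegral.integral_neg, Complex.exp_neg, norm_inv]
    rw [e, this]
    have hpos : 0 < ‖Complex.exp (∫ r in (0 : ℝ)..s, h r)‖ := norm_pos_iff.2 (Complex.exp_ne_zero _)
    generalize ‖Complex.exp (∫ r in (0 : ℝ)..s, h r)‖ = r at hpos
    have h2 : ((r⁻¹ ^ 2 : ℝ) : ℂ) * ((r ^ 2 : ℝ) : ℂ) = 1 := by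
      rw [← Complex.ofReal_mul, ← mul_pow, inv_mul_cancel₀ hpos.ne']; simp
    have h3 : ((r⁻¹ ^ (2 * σ) : ℝ) : ℂ) * ((r ^ (2 * σ) : ℝ) : ℂ) = 1 := by
      rw [← Complex.ofReal_mul, ← Real.mul_rpow (by positivity) (by positivity),
        inv_mul_cancel₀ hpos.ne']
      simp
    simp only [Par.scale, ← mul_assoc, h2, h3, one_mul]
  rw [e1]
  ring

theorem IsWeak.isForced (hσ : 2 < σ) (hR : 0 ≤ R) (hq : q.Good β 1 R) (hT : 0 ≤ T)
    (hh : IntegrableOn h (Icc 0 T)) (hu : IsWeak T σ (gaugePar σ q hT h) u₀ u U) :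
    IsForced T σ q h u₀ (fun t => Complex.exp (∫ s in (0 : ℝ)..t, h s) • u t)
      (fun t => Complex.exp (∫ s in (0 : ℝ)..t, h s) • U t) := by
  have cU := inClass_of_energy hσ hu.memLp hu.eq_ae hu.energy
  have cW := inClass_cexp_smul hσ hT hh cU
  obtain ⟨B, hB⟩ := isCompact_Icc.exists_bound_of_continuousOn (continuousOn_integral hT hh)
  refine ⟨(continuousOn_integral hT hh).cexp.smul hu.continuousOn, cW.memLp,
    ae_smul_eq hu.eq_ae, cW.energy hσ (ae_smul_eq hu.eq_ae), fun ψ w _ _ _ _ t ht => ?_⟩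
  have h1 := exp_integral_mul_eq hT (h := h)
    (F := fun s => form σ (gaugePar σ q hT h s) (U s) w) (x := fun t => inner ℂ (fn w) (u t))
    (cU.integrable_form hσ (InClass.const σ w) (by positivity)
      (fun t => (good_gaugePar hσ hR hq hT hB t).bdd) (continuous_form_gaugePar hσ hT hh q))
    hh (hu.equation w) t ht
  rw [inner_smul_right, h1]
  congr 1
  refine intervalIntegral.integral_congr fun s hs => ?_
  rw [uIcc_of_le ht.1] at hs
  have e : gaugePar σ q hT h s = q.scale σ ‖Complex.exp (∫ r in (0 : ℝ)..s, h r)‖ :=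
    gaugePar_of_mem hT ⟨hs.1, hs.2.trans ht.2⟩
  simp only [form_smul_left, inner_smul_right]
  rw [e]
  ring

end GaugeTransform

/-! ### Stability in the coefficients and uniqueness -/

section Stability

variable {L₁ L₂ σ T : ℝ}

/-- Weak solutions depend continuously on the coefficients. -/
theorem exists_stability (L₁ L₂ : ℝ) (hσ : 2 < σ) {R : ℝ} (hR : 0 ≤ R) {β m : ℝ} (hm : 0 < m)
    (hκ : 0 < ellip (2 * σ) β) (hT : 0 < T) (M : ℝ) : ∃ C : ℝ, 0 ≤ C ∧ ∀ (q q' : ℝ → Par) (δ : ℝ),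
      (∀ t, (q t).Good β m R) → (∀ t, (q' t).Bdd R) → (∀ t, (q t).Close (q' t) δ) →
      (∀ u ψ : V L₁ L₂, Continuous fun t => form σ (q t) u ψ) →
      (∀ u ψ : V L₁ L₂, Continuous fun t => form σ (q' t) u ψ) →
      ∀ (u₀ : V L₁ L₂) (u v : ℝ → H L₁ L₂) (U W : ℝ → V L₁ L₂), IsWeak T σ q u₀ u U →
      IsWeak T σ q' u₀ v W → (∀ᵐ s ∂(volume.restrict (Icc 0 T)), ‖W s‖ ≤ M) →
        (∀ t ∈ Icc 0 T, ‖u t - v t‖ ^ 2 ≤ C * δ ^ 2) ∧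
        ∫ s in Icc 0 T, gr (U s - W s) ≤ C * δ ^ 2 ∧ ∫ s in Icc 0 T, mass σ (U s - W s) ≤ C * δ ^ 2 := by
  -- The asymmetry of `exists_form_mono` is used here: only W, its second argument, has to be
  -- bounded in V, whereas U merely belongs to the solution class.
  obtain ⟨c, K, hc, hK, hmono⟩ := exists_form_mono L₁ L₂ hσ hR hm hκ M
  set E := 2 * K * T * Real.exp (2 * K * T)
  have hE : 0 ≤ E := by positivity
  refine ⟨E + 2 * E + E / (2 * c), by positivity, fun q q' δ hq hq' hqq hqc hqc' u₀ u v U W hu hv hW => ?_⟩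
  have cU := inClass_of_energy hσ hu.memLp hu.eq_ae hu.energy
  have cW := inClass_of_energy hσ hv.memLp hv.eq_ae hv.energy
  have cD := cU.sub hσ cW
  set D : ℝ → V L₁ L₂ := fun s => U s - W s
  have hy : ContinuousOn (fun t => ‖u t - v t‖ ^ 2) (Icc 0 T) :=
    (hu.continuousOn.sub hv.continuousOn).norm.pow 2
  have hiF := (cU.integrable_form hσ cD hR (fun t => (hq t).bdd) hqc).sub
    (cW.integrable_form hσ cD hR hq' hqc')
  have hyI : IntegrableOn (fun t => ‖u t - v t‖ ^ 2) (Icc 0 T) := hy.integrableOn_Icc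
  have hgr := cD.integrable_gr
  have hms := cD.integrable
  have hgi : IntegrableOn (fun s => 1 / 2 * gr (D s) + 2 * c * mass σ (D s)) (Icc 0 T) :=
    (hgr.const_mul (1 / 2)).add (hms.const_mul (2 * c))
  have hae : ∀ᵐ s ∂(volume.restrict (Icc 0 T)),
      (form σ (q s) (U s) (D s) - form σ (q' s) (W s) (D s)).re ≤
        K * ‖u s - v s‖ ^ 2 + K * δ ^ 2 - 1 / 2 * (1 / 2 * gr (D s) + 2 * c * mass σ (D s)) := by
    filter_upwards [hW, hu.eq_ae, hv.eq_ae] with s h1 h2 h3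
    have h4 := hmono (q s) (q' s) δ (hq s) (hqq s) (U s) (W s) h1
    have h5 : fn (U s - W s) = u s - v s := by rw [fn_sub, h2, h3]
    rw [← h5]
    change _ ≤ _ - c * mass σ (D s) + _ + _ at h4
    change (form σ (q s) (U s) (D s) - form σ (q' s) (W s) (D s)).re ≤ _ at h4
    linarith
  have key : ∀ t ∈ Icc 0 T, ‖u t - v t‖ ^ 2 + ∫ s in (0 : ℝ)..t, (1 / 2 * gr (D s) + 2 * c * mass σ (D s)) ≤
      2 * K * T * δ ^ 2 * Real.exp (2 * K * T) := by
    refine add_integral_le_mul_exp hT.le (by positivity) (by positivity) hy (fun s => ?_) fun t ht => ?_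
    · have := gr_nonneg (D s)
      have := mass_nonneg σ (D s)
      positivity
    · have h1 := hu.energy_sub_le hσ hR (fun t => (hq t).bdd) hq' hqc hqc' hT hv ht
      have i1 := intervalIntegrable_of_integrableOn_Icc (f := fun s => (form σ (q s) (U s) (D s) -
        form σ (q' s) (W s) (D s)).re) hiF.re ht
      have i2 := (intervalIntegrable_of_integrableOn_Icc hyI ht).const_mul K
      have i3 := (intervalIntegrable_of_integrableOn_Icc hgi ht).const_mul (1 / 2)
      have i4 : IntervalIntegrable (fun _ : ℝ => K * δ ^ 2) volume 0 t := intervalIntegrable_const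
      have h2 := intervalIntegral.integral_mono_ae_restrict ht.1 i1 ((i2.add i4).sub i3)
        (ae_restrict_of_ae_restrict_of_subset (Icc_subset_Icc_right ht.2) hae)
      rw [intervalIntegral.integral_sub (i2.add i4) i3, intervalIntegral.integral_add i2 i4,
        intervalIntegral.integral_const, intervalIntegral.integral_const_mul,
        intervalIntegral.integral_const_mul, sub_zero, smul_eq_mul] at h2
      have h3 : t * (K * δ ^ 2) ≤ T * (K * δ ^ 2) := mul_le_mul_of_nonneg_right ht.2 (by positivity)
      linarith
  have eE : 2 * K * T * δ ^ 2 * Real.exp (2 * K * T) = E * δ ^ 2 := by simp only [E]; ring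
  rw [eE] at key
  have hδ : 0 ≤ δ ^ 2 := sq_nonneg δ
  have hc1 : E * δ ^ 2 ≤ (E + 2 * E + E / (2 * c)) * δ ^ 2 := by
    refine mul_le_mul_of_nonneg_right ?_ hδ
    have : 0 ≤ E / (2 * c) := by positivity
    linarith
  have hI0 : ∀ t ∈ Icc 0 T, 0 ≤ ∫ s in (0 : ℝ)..t, (1 / 2 * gr (D s) + 2 * c * mass σ (D s)) :=
    fun t ht => intervalIntegral.integral_nonneg ht.1 fun s _ => by
      have := gr_nonneg (D s)
      have := mass_nonneg σ (D s)
      positivity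
  have hTT : T ∈ Icc 0 T := ⟨hT.le, le_rfl⟩
  have hfin : 1 / 2 * (∫ s in Icc 0 T, gr (D s)) + 2 * c * ∫ s in Icc 0 T, mass σ (D s) ≤ E * δ ^ 2 := by
    rw [← integral_const_mul, ← integral_const_mul, ← integral_add (hgr.const_mul _) (hms.const_mul _),
      ← restrict_Ioc_eq_restrict_Icc, ← intervalIntegral.integral_of_le hT.le]
    have := key T hTT
    have := sq_nonneg ‖u T - v T‖
    linarith
  have hg0 : 0 ≤ ∫ s in Icc 0 T, gr (D s) := integral_nonneg fun s => gr_nonneg _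
  have hm0 : 0 ≤ ∫ s in Icc 0 T, mass σ (D s) := integral_nonneg fun s => mass_nonneg _ _
  have hEδ : 0 ≤ E * δ ^ 2 := by positivity
  have hEc : 0 ≤ E / (2 * c) * δ ^ 2 := by positivity
  have hcm : 0 ≤ 2 * c * ∫ s in Icc 0 T, mass σ (D s) := by positivity
  refine ⟨fun t ht => ?_, ?_, ?_⟩
  · have := key t ht
    have := hI0 t ht
    linarith
  · change ∫ s in Icc 0 T, gr (D s) ≤ _
    linarith
  · change ∫ s in Icc 0 T, mass σ (D s) ≤ _
    have : ∫ s in Icc 0 T, mass σ (D s) ≤ E * δ ^ 2 / (2 * c) := by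
      rw [le_div_iff₀ (by positivity)]
      linarith
    have e : E * δ ^ 2 / (2 * c) = E / (2 * c) * δ ^ 2 := by ring
    linarith

/-- A weak solution coincides with a regular one. -/
theorem IsWeak.unique (hσ : 2 < σ) {R : ℝ} (hR : 0 ≤ R) {β m : ℝ} (hm : 0 < m)
    (hκ : 0 < ellip (2 * σ) β) (hT : 0 < T) {M : ℝ} {q : ℝ → Par} (hq : ∀ t, (q t).Good β m R)
    (hqc : ∀ u ψ : V L₁ L₂, Continuous fun t => form σ (q t) u ψ) {u₀ : V L₁ L₂}
    {u v : ℝ → H L₁ L₂} {U W : ℝ → V L₁ L₂} (hu : IsWeak T σ q u₀ u U) (hv : IsWeak T σ q u₀ v W)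
    (hW : ∀ᵐ s ∂(volume.restrict (Icc 0 T)), ‖W s‖ ≤ M) :
    EqOn u v (Icc 0 T) ∧ U =ᵐ[volume.restrict (Icc 0 T)] W := by
  obtain ⟨C, hC, h⟩ := exists_stability L₁ L₂ hσ hR hm hκ hT M
  obtain ⟨h1, h2, -⟩ := h q q 0 hq (fun t => (hq t).bdd) (fun t => Par.Close.refl _) hqc hqc u₀ u v U W
    hu hv hW
  have heq : EqOn u v (Icc 0 T) := fun t ht => by
    have := h1 t ht
    rw [zero_pow two_ne_zero, mul_zero] at this
    exact sub_eq_zero.1 (norm_eq_zero.1 (pow_eq_zero_iff two_ne_zero |>.1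
      (le_antisymm this (sq_nonneg _))))
  refine ⟨heq, ?_⟩
  have cD := (inClass_of_energy hσ hu.memLp hu.eq_ae hu.energy).sub hσ
    (inClass_of_energy hσ hv.memLp hv.eq_ae hv.energy)
  rw [zero_pow two_ne_zero, mul_zero] at h2
  have h3 := (integral_eq_zero_iff_of_nonneg (fun s => gr_nonneg _) cD.integrable_gr).1
    (le_antisymm h2 (integral_nonneg fun s => gr_nonneg _))
  filter_upwards [h3, hu.eq_ae, hv.eq_ae, ae_restrict_mem measurableSet_Icc] with s h4 h5 h6 hs
  have h7 := norm_sq_eq (U s - W s)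
  rw [fn_sub, h5, h6, heq hs, sub_self, norm_zero, h4] at h7
  simp only [Pi.zero_apply] at h7
  exact sub_eq_zero.1 (norm_eq_zero.1 (pow_eq_zero_iff two_ne_zero |>.1 (by rw [h7]; norm_num)))

end Stability

/-! ### Well-posedness and stability of the forced equation -/

section Convergence

variable {L₁ L₂ σ T β R : ℝ} {q : Par} {h : ℝ → ℂ} {u₀ : V L₁ L₂} {u : ℝ → H L₁ L₂}
  {U : ℝ → V L₁ L₂}

theorem mass_add_le (hσ : 2 < σ) (v w : V L₁ L₂) :
    mass σ (v + w) ≤ 2 ^ (2 * σ + 2) * (mass σ v + mass σ w) := by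
  have := fact_one_le hσ
  obtain ⟨J, hJ⟩ := exists_embedding L₁ L₂ (p := 2 * σ + 2) (by linarith)
  have e : ∀ w, mass σ w = ‖J w‖ ^ (2 * σ + 2) := fun w => (hJ w).symm
  rw [e, e, e, map_add]
  have hp : 0 ≤ 2 * σ + 2 := by linarith
  have h1 : ‖J v + J w‖ ≤ 2 * max ‖J v‖ ‖J w‖ := by
    have := norm_add_le (J v) (J w)
    have := le_max_left ‖J v‖ ‖J w‖
    have := le_max_right ‖J v‖ ‖J w‖
    linarith
  refine (Real.rpow_le_rpow (norm_nonneg _) h1 hp).trans ?_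
  rw [Real.mul_rpow zero_le_two (le_max_of_le_left (norm_nonneg _))]
  refine mul_le_mul_of_nonneg_left ?_ (by positivity)
  rcases max_choice ‖J v‖ ‖J w‖ with h | h <;> rw [h]
  · exact le_add_of_nonneg_right (by positivity)
  · exact le_add_of_nonneg_left (by positivity)

theorem cexp_smul_cexp_neg_smul {E : Type*} [AddCommGroup E] [Module ℂ E] (h : ℝ → ℂ) (t : ℝ) (x : E) :
    Complex.exp (∫ s in (0 : ℝ)..t, h s) • Complex.exp (∫ s in (0 : ℝ)..t, -h s) • x = x := by
  rw [smul_smul, intervalIntegral.integral_neg, Complex.exp_neg,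
    mul_inv_cancel₀ (Complex.exp_ne_zero _), one_smul]

/-- Existence and uniqueness for the forced equation. -/
theorem exists_isForced (hL₁ : 0 < L₁) (hL₂ : 0 < L₂) (hσ : 2 < σ) (hR : 0 ≤ R)
    (hκ : 0 < ellip (2 * σ) β) (hq : q.Good β 1 R) (hT : 0 < T) (hh : IntegrableOn h (Icc 0 T))
    (u₀ : V L₁ L₂) : ∃ (u : ℝ → H L₁ L₂) (U : ℝ → V L₁ L₂), IsForced T σ q h u₀ u U ∧
      ∀ (v : ℝ → H L₁ L₂) (W : ℝ → V L₁ L₂), IsForced T σ q h u₀ v W →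
        EqOn v u (Icc 0 T) ∧ W =ᵐ[volume.restrict (Icc 0 T)] U := by
  obtain ⟨B, hB⟩ := isCompact_Icc.exists_bound_of_continuousOn (continuousOn_integral hT.le hh)
  have hgood := good_gaugePar hσ hR hq hT.le hB
  have hcont := continuous_form_gaugePar (L₁ := L₁) (L₂ := L₂) hσ hT.le hh q
  obtain ⟨M, v, W, hv, hM⟩ := exists_isWeak hL₁ hL₂ hσ (by positivity) (Real.exp_pos _) hκ
    hgood hcont hT.le u₀
  refine ⟨_, _, hv.isForced hσ hR hq hT.le hh, fun v' W' hv' => ?_⟩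
  obtain ⟨h1, h2⟩ := (hv'.isWeak hσ hR hq hT.le hh).unique hσ (by positivity) (Real.exp_pos _) hκ hT
    hgood hcont hv hM
  refine ⟨fun t ht => ?_, h2.mono fun s hs => ?_⟩
  · simp only [← h1 ht, cexp_smul_cexp_neg_smul]
  · simp only [← hs, cexp_smul_cexp_neg_smul]

/-- A weak solution is bounded in `V`. -/
theorem IsWeak.exists_norm_le (hL₁ : 0 < L₁) (hL₂ : 0 < L₂) (hσ : 2 < σ) (hR : 0 ≤ R) {m : ℝ}
    (hm : 0 < m) (hκ : 0 < ellip (2 * σ) β) (hT : 0 < T) {q : ℝ → Par} (hq : ∀ t, (q t).Good β m R)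
    (hqc : ∀ u ψ : V L₁ L₂, Continuous fun t => form σ (q t) u ψ) (hu : IsWeak T σ q u₀ u U) :
    ∃ M, ∀ᵐ s ∂(volume.restrict (Icc 0 T)), ‖U s‖ ≤ M := by
  -- The regularity is inherited by uniqueness: the given solution coincides with the constructed
  -- one, which is bounded in V.
  obtain ⟨M, v, W, hv, hM⟩ := exists_isWeak hL₁ hL₂ hσ hR hm hκ hq hqc hT.le u₀
  refine ⟨M, ?_⟩
  filter_upwards [(hu.unique hσ hR hm hκ hT hq hqc hv hM).2, hM] with s h1 h2
  rwa [h1]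

theorem norm_sub_le_of_gauge {E : Type*} [NormedAddCommGroup E] [NormedSpace ℂ E] {c c' : ℂ} {G ε : ℝ}
    (hc' : ‖c'‖ ≤ G) (hcc : ‖c' - c‖ ≤ G * ε) {x x' y y' : E} (hx : c • y = x) (hx' : c' • y' = x') :
    ‖x' - x‖ ≤ G * ‖y' - y‖ + G * ε * ‖y‖ := by
  have e : x' - x = c' • (y' - y) + (c' - c) • y := by
    rw [← hx, ← hx', smul_sub, sub_smul]; abel
  rw [e]
  refine (norm_add_le _ _).trans ?_
  rw [norm_smul, norm_smul]
  gcongr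

theorem mass_sub_le_of_gauge (hσ : 2 < σ) {c c' : ℂ} {G ε : ℝ} (hG : 0 ≤ G) (hε : 0 ≤ ε)
    (hε1 : ε ≤ 1) (hc' : ‖c'‖ ≤ G) (hcc : ‖c' - c‖ ≤ G * ε) {x x' y y' : V L₁ L₂} (hx : c • y = x)
    (hx' : c' • y' = x') : mass σ (x' - x) ≤ (2 * G) ^ (2 * σ + 2) * (mass σ (y' - y) + ε * mass σ y) := by
  have e : x' - x = c' • (y' - y) + (c' - c) • y := by
    rw [← hx, ← hx', smul_sub, sub_smul]; abel
  have hp : 1 ≤ 2 * σ + 2 := by linarith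
  have h1 : ‖c'‖ ^ (2 * σ + 2) ≤ G ^ (2 * σ + 2) := Real.rpow_le_rpow (norm_nonneg _) hc' (by linarith)
  have h2 : ‖c' - c‖ ^ (2 * σ + 2) ≤ G ^ (2 * σ + 2) * ε := by
    refine (Real.rpow_le_rpow (norm_nonneg _) hcc (by linarith)).trans ?_
    rw [Real.mul_rpow hG hε]
    refine mul_le_mul_of_nonneg_left ?_ (by positivity)
    simpa using Real.rpow_le_rpow_of_exponent_ge' hε hε1 zero_le_one hp
  have h3 := mass_nonneg σ (y' - y)
  have h4 := mass_nonneg σ y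
  rw [e]
  refine (mass_add_le hσ _ _).trans ?_
  rw [mass_smul, mass_smul, Real.mul_rpow zero_le_two hG, mul_assoc]
  refine mul_le_mul_of_nonneg_left ?_ (by positivity)
  have h5 := mul_le_mul_of_nonneg_right h1 h3
  have h6 := mul_le_mul_of_nonneg_right h2 h4
  linarith

/-- The solution of the forced equation depends continuously on the primitive of the forcing. -/
theorem IsForced.exists_stability (hL₁ : 0 < L₁) (hL₂ : 0 < L₂) (hσ : 2 < σ) (hR : 0 ≤ R)
    (hκ : 0 < ellip (2 * σ) β) (hq : q.Good β 1 R) (hT : 0 < T) (hh : IntegrableOn h (Icc 0 T))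
    (hu : IsForced T σ q h u₀ u U) : ∃ K : ℝ, 0 ≤ K ∧ ∀ (h' : ℝ → ℂ) (u' : ℝ → H L₁ L₂)
      (U' : ℝ → V L₁ L₂) (ε : ℝ), IntegrableOn h' (Icc 0 T) → IsForced T σ q h' u₀ u' U' → 0 ≤ ε →
      ε ≤ 1 → (∀ t ∈ Icc 0 T, ‖(∫ s in (0 : ℝ)..t, h' s) - ∫ s in (0 : ℝ)..t, h s‖ ≤ ε) →
        (∀ t ∈ Icc 0 T, ‖u' t - u t‖ ≤ K * ε) ∧ ∫ s in Icc 0 T, ‖U' s - U s‖ ^ 2 ≤ K * ε ∧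
        ∫ s in Icc 0 T, mass σ (U' s - U s) ≤ K * ε := by
  obtain ⟨B₀, hB₀⟩ := isCompact_Icc.exists_bound_of_continuousOn (continuousOn_integral hT.le hh)
  -- Since ε ≤ 1, this bounds the primitive of h and that of every admissible h′, so the constants
  -- below do not depend on h′.
  set B := B₀ + 1
  have hB : ∀ t ∈ Icc 0 T, ‖∫ s in (0 : ℝ)..t, h s‖ ≤ B := fun t ht => by
    have := hB₀ t ht; linarith
  have hB0 : 0 ≤ B := (norm_nonneg _).trans (hB 0 ⟨le_rfl, hT.le⟩)
  set v : ℝ → H L₁ L₂ := fun t => Complex.exp (∫ s in (0 : ℝ)..t, -h s) • u t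
  set W : ℝ → V L₁ L₂ := fun t => Complex.exp (∫ s in (0 : ℝ)..t, -h s) • U t
  have hv : IsWeak T σ (gaugePar σ q hT.le h) u₀ v W := hu.isWeak hσ hR hq hT.le hh
  set R' := Real.exp (2 * σ * B) * R
  have hR' : 0 ≤ R' := by positivity
  have hm := Real.exp_pos (-(2 * σ * B))
  -- The V-bound concerns only the fixed solution, in its gauged form; the varying solution needs
  -- none.
  obtain ⟨M, hM⟩ := hv.exists_norm_le hL₁ hL₂ hσ hR' hm hκ hT (good_gaugePar hσ hR hq hT.le hB)
    (continuous_form_gaugePar hσ hT.le hh q)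
  obtain ⟨C, hC, hstab⟩ := GinzburgLandau.exists_stability L₁ L₂ hσ hR' hm hκ hT M
  obtain ⟨A, hA⟩ := isCompact_Icc.exists_bound_of_continuousOn hv.continuousOn
  have hA0 : 0 ≤ A := (norm_nonneg _).trans (hA 0 ⟨le_rfl, hT.le⟩)
  set G := Real.exp B
  have hG : 0 < G := Real.exp_pos B
  set L := Real.exp (2 * σ * B) * (2 * σ) * R
  have hL : 0 ≤ L := by positivity
  have cW := inClass_of_energy hσ hv.memLp hv.eq_ae hv.energy
  set A' := ∫ s in Icc 0 T, mass σ (W s)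
  have hA' : 0 ≤ A' := integral_nonneg fun s => mass_nonneg _ _
  set K₁ := G * (√C * L) + G * A
  set K₂ := 2 * G ^ 2 * (C * L ^ 2 * T + C * L ^ 2) + 2 * G ^ 2 * M ^ 2 * T
  set K₃ := (2 * G) ^ (2 * σ + 2) * (C * L ^ 2 + A')
  have hK₁ : 0 ≤ K₁ := by positivity
  have hK₂ : 0 ≤ K₂ := by positivity
  have hK₃ : 0 ≤ K₃ := by positivity
  refine ⟨K₁ + K₂ + K₃, by positivity, fun h' u' U' ε hh' hu' hε hε1 hθ => ?_⟩
  have hB' : ∀ t ∈ Icc 0 T, ‖∫ s in (0 : ℝ)..t, h' s‖ ≤ B := fun t ht => by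
    have h1 := norm_sub_norm_le (∫ s in (0 : ℝ)..t, h' s) (∫ s in (0 : ℝ)..t, h s)
    have := hB₀ t ht
    have := hθ t ht
    simp only [B]
    linarith
  set v' : ℝ → H L₁ L₂ := fun t => Complex.exp (∫ s in (0 : ℝ)..t, -h' s) • u' t
  set W' : ℝ → V L₁ L₂ := fun t => Complex.exp (∫ s in (0 : ℝ)..t, -h' s) • U' t
  have hv' : IsWeak T σ (gaugePar σ q hT.le h') u₀ v' W' := hu'.isWeak hσ hR hq hT.le hh'
  have cW' := inClass_of_energy hσ hv'.memLp hv'.eq_ae hv'.energy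
  have cU := inClass_of_energy hσ hu.memLp hu.eq_ae hu.energy
  have cU' := inClass_of_energy hσ hu'.memLp hu'.eq_ae hu'.energy
  have hclose : ∀ t, (gaugePar σ q hT.le h' t).Close (gaugePar σ q hT.le h t) (L * ε) := fun t => by
    have hmem := (projIcc 0 T hT.le t).2
    refine Par.close_scale_exp hσ hR hq.bdd ((Complex.abs_re_le_norm _).trans (hB' _ hmem))
      ((Complex.abs_re_le_norm _).trans (hB _ hmem)) ?_
    rw [← Complex.sub_re]
    exact (Complex.abs_re_le_norm _).trans (hθ _ hmem)
  obtain ⟨s1, s2, s3⟩ := hstab _ _ (L * ε) (good_gaugePar hσ hR hq hT.le hB')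
    (fun t => (good_gaugePar hσ hR hq hT.le hB t).bdd) hclose
    (continuous_form_gaugePar hσ hT.le hh' q) (continuous_form_gaugePar hσ hT.le hh q) u₀ v' v W' W
    hv' hv hM
  -- The squared quantities are in fact of order ε²; they are weakened to order ε so that a single
  -- constant serves all three estimates.
  have hεε : ε ^ 2 ≤ ε := by nlinarith
  have g1 : ∀ t ∈ Icc 0 T, ‖Complex.exp (∫ s in (0 : ℝ)..t, h' s)‖ ≤ G := fun t ht => by
    rw [Complex.norm_exp]
    exact Real.exp_le_exp.2 ((Complex.re_le_norm _).trans (hB' t ht))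
  have g2 : ∀ t ∈ Icc 0 T, ‖Complex.exp (∫ s in (0 : ℝ)..t, h' s) -
      Complex.exp (∫ s in (0 : ℝ)..t, h s)‖ ≤ G * ε := fun t ht =>
    (norm_cexp_sub_cexp_le ((Complex.re_le_norm _).trans (hB' t ht))
      ((Complex.re_le_norm _).trans (hB t ht))).trans (mul_le_mul_of_nonneg_left (hθ t ht) hG.le)
  have hmono : ∀ {K : ℝ}, K ≤ K₁ + K₂ + K₃ → K * ε ≤ (K₁ + K₂ + K₃) * ε := fun hK =>
    mul_le_mul_of_nonneg_right hK hε
  refine ⟨fun t ht => ?_, ?_, ?_⟩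
  · refine le_trans ?_ (hmono (K := K₁) (by linarith))
    have h1 := norm_sub_le_of_gauge (g1 t ht) (g2 t ht)
      (cexp_smul_cexp_neg_smul h t (u t)) (cexp_smul_cexp_neg_smul h' t (u' t))
    have h2 : ‖v' t - v t‖ ≤ √C * L * ε := by
      refine le_of_sq_le_sq ((s1 t ht).trans_eq ?_) (by positivity)
      rw [mul_assoc √C, mul_pow √C, Real.sq_sqrt hC]
    have h3 := hA t ht
    calc _ ≤ _ := h1
      _ ≤ G * (√C * L * ε) + G * ε * A := by gcongr
      _ = K₁ * ε := by simp only [K₁]; ring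
  · refine le_trans ?_ (hmono (K := K₂) (by linarith))
    have hiv : IntegrableOn (fun s => ‖v' s - v s‖ ^ 2) (Icc 0 T) :=
      ((hv'.continuousOn.sub hv.continuousOn).norm.pow 2).integrableOn_Icc
    have hig := (cW'.sub hσ cW).integrable_gr
    have hsum : Integrable (fun s => ‖v' s - v s‖ ^ 2 + gr (W' s - W s))
      (volume.restrict (Icc 0 T)) := hiv.add hig
    have hic : Integrable (fun _ : ℝ => 2 * G ^ 2 * ε ^ 2 * M ^ 2) (volume.restrict (Icc 0 T)) :=
      integrable_const _
    have h1 : ∫ s in Icc 0 T, ‖U' s - U s‖ ^ 2 ≤ ∫ s in Icc 0 T,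
        (2 * G ^ 2 * (‖v' s - v s‖ ^ 2 + gr (W' s - W s)) + 2 * G ^ 2 * ε ^ 2 * M ^ 2) := by
      refine integral_mono_ae (cU'.sub hσ cU).integrable_sq
        ((hsum.const_mul (2 * G ^ 2)).add hic) ?_
      filter_upwards [hM, hv.eq_ae, hv'.eq_ae, ae_restrict_mem measurableSet_Icc] with s h2 h3 h4 hs
      have h5 := norm_sub_le_of_gauge (g1 s hs) (g2 s hs)
        (cexp_smul_cexp_neg_smul h s (U s)) (cexp_smul_cexp_neg_smul h' s (U' s))
      have h6 : ‖W' s - W s‖ ^ 2 = ‖v' s - v s‖ ^ 2 + gr (W' s - W s) := by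
        rw [norm_sq_eq, fn_sub, h3, h4]
      rw [← h6]
      change ‖U' s - U s‖ ≤ G * ‖W' s - W s‖ + G * ε * ‖W s‖ at h5
      have h7 : ‖U' s - U s‖ ≤ G * ‖W' s - W s‖ + G * ε * M :=
        h5.trans (by gcongr)
      have h8 := pow_le_pow_left₀ (norm_nonneg _) h7 2
      nlinarith [sq_nonneg (G * ‖W' s - W s‖ - G * ε * M)]
    rw [integral_add (hsum.const_mul _) hic, integral_const_mul, integral_add hiv hig,
      integral_const, smul_eq_mul] at h1
    have h2 : ∫ s in Icc 0 T, ‖v' s - v s‖ ^ 2 ≤ T * (C * (L * ε) ^ 2) := by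
      have := setIntegral_mono_on hiv (integrable_const (C * (L * ε) ^ 2)) measurableSet_Icc s1
      simpa [hT.le] using this
    have h3 : (volume.restrict (Icc 0 T)).real univ = T := by simp [hT.le]
    rw [h3] at h1
    calc _ ≤ _ := h1
      _ ≤ 2 * G ^ 2 * (T * (C * (L * ε) ^ 2) + C * (L * ε) ^ 2) + T * (2 * G ^ 2 * ε ^ 2 * M ^ 2) := by
        gcongr
      _ = K₂ * ε ^ 2 := by simp only [K₂]; ring
      _ ≤ K₂ * ε := by gcongr
  · refine le_trans ?_ (hmono (K := K₃) (by linarith))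
    have him := (cW'.sub hσ cW).integrable
    have h1 : ∫ s in Icc 0 T, mass σ (U' s - U s) ≤ ∫ s in Icc 0 T,
        (2 * G) ^ (2 * σ + 2) * (mass σ (W' s - W s) + ε * mass σ (W s)) :=
      integral_mono_ae (cU'.sub hσ cU).integrable ((him.add (cW.integrable.const_mul ε)).const_mul _)
        ((ae_restrict_iff' measurableSet_Icc).2 (ae_of_all _ fun s hs => mass_sub_le_of_gauge hσ hG.le
          hε hε1 (g1 s hs) (g2 s hs) (cexp_smul_cexp_neg_smul h s (U s))
          (cexp_smul_cexp_neg_smul h' s (U' s))))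
    rw [integral_const_mul, integral_add him (cW.integrable.const_mul ε), integral_const_mul] at h1
    have h2 : C * (L * ε) ^ 2 ≤ C * L ^ 2 * ε := by
      rw [mul_pow, ← mul_assoc]; gcongr
    calc _ ≤ _ := h1
      _ ≤ (2 * G) ^ (2 * σ + 2) * (C * L ^ 2 * ε + ε * A') := by
        gcongr
        exact s3.trans h2
      _ = K₃ * ε := by simp only [K₃]; ring

end Convergence

/-! ### Convergence of solutions when the drift primitives converge uniformly -/

section Limit

variable {L₁ L₂ σ T β R : ℝ} {q : Par} {u₀ : V L₁ L₂}

/-- Convergence of the solutions of the forced equation. -/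
theorem tendsto_isForced (hL₁ : 0 < L₁) (hL₂ : 0 < L₂) (hσ : 2 < σ) (hR : 0 ≤ R)
    (hκ : 0 < ellip (2 * σ) β) (hq : q.Good β 1 R) (hT : 0 < T) {hn : ℕ → ℝ → ℂ} {h : ℝ → ℂ}
    (hhn : ∀ n, IntegrableOn (hn n) (Icc 0 T)) (hh : IntegrableOn h (Icc 0 T))
    (hlim : TendstoUniformlyOn (fun n t => ∫ s in (0 : ℝ)..t, hn n s)
      (fun t => ∫ s in (0 : ℝ)..t, h s) atTop (Icc 0 T)) {un : ℕ → ℝ → H L₁ L₂}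
    {Un : ℕ → ℝ → V L₁ L₂} {u : ℝ → H L₁ L₂} {U : ℝ → V L₁ L₂}
    (hun : ∀ n, IsForced T σ q (hn n) u₀ (un n) (Un n)) (hu : IsForced T σ q h u₀ u U) :
    TendstoUniformlyOn un u atTop (Icc 0 T) ∧
      Tendsto (fun n => eLpNorm (fun s => Un n s - U s) 2 (volume.restrict (Icc 0 T))) atTop (𝓝 0) ∧
      Tendsto (fun n => LpLpEnergy T (2 * σ + 2) (fun s => un n s - u s)) atTop (𝓝 0) := by
  obtain ⟨K, hK, hstab⟩ := hu.exists_stability hL₁ hL₂ hσ hR hκ hq hT hh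
  have key : ∀ η > 0, ∀ᶠ n in atTop, (∀ t ∈ Icc 0 T, ‖un n t - u t‖ < η) ∧
      ∫ s in Icc 0 T, ‖Un n s - U s‖ ^ 2 < η ∧ ∫ s in Icc 0 T, mass σ (Un n s - U s) < η := by
    intro η hη
    set ε := min 1 (η / (K + 1))
    have hε : 0 < ε := by positivity
    have hKε : K * ε < η := by
      have h1 : (K + 1) * ε ≤ η := by
        rw [mul_comm]
        exact (le_div_iff₀ (by positivity)).1 (min_le_right _ _)
      linarith
    filter_upwards [Metric.tendstoUniformlyOn_iff.1 hlim ε hε] with n hn'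
    obtain ⟨h1, h2, h3⟩ := hstab (hn n) (un n) (Un n) ε (hhn n) (hun n) hε.le (min_le_left _ _)
      fun t ht => by rw [← dist_eq_norm, dist_comm]; exact (hn' t ht).le
    exact ⟨fun t ht => (h1 t ht).trans_lt hKε, h2.trans_lt hKε, h3.trans_lt hKε⟩
  have cU := inClass_of_energy hσ hu.memLp hu.eq_ae hu.energy
  have cD := fun n => (inClass_of_energy hσ (hun n).memLp (hun n).eq_ae (hun n).energy).sub hσ cU
  refine ⟨?_, ?_, ?_⟩
  · refine Metric.tendstoUniformlyOn_iff.2 fun η hη => (key η hη).mono fun n hn t ht => ?_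
    rw [dist_comm, dist_eq_norm]
    exact hn.1 t ht
  · have h1 : Tendsto (fun n => ∫ s in Icc 0 T, ‖Un n s - U s‖ ^ 2) atTop (𝓝 0) :=
      tendsto_order.2 ⟨fun b hb => Eventually.of_forall fun n => hb.trans_le
        (integral_nonneg fun s => sq_nonneg _), fun η hη => (key η hη).mono fun n hn => hn.2.1⟩
    have e : ∀ n, eLpNorm (fun s => Un n s - U s) 2 (volume.restrict (Icc 0 T)) =
        ENNReal.ofReal (√(∫ s in Icc 0 T, ‖Un n s - U s‖ ^ 2)) := fun n => by
      rw [(cD n).memLp.eLpNorm_eq_integral_rpow_norm (by simp) (by simp)]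
      simp [Real.sqrt_eq_rpow]
    simp only [e]
    have h2 := ENNReal.tendsto_ofReal h1.sqrt
    rwa [Real.sqrt_zero, ENNReal.ofReal_zero] at h2
  · have h1 : Tendsto (fun n => ∫ s in Icc 0 T, mass σ (Un n s - U s)) atTop (𝓝 0) :=
      tendsto_order.2 ⟨fun b hb => Eventually.of_forall fun n => hb.trans_le
        (integral_nonneg fun s => mass_nonneg _ _), fun η hη => (key η hη).mono fun n hn => hn.2.2⟩
    have e : ∀ n, LpLpEnergy T (2 * σ + 2) (fun s => un n s - u s) =
        ENNReal.ofReal (∫ s in Icc 0 T, mass σ (Un n s - U s)) := fun n => by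
      rw [lintegral_mass_eq hσ (U := fun s => Un n s - U s), ofReal_integral_eq_lintegral_ofReal
        (cD n).integrable (ae_of_all _ fun s => mass_nonneg _ _)]
      filter_upwards [(hun n).eq_ae, hu.eq_ae] with s h2 h3
      rw [fn_sub, h2, h3]
    simp only [e]
    have h2 := ENNReal.tendsto_ofReal h1
    rwa [ENNReal.ofReal_zero] at h2

theorem exists_good_glPar (α β γ : ℝ) (a b : ℂ × ℂ) :
    ∃ R, 0 ≤ R ∧ (glPar α β γ a b).Good β 1 R := by
  obtain ⟨R, hR, h⟩ := (glPar α β γ a b).exists_bdd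
  exact ⟨R, hR, h, by simp [glPar], 1, le_rfl, by simp [glPar]⟩

end Limit

end GinzburgLandau

end

/-! ### The proposition: existence and uniqueness, then convergence -/

theorem proposition4p1 {Z : Type*} [TopologicalSpace Z] [PolishSpace Z] [LocallyCompactSpace Z]
    [MeasurableSpace Z] [BorelSpace Z] (ν : Measure Z) [IsFiniteMeasureOnCompacts ν]
    (L₁ L₂ T α β γ σ : ℝ) (hL₁ : 0 < L₁) (hL₂ : 0 < L₂) (hT : 0 < T) (hγ : 0 < γ)
    (hσ : 2 < σ) (hβ : 0 < |β|) (hβ' : |β| < √(2 * σ + 1) / σ) (a b : ℂ × ℂ)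
    (g : Z → ℂ) (hg : Measurable g) (hg2 : MemLp g 2 ν)
    (hgexp : ∃ δ > 0, ∀ E : Set Z, MeasurableSet E → ν E < ⊤ →
      IntegrableOn (fun z => Real.exp (δ * ‖g z‖ ^ 2)) E ν)
    (u₀ : V L₁ L₂) :
    (∀ (N : ℕ), ∀ φ ∈ controls T ν N, ∃ (u : ℝ → H L₁ L₂) (U : ℝ → V L₁ L₂),
      IsSkeletonSolution T α β γ σ a b ν g u₀ φ u U ∧
      ∀ (v : ℝ → H L₁ L₂) (W : ℝ → V L₁ L₂), IsSkeletonSolution T α β γ σ a b ν g u₀ φ v W →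
        EqOn v u (Icc 0 T) ∧ W =ᵐ[volume.restrict (Icc 0 T)] U) ∧
    ∀ (N : ℕ) (φn : ℕ → ℝ × Z → ℝ≥0) (φ : ℝ × Z → ℝ≥0),
      (∀ n, φn n ∈ controls T ν N) → φ ∈ controls T ν N → ControlTendsto T ν φn φ →
      ∀ (un : ℕ → ℝ → H L₁ L₂) (Un : ℕ → ℝ → V L₁ L₂) (u : ℝ → H L₁ L₂) (U : ℝ → V L₁ L₂),
        (∀ n, IsSkeletonSolution T α β γ σ a b ν g u₀ (φn n) (un n) (Un n)) →
        IsSkeletonSolution T α β γ σ a b ν g u₀ φ u U →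
        TendstoUniformlyOn un u atTop (Icc 0 T) ∧
        Tendsto (fun n => eLpNorm (fun s => Un n s - U s) 2 (volume.restrict (Icc 0 T)))
          atTop (𝓝 0) ∧
        Tendsto (fun n => LpLpEnergy T (2 * σ + 2) (fun s => un n s - u s)) atTop (𝓝 0) := by
  obtain ⟨R, hR, hq⟩ := exists_good_glPar α β γ a b
  have hκ : 0 < ellip (2 * σ) β := ellip_pos (by linarith) hβ'
  refine ⟨fun N φ hφ => ?_, fun N φn φ hφn hφ hconv un Un u U hun hu => ?_⟩
  · have hd := integrableOn_drift hφ hg hg2 hgexp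
    simp only [isSkeletonSolution_iff hσ α β γ a b hd]
    exact exists_isForced hL₁ hL₂ hσ hR hκ hq hT hd u₀
  · have hd := integrableOn_drift hφ hg hg2 hgexp
    have hdn := fun n => integrableOn_drift (hφn n) hg hg2 hgexp
    exact tendsto_isForced hL₁ hL₂ hσ hR hκ hq hT hdn hd
      (tendstoUniformlyOn_theta hT hφn hφ hconv hg hg2 hgexp)
      (fun n => (isSkeletonSolution_iff hσ α β γ a b (hdn n)).1 (hun n))
      ((isSkeletonSolution_iff hσ α β γ a b hd).1 hu)
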